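/- \textbf{Setting.} Let $\mathcal B$ be a braided monoidal category, with braiding $\tau$, in which every object $X$ has a left and a right dual; let $X^*$ be the dual with evaluation $\mathrm{ev}_X\colon X^*\otimes X\to\mathbb 1$ and coevaluation $\mathrm{coev}_X\colon\mathbb 1\to X\otimes X^*$. Coherence isomorphisms of $\mathcal B$ are suppressed. Assume that $\mathcal B$ admits a coend $C=\int^{Y\in\mathcal B}Y^*\otimes Y$, with universal dinatural family $i_Y\colon Y^*\otimes Y\to C$, and let $\delta_Y=(\mathrm{id}_Y\otimes i_Y)(\mathrm{coev}_Y\otimes\mathrm{id}_Y)\colon Y\to Y\otimes C$ be the universal coaction; $\varepsilon_C\colon C\to\mathbb 1$ is given by $\varepsilon_C i_Y=\mathrm{ev}_Y$. Let $A$ be a Hopf algebra in $\mathcal B$ with invertible antipode $S$, product $m$, unit $u$, coproduct $\Delta$, counit $\varepsilon$. For an algebra (resp. coalgebra) $H$ put $\mu_Y=\mathrm{id}_Y\otimes m_H$, $\eta_Y=\mathrm{id}_Y\otimes u_H$, $T_2(X,Y)=(\mathrm{id}_X\otimes\tau_{Y,H}\otimes\mathrm{id}_H)(\mathrm{id}_{X\otimes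 Y}\otimes\Delta_H)$, $T_0=\varepsilon_H$: these are the structure morphisms of $T=\,?\otimes H$. Isomorphisms of braided categories are strong monoidal braided functors which are isomorphisms of categories. $\mathcal B_H$ and ${}_H\mathcal B$ are the monoidal categories of right and left $H$-modules in $\mathcal B$ ($H$ acts on tensor products through $\Delta_H$ and $\tau$, and on $\mathbb 1$ through $\varepsilon_H$). $\mathcal Z(\mathcal C)$ is the center of $\mathcal C$ (objects $(M,\sigma)$ with a half braiding $\sigma_X\colon M\otimes X\cong X\otimes M$, braiding $\sigma_N$ on $(M,\sigma)\otimes(N,\sigma')$), $\mathcal Z'(\mathcal C)=\mathcal Z(\mathcal C^{\otimes\mathrm{op}})^{\otimes\mathrm{op}}$ is the right center (half braidings $\gamma_X\colon X\otimes M\cong M\otimes X$; the braiding of $(M,\gamma)$ and $(N,\gamma')$ is $\gamma'_M$), and $\overline{\mathcal C}$ is the mirror of a braided category $\mathcal C$, i.e. $\mathcal C$ with the inverse braiding $\tau_{Y,X}^{-1}$. \textbf{The centralizer.} Let $Z=Z(A)=A^*\otimes C$, and put $\delta^A_Y=(\mathrm{id}_Y\otimes\mathrm{coev}_A\otimes\mathrm{id}_C)\delta_Y\colon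 Y\to Y\otimes A\otimes Z$, $\ \partial_{X,Y}=(\tau_{X,Y\otimes A}\otimes\mathrm{id}_Z)(\mathrm{id}_X\otimes\delta^A_Y)\colon X\otimes Y\to (Y\otimes A)\otimes X\otimes Z$. Let $\mu,\eta,T_2,T_0$ be those of $T=\,?\otimes A$. Define $m_Z\colon Z\otimes Z\to Z$, $u_Z\colon\mathbb 1\to Z$, $\Delta_Z\colon Z\to Z\otimes Z$, $\varepsilon_Z\colon Z\to\mathbb 1$ by: $u_Z=(\varepsilon\otimes\mathrm{id}_Z)\delta^A_{\mathbb 1}$ and, for all $X,Y$, $$(\mathrm{id}\otimes\varepsilon_Z)\delta^A_Y=\eta_Y,\qquad (\mathrm{id}\otimes\Delta_Z)\delta^A_Y=(\mu_Y\otimes\mathrm{id}_{Z\otimes Z})(\delta^A_{Y\otimes A}\otimes\mathrm{id}_Z)\delta^A_Y,$$ $$(\mathrm{id}_{X\otimes A\otimes Y\otimes A}\otimes m_Z)(\mathrm{id}_{X\otimes A}\otimes\partial_{Z,Y})(\delta^A_X\otimes\mathrm{id}_Y)=(T_2(X,Y)\otimes\mathrm{id}_Z)\delta^A_{X\otimes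 Y}.$$ \textbf{The canonical law.} Put $s_Y=(\tau_{Y,A}\otimes\mathrm{id}_A)(\mathrm{id}_Y\otimes\Delta)\colon Y\otimes A\to A\otimes Y\otimes A$, $\;k_Y=(\mu_Y\otimes\mathrm{id}_{A\otimes Z})\,\partial_{A,Y\otimes A}\,s_Y\colon Y\otimes A\to Y\otimes A\otimes A\otimes Z$, and $a_Y=\mu_Y\,\tau^{-1}_{Y\otimes A,A}(S^{-1}\otimes\mathrm{id}_{Y\otimes A})\colon A\otimes Y\otimes A\to Y\otimes A$. Let $\Omega\colon Z\otimes A\to A\otimes Z$ be the unique morphism with $(\mathrm{id}_{Y\otimes A}\otimes\Omega)(\delta^A_Y\otimes\mathrm{id}_A)=(a_Y\otimes\mathrm{id}_{A\otimes Z})(\mathrm{id}_A\otimes k_Y)s_Y$ for all $Y$. \textbf{R-matrices.} For a morphism $\mathfrak r\colon C\otimes C\to H\otimes H$ let $R_{X,Y}=(\mathrm{id}_Y\otimes\tau_{X,H}\otimes\mathrm{id}_H)(\tau_{X,Y}\otimes\mathfrak r)(\mathrm{id}_X\otimes\tau_{C,Y}\otimes\mathrm{id}_C)(\delta_X\otimes\delta_Y)\colon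 X\otimes Y\to (Y\otimes H)\otimes(X\otimes H)$. With $T=\,?\otimes H$, $\mathfrak r$ is an R-matrix for the Hopf algebra $H$ if, for all $X,Y,V$: $(\mu_Y\otimes\mu_X)R_{TX,TY}T_2(X,Y)=(\mu_Y\otimes\mu_X)T_2(TY,TX)T(R_{X,Y})$; $(\mathrm{id}\otimes T_2(X,Y))R_{X\otimes Y,V}=(\mu_V\otimes\mathrm{id})(R_{X,TV}\otimes\mathrm{id}_{TY})(\mathrm{id}_X\otimes R_{Y,V})$; $(T_2(Y,V)\otimes\mathrm{id})R_{X,Y\otimes V}=(\mathrm{id}\otimes\mu_X)(\mathrm{id}_{TY}\otimes R_{TX,V})(R_{X,Y}\otimes\mathrm{id}_V)$; $(\mathrm{id}\otimes T_0)R_{\mathbb 1,X}=\eta_X=(T_0\otimes\mathrm{id})R_{X,\mathbb 1}$. A quasitriangular Hopf algebra is a Hopf algebra with an R-matrix. \textbf{Theorem.} (1) With $m_Z,u_Z,\Delta_Z,\varepsilon_Z$, $Z(A)$ is a Hopf algebra in $\mathcal B$ with invertible antipode. The morphism $\Omega$ is an invertible comultiplicative distributive law of $Z(A)$ over $A$,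 i.e. it is compatible with products and units on both sides, and satisfies $(\mathrm{id}\otimes\tau_{A,Z}\otimes\mathrm{id})(\Delta_A\otimes\Delta_Z)\Omega=(\Omega\otimes\Omega)(\mathrm{id}\otimes\tau_{Z,A}\otimes\mathrm{id})(\Delta_Z\otimes\Delta_A)$ and $(\varepsilon_A\otimes\varepsilon_Z)\Omega=\varepsilon_Z\otimes\varepsilon_A$; and it is the canonical one: for all $X,Y$, $(\mu_Y\otimes\mathrm{id}_X\otimes\Omega)\,T_2(TY,X\otimes Z)\,T(\partial_{X,Y})=(\mu_Y\otimes\mathrm{id})\,\partial_{TX,TY}\,T_2(X,Y)$, where $T=\,?\otimes A$. (2) The double $D(A)=A\otimes_\Omega Z(A)$, that is the object $A\otimes Z(A)$ with product $(m_A\otimes m_Z)(\mathrm{id}_A\otimes\Omega\otimes\mathrm{id}_Z)$, unit $u_A\otimes u_Z$, coproduct $(\mathrm{id}_A\otimes\tau_{A,Z}\otimes\mathrm{id}_Z)(\Delta_A\otimes\Delta_Z)$ and counit $\varepsilon_A\otimes\varepsilon_Z$, is a Hopf algebra in $\mathcal B$ with invertible antipode, and it is quasitriangular with R-matrix $$\mathfrak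 r=(\mathrm{id}_A\otimes u_Z\otimes u_A\otimes\mathrm{id}_Z)(\mathrm{coev}_A\otimes\mathrm{id}_C)(\varepsilon_C\otimes\mathrm{id}_C)\colon C\otimes C\to D(A)\otimes D(A),$$ whose family is $R_{X,Y}=(\mathrm{id}_{Y\otimes A}\otimes u_Z\otimes \mathrm{id}_X\otimes u_A\otimes\mathrm{id}_Z)\,\partial_{X,Y}$. (3) The morphisms $c_{(M,r),(N,s)}=(s\otimes r)R_{M,N}$ form a braiding on $\mathcal B_{D(A)}$. For a left $D(A)$-module $M$ with action $r$, let $M^\flat$ be the right module with action $r\,\tau_{M,D(A)}(\mathrm{id}_M\otimes S_{D(A)})$; the morphisms $c'_{M,N}=\tau_{M,N}\,c_{N^\flat,M^\flat}\,\tau_{N,M}^{-1}$ form a braiding on ${}_{D(A)}\mathcal B$. (4) With these braidings, there are isomorphisms of braided categories $$\mathcal Z(\mathcal B_A)\;\simeq\;\mathcal B_{D(A)}\;\simeq\;{}_{D(A)}\mathcal B\;\simeq\;\mathcal Z'({}_A\mathcal B)\;\simeq\;\overline{\mathcal Z({}_A\mathcal B)}.$$ -/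

import Mathlib

open CategoryTheory MonoidalCategory BraidedCategory MonObj ComonObj HopfObj Limits

universe v u v' u'

namespace BraidedDouble

/-! ### Isomorphisms of braided categories, mirror, right center -/

/-- An isomorphism of braided categories: a strong monoidal braided functor which is an
isomorphism of categories. -/
structure BraidedIso (C : Type u) [Category.{v} C] [MonoidalCategory C] [BraidedCategory C]
    (D : Type u') [Category.{v'} D] [MonoidalCategory D] [BraidedCategory D] where
  functor : C ⥤ D
  braided : functor.Braided
  inverse : D ⥤ C
  functor_comp_inverse : functor ⋙ inverse = 𝟭 C
  inverse_comp_functor : inverse ⋙ functor = 𝟭 D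

/-- The mirror of a braided category: the same monoidal category, with the braiding
`X ⊗ Y ⟶ Y ⊗ X` replaced by the inverse of `Y ⊗ X ⟶ X ⊗ Y`. -/
def Mirror (C : Type u) : Type u := C

instance (C : Type u) [h : Category.{v} C] : Category.{v} (Mirror C) := h

instance (C : Type u) [Category.{v} C] [h : MonoidalCategory C] : MonoidalCategory (Mirror C) := h

instance (C : Type u) [Category.{v} C] [MonoidalCategory C] [BraidedCategory C] :
    BraidedCategory (Mirror C) := reverseBraiding C

/-- The right center: objects are pairs of an object `M` and a half braiding
`? ⊗ M ≅ M ⊗ ?`. It is the left center of the opposite monoidal category, again with opposite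
tensor product. -/
abbrev RightCenter (C : Type u) [Category.{v} C] [MonoidalCategory C] : Type (max u v) :=
  (Center (Cᴹᵒᵖ))ᴹᵒᵖ

section Modules

variable {B : Type u} [Category.{v} B] [MonoidalCategory B]

/-! ### Right modules -/

/-- Right modules over an algebra `H` in `B`. -/
structure RightMod (H : B) [MonObj H] where
  X : B
  act : X ⊗ H ⟶ X
  act_one : X ◁ η[H] ≫ act = (ρ_ X).hom
  act_act : act ▷ H ≫ act = (α_ X H H).hom ≫ X ◁ μ[H] ≫ act

/-- Morphisms of right modules. -/
@[ext]
structure RightMod.Hom {H : B} [MonObj H] (M N : RightMod H) where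
  hom : M.X ⟶ N.X
  act_hom : M.act ≫ hom = hom ▷ H ≫ N.act

instance (H : B) [MonObj H] : Category (RightMod H) where
  Hom M N := RightMod.Hom M N
  id M := { hom := 𝟙 M.X, act_hom := by simp }
  comp f g :=
    { hom := f.hom ≫ g.hom
      act_hom := by
        rw [← Category.assoc, f.act_hom, Category.assoc, g.act_hom, comp_whiskerRight,
          Category.assoc] }

@[ext]
lemma RightMod.hom_ext {H : B} [MonObj H] {M N : RightMod H} (f g : M ⟶ N)
    (h : f.hom = g.hom) : f = g := RightMod.Hom.ext h

@[simp]
lemma RightMod.id_hom {H : B} [MonObj H] (M : RightMod H) :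
    RightMod.Hom.hom (𝟙 M) = 𝟙 M.X := rfl

@[simp]
lemma RightMod.comp_hom {H : B} [MonObj H] {M N P : RightMod H} (f : M ⟶ N) (g : N ⟶ P) :
    (f ≫ g).hom = f.hom ≫ g.hom := rfl

/-- An isomorphism of underlying objects which is linear is an isomorphism of right modules. -/
def RightMod.isoMk {H : B} [MonObj H] {M N : RightMod H} (e : M.X ≅ N.X)
    (h : M.act ≫ e.hom = e.hom ▷ H ≫ N.act) : M ≅ N where
  hom := { hom := e.hom, act_hom := h }
  inv :=
    { hom := e.inv
      act_hom := by rw [Iso.comp_inv_eq, Category.assoc, h, inv_hom_whiskerRight_assoc] }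

/-! ### Left modules -/

/-- The action of `H` on a left module. -/
def leftAct {H : B} [MonObj H] (M : Mod B H) : H ⊗ M.X ⟶ M.X := γ[H, M.X]

lemma leftAct_one {H : B} [MonObj H] (M : Mod B H) :
    η[H] ▷ M.X ≫ leftAct M = (λ_ M.X).hom := ModObj.one_smul_self H M.X

lemma leftAct_mul {H : B} [MonObj H] (M : Mod B H) :
    μ[H] ▷ M.X ≫ leftAct M = (α_ H H M.X).hom ≫ H ◁ leftAct M ≫ leftAct M :=
  ModObj.mul_smul_self H M.X

lemma leftAct_hom {H : B} [MonObj H] {M N : Mod B H} (f : M ⟶ N) :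
    leftAct M ≫ f.hom = H ◁ f.hom ≫ leftAct N := IsModHom.smul_hom (A := H) (f := f.hom)

/-- A left module from its underlying object and its action. -/
abbrev leftMk {H : B} [MonObj H] (X : B) (act : H ⊗ X ⟶ X)
    (act_one : η[H] ▷ X ≫ act = (λ_ X).hom)
    (act_mul : μ[H] ▷ X ≫ act = (α_ H H X).hom ≫ H ◁ act ≫ act) : Mod B H where
  X := X
  mod := { smul := act, one_smul := act_one, mul_smul := act_mul }

/-- A morphism of left modules from a linear morphism. -/
def leftHomMk {H : B} [MonObj H] {M N : Mod B H} (f : M.X ⟶ N.X)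
    (h : leftAct M ≫ f = H ◁ f ≫ leftAct N) : M ⟶ N :=
  Mod.Hom.mk' f h

/-- An isomorphism of underlying objects which is linear is an isomorphism of left modules. -/
def leftIsoMk {H : B} [MonObj H] {M N : Mod B H} (e : M.X ≅ N.X)
    (h : leftAct M ≫ e.hom = H ◁ e.hom ≫ leftAct N) : M ≅ N where
  hom := leftHomMk e.hom h
  inv := leftHomMk e.inv (by
    rw [Iso.comp_inv_eq, Category.assoc, h, whiskerLeft_inv_hom_assoc])
  hom_inv_id := Mod.hom_ext _ _ e.hom_inv_id
  inv_hom_id := Mod.hom_ext _ _ e.inv_hom_id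

/-! ### Tensor products of modules -/

variable [BraidedCategory B]

/-- The tensor product of right modules over a bialgebra: `H` acts on `M ⊗ N` through its
coproduct. -/
def RightMod.tensor {H : B} [BimonObj H] (M N : RightMod H) : RightMod H where
  X := M.X ⊗ N.X
  act := (M.X ⊗ N.X) ◁ Δ[H] ≫ tensorμ M.X N.X H H ≫ (M.act ⊗ₘ N.act)
  act_one := by
    have h : η[H] ≫ Δ[H] = (λ_ (𝟙_ B)).inv ≫ (η[H] ⊗ₘ η[H]) := BimonObj.one_comul H
    rw [← whiskerLeft_comp_assoc, h,
      whiskerLeft_comp_assoc, tensorμ_natural_right_assoc, tensorHom_comp_tensorHom,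
      M.act_one, N.act_one, tensor_right_unitality]
  act_act := by
    have h1 : ((M.X ⊗ N.X) ◁ Δ[H] ≫ tensorμ M.X N.X H H ≫ (M.act ⊗ₘ N.act)) ▷ H ≫
        (M.X ⊗ N.X) ◁ Δ[H] ≫ tensorμ M.X N.X H H ≫ (M.act ⊗ₘ N.act) =
        ((M.X ⊗ N.X) ◁ Δ[H] ⊗ₘ Δ[H]) ≫ tensorμ M.X N.X H H ▷ (H ⊗ H) ≫
          tensorμ (M.X ⊗ H) (N.X ⊗ H) H H ≫
          ((M.act ▷ H ≫ M.act) ⊗ₘ (N.act ▷ H ≫ N.act)) := by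
      rw [comp_whiskerRight, comp_whiskerRight, Category.assoc, Category.assoc,
        ← whisker_exchange_assoc, tensorμ_natural_left_assoc, ← whisker_exchange_assoc,
        tensorHom_comp_tensorHom,
        MonoidalCategory.tensorHom_def ((M.X ⊗ N.X) ◁ Δ[H]) Δ[H], Category.assoc]
    rw [h1, M.act_act, N.act_act, ← tensorHom_comp_tensorHom, tensor_associativity_assoc,
      ← whiskerLeft_comp_assoc, BimonObj.mul_comul]
    simp only [whiskerLeft_comp, Category.assoc]
    rw [tensorμ_natural_right_assoc, ← id_tensorHom, associator_naturality_assoc,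
      id_tensorHom, tensorHom_comp_tensorHom]

/-- The unit object, on which `H` acts through its counit. -/
def RightMod.unit (H : B) [BimonObj H] : RightMod H where
  X := 𝟙_ B
  act := 𝟙_ B ◁ ε[H] ≫ (ρ_ (𝟙_ B)).hom
  act_one := by
    rw [← whiskerLeft_comp_assoc, BimonObj.one_counit]; simp
  act_act := by
    have h : μ[H] ≫ ε[H] = (ε[H] ⊗ₘ ε[H]) ≫ (λ_ (𝟙_ B)).hom := BimonObj.mul_counit H
    rw [← whiskerLeft_comp_assoc, h, MonoidalCategory.tensorHom_def]
    monoidal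

lemma RightMod.tensor_act_natural {H : B} [BimonObj H] {M N P Q : RightMod H} (f : M ⟶ P)
    (g : N ⟶ Q) : (M.tensor N).act ≫ (f.hom ⊗ₘ g.hom) =
      (f.hom ⊗ₘ g.hom) ▷ H ≫ (P.tensor Q).act := by
  dsimp only [RightMod.tensor]
  rw [← whisker_exchange_assoc, tensorμ_natural_left_assoc, Category.assoc, Category.assoc,
    tensorHom_comp_tensorHom, tensorHom_comp_tensorHom, f.act_hom, g.act_hom]

instance (H : B) [BimonObj H] : MonoidalCategoryStruct (RightMod H) where
  tensorObj M N := M.tensor N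
  whiskerLeft M N P f :=
    { hom := M.X ◁ f.hom
      act_hom := by
        have h := RightMod.tensor_act_natural (𝟙 M) f
        rwa [RightMod.id_hom, id_tensorHom] at h }
  whiskerRight {M P} f N :=
    { hom := f.hom ▷ N.X
      act_hom := by
        have h := RightMod.tensor_act_natural f (𝟙 N)
        rwa [RightMod.id_hom, tensorHom_id] at h }
  tensorHom f g :=
    { hom := f.hom ⊗ₘ g.hom
      act_hom := RightMod.tensor_act_natural f g }
  tensorUnit := RightMod.unit H
  associator M N P := RightMod.isoMk (α_ M.X N.X P.X) (by
    have h1 : ((M.X ⊗ N.X) ◁ Δ[H] ≫ tensorμ M.X N.X H H ≫ (M.act ⊗ₘ N.act)) ⊗ₘ P.act =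
        ((M.X ⊗ N.X) ◁ Δ[H] ⊗ₘ P.X ◁ 𝟙 H) ≫ tensorμ M.X N.X H H ▷ (P.X ⊗ H) ≫
          ((M.act ⊗ₘ N.act) ⊗ₘ P.act) := by
      simp only [← tensorHom_id, tensorHom_comp_tensorHom, whiskerLeft_id, Category.id_comp]
    have h2 : M.act ⊗ₘ ((N.X ⊗ P.X) ◁ Δ[H] ≫ tensorμ N.X P.X H H ≫ (N.act ⊗ₘ P.act)) =
        (M.X ◁ 𝟙 H ⊗ₘ (N.X ⊗ P.X) ◁ Δ[H]) ≫ (M.X ⊗ H) ◁ tensorμ N.X P.X H H ≫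
          (M.act ⊗ₘ (N.act ⊗ₘ P.act)) := by
      simp only [← id_tensorHom, tensorHom_comp_tensorHom, id_tensorHom_id, Category.id_comp]
    dsimp only [RightMod.tensor]
    rw [h1, h2]
    simp only [Category.assoc]
    rw [← tensorμ_natural_right_assoc, ← tensorμ_natural_right_assoc, associator_naturality,
      associator_monoidal_assoc]
    simp only [tensorHom_id, id_tensorHom]
    rw [← whiskerLeft_comp_assoc, ← whiskerLeft_comp_assoc,
      MonoidalCategory.tensorHom_def_assoc, whisker_exchange_assoc, ← whiskerLeft_comp_assoc,
      Category.assoc, ComonObj.comul_assoc])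
  leftUnitor M := RightMod.isoMk (λ_ M.X) (by
    have h1 : (𝟙_ B ◁ ε[H] ≫ (ρ_ (𝟙_ B)).hom) ⊗ₘ M.act =
        (𝟙_ B ◁ ε[H] ⊗ₘ M.X ◁ 𝟙 H) ≫ (λ_ (𝟙_ B)).hom ▷ (M.X ⊗ H) ≫ 𝟙_ B ◁ M.act := by
      rw [whiskerLeft_id, tensorHom_id, ← unitors_equal, ← comp_whiskerRight_assoc,
        MonoidalCategory.tensorHom_def]
    dsimp only [RightMod.tensor, RightMod.unit]
    rw [h1]
    simp only [Category.assoc]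
    rw [← tensorμ_natural_right_assoc, leftUnitor_naturality, ← leftUnitor_monoidal_assoc,
      tensorHom_id, ← whiskerLeft_comp_assoc, ComonObj.counit_comul]
    simp [MonoidalCategory.tensorHom_def'])
  rightUnitor M := RightMod.isoMk (ρ_ M.X) (by
    have h1 : M.act ⊗ₘ (𝟙_ B ◁ ε[H] ≫ (ρ_ (𝟙_ B)).hom) =
        (M.X ◁ 𝟙 H ⊗ₘ 𝟙_ B ◁ ε[H]) ≫ (M.X ⊗ H) ◁ (λ_ (𝟙_ B)).hom ≫ M.act ▷ 𝟙_ B := by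
      rw [whiskerLeft_id, id_tensorHom, unitors_equal, ← whiskerLeft_comp_assoc,
        MonoidalCategory.tensorHom_def']
    dsimp only [RightMod.tensor, RightMod.unit]
    rw [h1]
    simp only [Category.assoc]
    rw [← tensorμ_natural_right_assoc, rightUnitor_naturality, ← rightUnitor_monoidal_assoc,
      id_tensorHom, ← whiskerLeft_comp_assoc, ComonObj.comul_counit]
    simp [MonoidalCategory.tensorHom_def'])

instance (H : B) [BimonObj H] : MonoidalCategory (RightMod H) where
  tensorHom_def f g := RightMod.hom_ext _ _ (MonoidalCategory.tensorHom_def f.hom g.hom)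
  id_tensorHom_id M N := RightMod.hom_ext _ _ (id_tensorHom_id M.X N.X)
  tensorHom_comp_tensorHom f₁ f₂ g₁ g₂ :=
    RightMod.hom_ext _ _ (tensorHom_comp_tensorHom f₁.hom f₂.hom g₁.hom g₂.hom)
  whiskerLeft_id M N := RightMod.hom_ext _ _ (whiskerLeft_id M.X N.X)
  id_whiskerRight M N := RightMod.hom_ext _ _ (id_whiskerRight M.X N.X)
  associator_naturality f g h :=
    RightMod.hom_ext _ _ (associator_naturality f.hom g.hom h.hom)
  leftUnitor_naturality f := RightMod.hom_ext _ _ (leftUnitor_naturality f.hom)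
  rightUnitor_naturality f := RightMod.hom_ext _ _ (rightUnitor_naturality f.hom)
  pentagon M N P Q := RightMod.hom_ext _ _ (pentagon M.X N.X P.X Q.X)
  triangle M N := RightMod.hom_ext _ _ (triangle M.X N.X)

/-- The tensor product of left modules over a bialgebra: `H` acts on `M ⊗ N` through its
coproduct. -/
def leftTensor {H : B} [BimonObj H] (M N : Mod B H) : Mod B H :=
  leftMk (M.X ⊗ N.X) (Δ[H] ▷ (M.X ⊗ N.X) ≫ tensorμ H H M.X N.X ≫ (leftAct M ⊗ₘ leftAct N))
    (by
      have h : η[H] ≫ Δ[H] = (λ_ (𝟙_ B)).inv ≫ (η[H] ⊗ₘ η[H]) := BimonObj.one_comul H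
      rw [← comp_whiskerRight_assoc, h,
        comp_whiskerRight_assoc, tensorμ_natural_left_assoc, tensorHom_comp_tensorHom,
        leftAct_one, leftAct_one, tensor_left_unitality])
    (by
      have h1 : H ◁ (Δ[H] ▷ (M.X ⊗ N.X) ≫ tensorμ H H M.X N.X ≫ (leftAct M ⊗ₘ leftAct N)) ≫
          Δ[H] ▷ (M.X ⊗ N.X) ≫ tensorμ H H M.X N.X ≫ (leftAct M ⊗ₘ leftAct N) =
          (Δ[H] ⊗ₘ Δ[H] ▷ (M.X ⊗ N.X)) ≫ (H ⊗ H) ◁ tensorμ H H M.X N.X ≫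
            tensorμ H H (H ⊗ M.X) (H ⊗ N.X) ≫
            ((H ◁ leftAct M ≫ leftAct M) ⊗ₘ (H ◁ leftAct N ≫ leftAct N)) := by
        rw [whiskerLeft_comp, whiskerLeft_comp, Category.assoc, Category.assoc,
          whisker_exchange_assoc, tensorμ_natural_right_assoc, whisker_exchange_assoc,
          tensorHom_comp_tensorHom,
          MonoidalCategory.tensorHom_def' Δ[H] (Δ[H] ▷ (M.X ⊗ N.X)), Category.assoc]
      rw [h1, ← comp_whiskerRight_assoc, BimonObj.mul_comul]
      simp only [comp_whiskerRight, Category.assoc]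
      rw [tensorμ_natural_left_assoc, tensorHom_comp_tensorHom, leftAct_mul, leftAct_mul,
        ← tensorHom_comp_tensorHom, tensor_associativity_assoc, ← tensorHom_id,
        associator_naturality_assoc, tensorHom_id])

/-- The unit object, on which `H` acts through its counit. -/
def leftUnit (H : B) [BimonObj H] : Mod B H :=
  leftMk (𝟙_ B) (ε[H] ▷ 𝟙_ B ≫ (λ_ (𝟙_ B)).hom)
    (by rw [← comp_whiskerRight_assoc, BimonObj.one_counit]; simp)
    (by
      have h : μ[H] ≫ ε[H] = (ε[H] ⊗ₘ ε[H]) ≫ (λ_ (𝟙_ B)).hom := BimonObj.mul_counit H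
      rw [← comp_whiskerRight_assoc, h, MonoidalCategory.tensorHom_def']
      monoidal)

lemma leftTensor_act_natural {H : B} [BimonObj H] {M N P Q : Mod B H} (f : M ⟶ P)
    (g : N ⟶ Q) : leftAct (leftTensor M N) ≫ (f.hom ⊗ₘ g.hom) =
      H ◁ (f.hom ⊗ₘ g.hom) ≫ leftAct (leftTensor P Q) := by
  change (Δ[H] ▷ (M.X ⊗ N.X) ≫ tensorμ H H M.X N.X ≫ (leftAct M ⊗ₘ leftAct N)) ≫
      (f.hom ⊗ₘ g.hom) = H ◁ (f.hom ⊗ₘ g.hom) ≫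
      Δ[H] ▷ (P.X ⊗ Q.X) ≫ tensorμ H H P.X Q.X ≫ (leftAct P ⊗ₘ leftAct Q)
  rw [whisker_exchange_assoc, tensorμ_natural_right_assoc,
    Category.assoc, Category.assoc, tensorHom_comp_tensorHom, tensorHom_comp_tensorHom,
    leftAct_hom, leftAct_hom]

instance (H : B) [BimonObj H] : MonoidalCategoryStruct (Mod B H) where
  tensorObj M N := leftTensor M N
  whiskerLeft M N P f := leftHomMk (M := leftTensor M N) (N := leftTensor M P) (M.X ◁ f.hom) (by
    have h := leftTensor_act_natural (𝟙 M) f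
    rwa [Mod.id_hom', id_tensorHom] at h)
  whiskerRight {M P} f N :=
    leftHomMk (M := leftTensor M N) (N := leftTensor P N) (f.hom ▷ N.X) (by
      have h := leftTensor_act_natural f (𝟙 N)
      rwa [Mod.id_hom', tensorHom_id] at h)
  tensorHom {M P N Q} f g :=
    leftHomMk (M := leftTensor M N) (N := leftTensor P Q) (f.hom ⊗ₘ g.hom)
      (leftTensor_act_natural f g)
  tensorUnit := leftUnit H
  associator M N P := leftIsoMk (M := leftTensor (leftTensor M N) P)
    (N := leftTensor M (leftTensor N P)) (α_ M.X N.X P.X) (by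
    have h1 : (Δ[H] ▷ (M.X ⊗ N.X) ≫ tensorμ H H M.X N.X ≫ (leftAct M ⊗ₘ leftAct N)) ⊗ₘ
          leftAct P =
        (Δ[H] ▷ (M.X ⊗ N.X) ⊗ₘ 𝟙 H ▷ P.X) ≫ tensorμ H H M.X N.X ▷ (H ⊗ P.X) ≫
          ((leftAct M ⊗ₘ leftAct N) ⊗ₘ leftAct P) := by
      simp only [← tensorHom_id, tensorHom_comp_tensorHom, id_tensorHom_id, Category.id_comp]
    have h2 : leftAct M ⊗ₘ
          (Δ[H] ▷ (N.X ⊗ P.X) ≫ tensorμ H H N.X P.X ≫ (leftAct N ⊗ₘ leftAct P)) =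
        (𝟙 H ▷ M.X ⊗ₘ Δ[H] ▷ (N.X ⊗ P.X)) ≫ (H ⊗ M.X) ◁ tensorμ H H N.X P.X ≫
          (leftAct M ⊗ₘ (leftAct N ⊗ₘ leftAct P)) := by
      simp only [← id_tensorHom, tensorHom_comp_tensorHom, id_whiskerRight, Category.id_comp]
    change (Δ[H] ▷ ((M.X ⊗ N.X) ⊗ P.X) ≫ tensorμ H H (M.X ⊗ N.X) P.X ≫
        ((Δ[H] ▷ (M.X ⊗ N.X) ≫ tensorμ H H M.X N.X ≫ (leftAct M ⊗ₘ leftAct N)) ⊗ₘ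
          leftAct P)) ≫ (α_ M.X N.X P.X).hom = H ◁ (α_ M.X N.X P.X).hom ≫
      Δ[H] ▷ (M.X ⊗ (N.X ⊗ P.X)) ≫ tensorμ H H M.X (N.X ⊗ P.X) ≫
        (leftAct M ⊗ₘ
          (Δ[H] ▷ (N.X ⊗ P.X) ≫ tensorμ H H N.X P.X ≫ (leftAct N ⊗ₘ leftAct P)))
    rw [h1, h2]
    simp only [Category.assoc]
    rw [← tensorμ_natural_left_assoc, ← tensorμ_natural_left_assoc, associator_naturality,
      associator_monoidal_assoc]
    simp only [tensorHom_id, id_tensorHom]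
    rw [← comp_whiskerRight_assoc, ← comp_whiskerRight_assoc,
      MonoidalCategory.tensorHom_def'_assoc, ← whisker_exchange_assoc,
      ← comp_whiskerRight_assoc, Category.assoc, ComonObj.comul_assoc])
  leftUnitor M := leftIsoMk (M := leftTensor (leftUnit H) M) (λ_ M.X) (by
    have h1 : (ε[H] ▷ 𝟙_ B ≫ (λ_ (𝟙_ B)).hom) ⊗ₘ leftAct M =
        (ε[H] ▷ 𝟙_ B ⊗ₘ 𝟙 H ▷ M.X) ≫ (λ_ (𝟙_ B)).hom ▷ (H ⊗ M.X) ≫ 𝟙_ B ◁ leftAct M := by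
      rw [id_whiskerRight, tensorHom_id, ← comp_whiskerRight_assoc,
        MonoidalCategory.tensorHom_def]
    change (Δ[H] ▷ (𝟙_ B ⊗ M.X) ≫ tensorμ H H (𝟙_ B) M.X ≫
        ((ε[H] ▷ 𝟙_ B ≫ (λ_ (𝟙_ B)).hom) ⊗ₘ leftAct M)) ≫ (λ_ M.X).hom =
      H ◁ (λ_ M.X).hom ≫ leftAct M
    rw [h1]
    simp only [Category.assoc]
    rw [← tensorμ_natural_left_assoc, leftUnitor_naturality, ← leftUnitor_monoidal_assoc,
      tensorHom_id, ← comp_whiskerRight_assoc, ComonObj.counit_comul]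
    simp [MonoidalCategory.tensorHom_def])
  rightUnitor M := leftIsoMk (M := leftTensor M (leftUnit H)) (ρ_ M.X) (by
    have h1 : leftAct M ⊗ₘ (ε[H] ▷ 𝟙_ B ≫ (λ_ (𝟙_ B)).hom) =
        (𝟙 H ▷ M.X ⊗ₘ ε[H] ▷ 𝟙_ B) ≫ (H ⊗ M.X) ◁ (λ_ (𝟙_ B)).hom ≫ leftAct M ▷ 𝟙_ B := by
      rw [id_whiskerRight, id_tensorHom, ← whiskerLeft_comp_assoc,
        MonoidalCategory.tensorHom_def']
    change (Δ[H] ▷ (M.X ⊗ 𝟙_ B) ≫ tensorμ H H M.X (𝟙_ B) ≫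
        (leftAct M ⊗ₘ (ε[H] ▷ 𝟙_ B ≫ (λ_ (𝟙_ B)).hom))) ≫ (ρ_ M.X).hom =
      H ◁ (ρ_ M.X).hom ≫ leftAct M
    rw [h1]
    simp only [Category.assoc]
    rw [← tensorμ_natural_left_assoc, rightUnitor_naturality, ← rightUnitor_monoidal_assoc,
      id_tensorHom, ← comp_whiskerRight_assoc, ComonObj.comul_counit]
    simp [MonoidalCategory.tensorHom_def])

instance (H : B) [BimonObj H] : MonoidalCategory (Mod B H) where
  tensorHom_def f g := Mod.hom_ext _ _ (MonoidalCategory.tensorHom_def f.hom g.hom)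
  id_tensorHom_id M N := Mod.hom_ext _ _ (id_tensorHom_id M.X N.X)
  tensorHom_comp_tensorHom f₁ f₂ g₁ g₂ :=
    Mod.hom_ext _ _ (tensorHom_comp_tensorHom f₁.hom f₂.hom g₁.hom g₂.hom)
  whiskerLeft_id M N := Mod.hom_ext _ _ (whiskerLeft_id M.X N.X)
  id_whiskerRight M N := Mod.hom_ext _ _ (id_whiskerRight M.X N.X)
  associator_naturality f g h :=
    Mod.hom_ext _ _ (associator_naturality f.hom g.hom h.hom)
  leftUnitor_naturality f := Mod.hom_ext _ _ (leftUnitor_naturality f.hom)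
  rightUnitor_naturality f := Mod.hom_ext _ _ (rightUnitor_naturality f.hom)
  pentagon M N P Q := Mod.hom_ext _ _ (pentagon M.X N.X P.X Q.X)
  triangle M N := Mod.hom_ext _ _ (triangle M.X N.X)

end Modules

/-! ### The coend of a braided autonomous category -/

section Double

set_option linter.unusedSectionVars false

variable {B : Type u} [Category.{v} B] [MonoidalCategory B] [RigidCategory B]

variable (B) in
/-- The bifunctor `(X, Y) ↦ Xᘁ ⊗ Y`, where `Xᘁ` is the dual of `X` with evaluation
`Xᘁ ⊗ X ⟶ 𝟙` and coevaluation `𝟙 ⟶ X ⊗ Xᘁ`. -/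
def dualTensor : Bᵒᵖ ⥤ B ⥤ B where
  obj X :=
    { obj := fun Y => X.unopᘁ ⊗ Y
      map := fun g => X.unopᘁ ◁ g }
  map f :=
    { app := fun Y => (f.unopᘁ) ▷ Y
      naturality := fun _ _ g => whisker_exchange _ g }
  map_id X := by
    ext Y
    simp [rightAdjointMate_id]
  map_comp f g := by
    ext Y
    simp [comp_rightAdjointMate]

variable {W : Cowedge (dualTensor B)}

/-- The universal dinatural transformation `i_Y : Yᘁ ⊗ Y ⟶ C` of a coend `C`. -/
def coendι (W : Cowedge (dualTensor B)) (Y : B) : Yᘁ ⊗ Y ⟶ W.pt := W.π Y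

lemma coendι_condition (W : Cowedge (dualTensor B)) {X Y : B} (f : X ⟶ Y) :
    fᘁ ▷ X ≫ coendι W X = Yᘁ ◁ f ≫ coendι W Y :=
  Cowedge.condition W f

/-- The universal coaction `Y ⟶ Y ⊗ C` of the coend. -/
def coact (W : Cowedge (dualTensor B)) (Y : B) : Y ⟶ Y ⊗ W.pt :=
  tensorLeftHomEquiv Y Y Yᘁ W.pt (coendι W Y)

/-- The morphism `C ⟶ V` induced by a natural family `Y ⟶ Y ⊗ V`. -/
noncomputable def coendLift (hW : IsColimit W) (V : B) (ξ : ∀ Y : B, Y ⟶ Y ⊗ V)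
    (hξ : ∀ {Y Y' : B} (f : Y ⟶ Y'), f ≫ ξ Y' = ξ Y ≫ f ▷ V) : W.pt ⟶ V :=
  Cowedge.IsColimit.desc hW (fun Y => (tensorLeftHomEquiv Y Y Yᘁ V).symm (ξ Y)) (by
    intro X Y f
    change fᘁ ▷ X ≫ (tensorLeftHomEquiv X X Xᘁ V).symm (ξ X) =
      Yᘁ ◁ f ≫ (tensorLeftHomEquiv Y Y Yᘁ V).symm (ξ Y)
    rw [← tensorLeftHomEquiv_symm_naturality, hξ f]
    change fᘁ ▷ X ≫ Xᘁ ◁ ξ X ≫ (α_ _ _ _).inv ≫ ε_ X Xᘁ ▷ V ≫ (λ_ V).hom =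
      Yᘁ ◁ (ξ X ≫ f ▷ V) ≫ (α_ _ _ _).inv ≫ ε_ Y Yᘁ ▷ V ≫ (λ_ V).hom
    rw [← whisker_exchange_assoc, whiskerLeft_comp, Category.assoc,
      associator_inv_naturality_middle_assoc, associator_inv_naturality_left_assoc,
      ← comp_whiskerRight_assoc, ← comp_whiskerRight_assoc, rightAdjointMate_comp_evaluation])

lemma coendι_desc (hW : IsColimit W) (V : B) (ξ : ∀ Y : B, Y ⟶ Y ⊗ V)
    (hξ : ∀ {Y Y' : B} (f : Y ⟶ Y'), f ≫ ξ Y' = ξ Y ≫ f ▷ V) (Y : B) :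
    coendι W Y ≫ coendLift hW V ξ hξ = (tensorLeftHomEquiv Y Y Yᘁ V).symm (ξ Y) :=
  Cowedge.IsColimit.π_desc _ _ _ _

lemma coact_natural (W : Cowedge (dualTensor B)) {Y Y' : B} (f : Y ⟶ Y') :
    f ≫ coact W Y' = coact W Y ≫ f ▷ W.pt := by
  change f ≫ (λ_ _).inv ≫ η_ Y' Y'ᘁ ▷ Y' ≫ (α_ _ _ _).hom ≫ Y' ◁ coendι W Y' =
    ((λ_ _).inv ≫ η_ Y Yᘁ ▷ Y ≫ (α_ _ _ _).hom ≫ Y ◁ coendι W Y) ≫ f ▷ W.pt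
  rw [leftUnitor_inv_naturality_assoc, whisker_exchange_assoc,
    associator_naturality_right_assoc, ← whiskerLeft_comp, ← coendι_condition,
    whiskerLeft_comp, ← associator_naturality_middle_assoc, ← comp_whiskerRight_assoc,
    coevaluation_comp_rightAdjointMate]
  simp only [Category.assoc, whisker_exchange, comp_whiskerRight]
  rw [associator_naturality_left_assoc]

lemma coact_coendLift (hW : IsColimit W) (V : B) (ξ : ∀ Y : B, Y ⟶ Y ⊗ V)
    (hξ : ∀ {Y Y' : B} (f : Y ⟶ Y'), f ≫ ξ Y' = ξ Y ≫ f ▷ V) (Y : B) :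
    coact W Y ≫ Y ◁ coendLift hW V ξ hξ = ξ Y := by
  rw [coact, ← tensorLeftHomEquiv_naturality, coendι_desc, Equiv.apply_symm_apply]

lemma coend_hom_ext (hW : IsColimit W) {V : B} {f g : W.pt ⟶ V}
    (h : ∀ Y : B, coact W Y ≫ Y ◁ f = coact W Y ≫ Y ◁ g) : f = g := by
  refine Cowedge.IsColimit.hom_ext hW fun (Y : B) => ?_
  change coendι W Y ≫ f = coendι W Y ≫ g
  apply (tensorLeftHomEquiv Y Y Yᘁ V).injective
  have h' := h Y
  rw [coact, ← tensorLeftHomEquiv_naturality, ← tensorLeftHomEquiv_naturality] at h'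
  exact h'

/-- The counit of the coend, with `i_Y ≫ ε_C` the evaluation. -/
noncomputable def coendCounit (hW : IsColimit W) : W.pt ⟶ 𝟙_ B :=
  coendLift hW (𝟙_ B) (fun Y => (ρ_ Y).inv) (fun f => by simp)

/-! ### The centralizer of `A` -/

/-- The object `Z(A) = Aᘁ ⊗ C`. -/
def centralizerObj (W : Cowedge (dualTensor B)) (A : B) : B := Aᘁ ⊗ W.pt

/-- The morphism `C ⟶ A ⊗ Z(A)` given by the coevaluation of `A`. -/
def coevZ (W : Cowedge (dualTensor B)) (A : B) : W.pt ⟶ A ⊗ centralizerObj W A :=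
  tensorLeftHomEquiv W.pt A Aᘁ (Aᘁ ⊗ W.pt) (𝟙 _)

/-- The universal natural transformation `Y ⟶ (Y ⊗ A) ⊗ Z(A)`. -/
def coactZ (W : Cowedge (dualTensor B)) (A Y : B) : Y ⟶ (Y ⊗ A) ⊗ centralizerObj W A :=
  coact W Y ≫ Y ◁ coevZ W A ≫ (α_ Y A (centralizerObj W A)).inv

lemma coactZ_natural (W : Cowedge (dualTensor B)) (A : B) {Y Y' : B} (f : Y ⟶ Y') :
    f ≫ coactZ W A Y' = coactZ W A Y ≫ f ▷ A ▷ centralizerObj W A := by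
  dsimp only [coactZ]
  rw [← Category.assoc, coact_natural]
  simp only [Category.assoc]
  rw [← whisker_exchange_assoc]
  simp

lemma zLift_natural {A V : B} (ξ : ∀ Y : B, Y ⟶ (Y ⊗ A) ⊗ V)
    (hξ : ∀ {Y Y' : B} (f : Y ⟶ Y'), f ≫ ξ Y' = ξ Y ≫ f ▷ A ▷ V) {Y Y' : B} (f : Y ⟶ Y') :
    f ≫ ξ Y' ≫ (α_ Y' A V).hom = (ξ Y ≫ (α_ Y A V).hom) ≫ f ▷ (A ⊗ V) := by
  rw [← Category.assoc, hξ f]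
  simp

/-- The morphism `Z(A) ⟶ V` induced by a natural family `Y ⟶ (Y ⊗ A) ⊗ V`. -/
noncomputable def zLift (hW : IsColimit W) (A V : B) (ξ : ∀ Y : B, Y ⟶ (Y ⊗ A) ⊗ V)
    (hξ : ∀ {Y Y' : B} (f : Y ⟶ Y'), f ≫ ξ Y' = ξ Y ≫ f ▷ A ▷ V) : centralizerObj W A ⟶ V :=
  (tensorLeftHomEquiv W.pt A Aᘁ V).symm
    (coendLift hW (A ⊗ V) (fun Y => ξ Y ≫ (α_ Y A V).hom) (zLift_natural ξ hξ))

lemma coevZ_comp (W : Cowedge (dualTensor B)) (A : B) {V : B} (g : centralizerObj W A ⟶ V) :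
    coevZ W A ≫ A ◁ g = tensorLeftHomEquiv W.pt A Aᘁ V g := by
  have h := tensorLeftHomEquiv_naturality (X := W.pt) (Y := A) (Y' := Aᘁ)
    (𝟙 (Aᘁ ⊗ W.pt)) (Z' := V) g
  exact h.symm.trans (congrArg _ (Category.id_comp (X := Aᘁ ⊗ W.pt) g))

lemma coactZ_comp (W : Cowedge (dualTensor B)) (A : B) {V : B} (g : centralizerObj W A ⟶ V)
    (Y : B) : coactZ W A Y ≫ (Y ⊗ A) ◁ g =
      coact W Y ≫ Y ◁ tensorLeftHomEquiv W.pt A Aᘁ V g ≫ (α_ Y A V).inv := by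
  rw [← coevZ_comp]
  simp [coactZ]

lemma coactZ_zLift (hW : IsColimit W) (A V : B) (ξ : ∀ Y : B, Y ⟶ (Y ⊗ A) ⊗ V)
    (hξ : ∀ {Y Y' : B} (f : Y ⟶ Y'), f ≫ ξ Y' = ξ Y ≫ f ▷ A ▷ V) (Y : B) :
    coactZ W A Y ≫ (Y ⊗ A) ◁ zLift hW A V ξ hξ = ξ Y := by
  rw [coactZ_comp, zLift, Equiv.apply_symm_apply, ← Category.assoc,
    coact_coendLift hW (A ⊗ V) (fun Y => ξ Y ≫ (α_ Y A V).hom) (zLift_natural ξ hξ)]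
  simp

lemma z_hom_ext (hW : IsColimit W) {A V : B} {f g : centralizerObj W A ⟶ V}
    (h : ∀ Y : B, coactZ W A Y ≫ (Y ⊗ A) ◁ f = coactZ W A Y ≫ (Y ⊗ A) ◁ g) : f = g := by
  apply (tensorLeftHomEquiv W.pt A Aᘁ V).injective
  refine coend_hom_ext hW fun Y => ?_
  have h' := h Y
  rw [coactZ_comp, coactZ_comp, ← Category.assoc, ← Category.assoc, cancel_mono] at h'
  exact h'

lemma zLiftParam_natural {A P V : B} (ξ : ∀ Y : B, Y ⊗ P ⟶ (Y ⊗ A) ⊗ V)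
    (hξ : ∀ {Y Y' : B} (f : Y ⟶ Y'), f ▷ P ≫ ξ Y' = ξ Y ≫ f ▷ A ▷ V)
    {Y Y' : B} (f : Y ⟶ Y') :
    f ≫ tensorRightHomEquiv Y' P Pᘁ ((Y' ⊗ A) ⊗ V) (ξ Y') ≫ (α_ (Y' ⊗ A) V Pᘁ).hom =
      (tensorRightHomEquiv Y P Pᘁ ((Y ⊗ A) ⊗ V) (ξ Y) ≫ (α_ (Y ⊗ A) V Pᘁ).hom) ≫
        f ▷ A ▷ (V ⊗ Pᘁ) := by
  change f ≫ ((ρ_ Y').inv ≫ Y' ◁ η_ P Pᘁ ≫ (α_ _ _ _).inv ≫ ξ Y' ▷ Pᘁ) ≫ (α_ _ _ _).hom =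
    (((ρ_ Y).inv ≫ Y ◁ η_ P Pᘁ ≫ (α_ _ _ _).inv ≫ ξ Y ▷ Pᘁ) ≫ (α_ _ _ _).hom) ≫ _
  simp only [Category.assoc]
  rw [rightUnitor_inv_naturality_assoc, ← whisker_exchange_assoc,
    associator_inv_naturality_left_assoc, ← comp_whiskerRight_assoc, hξ f]
  simp

/-- The morphism `Z(A) ⊗ P ⟶ V` induced by a family `Y ⊗ P ⟶ (Y ⊗ A) ⊗ V` natural in `Y`. -/
noncomputable def zLiftParam (hW : IsColimit W) (A P V : B)
    (ξ : ∀ Y : B, Y ⊗ P ⟶ (Y ⊗ A) ⊗ V)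
    (hξ : ∀ {Y Y' : B} (f : Y ⟶ Y'), f ▷ P ≫ ξ Y' = ξ Y ≫ f ▷ A ▷ V) :
    centralizerObj W A ⊗ P ⟶ V :=
  (tensorRightHomEquiv (centralizerObj W A) P Pᘁ V).symm
    (zLift hW A (V ⊗ Pᘁ)
      (fun Y => tensorRightHomEquiv Y P Pᘁ ((Y ⊗ A) ⊗ V) (ξ Y) ≫ (α_ (Y ⊗ A) V Pᘁ).hom)
      (zLiftParam_natural ξ hξ))

lemma coactZ_param (W : Cowedge (dualTensor B)) (A P V : B) (f : centralizerObj W A ⊗ P ⟶ V)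
    (Y : B) : coactZ W A Y ▷ P ≫ (α_ (Y ⊗ A) (centralizerObj W A) P).hom ≫ (Y ⊗ A) ◁ f =
      (tensorRightHomEquiv Y P Pᘁ ((Y ⊗ A) ⊗ V)).symm (coactZ W A Y ≫
        (Y ⊗ A) ◁ tensorRightHomEquiv (centralizerObj W A) P Pᘁ V f ≫
          (α_ (Y ⊗ A) V Pᘁ).inv) := by
  obtain ⟨g, rfl⟩ := (tensorRightHomEquiv (centralizerObj W A) P Pᘁ V).symm.surjective f
  rw [Equiv.apply_symm_apply]
  change coactZ W A Y ▷ P ≫ (α_ _ _ _).hom ≫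
      (Y ⊗ A) ◁ (g ▷ P ≫ (α_ _ _ _).hom ≫ V ◁ ε_ P Pᘁ ≫ (ρ_ V).hom) =
    (coactZ W A Y ≫ (Y ⊗ A) ◁ g ≫ (α_ _ _ _).inv) ▷ P ≫ (α_ _ _ _).hom ≫
      ((Y ⊗ A) ⊗ V) ◁ ε_ P Pᘁ ≫ (ρ_ _).hom
  simp only [comp_whiskerRight, whiskerLeft_comp, Category.assoc]
  monoidal

lemma coactZ_zLiftParam (hW : IsColimit W) (A P V : B)
    (ξ : ∀ Y : B, Y ⊗ P ⟶ (Y ⊗ A) ⊗ V)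
    (hξ : ∀ {Y Y' : B} (f : Y ⟶ Y'), f ▷ P ≫ ξ Y' = ξ Y ≫ f ▷ A ▷ V) (Y : B) :
    coactZ W A Y ▷ P ≫ (α_ (Y ⊗ A) (centralizerObj W A) P).hom ≫
      (Y ⊗ A) ◁ zLiftParam hW A P V ξ hξ = ξ Y := by
  rw [coactZ_param, zLiftParam, Equiv.apply_symm_apply, ← Category.assoc,
    coactZ_zLift hW A (V ⊗ Pᘁ) _ (zLiftParam_natural ξ hξ), Category.assoc, Iso.hom_inv_id, Category.comp_id, Equiv.symm_apply_apply]

lemma z_param_hom_ext (hW : IsColimit W) {A P V : B} {f g : centralizerObj W A ⊗ P ⟶ V}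
    (h : ∀ Y : B, coactZ W A Y ▷ P ≫ (α_ (Y ⊗ A) (centralizerObj W A) P).hom ≫ (Y ⊗ A) ◁ f =
      coactZ W A Y ▷ P ≫ (α_ (Y ⊗ A) (centralizerObj W A) P).hom ≫ (Y ⊗ A) ◁ g) : f = g := by
  apply (tensorRightHomEquiv (centralizerObj W A) P Pᘁ V).injective
  refine z_hom_ext hW fun Y => ?_
  have h' := h Y
  rw [coactZ_param, coactZ_param, EmbeddingLike.apply_eq_iff_eq, ← Category.assoc,
    ← Category.assoc, cancel_mono] at h'
  exact h'

variable [BraidedCategory B]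

/-- The centralizing morphisms `∂_{X,Y} : X ⊗ Y ⟶ (Y ⊗ A) ⊗ (X ⊗ Z(A))`. -/
def centralizing (W : Cowedge (dualTensor B)) (A X Y : B) :
    X ⊗ Y ⟶ (Y ⊗ A) ⊗ (X ⊗ centralizerObj W A) :=
  X ◁ coactZ W A Y ≫ (α_ X (Y ⊗ A) (centralizerObj W A)).inv ≫
    (β_ X (Y ⊗ A)).hom ▷ centralizerObj W A ≫ (α_ (Y ⊗ A) X (centralizerObj W A)).hom

lemma zLiftLeft_natural {A X V : B} (κ : ∀ Y : B, X ⊗ Y ⟶ (Y ⊗ A) ⊗ V)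
    (hκ : ∀ {Y Y' : B} (f : Y ⟶ Y'), X ◁ f ≫ κ Y' = κ Y ≫ f ▷ A ▷ V)
    {Y Y' : B} (f : Y ⟶ Y') :
    f ≫ tensorLeftHomEquiv Y' (ᘁX) X ((Y' ⊗ A) ⊗ V) (κ Y') ≫ (α_ (ᘁX) (Y' ⊗ A) V).inv ≫
        (β_ (ᘁX) (Y' ⊗ A)).hom ▷ V ≫ (α_ (Y' ⊗ A) (ᘁX) V).hom =
      (tensorLeftHomEquiv Y (ᘁX) X ((Y ⊗ A) ⊗ V) (κ Y) ≫ (α_ (ᘁX) (Y ⊗ A) V).inv ≫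
        (β_ (ᘁX) (Y ⊗ A)).hom ▷ V ≫ (α_ (Y ⊗ A) (ᘁX) V).hom) ≫ f ▷ A ▷ ((ᘁX) ⊗ V) := by
  change f ≫ ((λ_ _).inv ≫ η_ (ᘁX : B) X ▷ Y' ≫ (α_ _ _ _).hom ≫ (ᘁX : B) ◁ κ Y') ≫ _ =
    (((λ_ _).inv ≫ η_ (ᘁX : B) X ▷ Y ≫ (α_ _ _ _).hom ≫ (ᘁX : B) ◁ κ Y) ≫ _) ≫ _
  simp only [Category.assoc]
  rw [leftUnitor_inv_naturality_assoc, whisker_exchange_assoc,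
    associator_naturality_right_assoc, ← whiskerLeft_comp_assoc, hκ f, whiskerLeft_comp_assoc,
    associator_inv_naturality_middle_assoc, ← comp_whiskerRight_assoc,
    braiding_naturality_right, comp_whiskerRight_assoc, associator_naturality_left]

/-- The morphism `X ⊗ Z(A) ⟶ V` induced, through the morphisms `∂_{X,Y}`, by a family
`X ⊗ Y ⟶ (Y ⊗ A) ⊗ V` natural in `Y`. -/
noncomputable def zLiftLeft (hW : IsColimit W) (A X V : B)
    (κ : ∀ Y : B, X ⊗ Y ⟶ (Y ⊗ A) ⊗ V)
    (hκ : ∀ {Y Y' : B} (f : Y ⟶ Y'), X ◁ f ≫ κ Y' = κ Y ≫ f ▷ A ▷ V) :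
    X ⊗ centralizerObj W A ⟶ V :=
  (tensorLeftHomEquiv (centralizerObj W A) (ᘁX) X V).symm
    (zLift hW A ((ᘁX) ⊗ V)
      (fun Y => tensorLeftHomEquiv Y (ᘁX) X ((Y ⊗ A) ⊗ V) (κ Y) ≫ (α_ (ᘁX) (Y ⊗ A) V).inv ≫
        (β_ (ᘁX) (Y ⊗ A)).hom ▷ V ≫ (α_ (Y ⊗ A) (ᘁX) V).hom)
      (zLiftLeft_natural κ hκ))

lemma braiding_slide (X X' T V : B) (e : X ⊗ X' ⟶ 𝟙_ B) :
    X ◁ ((α_ X' T V).inv ≫ (β_ X' T).hom ▷ V ≫ (α_ T X' V).hom) ≫ (α_ X T (X' ⊗ V)).inv ≫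
      (β_ X T).hom ▷ (X' ⊗ V) ≫ (α_ T X (X' ⊗ V)).hom ≫
        T ◁ ((α_ X X' V).inv ≫ e ▷ V ≫ (λ_ V).hom) =
      (α_ X X' (T ⊗ V)).inv ≫ e ▷ (T ⊗ V) ≫ (λ_ (T ⊗ V)).hom := by
  have h : e ▷ T = (α_ X X' T).hom ≫ X ◁ (β_ X' T).hom ≫ (α_ X T X').inv ≫
      (β_ X T).hom ▷ X' ≫ (α_ T X X').hom ≫ T ◁ e ≫ (ρ_ T).hom ≫ (λ_ T).inv := by
    have h1 := braiding_naturality_left e T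
    rw [braiding_tensor_left_hom, braiding_tensorUnit_left] at h1
    simp only [Category.assoc] at h1
    rw [← reassoc_of% h1]
    simp
  have h2 : (α_ X X' (T ⊗ V)).inv ≫ e ▷ (T ⊗ V) ≫ (λ_ (T ⊗ V)).hom =
      (α_ X X' (T ⊗ V)).inv ≫ (α_ (X ⊗ X') T V).inv ≫ (e ▷ T) ▷ V ≫ (λ_ T).hom ▷ V := by
    monoidal
  rw [h2, h]
  monoidal

lemma centralizing_zLiftLeft (hW : IsColimit W) (A X V : B)
    (κ : ∀ Y : B, X ⊗ Y ⟶ (Y ⊗ A) ⊗ V)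
    (hκ : ∀ {Y Y' : B} (f : Y ⟶ Y'), X ◁ f ≫ κ Y' = κ Y ≫ f ▷ A ▷ V) (Y : B) :
    centralizing W A X Y ≫ (Y ⊗ A) ◁ zLiftLeft hW A X V κ hκ = κ Y := by
  have h := coactZ_zLift hW A ((ᘁX) ⊗ V) _ (zLiftLeft_natural κ hκ) Y
  change (X ◁ coactZ W A Y ≫ (α_ _ _ _).inv ≫ (β_ X (Y ⊗ A)).hom ▷ _ ≫ (α_ _ _ _).hom) ≫
    (Y ⊗ A) ◁ (X ◁ zLift hW A ((ᘁX) ⊗ V) _ (zLiftLeft_natural κ hκ) ≫ (α_ _ _ _).inv ≫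
      ε_ (ᘁX : B) X ▷ V ≫ (λ_ V).hom) = κ Y
  rw [whiskerLeft_comp]
  simp only [Category.assoc]
  rw [← associator_naturality_right_assoc, ← whisker_exchange_assoc,
    ← associator_inv_naturality_right_assoc, ← whiskerLeft_comp_assoc, h]
  rw [whiskerLeft_comp, Category.assoc, braiding_slide]
  exact (tensorLeftHomEquiv Y (ᘁX) X ((Y ⊗ A) ⊗ V)).symm_apply_apply (κ Y)

/-! ### The monad `? ⊗ A` -/

/-- The product `(Y ⊗ A) ⊗ A ⟶ Y ⊗ A` of the monad `? ⊗ A`. -/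
def freeMul (A : B) [MonObj A] (Y : B) : (Y ⊗ A) ⊗ A ⟶ Y ⊗ A :=
  (α_ Y A A).hom ≫ Y ◁ μ[A]

/-- The unit `Y ⟶ Y ⊗ A` of the monad `? ⊗ A`. -/
def freeUnit (A : B) [MonObj A] (Y : B) : Y ⟶ Y ⊗ A :=
  (ρ_ Y).inv ≫ Y ◁ η[A]

/-- The comonoidal structure `(X ⊗ Y) ⊗ A ⟶ (X ⊗ A) ⊗ (Y ⊗ A)` of the bimonad `? ⊗ A`. -/
def freeComul (A : B) [ComonObj A] (X Y : B) : (X ⊗ Y) ⊗ A ⟶ (X ⊗ A) ⊗ (Y ⊗ A) :=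
  (X ⊗ Y) ◁ Δ[A] ≫ tensorμ X Y A A

/-- The comonoidal structure `𝟙 ⊗ A ⟶ 𝟙` of the bimonad `? ⊗ A`. -/
def freeCounit (A : B) [ComonObj A] : 𝟙_ B ⊗ A ⟶ 𝟙_ B :=
  (λ_ A).hom ≫ ε[A]

lemma freeMul_natural (A : B) [MonObj A] {Y Y' : B} (f : Y ⟶ Y') :
    f ▷ A ▷ A ≫ freeMul A Y' = freeMul A Y ≫ f ▷ A := by
  simp [freeMul, whisker_exchange]

lemma freeComul_natural (A : B) [ComonObj A] {X X' Y Y' : B} (f : X ⟶ X') (g : Y ⟶ Y') :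
    (f ⊗ₘ g) ▷ A ≫ freeComul A X' Y' = freeComul A X Y ≫ (f ▷ A ⊗ₘ g ▷ A) := by
  dsimp only [freeComul]
  rw [← whisker_exchange_assoc, tensorμ_natural_left, Category.assoc]

/-! ### The Hopf algebra `Z(A)` -/

/-- The unit of `Z(A)`. -/
def zUnit (W : Cowedge (dualTensor B)) (A : B) [ComonObj A] : 𝟙_ B ⟶ centralizerObj W A :=
  coactZ W A (𝟙_ B) ≫ freeCounit A ▷ centralizerObj W A ≫ (λ_ (centralizerObj W A)).hom

lemma zCounit_natural (A : B) [MonObj A] {Y Y' : B} (f : Y ⟶ Y') :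
    f ≫ freeUnit A Y' ≫ (ρ_ (Y' ⊗ A)).inv = (freeUnit A Y ≫ (ρ_ (Y ⊗ A)).inv) ≫ f ▷ A ▷ 𝟙_ B := by
  dsimp only [freeUnit]
  simp only [Category.assoc]
  rw [← rightUnitor_inv_naturality, rightUnitor_inv_naturality_assoc, ← whisker_exchange_assoc]

/-- The counit of `Z(A)`, induced by the unit of `A`. -/
noncomputable def zCounit (hW : IsColimit W) (A : B) [MonObj A] :
    centralizerObj W A ⟶ 𝟙_ B :=
  zLift hW A (𝟙_ B) (fun Y => freeUnit A Y ≫ (ρ_ (Y ⊗ A)).inv) (zCounit_natural A)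

lemma zComul_natural (W : Cowedge (dualTensor B)) (A : B) [MonObj A] {Y Y' : B} (f : Y ⟶ Y') :
    f ≫ coactZ W A Y' ≫ coactZ W A (Y' ⊗ A) ▷ centralizerObj W A ≫
        freeMul A Y' ▷ centralizerObj W A ▷ centralizerObj W A ≫
        (α_ (Y' ⊗ A) (centralizerObj W A) (centralizerObj W A)).hom =
      (coactZ W A Y ≫ coactZ W A (Y ⊗ A) ▷ centralizerObj W A ≫
        freeMul A Y ▷ centralizerObj W A ▷ centralizerObj W A ≫
        (α_ (Y ⊗ A) (centralizerObj W A) (centralizerObj W A)).hom) ≫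
        f ▷ A ▷ (centralizerObj W A ⊗ centralizerObj W A) := by
  simp only [Category.assoc]
  rw [← Category.assoc, coactZ_natural, Category.assoc, ← comp_whiskerRight_assoc,
    coactZ_natural, comp_whiskerRight, Category.assoc,
    ← comp_whiskerRight_assoc (f ▷ A ▷ A ▷ centralizerObj W A), ← comp_whiskerRight,
    freeMul_natural]
  simp

/-- The coproduct of `Z(A)`, induced by the product of `A`. -/
noncomputable def zComul (hW : IsColimit W) (A : B) [MonObj A] :
    centralizerObj W A ⟶ centralizerObj W A ⊗ centralizerObj W A :=
  zLift hW A (centralizerObj W A ⊗ centralizerObj W A)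
    (fun Y => coactZ W A Y ≫ coactZ W A (Y ⊗ A) ▷ centralizerObj W A ≫
      freeMul A Y ▷ centralizerObj W A ▷ centralizerObj W A ≫
      (α_ (Y ⊗ A) (centralizerObj W A) (centralizerObj W A)).hom)
    (zComul_natural W A)

lemma zMulAux_natural (W : Cowedge (dualTensor B)) (A : B) [ComonObj A] (Y : B) {X X' : B}
    (f : X ⟶ X') :
    f ▷ Y ≫ coactZ W A (X' ⊗ Y) ≫ freeComul A X' Y ▷ centralizerObj W A ≫
        (α_ (X' ⊗ A) (Y ⊗ A) (centralizerObj W A)).hom =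
      (coactZ W A (X ⊗ Y) ≫ freeComul A X Y ▷ centralizerObj W A ≫
        (α_ (X ⊗ A) (Y ⊗ A) (centralizerObj W A)).hom) ≫
        f ▷ A ▷ ((Y ⊗ A) ⊗ centralizerObj W A) := by
  have h := freeComul_natural A f (𝟙 Y)
  simp only [id_whiskerRight, tensorHom_id] at h
  simp only [Category.assoc]
  rw [← Category.assoc, coactZ_natural, Category.assoc, ← comp_whiskerRight_assoc, h]
  simp

/-- The morphism `Z(A) ⊗ Y ⟶ (Y ⊗ A) ⊗ Z(A)` through which the product of `Z(A)` is defined: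
it is induced by `X ⊗ Y ⟶ ((X ⊗ Y) ⊗ A) ⊗ Z(A) ⟶ (X ⊗ A) ⊗ ((Y ⊗ A) ⊗ Z(A))`. -/
noncomputable def zMulAux (hW : IsColimit W) (A : B) [ComonObj A] (Y : B) :
    centralizerObj W A ⊗ Y ⟶ (Y ⊗ A) ⊗ centralizerObj W A :=
  zLiftParam hW A Y ((Y ⊗ A) ⊗ centralizerObj W A)
    (fun X => coactZ W A (X ⊗ Y) ≫ freeComul A X Y ▷ centralizerObj W A ≫
      (α_ (X ⊗ A) (Y ⊗ A) (centralizerObj W A)).hom)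
    (zMulAux_natural W A Y)

lemma zMul_natural (hW : IsColimit W) (A : B) [ComonObj A] {Y Y' : B} (f : Y ⟶ Y') :
    centralizerObj W A ◁ f ≫ zMulAux hW A Y' =
      zMulAux hW A Y ≫ f ▷ A ▷ centralizerObj W A := by
  refine z_param_hom_ext hW fun X => ?_
  have h1 := coactZ_zLiftParam hW A Y ((Y ⊗ A) ⊗ centralizerObj W A) _
    (zMulAux_natural W A Y) X
  have h2 := coactZ_zLiftParam hW A Y' ((Y' ⊗ A) ⊗ centralizerObj W A) _
    (zMulAux_natural W A Y') X
  have h := freeComul_natural A (𝟙 X) f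
  simp only [id_whiskerRight, id_tensorHom] at h
  rw [whiskerLeft_comp, ← associator_naturality_right_assoc, ← whisker_exchange_assoc, zMulAux, h2,
    whiskerLeft_comp, zMulAux, reassoc_of% h1, ← Category.assoc, coactZ_natural]
  simp only [Category.assoc]
  rw [← comp_whiskerRight_assoc, h]
  simp

/-- The product of `Z(A)`, induced by the coproduct of `A`. -/
noncomputable def zMul (hW : IsColimit W) (A : B) [ComonObj A] :
    centralizerObj W A ⊗ centralizerObj W A ⟶ centralizerObj W A :=
  zLiftLeft hW A (centralizerObj W A) (centralizerObj W A) (fun Y => zMulAux hW A Y)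
    (zMul_natural hW A)

/-! ### The canonical distributive law -/

lemma centralizing_natural (W : Cowedge (dualTensor B)) (A X : B) {Y Y' : B} (f : Y ⟶ Y') :
    X ◁ f ≫ centralizing W A X Y' =
      centralizing W A X Y ≫ f ▷ A ▷ (X ⊗ centralizerObj W A) := by
  dsimp only [centralizing]
  simp only [Category.assoc]
  rw [← whiskerLeft_comp_assoc, coactZ_natural, whiskerLeft_comp_assoc,
    associator_inv_naturality_middle_assoc, ← comp_whiskerRight_assoc,
    braiding_naturality_right, comp_whiskerRight_assoc, associator_naturality_left]

/-- The morphism `Y ⊗ A ⟶ A ⊗ (Y ⊗ A)` which splits `A` with the coproduct and braids the first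
factor in front of `Y`. -/
def splitAct (A : B) [ComonObj A] (Y : B) : Y ⊗ A ⟶ A ⊗ (Y ⊗ A) :=
  Y ◁ Δ[A] ≫ (α_ Y A A).inv ≫ (β_ Y A).hom ▷ A ≫ (α_ A Y A).hom

lemma splitAct_natural (A : B) [ComonObj A] {Y Y' : B} (f : Y ⟶ Y') :
    f ▷ A ≫ splitAct A Y' = splitAct A Y ≫ A ◁ f ▷ A := by
  dsimp only [splitAct]
  rw [← whisker_exchange_assoc, associator_inv_naturality_left_assoc, ← comp_whiskerRight_assoc,
    braiding_naturality_left]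
  simp

/-- The morphism `Y ⊗ A ⟶ (Y ⊗ A) ⊗ (A ⊗ Z(A))` which sends `y ⊗ a` to `∂(a₁, y ⊗ a₂)`, the two
factors `A` next to `Y` being multiplied. -/
def lawAux (W : Cowedge (dualTensor B)) (A : B) [BimonObj A] (Y : B) :
    Y ⊗ A ⟶ (Y ⊗ A) ⊗ (A ⊗ centralizerObj W A) :=
  splitAct A Y ≫ centralizing W A A (Y ⊗ A) ≫ freeMul A Y ▷ (A ⊗ centralizerObj W A)

lemma lawAux_natural (W : Cowedge (dualTensor B)) (A : B) [BimonObj A] {Y Y' : B} (f : Y ⟶ Y') :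
    f ▷ A ≫ lawAux W A Y' = lawAux W A Y ≫ f ▷ A ▷ (A ⊗ centralizerObj W A) := by
  dsimp only [lawAux]
  rw [← Category.assoc, splitAct_natural]
  simp only [Category.assoc]
  rw [← Category.assoc (A ◁ f ▷ A), centralizing_natural, Category.assoc, ← comp_whiskerRight,
    freeMul_natural, comp_whiskerRight]

/-- The morphism `A ⊗ (Y ⊗ A) ⟶ Y ⊗ A` by which the inverse antipode of the first factor acts on
the free right module `Y ⊗ A`, after an inverse braiding. -/
noncomputable def antipodeAct (A : B) [HopfObj A] [IsIso 𝒮[A]] (Y : B) :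
    A ⊗ (Y ⊗ A) ⟶ Y ⊗ A :=
  inv 𝒮[A] ▷ (Y ⊗ A) ≫ (β_ (Y ⊗ A) A).inv ≫ freeMul A Y

lemma antipodeAct_natural (A : B) [HopfObj A] [IsIso 𝒮[A]] {Y Y' : B} (f : Y ⟶ Y') :
    A ◁ f ▷ A ≫ antipodeAct A Y' = antipodeAct A Y ≫ f ▷ A := by
  dsimp only [antipodeAct]
  simp only [Category.assoc]
  rw [← freeMul_natural, whisker_exchange_assoc, braiding_inv_naturality_right_assoc]

lemma canonicalLaw_natural (W : Cowedge (dualTensor B)) (A : B) [HopfObj A] [IsIso 𝒮[A]]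
    {Y Y' : B} (f : Y ⟶ Y') :
    f ▷ A ≫ splitAct A Y' ≫ A ◁ lawAux W A Y' ≫
        (α_ A (Y' ⊗ A) (A ⊗ centralizerObj W A)).inv ≫
        antipodeAct A Y' ▷ (A ⊗ centralizerObj W A) =
      (splitAct A Y ≫ A ◁ lawAux W A Y ≫ (α_ A (Y ⊗ A) (A ⊗ centralizerObj W A)).inv ≫
        antipodeAct A Y ▷ (A ⊗ centralizerObj W A)) ≫ f ▷ A ▷ (A ⊗ centralizerObj W A) := by
  rw [← Category.assoc, splitAct_natural]
  simp only [Category.assoc]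
  rw [← whiskerLeft_comp_assoc, lawAux_natural, whiskerLeft_comp_assoc,
    associator_inv_naturality_middle_assoc, ← comp_whiskerRight, antipodeAct_natural,
    comp_whiskerRight]

/-- The canonical distributive law `Ω : Z(A) ⊗ A ⟶ A ⊗ Z(A)` of `A`. -/
noncomputable def canonicalLaw (hW : IsColimit W) (A : B) [HopfObj A] [IsIso 𝒮[A]] :
    centralizerObj W A ⊗ A ⟶ A ⊗ centralizerObj W A :=
  zLiftParam hW A A (A ⊗ centralizerObj W A)
    (fun Y => splitAct A Y ≫ A ◁ lawAux W A Y ≫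
      (α_ A (Y ⊗ A) (A ⊗ centralizerObj W A)).inv ≫
      antipodeAct A Y ▷ (A ⊗ centralizerObj W A))
    (canonicalLaw_natural W A)

/-- The equation `(μ ⊗ Ω) T₂ T(∂) = (μ ⊗ id) ∂_{T,T} T₂`, for `T = ? ⊗ A`, by which a morphism
`Ω : Z(A) ⊗ A ⟶ A ⊗ Z(A)` is the canonical distributive law of the monad `T`. -/
def IsCanonicalLaw (W : Cowedge (dualTensor B)) (A : B) [BimonObj A]
    (ω : centralizerObj W A ⊗ A ⟶ A ⊗ centralizerObj W A) : Prop :=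
  ∀ X Y : B,
    centralizing W A X Y ▷ A ≫ freeComul A (Y ⊗ A) (X ⊗ centralizerObj W A) ≫
      (freeMul A Y ⊗ₘ
        ((α_ X (centralizerObj W A) A).hom ≫ X ◁ ω ≫ (α_ X A (centralizerObj W A)).inv)) =
    freeComul A X Y ≫ centralizing W A (X ⊗ A) (Y ⊗ A) ≫
      freeMul A Y ▷ ((X ⊗ A) ⊗ centralizerObj W A)

/-- Comultiplicative distributive laws `Q ⊗ P ⟶ P ⊗ Q` of a bialgebra `Q` over a
bialgebra `P`. -/
structure IsComulDistribLaw (P Q : B) [BimonObj P] [BimonObj Q] (ω : Q ⊗ P ⟶ P ⊗ Q) : Prop where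
  mul_left : μ[Q] ▷ P ≫ ω = (α_ Q Q P).hom ≫ Q ◁ ω ≫ (α_ Q P Q).inv ≫ ω ▷ Q ≫
    (α_ P Q Q).hom ≫ P ◁ μ[Q]
  one_left : η[Q] ▷ P ≫ ω = (λ_ P).hom ≫ (ρ_ P).inv ≫ P ◁ η[Q]
  mul_right : Q ◁ μ[P] ≫ ω = (α_ Q P P).inv ≫ ω ▷ P ≫ (α_ P Q P).hom ≫ P ◁ ω ≫
    (α_ P P Q).inv ≫ μ[P] ▷ Q
  one_right : Q ◁ η[P] ≫ ω = (ρ_ Q).hom ≫ (λ_ Q).inv ≫ η[P] ▷ Q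
  comul : ω ≫ (Δ[P] ⊗ₘ Δ[Q]) ≫ tensorμ P P Q Q =
    (Δ[Q] ⊗ₘ Δ[P]) ≫ tensorμ Q Q P P ≫ (ω ⊗ₘ ω)
  counit : ω ≫ (ε[P] ⊗ₘ ε[Q]) = ε[Q] ⊗ₘ ε[P]

/-! ### The double -/

/-- The object `D(A) = A ⊗ Z(A) = A ⊗ (Aᘁ ⊗ C)`. -/
def doubleObj (W : Cowedge (dualTensor B)) (A : B) : B := A ⊗ centralizerObj W A

/-- The product of `P ⊗_ω Q`. -/
def distribMul (P Q : B) [MonObj P] [MonObj Q] (ω : Q ⊗ P ⟶ P ⊗ Q) :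
    (P ⊗ Q) ⊗ (P ⊗ Q) ⟶ P ⊗ Q :=
  (α_ P Q (P ⊗ Q)).hom ≫ P ◁ ((α_ Q P Q).inv ≫ ω ▷ Q ≫ (α_ P Q Q).hom) ≫
    (α_ P P (Q ⊗ Q)).inv ≫ (μ[P] ⊗ₘ μ[Q])

/-- The unit of `P ⊗_ω Q`. -/
def distribOne (P Q : B) [MonObj P] [MonObj Q] : 𝟙_ B ⟶ P ⊗ Q :=
  (λ_ (𝟙_ B)).inv ≫ (η[P] ⊗ₘ η[Q])

/-- The coproduct of `P ⊗_ω Q`. -/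
def distribComul (P Q : B) [ComonObj P] [ComonObj Q] : P ⊗ Q ⟶ (P ⊗ Q) ⊗ (P ⊗ Q) :=
  (Δ[P] ⊗ₘ Δ[Q]) ≫ tensorμ P P Q Q

/-- The counit of `P ⊗_ω Q`. -/
def distribCounit (P Q : B) [ComonObj P] [ComonObj Q] : P ⊗ Q ⟶ 𝟙_ B :=
  (ε[P] ⊗ₘ ε[Q]) ≫ (λ_ (𝟙_ B)).hom

/-! ### R-matrices -/

/-- The family `X ⊗ Y ⟶ (Y ⊗ H) ⊗ (X ⊗ H)` encoded by a morphism `r : C ⊗ C ⟶ H ⊗ H`: both `X`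
and `Y` coact, `X` and `Y` are exchanged, and `r` is applied to the coefficients. -/
def rFamily (W : Cowedge (dualTensor B)) {H : B} (r : W.pt ⊗ W.pt ⟶ H ⊗ H) (X Y : B) :
    X ⊗ Y ⟶ (Y ⊗ H) ⊗ (X ⊗ H) :=
  (coact W X ⊗ₘ coact W Y) ≫ tensorμ X W.pt Y W.pt ≫ ((β_ X Y).hom ⊗ₘ r) ≫ tensorμ Y X H H

/-- R-matrices for a Hopf algebra `H`: morphisms `r : C ⊗ C ⟶ H ⊗ H` such that the family which
they encode is an R-matrix for the Hopf monad `? ⊗ H`. -/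
structure IsRMatrix (W : Cowedge (dualTensor B)) (H : B) [BimonObj H]
    (r : W.pt ⊗ W.pt ⟶ H ⊗ H) : Prop where
  linear : ∀ X Y : B,
    freeComul H X Y ≫ rFamily W r (X ⊗ H) (Y ⊗ H) ≫ (freeMul H Y ⊗ₘ freeMul H X) =
      rFamily W r X Y ▷ H ≫ freeComul H (Y ⊗ H) (X ⊗ H) ≫ (freeMul H Y ⊗ₘ freeMul H X)
  tensor_left : ∀ X Y V : B,
    rFamily W r (X ⊗ Y) V ≫ (V ⊗ H) ◁ freeComul H X Y =
      (α_ X Y V).hom ≫ X ◁ rFamily W r Y V ≫ (α_ X (V ⊗ H) (Y ⊗ H)).inv ≫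
        rFamily W r X (V ⊗ H) ▷ (Y ⊗ H) ≫ (α_ ((V ⊗ H) ⊗ H) (X ⊗ H) (Y ⊗ H)).hom ≫
          freeMul H V ▷ ((X ⊗ H) ⊗ (Y ⊗ H))
  tensor_right : ∀ X Y V : B,
    rFamily W r X (Y ⊗ V) ≫ freeComul H Y V ▷ (X ⊗ H) =
      (α_ X Y V).inv ≫ rFamily W r X Y ▷ V ≫ (α_ (Y ⊗ H) (X ⊗ H) V).hom ≫
        (Y ⊗ H) ◁ rFamily W r (X ⊗ H) V ≫ (α_ (Y ⊗ H) (V ⊗ H) ((X ⊗ H) ⊗ H)).inv ≫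
          ((Y ⊗ H) ⊗ (V ⊗ H)) ◁ freeMul H X
  unit_left : ∀ X : B,
    rFamily W r (𝟙_ B) X ≫ (X ⊗ H) ◁ freeCounit H = (λ_ X).hom ≫ freeUnit H X ≫ (ρ_ (X ⊗ H)).inv
  unit_right : ∀ X : B,
    rFamily W r X (𝟙_ B) ≫ freeCounit H ▷ (X ⊗ H) = (ρ_ X).hom ≫ freeUnit H X ≫ (λ_ (X ⊗ H)).inv

/-- The R-matrix of the double: the counit of the first factor `C`, followed by
`C ⟶ A ⊗ Z(A)` with the units of `A` and `Z(A)` inserted in the middle. -/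
noncomputable def doubleRMatrix (hW : IsColimit W) (A : B) [BimonObj A] :
    W.pt ⊗ W.pt ⟶ doubleObj W A ⊗ doubleObj W A :=
  coendCounit hW ▷ W.pt ≫ (λ_ W.pt).hom ≫ coevZ W A ≫
    (((ρ_ A).inv ≫ A ◁ zUnit W A) ⊗ₘ
      ((λ_ (centralizerObj W A)).inv ≫ η[A] ▷ centralizerObj W A))

/-- The braiding of two right `H`-modules given by an R-matrix `r`. -/
def rightBraid (W : Cowedge (dualTensor B)) {H : B} [MonObj H] (r : W.pt ⊗ W.pt ⟶ H ⊗ H)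
    (M N : RightMod H) : M.X ⊗ N.X ⟶ N.X ⊗ M.X :=
  rFamily W r M.X N.X ≫ (N.act ⊗ₘ M.act)

/-- The right action `M ⊗ H ⟶ M` obtained from a left module with the braiding and the
antipode. -/
def flipAct {H : B} [HopfObj H] (M : Mod B H) : M.X ⊗ H ⟶ M.X :=
  M.X ◁ 𝒮[H] ≫ (β_ M.X H).hom ≫ leftAct M

/-- The braiding of two left `H`-modules given by an R-matrix `r`: the transport, along the
monoidal isomorphism from left modules with the opposite tensor product to right modules, of the
braiding of right modules. -/
def leftBraid (W : Cowedge (dualTensor B)) {H : B} [HopfObj H] (r : W.pt ⊗ W.pt ⟶ H ⊗ H)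
    (M N : Mod B H) : M.X ⊗ N.X ⟶ N.X ⊗ M.X :=
  (β_ N.X M.X).inv ≫ rFamily W r N.X M.X ≫ (flipAct M ⊗ₘ flipAct N) ≫ (β_ M.X N.X).hom

end Double

end BraidedDouble

open BraidedDouble

/-!
Let `A` be a Hopf algebra with invertible antipode in a rigid braided category with coend `C`, and
let `Z = A* ⊗ C`. The proof rests on one universal property. The morphisms `δ^A_Y` induce, for
each right `A`-module `N`, a coaction `N ⟶ N ⊗ Z`, and `Z` represents natural families `M ⊗ N ⟶ N
⊗ V` indexed by right `A`-modules `N`, with a parameter `M` allowed (`UnivCoact`,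
`centralizerCoact`). In particular the coactions are jointly epic (`JointlyEpic`), and so are
their iterates on several modules; every identity between morphisms out of tensor powers of `Z` is
tested on them, much as one computes with elements.

*The Hopf algebra `Z`.* The definitions of the structure morphisms say that the coaction is
compatible with tensor products, composition and units (`Compat`), and the bialgebra axioms follow
by testing (`Compat.bimonObj`). A right `Z`-module `M` gives a family `M ⊗ N ⟶ N ⊗ M` natural and
multiplicative in `N`. Since `A`-modules have duals, on the left because of the antipode and on
the right because the antipode is invertible, such families are invertible
(`isIso_of_exactPairing_left`, `isIso_of_exactPairing_right`). The same argument inverts the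
Galois morphisms `N ⊗ Z ⟶ N ⊗ Z`; their inverses are `Z`-linear, and their values on the unit of
`Z` define the antipode. The inverse half braidings of the regular `Z`-module define in the same
way an antipode for the opposite product, which makes the antipode invertible
(`Compat.exists_antipode`, `Compat.exists_skewAntipode`, `isIso_antipode_of_skew`).

*The canonical law.* The law `Ω` is determined by the requirement that the centralizing morphisms
`M ⊗ N ⟶ N ⊗ (M ⊗ Z)` be `A`-linear when `A` acts on `M ⊗ Z` through `Ω`. Linearity is tested on
universal families: a diagonal action is a twist of the action on one factor by the action on the
other, and twisting is injective because `A` has a skew antipode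
(`IsSkewAntipode.twist_injective`, `IsSkewAntipode.linear_of_jointlyEpic`). Hence `A` acts on `M ⊗
Z`, and the structure morphisms of the Hopf monad `? ⊗ Z` are linear. Evaluated on the regular
module these facts are the axioms of a comultiplicative distributive law
(`UnivCoact.IsLaw.isComulDistribLaw`), and evaluated on free modules the linearity of the
centralizing morphisms is the canonicity of `Ω` (`UnivCoact.IsLaw.isCanonicalLaw`).

*The double.* The bialgebra `D = A ⊗_Ω Z` is the product of two sub-bialgebras (`Factorization`).
Its identity is the convolution product of two convolution-invertible morphisms, for the coproduct
and for the coopposite coproduct, which gives an antipode and a skew antipode; the antipode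
exchanges the two orders of multiplication, so `Ω` is invertible (`Factorization.isIso_law`). A
right `D`-module is an `A`-module with a compatible action of `Z`, and by the universal property
this is an `A`-module with a half braiding: the functor `Factorization.toCenter` is an isomorphism
of monoidal categories onto the center. The braiding of the center, pulled back to `D`-modules, is
the one encoded by the R-matrix, whose axioms are the axioms of the braiding evaluated on free
modules and restricted along units (`isRMatrix_of_braiding`).

*Left modules.* The antipode and the braiding turn left modules, with the opposite tensor product,
into right modules by an isomorphism of monoidal categories (`leftFlip`). This transports the
braiding to left `D`-modules, and the functoriality of the center (`centerIso`) identifies the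
center of right `A`-modules with the right center of left `A`-modules. Inverting half braidings
identifies a right center with the mirror of the center (`mirrorIso`).
-/

namespace BraidedDouble

/-! ### Jointly epic families with parameters -/

section JointlyEpic

variable {B : Type u} [Category.{v} B] [MonoidalCategory B]

/-- A family of morphisms `e i : E i ⟶ N i ⊗ X` is jointly epic if a morphism out of `X`, possibly
with a parameter tensored on the right, is determined by its composites with the `e i`, in which
the factor `N i` is carried along. -/
def JointlyEpic {I : Type*} {E N : I → B} {X : B} (e : ∀ i, E i ⟶ N i ⊗ X) : Prop :=
  ∀ ⦃P V : B⦄ (g h : X ⊗ P ⟶ V),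
    (∀ i, e i ▷ P ≫ (α_ (N i) X P).hom ≫ N i ◁ g = e i ▷ P ≫ (α_ (N i) X P).hom ≫ N i ◁ h) →
    g = h

namespace JointlyEpic

variable {I : Type*} {E N : I → B} {X : B} {e : ∀ i, E i ⟶ N i ⊗ X}

lemma hom_ext (he : JointlyEpic e) {V : B} {g h : X ⟶ V}
    (w : ∀ i, e i ≫ N i ◁ g = e i ≫ N i ◁ h) : g = h := by
  rw [← cancel_epi (ρ_ X).hom]
  refine he _ _ fun i => ?_
  have := congrArg (fun k => (ρ_ (E i)).hom ≫ k) (w i)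
  convert this using 1 <;> monoidal

lemma of_iso (he : JointlyEpic e) {E' : I → B} (a : ∀ i, E' i ≅ E i) {X' : B} (b : X ≅ X')
    {e' : ∀ i, E' i ⟶ N i ⊗ X'} (w : ∀ i, e' i = (a i).hom ≫ e i ≫ N i ◁ b.hom) :
    JointlyEpic e' := by
  intro P V g h H
  rw [← cancel_epi (b.hom ▷ P)]
  refine he _ _ fun i => ?_
  have := H i
  rw [w i] at this
  rw [← cancel_epi ((a i).hom ▷ P)]
  simpa using this

lemma whiskerRight (he : JointlyEpic e) (Q : B) :
    JointlyEpic fun i => e i ▷ Q ≫ (α_ (N i) X Q).hom := by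
  intro P V g h H
  rw [← cancel_epi (α_ X Q P).inv]
  refine he _ _ fun i => ?_
  have := congrArg (fun k => (α_ (E i) Q P).inv ≫ k) (H i)
  convert this using 1 <;> monoidal

/-- Composites of jointly epic families are jointly epic. -/
lemma comp (he : JointlyEpic e) {J : Type*} {Q M : J → B} {X' : B}
    {f : ∀ j, X ⊗ Q j ⟶ M j ⊗ X'} (hf : JointlyEpic f) :
    JointlyEpic fun p : I × J => e p.1 ▷ Q p.2 ≫ (α_ (N p.1) X (Q p.2)).hom ≫ N p.1 ◁ f p.2 ≫
      (α_ (N p.1) (M p.2) X').inv := by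
  intro P V g h H
  refine hf _ _ fun j => ?_
  rw [← cancel_epi (α_ X (Q j) P).inv]
  refine he _ _ fun i => ?_
  have := congrArg (fun k => (α_ (E i) (Q j) P).inv ≫ k ≫ (α_ (N i) (M j) V).hom) (H (i, j))
  convert this using 1 <;> monoidal

/-- A jointly epic family remains so when an object is tensored on the left and braided past the
`N i`. -/
lemma whiskerLeft [BraidedCategory B] (he : JointlyEpic e) (Y : B) :
    JointlyEpic fun i => Y ◁ e i ≫ (α_ Y (N i) X).inv ≫ (β_ Y (N i)).hom ▷ X ≫
      (α_ (N i) Y X).hom := by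
  refine (he.whiskerRight Y).of_iso (fun i => β_ Y (E i)) (β_ Y X).symm fun i => ?_
  rw [Iso.symm_hom, Category.assoc, ← braiding_naturality_right_assoc, braiding_tensor_right_hom]
  simp

end JointlyEpic

end JointlyEpic

/-! ### Sliding an object past a coaction -/

section Slide

variable {B : Type u} [Category.{v} B] [MonoidalCategory B] [BraidedCategory B]

/-- The morphism `Y ⊗ E ⟶ N ⊗ (Y ⊗ X)` obtained from `f : E ⟶ N ⊗ X` by braiding `Y` past `N`. -/
def slide (Y : B) {E N X : B} (f : E ⟶ N ⊗ X) : Y ⊗ E ⟶ N ⊗ (Y ⊗ X) :=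
  Y ◁ f ≫ (α_ Y N X).inv ≫ (β_ Y N).hom ▷ X ≫ (α_ N Y X).hom

lemma slide_natural {Y Y' : B} (g : Y ⟶ Y') {E N X : B} (f : E ⟶ N ⊗ X) :
    g ▷ E ≫ slide Y' f = slide Y f ≫ N ◁ g ▷ X := by
  dsimp only [slide]
  rw [← whisker_exchange_assoc, associator_inv_naturality_left_assoc, ← comp_whiskerRight_assoc,
    braiding_naturality_left]
  simp

lemma slide_comp (Y : B) {E E' N X : B} (g : E' ⟶ E) (f : E ⟶ N ⊗ X) :
    slide Y (g ≫ f) = Y ◁ g ≫ slide Y f := by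
  simp [slide]

lemma slide_comp_whiskerLeft (Y : B) {E N X X' : B} (f : E ⟶ N ⊗ X) (k : X ⟶ X') :
    slide Y (f ≫ N ◁ k) = slide Y f ≫ N ◁ Y ◁ k := by
  dsimp only [slide]
  simp only [whiskerLeft_comp, Category.assoc, associator_inv_naturality_right_assoc,
    whisker_exchange_assoc, associator_naturality_right]

lemma slide_comp_whiskerRight (Y : B) {E N N' X : B} (f : E ⟶ N ⊗ X) (k : N ⟶ N') :
    slide Y (f ≫ k ▷ X) = slide Y f ≫ k ▷ (Y ⊗ X) := by
  dsimp only [slide]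
  simp only [whiskerLeft_comp, Category.assoc, associator_inv_naturality_middle_assoc]
  rw [← comp_whiskerRight_assoc, braiding_naturality_right]
  simp

lemma slide_tensor (Y Y' : B) {E N X : B} (f : E ⟶ N ⊗ X) :
    slide (Y ⊗ Y') f = (α_ Y Y' E).hom ≫ slide Y (slide Y' f) ≫ N ◁ (α_ Y Y' X).inv := by
  dsimp only [slide]
  rw [braiding_tensor_left_hom]
  monoidal

lemma slide_unit {E N X : B} (f : E ⟶ N ⊗ X) :
    slide (𝟙_ B) f = (λ_ E).hom ≫ f ≫ N ◁ (λ_ X).inv := by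
  dsimp only [slide]
  rw [braiding_tensorUnit_left]
  monoidal

/-- Sliding past an iterated coaction. -/
lemma slide_comp_coact (Y : B) {E N N' X X' : B} (f : E ⟶ N ⊗ X) (g : N ⟶ N' ⊗ X') :
    slide Y (f ≫ g ▷ X ≫ (α_ N' X' X).hom) =
      Y ◁ f ≫ (α_ Y N X).inv ≫ slide Y g ▷ X ≫ (α_ N' (Y ⊗ X') X).hom ≫
        N' ◁ (α_ Y X' X).hom := by
  dsimp only [slide]
  monoidal

/-- Sliding past the tensor product of two coactions. -/
lemma slide_comp_slide (Y : B) {E N X Q M X' : B} (f : E ⟶ N ⊗ X) (g : X ⊗ Q ⟶ M ⊗ X') :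
    slide Y (f ▷ Q ≫ (α_ N X Q).hom ≫ N ◁ g ≫ (α_ N M X').inv) =
      (α_ Y E Q).inv ≫ slide Y f ▷ Q ≫ (α_ N (Y ⊗ X) Q).hom ≫
        N ◁ ((α_ Y X Q).hom ≫ Y ◁ g ≫ (α_ Y M X').inv ≫ (β_ Y M).hom ▷ X' ≫ (α_ M Y X').hom) ≫
          (α_ N M (Y ⊗ X')).inv := by
  dsimp only [slide]
  rw [braiding_tensor_right_hom]
  calc
    _ = Y ◁ f ▷ Q ⊗≫ ((Y ⊗ N) ◁ g ≫ (β_ Y N).hom ▷ (M ⊗ X')) ⊗≫ N ◁ (β_ Y M).hom ▷ X' ⊗≫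
        𝟙 _ := by monoidal
    _ = _ := by rw [whisker_exchange]; monoidal

lemma tensorHom_tensorμ_eq_slide {E N X F M X' : B} (f : E ⟶ N ⊗ X) (g : F ⟶ M ⊗ X') :
    (f ⊗ₘ g) ≫ tensorμ N X M X' =
      f ▷ F ≫ (α_ N X F).hom ≫ N ◁ slide X g ≫ (α_ N M (X ⊗ X')).inv := by
  dsimp only [slide, tensorμ]
  rw [MonoidalCategory.tensorHom_def]
  monoidal

lemma JointlyEpic.slide {I : Type*} {E N : I → B} {X : B} {e : ∀ i, E i ⟶ N i ⊗ X}
    (he : JointlyEpic e) (Y : B) : JointlyEpic fun i => slide Y (e i) :=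
  he.whiskerLeft Y

end Slide

/-! ### Right modules -/

section RightModules

variable {B : Type u} [Category.{v} B] [MonoidalCategory B]

/-- The free right module `Y ⊗ A`. -/
def RightMod.free (A : B) [MonObj A] (Y : B) : RightMod A where
  X := Y ⊗ A
  act := (α_ Y A A).hom ≫ Y ◁ μ[A]
  act_one := by
    have h := MonObj.mul_one A
    rw [associator_naturality_right_assoc, ← whiskerLeft_comp, h]
    simp
  act_act := by
    have h := MonObj.mul_assoc A
    simp only [comp_whiskerRight, whisker_assoc, Category.assoc, Iso.inv_hom_id_assoc,
      associator_naturality_right_assoc]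
    rw [← whiskerLeft_comp, h]
    monoidal

@[simp]
lemma RightMod.tensor_X {B : Type u} [Category.{v} B] [MonoidalCategory B] [BraidedCategory B]
    {A : B} [BimonObj A] (M N : RightMod A) : (M ⊗ N).X = M.X ⊗ N.X := rfl

@[simp]
lemma RightMod.unit_X {B : Type u} [Category.{v} B] [MonoidalCategory B] [BraidedCategory B]
    {A : B} [BimonObj A] : (𝟙_ (RightMod A)).X = 𝟙_ B := rfl

end RightModules

/-! ### Universal coactions -/

section Universal

variable {B : Type u} [Category.{v} B] [MonoidalCategory B] [BraidedCategory B]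

/-- A universal coaction of an object `Z` on the forgetful functor from right `A`-modules to `B`:
the object `Z` represents, with parameters, the natural families `M ⊗ N ⟶ N ⊗ V` indexed by the
right `A`-modules `N`. -/
structure UnivCoact (A : B) [BimonObj A] (Z : B) where
  /-- The coaction on the object underlying a module. -/
  coact : ∀ N : RightMod A, N.X ⟶ N.X ⊗ Z
  natural : ∀ {M N : RightMod A} (f : M ⟶ N), f.hom ≫ coact N = coact M ≫ f.hom ▷ Z
  jointlyEpic : JointlyEpic coact
  exists_lift : ∀ {M V : B} (k : ∀ N : RightMod A, M ⊗ N.X ⟶ N.X ⊗ V),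
    (∀ {N N' : RightMod A} (f : N ⟶ N'), M ◁ f.hom ≫ k N' = k N ≫ f.hom ▷ V) →
    ∃ g : M ⊗ Z ⟶ V, ∀ N : RightMod A, slide M (coact N) ≫ N.X ◁ g = k N

namespace UnivCoact

variable {A : B} [BimonObj A] {Z : B} (U : UnivCoact A Z)

/-- The centralizing morphism `M ⊗ N ⟶ N ⊗ (M ⊗ Z)`. -/
def cent (M : B) (N : RightMod A) : M ⊗ N.X ⟶ N.X ⊗ (M ⊗ Z) := slide M (U.coact N)

lemma cent_def (M : B) (N : RightMod A) : U.cent M N = slide M (U.coact N) := rfl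

lemma cent_natural_left {M M' : B} (g : M ⟶ M') (N : RightMod A) :
    g ▷ N.X ≫ U.cent M' N = U.cent M N ≫ N.X ◁ g ▷ Z :=
  slide_natural g _

lemma cent_natural_right (M : B) {N N' : RightMod A} (f : N ⟶ N') :
    M ◁ f.hom ≫ U.cent M N' = U.cent M N ≫ f.hom ▷ (M ⊗ Z) := by
  rw [cent, cent, ← slide_comp, U.natural, slide_comp_whiskerRight]

lemma jointlyEpic_cent (M : B) : JointlyEpic fun N : RightMod A => U.cent M N :=
  U.jointlyEpic.slide M

lemma exists_lift_coact {V : B} (s : ∀ N : RightMod A, N.X ⟶ N.X ⊗ V)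
    (hs : ∀ {N N' : RightMod A} (f : N ⟶ N'), f.hom ≫ s N' = s N ≫ f.hom ▷ V) :
    ∃ g : Z ⟶ V, ∀ N : RightMod A, U.coact N ≫ N.X ◁ g = s N := by
  obtain ⟨g, hg⟩ := U.exists_lift (M := 𝟙_ B) (fun N => (λ_ N.X).hom ≫ s N) (fun f => by
    rw [leftUnitor_naturality_assoc, hs f, Category.assoc])
  refine ⟨(λ_ Z).inv ≫ g, fun N => ?_⟩
  have h := hg N
  rw [slide_unit] at h
  rw [← cancel_epi (λ_ N.X).hom, ← h]
  simp

/-- The equations between the structure morphisms of a bialgebra `Z` and a universal coaction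
which make the coaction a monoidal functor to right comodules. -/
structure Compat (m : Z ⊗ Z ⟶ Z) (o : 𝟙_ B ⟶ Z) (d : Z ⟶ Z ⊗ Z) (e : Z ⟶ 𝟙_ B) : Prop where
  mul : ∀ M N : RightMod A, U.coact (M ⊗ N) = U.coact M ▷ N.X ≫ (α_ M.X Z N.X).hom ≫
    M.X ◁ (U.cent Z N ≫ N.X ◁ m) ≫ (α_ M.X N.X Z).inv
  one : U.coact (𝟙_ (RightMod A)) = o ≫ (λ_ Z).inv
  comul : ∀ N : RightMod A, U.coact N ≫ N.X ◁ d = U.coact N ≫ U.coact N ▷ Z ≫ (α_ N.X Z Z).hom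
  counit : ∀ N : RightMod A, U.coact N ≫ N.X ◁ e = (ρ_ N.X).inv

namespace Compat

variable {U} {m : Z ⊗ Z ⟶ Z} {o : 𝟙_ B ⟶ Z} {d : Z ⟶ Z ⊗ Z} {e : Z ⟶ 𝟙_ B}

/-- The product of `Z` describes the centralizing morphisms of a tensor product. -/
lemma cent_tensor (h : U.Compat m o d e) (X : B) (M N : RightMod A) :
    U.cent X (M ⊗ N) = (α_ X M.X N.X).inv ≫ U.cent X M ▷ N.X ≫ (α_ M.X (X ⊗ Z) N.X).hom ≫
      M.X ◁ (U.cent (X ⊗ Z) N ≫ N.X ◁ ((α_ X Z Z).hom ≫ X ◁ m)) ≫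
        (α_ M.X N.X (X ⊗ Z)).inv := by
  have h1 := slide_comp_slide X (U.coact M) (U.cent Z N ≫ N.X ◁ m)
  rw [cent_def, h.mul M N]
  refine h1.trans ?_
  have h2 : (α_ X Z N.X).hom ≫ X ◁ (U.cent Z N ≫ N.X ◁ m) ≫ (α_ X N.X Z).inv ≫
      (β_ X N.X).hom ▷ Z ≫ (α_ N.X X Z).hom =
      U.cent (X ⊗ Z) N ≫ N.X ◁ ((α_ X Z Z).hom ≫ X ◁ m) := by
    have h3 := slide_comp_whiskerLeft X (U.cent Z N) m
    rw [slide] at h3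
    rw [h3, cent_def _ (X ⊗ Z), slide_tensor, cent_def]
    simp
  rw [h2]
  rfl

/-- The unit of `Z` describes the centralizing morphism of the unit module. -/
lemma cent_one (h : U.Compat m o d e) (X : B) :
    U.cent X (𝟙_ (RightMod A)) = X ◁ o ≫ (λ_ (X ⊗ Z)).inv := by
  rw [cent_def, h.one]
  change X ◁ (o ≫ (λ_ Z).inv) ≫ (α_ X (𝟙_ B) Z).inv ≫ (β_ X (𝟙_ B)).hom ▷ Z ≫
    (α_ (𝟙_ B) X Z).hom = _
  rw [braiding_tensorUnit_right]
  monoidal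

end Compat

end UnivCoact

end Universal

/-! ### The bialgebra of a universal coaction -/

section Bialgebra

variable {B : Type u} [Category.{v} B] [MonoidalCategory B] [BraidedCategory B]
variable {A : B} [BimonObj A] {Z : B} {U : UnivCoact A Z}

namespace UnivCoact

variable (U) in
/-- The coaction on a pair of modules, before its coefficients are multiplied. -/
def coact₂ (M N : RightMod A) : M.X ⊗ N.X ⟶ (M.X ⊗ N.X) ⊗ (Z ⊗ Z) :=
  U.coact M ▷ N.X ≫ (α_ M.X Z N.X).hom ≫ M.X ◁ U.cent Z N ≫ (α_ M.X N.X (Z ⊗ Z)).inv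

lemma coact₂_eq (M N : RightMod A) :
    U.coact₂ M N = (U.coact M ⊗ₘ U.coact N) ≫ tensorμ M.X Z N.X Z :=
  (tensorHom_tensorμ_eq_slide (U.coact M) (U.coact N)).symm

variable (U) in
lemma jointlyEpic₂ : JointlyEpic fun p : RightMod A × RightMod A => U.coact₂ p.1 p.2 :=
  U.jointlyEpic.comp (U.jointlyEpic_cent Z)

variable (U) in
lemma jointlyEpic₃ : JointlyEpic fun p : (RightMod A × RightMod A) × RightMod A =>
    U.coact₂ p.1.1 p.1.2 ▷ p.2.X ≫ (α_ _ _ _).hom ≫ _ ◁ U.cent (Z ⊗ Z) p.2 ≫ (α_ _ _ _).inv :=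
  U.jointlyEpic₂.comp (U.jointlyEpic_cent (Z ⊗ Z))

namespace Compat

variable {m : Z ⊗ Z ⟶ Z} {o : 𝟙_ B ⟶ Z} {d : Z ⟶ Z ⊗ Z} {e : Z ⟶ 𝟙_ B}

lemma coact_tensor (h : U.Compat m o d e) (M N : RightMod A) :
    (U.coact (M ⊗ N) : M.X ⊗ N.X ⟶ (M.X ⊗ N.X) ⊗ Z) = U.coact₂ M N ≫ (M.X ⊗ N.X) ◁ m := by
  rw [h.mul M N, coact₂]
  simp

lemma comul_assoc (h : U.Compat m o d e) : d ≫ Z ◁ d = d ≫ d ▷ Z ≫ (α_ Z Z Z).hom := by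
  refine U.jointlyEpic.hom_ext fun N => ?_
  have h1 := h.comul N
  calc U.coact N ≫ N.X ◁ (d ≫ Z ◁ d) =
        (U.coact N ≫ N.X ◁ d) ≫ N.X ◁ Z ◁ d := by simp
    _ = U.coact N ≫ (U.coact N ▷ Z ≫ (N.X ⊗ Z) ◁ d) ≫ (α_ N.X Z (Z ⊗ Z)).hom := by
        rw [h1]; simp
    _ = (U.coact N ≫ N.X ◁ d) ≫ U.coact N ▷ (Z ⊗ Z) ≫ (α_ N.X Z (Z ⊗ Z)).hom := by
        rw [← whisker_exchange]; simp
    _ = U.coact N ≫ (U.coact N ≫ U.coact N ▷ Z ≫ (α_ N.X Z Z).hom) ▷ Z ≫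
          (α_ N.X (Z ⊗ Z) Z).hom ≫ N.X ◁ (α_ Z Z Z).hom := by
        rw [h1]; monoidal
    _ = U.coact N ≫ (U.coact N ≫ N.X ◁ d) ▷ Z ≫ (α_ N.X (Z ⊗ Z) Z).hom ≫
          N.X ◁ (α_ Z Z Z).hom := by rw [h1]
    _ = (U.coact N ≫ U.coact N ▷ Z ≫ (α_ N.X Z Z).hom) ≫ N.X ◁ (d ▷ Z ≫ (α_ Z Z Z).hom) := by
        simp
    _ = _ := by rw [← h1]; simp

lemma comul_counit (h : U.Compat m o d e) : d ≫ Z ◁ e = (ρ_ Z).inv := by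
  refine U.jointlyEpic.hom_ext fun N => ?_
  calc U.coact N ≫ N.X ◁ (d ≫ Z ◁ e) = (U.coact N ≫ N.X ◁ d) ≫ N.X ◁ Z ◁ e := by simp
    _ = U.coact N ≫ (U.coact N ▷ Z ≫ (N.X ⊗ Z) ◁ e) ≫ (α_ N.X Z (𝟙_ B)).hom := by
        rw [h.comul N]; simp
    _ = (U.coact N ≫ N.X ◁ e) ≫ U.coact N ▷ 𝟙_ B ≫ (α_ N.X Z (𝟙_ B)).hom := by
        rw [← whisker_exchange]; simp
    _ = _ := by rw [h.counit N]; monoidal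

lemma counit_comul (h : U.Compat m o d e) : d ≫ e ▷ Z = (λ_ Z).inv := by
  refine U.jointlyEpic.hom_ext fun N => ?_
  calc U.coact N ≫ N.X ◁ (d ≫ e ▷ Z) = (U.coact N ≫ N.X ◁ d) ≫ N.X ◁ e ▷ Z := by simp
    _ = U.coact N ≫ (U.coact N ≫ N.X ◁ e) ▷ Z ≫ (α_ N.X (𝟙_ B) Z).hom := by
        rw [h.comul N]; simp
    _ = _ := by rw [h.counit N]; monoidal

lemma one_mul (h : U.Compat m o d e) : o ▷ Z ≫ m = (λ_ Z).hom := by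
  rw [← cancel_epi (λ_ Z).inv, Iso.inv_hom_id]
  refine U.jointlyEpic.hom_ext fun N => ?_
  have h1 := U.natural (λ_ N).inv
  rw [h.mul, h.one] at h1
  change (λ_ N.X).inv ≫ (o ≫ (λ_ Z).inv) ▷ N.X ≫ (α_ (𝟙_ B) Z N.X).hom ≫
    𝟙_ B ◁ (U.cent Z N ≫ N.X ◁ m) ≫ (α_ (𝟙_ B) N.X Z).inv = U.coact N ≫ (λ_ N.X).inv ▷ Z at h1
  have h2 : (λ_ N.X).inv ≫ (o ▷ N.X ≫ U.cent Z N) ≫ N.X ◁ m = U.coact N := by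
    rw [← cancel_mono ((λ_ N.X).inv ▷ Z), ← h1]
    monoidal
  rw [U.cent_natural_left, cent_def, slide_unit] at h2
  simpa using h2

lemma mul_one (h : U.Compat m o d e) : Z ◁ o ≫ m = (ρ_ Z).hom := by
  rw [← cancel_epi (ρ_ Z).inv, Iso.inv_hom_id]
  refine U.jointlyEpic.hom_ext fun N => ?_
  have h1 := U.natural (ρ_ N).inv
  rw [h.mul, h.cent_one] at h1
  change (ρ_ N.X).inv ≫ U.coact N ▷ 𝟙_ B ≫ (α_ N.X Z (𝟙_ B)).hom ≫
    N.X ◁ ((Z ◁ o ≫ (λ_ (Z ⊗ Z)).inv) ≫ 𝟙_ B ◁ m) ≫ (α_ N.X (𝟙_ B) Z).inv =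
    U.coact N ≫ (ρ_ N.X).inv ▷ Z at h1
  rw [← cancel_mono ((ρ_ N.X).inv ▷ Z), whiskerLeft_id, Category.comp_id, ← h1]
  monoidal

lemma mul_assoc (h : U.Compat m o d e) : m ▷ Z ≫ m = (α_ Z Z Z).hom ≫ Z ◁ m ≫ m := by
  refine U.jointlyEpic₃.hom_ext fun p => ?_
  obtain ⟨⟨L, M⟩, N⟩ := p
  have h3 := U.natural (α_ L M N).hom
  rw [h.mul (L ⊗ M) N, h.mul L (M ⊗ N), h.cent_tensor, h.coact_tensor] at h3
  have h4 := U.cent_natural_left m N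
  change (α_ L.X M.X N.X).hom ≫ U.coact L ▷ (M.X ⊗ N.X) ≫ (α_ L.X Z (M.X ⊗ N.X)).hom ≫
    L.X ◁ (((α_ Z M.X N.X).inv ≫ U.cent Z M ▷ N.X ≫ (α_ M.X (Z ⊗ Z) N.X).hom ≫
      M.X ◁ (U.cent (Z ⊗ Z) N ≫ N.X ◁ ((α_ Z Z Z).hom ≫ Z ◁ m)) ≫
        (α_ M.X N.X (Z ⊗ Z)).inv) ≫ (M.X ⊗ N.X) ◁ m) ≫ (α_ L.X (M.X ⊗ N.X) Z).inv =
    ((U.coact₂ L M ≫ (L.X ⊗ M.X) ◁ m) ▷ N.X ≫ (α_ (L.X ⊗ M.X) Z N.X).hom ≫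
      (L.X ⊗ M.X) ◁ (U.cent Z N ≫ N.X ◁ m) ≫ (α_ (L.X ⊗ M.X) N.X Z).inv) ≫
        (α_ L.X M.X N.X).hom ▷ Z at h3
  rw [← cancel_mono ((α_ L.X M.X N.X).hom ▷ Z)]
  dsimp only
  calc
    _ = U.coact₂ L M ▷ N.X ≫ (α_ (L.X ⊗ M.X) (Z ⊗ Z) N.X).hom ≫
        (L.X ⊗ M.X) ◁ ((U.cent (Z ⊗ Z) N ≫ N.X ◁ m ▷ Z) ≫ N.X ◁ m) ≫
          (α_ (L.X ⊗ M.X) N.X Z).inv ≫ (α_ L.X M.X N.X).hom ▷ Z := by monoidal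
    _ = ((U.coact₂ L M ≫ (L.X ⊗ M.X) ◁ m) ▷ N.X ≫ (α_ (L.X ⊗ M.X) Z N.X).hom ≫
      (L.X ⊗ M.X) ◁ (U.cent Z N ≫ N.X ◁ m) ≫ (α_ (L.X ⊗ M.X) N.X Z).inv) ≫
        (α_ L.X M.X N.X).hom ▷ Z := by rw [← h4]; monoidal
    _ = _ := by
      rw [← h3]
      dsimp only [coact₂]
      monoidal

lemma mul_comul (h : U.Compat m o d e) :
    m ≫ d = (d ⊗ₘ d) ≫ tensorμ Z Z Z Z ≫ (m ⊗ₘ m) := by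
  refine U.jointlyEpic₂.hom_ext fun p => ?_
  obtain ⟨M, N⟩ := p
  have h1 : (U.coact₂ M N ≫ (M.X ⊗ N.X) ◁ m) ≫ (M.X ⊗ N.X) ◁ d =
      (U.coact₂ M N ≫ (M.X ⊗ N.X) ◁ m) ≫ (U.coact₂ M N ≫ (M.X ⊗ N.X) ◁ m) ▷ Z ≫
        (α_ (M.X ⊗ N.X) Z Z).hom := by
    have h1 := h.comul (M ⊗ N)
    rw [h.coact_tensor] at h1
    exact h1
  have h3 := tensorμ_natural (𝟙 M.X) d (𝟙 N.X) d
  have h4 := associator_monoidal M.X Z Z N.X Z Z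
  have h5 := tensorμ_natural (U.coact M) (𝟙 Z) (U.coact N) (𝟙 Z)
  have hM := h.comul M
  have hN := h.comul N
  simp only [id_tensorHom, tensorHom_id] at h3 h5
  dsimp only
  rw [whiskerLeft_comp, ← Category.assoc, h1, whiskerLeft_comp, whiskerLeft_comp]
  calc
    _ = (U.coact₂ M N ≫ U.coact₂ M N ▷ (Z ⊗ Z)) ≫ (α_ (M.X ⊗ N.X) (Z ⊗ Z) (Z ⊗ Z)).hom ≫
        (M.X ⊗ N.X) ◁ (m ⊗ₘ m) := by
      rw [MonoidalCategory.tensorHom_def']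
      simp only [Category.assoc, comp_whiskerRight, whiskerLeft_comp]
      rw [whisker_exchange_assoc]
      simp
    _ = (U.coact M ⊗ₘ U.coact N) ≫ (U.coact M ▷ Z ⊗ₘ U.coact N ▷ Z) ≫
          tensorμ (M.X ⊗ Z) Z (N.X ⊗ Z) Z ≫ tensorμ M.X Z N.X Z ▷ (Z ⊗ Z) ≫
          (α_ (M.X ⊗ N.X) (Z ⊗ Z) (Z ⊗ Z)).hom ≫ (M.X ⊗ N.X) ◁ (m ⊗ₘ m) := by
      rw [coact₂_eq, reassoc_of% h5]
      simp
    _ = ((U.coact M ≫ M.X ◁ d) ⊗ₘ (U.coact N ≫ N.X ◁ d)) ≫ tensorμ M.X (Z ⊗ Z) N.X (Z ⊗ Z) ≫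
          (M.X ⊗ N.X) ◁ tensorμ Z Z Z Z ≫ (M.X ⊗ N.X) ◁ (m ⊗ₘ m) := by
      rw [reassoc_of% h4, hM, hN]
      simp only [tensorHom_comp_tensorHom_assoc]
    _ = _ := by
      rw [coact₂_eq, ← tensorHom_comp_tensorHom_assoc, reassoc_of% h3]
      simp

lemma one_comul (h : U.Compat m o d e) : o ≫ d = (λ_ (𝟙_ B)).inv ≫ (o ⊗ₘ o) := by
  have h1 := h.comul (𝟙_ (RightMod A))
  rw [h.one] at h1
  change (o ≫ (λ_ Z).inv) ≫ 𝟙_ B ◁ d = (o ≫ (λ_ Z).inv) ≫ (o ≫ (λ_ Z).inv) ▷ Z ≫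
    (α_ (𝟙_ B) Z Z).hom at h1
  rw [← cancel_mono (λ_ (Z ⊗ Z)).inv, MonoidalCategory.tensorHom_def']
  calc _ = (o ≫ (λ_ Z).inv) ≫ 𝟙_ B ◁ d := by simp
    _ = _ := by rw [h1]; monoidal

lemma one_counit (h : U.Compat m o d e) : o ≫ e = 𝟙 (𝟙_ B) := by
  have h1 := h.counit (𝟙_ (RightMod A))
  rw [h.one] at h1
  change (o ≫ (λ_ Z).inv) ≫ 𝟙_ B ◁ e = (ρ_ (𝟙_ B)).inv at h1
  rw [← cancel_mono (ρ_ (𝟙_ B)).inv, ← unitors_inv_equal]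
  simpa [unitors_inv_equal] using h1

lemma mul_counit (h : U.Compat m o d e) : m ≫ e = (e ⊗ₘ e) ≫ (λ_ (𝟙_ B)).hom := by
  refine U.jointlyEpic₂.hom_ext fun p => ?_
  obtain ⟨M, N⟩ := p
  have h1 : (U.coact₂ M N ≫ (M.X ⊗ N.X) ◁ m) ≫ (M.X ⊗ N.X) ◁ e = (ρ_ (M.X ⊗ N.X)).inv := by
    have h1 := h.counit (M ⊗ N)
    rw [h.coact_tensor] at h1
    exact h1
  have h3 := tensorμ_natural (𝟙 M.X) e (𝟙 N.X) e
  simp only [id_tensorHom, MonoidalCategory.whiskerLeft_id] at h3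
  dsimp only
  rw [whiskerLeft_comp, ← Category.assoc, h1, whiskerLeft_comp, coact₂_eq, Category.assoc,
    ← reassoc_of% h3, tensorHom_comp_tensorHom_assoc, h.counit, h.counit,
    ← cancel_mono (ρ_ (M.X ⊗ N.X)).hom]
  simp only [Category.assoc]
  rw [← rightUnitor_monoidal]
  simp

/-- The bialgebra structure on `Z`. -/
@[reducible]
def bimonObj (h : U.Compat m o d e) : BimonObj Z where
  one := o
  mul := m
  comul := d
  counit := e
  one_mul := h.one_mul
  mul_one := h.mul_one
  mul_assoc := h.mul_assoc
  counit_comul := h.counit_comul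
  comul_counit := h.comul_counit
  comul_assoc := h.comul_assoc
  mul_comul := h.mul_comul
  one_comul := h.one_comul
  mul_counit := h.mul_counit
  one_counit := h.one_counit

end Compat

end UnivCoact

end Bialgebra

/-! ### Twisting by the action of a module -/

section Twist

variable {B : Type u} [Category.{v} B] [MonoidalCategory B] [BraidedCategory B]

/-- Splitting off a copy of `P` twice is splitting it off once and applying the coproduct. -/
lemma splitAct_splitAct (P : B) [ComonObj P] (E : B) :
    splitAct P E ≫ P ◁ splitAct P E ≫ (α_ P P (E ⊗ P)).inv = splitAct P E ≫ Δ[P] ▷ (E ⊗ P) := by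
  have h := ComonObj.comul_assoc P
  dsimp only [splitAct]
  calc
    _ = E ◁ (Δ[P] ≫ P ◁ Δ[P]) ⊗≫ (β_ E P).hom ▷ (P ⊗ P) ⊗≫ P ◁ (β_ E P).hom ▷ P ⊗≫ 𝟙 _ := by
      rw [whiskerLeft_comp]
      calc
        _ = E ◁ Δ[P] ⊗≫ ((β_ E P).hom ▷ P ≫ (P ⊗ E) ◁ Δ[P]) ⊗≫ P ◁ (β_ E P).hom ▷ P ⊗≫ 𝟙 _ := by
          monoidal
        _ = _ := by rw [← whisker_exchange]; monoidal
    _ = E ◁ Δ[P] ≫ (α_ E P P).inv ≫ (E ◁ Δ[P] ≫ (β_ E (P ⊗ P)).hom) ▷ P ≫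
        (α_ (P ⊗ P) E P).hom := by
      rw [h, braiding_tensor_right_hom]
      monoidal
    _ = _ := by
      rw [braiding_naturality_right]
      monoidal

variable {A : B} [MonObj A]

/-- The action of `A` on the left of a right module, through the inverse braiding. -/
def RightMod.opAct (N : RightMod A) : A ⊗ N.X ⟶ N.X := (β_ N.X A).inv ≫ N.act

lemma RightMod.one_opAct (N : RightMod A) : η[A] ▷ N.X ≫ N.opAct = (λ_ N.X).hom := by
  rw [RightMod.opAct, braiding_inv_naturality_left_assoc, N.act_one]
  simp

lemma RightMod.opAct_opAct (N : RightMod A) :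
    (α_ A A N.X).hom ≫ A ◁ N.opAct ≫ N.opAct = ((β_ A A).inv ≫ μ[A]) ▷ N.X ≫ N.opAct := by
  dsimp only [RightMod.opAct]
  rw [whiskerLeft_comp, Category.assoc, braiding_inv_naturality_right_assoc, N.act_act,
    comp_whiskerRight, Category.assoc, braiding_inv_naturality_left_assoc,
    braiding_inv_naturality_left_assoc, braiding_tensor_left_inv, braiding_tensor_right_inv]
  monoidal

/-- The twist of a morphism `h : E ⊗ P ⟶ N ⊗ V` by a morphism `x : P ⟶ A` acting on the right
module `N`: on elements it is `e ⊗ p ↦ h(e ⊗ p₂) · x(p₁)`. -/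
def RightMod.twist (N : RightMod A) {P : B} [ComonObj P] (x : P ⟶ A) {E V : B}
    (h : E ⊗ P ⟶ N.X ⊗ V) : E ⊗ P ⟶ N.X ⊗ V :=
  splitAct P E ≫ P ◁ h ≫ (α_ P N.X V).inv ≫ (x ▷ N.X ≫ N.opAct) ▷ V

/-- Twists compose by the opposite of the convolution product: on elements, `h(e ⊗ p₃) · y(p₂) ·
x(p₁)`. -/
lemma RightMod.twist_twist (N : RightMod A) {P : B} [ComonObj P] (x y : P ⟶ A) {E V : B}
    (h : E ⊗ P ⟶ N.X ⊗ V) :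
    N.twist x (N.twist y h) = N.twist (Δ[P] ≫ (β_ P P).inv ≫ (y ⊗ₘ x) ≫ μ[A]) h := by
  have h1 := splitAct_splitAct P E
  have h2 := N.opAct_opAct
  have h3 := braiding_inv_naturality x y
  dsimp only [RightMod.twist]
  rw [← reassoc_of% h3]
  calc
    _ = (splitAct P E ≫ P ◁ splitAct P E ≫ (α_ P P (E ⊗ P)).inv) ≫ (P ⊗ P) ◁ h ⊗≫
        P ◁ y ▷ N.X ▷ V ⊗≫ (P ◁ N.opAct ≫ x ▷ N.X) ▷ V ⊗≫ N.opAct ▷ V := by monoidal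
    _ = splitAct P E ≫ Δ[P] ▷ (E ⊗ P) ≫ (P ⊗ P) ◁ h ≫ (α_ (P ⊗ P) N.X V).inv ≫
        ((x ⊗ₘ y) ▷ N.X ≫ (α_ A A N.X).hom ≫ A ◁ N.opAct ≫ N.opAct) ▷ V := by
      rw [h1, whisker_exchange, MonoidalCategory.tensorHom_def']
      monoidal
    _ = _ := by
      rw [h2, ← whisker_exchange_assoc]
      monoidal

lemma RightMod.twist_one (N : RightMod A) {P : B} [ComonObj P] {E V : B}
    (h : E ⊗ P ⟶ N.X ⊗ V) : N.twist (ε[P] ≫ η[A]) h = h := by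
  have h1 := N.one_opAct
  have h2 := ComonObj.counit_comul P
  have h3 := braiding_naturality_right E ε[P]
  dsimp only [RightMod.twist, splitAct]
  calc
    _ = E ◁ Δ[P] ≫ (α_ E P P).inv ≫ (β_ E P).hom ▷ P ≫ (α_ P E P).hom ≫
        (P ◁ h ≫ ε[P] ▷ (N.X ⊗ V)) ⊗≫ (η[A] ▷ N.X ≫ N.opAct) ▷ V := by monoidal
    _ = E ◁ Δ[P] ⊗≫ ((β_ E P).hom ≫ ε[P] ▷ E) ▷ P ⊗≫ h := by
      rw [h1, whisker_exchange]; monoidal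
    _ = E ◁ (Δ[P] ≫ ε[P] ▷ P) ⊗≫ h := by
      rw [← h3, braiding_tensorUnit_right]; monoidal
    _ = h := by rw [h2]; monoidal

lemma RightMod.twist_comp (N : RightMod A) {P : B} [ComonObj P] (x : P ⟶ A) {E V V' : B}
    (h : E ⊗ P ⟶ N.X ⊗ V) (g : V ⟶ V') : N.twist x h ≫ N.X ◁ g = N.twist x (h ≫ N.X ◁ g) := by
  dsimp only [RightMod.twist]
  simp only [Category.assoc, whiskerLeft_comp, associator_inv_naturality_right_assoc,
    whisker_exchange]

lemma RightMod.comp_twist (N : RightMod A) {P : B} [ComonObj P] (x : P ⟶ A) {E E' V : B}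
    (f : E' ⟶ E) (h : E ⊗ P ⟶ N.X ⊗ V) : f ▷ P ≫ N.twist x h = N.twist x (f ▷ P ≫ h) := by
  dsimp only [RightMod.twist, splitAct]
  simp only [Category.assoc]
  rw [← whisker_exchange_assoc, associator_inv_naturality_left_assoc, ← comp_whiskerRight_assoc,
    braiding_naturality_left]
  simp

/-- The diagonal action of `P` on `N ⊗ X`, in which `P` acts on `N` through `x`, is a twist. -/
lemma RightMod.twist_eq_diag (N : RightMod A) {P : B} [ComonObj P] (x : P ⟶ A) {E X V : B}
    (f : E ⟶ N.X ⊗ X) (g : X ⊗ P ⟶ V) :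
    N.twist x (f ▷ P ≫ (α_ N.X X P).hom ≫ N.X ◁ g) =
      f ▷ P ≫ (N.X ⊗ X) ◁ Δ[P] ≫ tensorμ N.X X P P ≫ ((N.X ◁ x ≫ N.act) ⊗ₘ g) := by
  rw [← RightMod.comp_twist, ← RightMod.twist_comp]
  congr 1
  dsimp only [RightMod.twist, RightMod.opAct, splitAct, tensorμ]
  rw [braiding_inv_naturality_left_assoc, braiding_tensor_left_hom, MonoidalCategory.tensorHom_def]
  have h1 : (β_ N.X P).hom ▷ X ≫ (β_ N.X P).inv ▷ X = 𝟙 _ := by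
    rw [← comp_whiskerRight, Iso.hom_inv_id, id_whiskerRight]
  calc
    _ = (N.X ⊗ X) ◁ Δ[P] ⊗≫ N.X ◁ (β_ X P).hom ▷ P ⊗≫ ((β_ N.X P).hom ▷ X ≫
        (β_ N.X P).inv ▷ X) ▷ P ⊗≫ (N.X ◁ x ≫ N.act) ▷ (X ⊗ P) ⊗≫ N.X ◁ g := by monoidal
    _ = _ := by rw [h1]; monoidal

/-- Twists commute with sliding an object past the module. -/
lemma RightMod.twist_slide (N : RightMod A) {P : B} [ComonObj P] (x : P ⟶ A) (M : B) {E V : B}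
    (h : E ⊗ P ⟶ N.X ⊗ V) :
    N.twist x ((α_ M E P).hom ≫ slide M h) = (α_ M E P).hom ≫ slide M (N.twist x h) := by
  dsimp only [RightMod.twist, splitAct, slide]
  rw [braiding_tensor_left_hom]
  have h2 := braiding_naturality_right M (x ▷ N.X ≫ N.opAct)
  rw [braiding_tensor_right_hom] at h2
  calc
    _ = 𝟙 _ ⊗≫ M ◁ E ◁ Δ[P] ⊗≫ M ◁ (β_ E P).hom ▷ P ⊗≫ ((β_ M P).hom ▷ (E ⊗ P) ≫ (P ⊗ M) ◁ h) ⊗≫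
        P ◁ (β_ M N.X).hom ▷ V ⊗≫ (x ▷ N.X ≫ N.opAct) ▷ M ▷ V ≫ (α_ N.X M V).hom := by monoidal
    _ = 𝟙 _ ⊗≫ M ◁ E ◁ Δ[P] ⊗≫ M ◁ (β_ E P).hom ▷ P ⊗≫ M ◁ P ◁ h ⊗≫
        (((α_ M P N.X).inv ≫ (β_ M P).hom ▷ N.X ≫ (α_ P M N.X).hom ≫ P ◁ (β_ M N.X).hom ≫
          (α_ P N.X M).inv) ≫ (x ▷ N.X ≫ N.opAct) ▷ M) ▷ V ≫ (α_ N.X M V).hom := by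
      rw [← whisker_exchange]; monoidal
    _ = _ := by rw [← h2]; monoidal

end Twist

/-! ### Skew antipodes -/

section SkewAntipode

variable {B : Type u} [Category.{v} B] [MonoidalCategory B] [BraidedCategory B]

/-- A skew antipode of a bialgebra: an antipode for the product composed with the inverse
braiding. -/
structure IsSkewAntipode (A : B) [BimonObj A] (T : A ⟶ A) : Prop where
  left : Δ[A] ≫ (β_ A A).inv ≫ T ▷ A ≫ μ[A] = ε[A] ≫ η[A]
  right : Δ[A] ≫ (β_ A A).inv ≫ A ◁ T ≫ μ[A] = ε[A] ≫ η[A]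

/-- The inverse of the antipode is a skew antipode. -/
lemma isSkewAntipode_inv (A : B) [HopfObj A] [IsIso 𝒮[A]] : IsSkewAntipode A (inv 𝒮[A]) where
  left := by
    have h1 := HopfObj.mul_antipode A
    have h2 := HopfObj.one_antipode A
    have h3 := HopfObj.antipode_left A
    rw [← cancel_mono 𝒮[A]]
    simp only [Category.assoc, h1, h2]
    rw [← tensorHom_id, tensorHom_comp_tensorHom_assoc, IsIso.inv_hom_id, Category.id_comp,
      id_tensorHom, braiding_naturality_right_assoc, Iso.inv_hom_id_assoc, h3]
  right := by
    have h1 := HopfObj.mul_antipode A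
    have h2 := HopfObj.one_antipode A
    have h3 := HopfObj.antipode_right A
    rw [← cancel_mono 𝒮[A]]
    simp only [Category.assoc, h1, h2]
    rw [← id_tensorHom, tensorHom_comp_tensorHom_assoc, IsIso.inv_hom_id, Category.id_comp,
      tensorHom_id, braiding_naturality_left_assoc, Iso.inv_hom_id_assoc, h3]

/-- A one-sided skew antipode is inverse to the antipode: both composites are inverse to the
antipode for the convolution product. -/
lemma isIso_antipode_of_skew (A : B) [HopfObj A] (T : A ⟶ A)
    (hT : Δ[A] ≫ (β_ A A).inv ≫ A ◁ T ≫ μ[A] = ε[A] ≫ η[A]) : IsIso 𝒮[A] := by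
  have h1 : (Conv.instMul (M := A) (N := A)).mul (𝒮[A] : A ⟶ A) (𝟙 A) =
      (1 : Conv A A) := by
    change Δ[A] ≫ 𝒮[A] ▷ A ≫ A ◁ 𝟙 A ≫ μ[A] = ε[A] ≫ η[A]
    simp
  have h1' : (Conv.instMul (M := A) (N := A)).mul (𝟙 A) (𝒮[A] : A ⟶ A) =
      (1 : Conv A A) := by
    change Δ[A] ≫ 𝟙 A ▷ A ≫ A ◁ 𝒮[A] ≫ μ[A] = ε[A] ≫ η[A]
    simp
  have h2 : (Conv.instMul (M := A) (N := A)).mul (𝒮[A] : A ⟶ A) (𝒮[A] ≫ T) =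
      (1 : Conv A A) := by
    have h := 𝒮[A] ≫= hT
    have h3 := HopfObj.antipode_comul A
    have h4 := HopfObj.antipode_counit A
    rw [reassoc_of% h3, reassoc_of% h4, ← braiding_naturality_assoc, Iso.hom_inv_id_assoc] at h
    change Δ[A] ≫ 𝒮[A] ▷ A ≫ A ◁ (𝒮[A] ≫ T) ≫ μ[A] = ε[A] ≫ η[A]
    rw [← h, MonoidalCategory.tensorHom_def]
    simp
  have h3 : (Conv.instMul (M := A) (N := A)).mul (T ≫ 𝒮[A] : A ⟶ A) (𝒮[A]) =
      (1 : Conv A A) := by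
    have h := hT =≫ 𝒮[A]
    have h3 := HopfObj.mul_antipode A
    have h4 := HopfObj.one_antipode A
    simp only [Category.assoc, h3, h4] at h
    rw [← id_tensorHom, tensorHom_comp_tensorHom_assoc, Category.id_comp,
      braiding_naturality_assoc, Iso.inv_hom_id_assoc] at h
    change Δ[A] ≫ (T ≫ 𝒮[A]) ▷ A ≫ A ◁ 𝒮[A] ≫ μ[A] = ε[A] ≫ η[A]
    rw [← h, MonoidalCategory.tensorHom_def_assoc]
  have h4 : 𝟙 A = 𝒮[A] ≫ T :=
    left_inv_eq_right_inv (M := Conv A A) h1' h2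
  have h5 : T ≫ 𝒮[A] = 𝟙 A :=
    left_inv_eq_right_inv (M := Conv A A) h3 h1
  exact ⟨T, h4.symm, h5⟩

variable {A : B} [BimonObj A] {T : A ⟶ A}

/-- Twisting by a coalgebra morphism is injective. -/
lemma IsSkewAntipode.twist_injective (hT : IsSkewAntipode A T) (N : RightMod A) {P : B}
    [ComonObj P] (x : P ⟶ A) [IsComonHom x] {E V : B} {g h : E ⊗ P ⟶ N.X ⊗ V}
    (hgh : N.twist x g = N.twist x h) : g = h := by
  have h1 : Δ[P] ≫ (β_ P P).inv ≫ (x ⊗ₘ (x ≫ T)) ≫ μ[A] = ε[P] ≫ η[A] := by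
    have h2 := IsComonHom.hom_comul x
    have h3 := IsComonHom.hom_counit x
    have h4 := braiding_inv_naturality x x
    have h5 : (x ⊗ₘ (x ≫ T)) = (x ⊗ₘ x) ≫ A ◁ T := by
      rw [← id_tensorHom, tensorHom_comp_tensorHom, Category.comp_id]
    rw [h5, Category.assoc, ← reassoc_of% h4, ← reassoc_of% h2, hT.right, reassoc_of% h3]
  have h2 := congrArg (N.twist (x ≫ T)) hgh
  rwa [N.twist_twist, N.twist_twist, h1, N.twist_one, N.twist_one] at h2

/-- Twisting by the identity undoes twisting by a skew antipode. -/
lemma IsSkewAntipode.twist_id_twist (hT : IsSkewAntipode A T) (N : RightMod A) {E V : B}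
    (h : E ⊗ A ⟶ N.X ⊗ V) : N.twist (𝟙 A) (N.twist T h) = h := by
  rw [N.twist_twist, tensorHom_id, hT.left, N.twist_one]

end SkewAntipode

/-! ### Linearity and universal families -/

section Linearity

variable {B : Type u} [Category.{v} B] [MonoidalCategory B] [BraidedCategory B]
  {A : B} [BimonObj A] {T : A ⟶ A}

/-- The diagonal action on `N ⊗ X` for a right module `N` and any morphism `X ⊗ A ⟶ X`. -/
def RightMod.diagAct (N : RightMod A) {X : B} (a : X ⊗ A ⟶ X) : (N.X ⊗ X) ⊗ A ⟶ N.X ⊗ X :=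
  (N.X ⊗ X) ◁ Δ[A] ≫ tensorμ N.X X A A ≫ (N.act ⊗ₘ a)

lemma RightMod.whiskerLeft_diagAct (N : RightMod A) {X Y : B} {b : Y ⊗ A ⟶ Y}
    (f : X ⟶ Y) : (N.X ◁ f) ▷ A ≫ N.diagAct b =
      (N.X ⊗ X) ◁ Δ[A] ≫ tensorμ N.X X A A ≫ (N.act ⊗ₘ (f ▷ A ≫ b)) := by
  dsimp only [RightMod.diagAct]
  rw [← whisker_exchange_assoc, ← id_tensorHom N.X f, tensorμ_natural_left_assoc,
    tensorHom_comp_tensorHom, id_whiskerRight, Category.id_comp]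

variable {I : Type*} {E N : I → RightMod A} {X : B} {e : ∀ i, (E i).X ⟶ (N i).X ⊗ X}
  {a : X ⊗ A ⟶ X}

/-- A morphism out of `X` is linear if its composites with a universal family of linear morphisms
`E i ⟶ N i ⊗ X` are. -/
lemma IsSkewAntipode.linear_of_jointlyEpic (hT : IsSkewAntipode A T) (he : JointlyEpic e)
    (hea : ∀ i, (E i).act ≫ e i = e i ▷ A ≫ (N i).diagAct a) {V : B} {b : V ⊗ A ⟶ V}
    (f : X ⟶ V)
    (hf : ∀ i, (E i).act ≫ e i ≫ (N i).X ◁ f = (e i ≫ (N i).X ◁ f) ▷ A ≫ (N i).diagAct b) :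
    a ≫ f = f ▷ A ≫ b := by
  refine he _ _ fun i => hT.twist_injective (N i) (𝟙 A) ?_
  rw [RightMod.twist_eq_diag, RightMod.twist_eq_diag]
  have h1 := hf i
  have h2 := hea i
  rw [reassoc_of% h2, comp_whiskerRight, Category.assoc,
    (N i).whiskerLeft_diagAct f] at h1
  rw [whiskerLeft_id, Category.id_comp, ← h1, RightMod.diagAct]
  simp only [Category.assoc]
  rw [← id_tensorHom (N i).X f, tensorHom_comp_tensorHom, Category.comp_id]

/-- A morphism `X ⊗ A ⟶ X` for which a universal family `E i ⟶ N i ⊗ X` is linear satisfies the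
associativity of an action. -/
lemma IsSkewAntipode.act_act_of_jointlyEpic (hT : IsSkewAntipode A T) (he : JointlyEpic e)
    (hea : ∀ i, (E i).act ≫ e i = e i ▷ A ≫ (N i).diagAct a) :
    a ▷ A ≫ a = (α_ X A A).hom ≫ X ◁ μ[A] ≫ a := by
  have hμ : IsComonHom μ[A] :=
    { hom_comul := by rw [BimonObj.mul_comul, Comon.tensorObj_comul, Category.assoc]
      hom_counit := BimonObj.mul_counit A }
  rw [← cancel_epi (α_ X A A).inv, Iso.inv_hom_id_assoc]
  refine he _ _ fun i => hT.twist_injective (N i) μ[A] ?_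
  rw [RightMod.twist_eq_diag, RightMod.twist_eq_diag]
  have h1 := hea i
  have h2 : (N i).diagAct a ▷ A ≫ (N i).diagAct a =
      (α_ _ A A).hom ≫ ((N i).X ⊗ X) ◁ Δ[A ⊗ A] ≫ tensorμ (N i).X X (A ⊗ A) (A ⊗ A) ≫
        (((N i).X ◁ μ[A] ≫ (N i).act) ⊗ₘ ((α_ X A A).inv ≫ a ▷ A ≫ a)) := by
    have h3 : (N i).diagAct a ▷ A ≫ (N i).diagAct a =
        (((N i).X ⊗ X) ◁ Δ[A] ⊗ₘ Δ[A]) ≫ tensorμ (N i).X X A A ▷ (A ⊗ A) ≫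
          tensorμ ((N i).X ⊗ A) (X ⊗ A) A A ≫
          (((N i).act ▷ A ≫ (N i).act) ⊗ₘ (a ▷ A ≫ a)) := by
      dsimp only [RightMod.diagAct]
      rw [comp_whiskerRight, comp_whiskerRight, Category.assoc, Category.assoc,
        ← whisker_exchange_assoc, tensorμ_natural_left_assoc, ← whisker_exchange_assoc,
        tensorHom_comp_tensorHom,
        MonoidalCategory.tensorHom_def (((N i).X ⊗ X) ◁ Δ[A]) Δ[A], Category.assoc]
    have h4 : ((N i).act ▷ A ≫ (N i).act) ⊗ₘ (a ▷ A ≫ a) =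
        ((α_ (N i).X A A).hom ⊗ₘ (α_ X A A).hom) ≫
        (((N i).X ◁ μ[A] ≫ (N i).act) ⊗ₘ ((α_ X A A).inv ≫ a ▷ A ≫ a)) := by
      rw [tensorHom_comp_tensorHom, (N i).act_act, Iso.hom_inv_id_assoc]
    rw [h3, h4, tensor_associativity_assoc, ← id_tensorHom, associator_naturality_assoc,
      id_tensorHom, Comon.tensorObj_comul, whiskerLeft_comp, Category.assoc]
  have h3 : ((N i).X ⊗ X) ◁ μ[A] ≫ (N i).diagAct a =
      ((N i).X ⊗ X) ◁ Δ[A ⊗ A] ≫ tensorμ (N i).X X (A ⊗ A) (A ⊗ A) ≫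
        (((N i).X ◁ μ[A] ≫ (N i).act) ⊗ₘ (X ◁ μ[A] ≫ a)) := by
    dsimp only [RightMod.diagAct]
    rw [← whiskerLeft_comp_assoc, hμ.hom_comul, whiskerLeft_comp_assoc,
      tensorμ_natural_right_assoc, tensorHom_comp_tensorHom]
  rw [← cancel_epi (α_ _ A A).hom]
  calc
    _ = (e i ▷ A ≫ (N i).diagAct a) ▷ A ≫ (N i).diagAct a := by
      rw [comp_whiskerRight_assoc, h2]
      simp
    _ = (E i).act ▷ A ≫ (E i).act ≫ e i := by rw [← h1, comp_whiskerRight_assoc, h1]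
    _ = (α_ _ A A).hom ≫ (E i).X ◁ μ[A] ≫ e i ▷ A ≫ (N i).diagAct a := by
      rw [reassoc_of% (E i).act_act, h1]
    _ = _ := by rw [← h3, whisker_exchange_assoc]

/-- A morphism `X ⊗ A ⟶ X` for which a universal family `E i ⟶ N i ⊗ X` is linear satisfies the
unit law of an action. -/
lemma act_one_of_jointlyEpic (he : JointlyEpic e)
    (hea : ∀ i, (E i).act ≫ e i = e i ▷ A ≫ (N i).diagAct a) :
    X ◁ η[A] ≫ a = (ρ_ X).hom := by
  refine he _ _ fun i => ?_
  have h : η[A] ≫ Δ[A] = (λ_ (𝟙_ B)).inv ≫ (η[A] ⊗ₘ η[A]) := BimonObj.one_comul A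
  have h1 : ((N i).X ⊗ X) ◁ η[A] ≫ (N i).diagAct a =
      (α_ (N i).X X (𝟙_ B)).hom ≫ (N i).X ◁ (X ◁ η[A] ≫ a) := by
    dsimp only [RightMod.diagAct]
    have h2 : (ρ_ (N i).X).hom ⊗ₘ (X ◁ η[A] ≫ a) = ((ρ_ (N i).X).hom ⊗ₘ (ρ_ X).hom) ≫
        (N i).X ◁ ((ρ_ X).inv ≫ X ◁ η[A] ≫ a) := by
      rw [← id_tensorHom (N i).X, tensorHom_comp_tensorHom, Category.comp_id,
        Iso.hom_inv_id_assoc]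
    rw [← whiskerLeft_comp_assoc, h, whiskerLeft_comp_assoc, tensorμ_natural_right_assoc,
      tensorHom_comp_tensorHom, (N i).act_one, h2, ← tensor_right_unitality_assoc]
    monoidal
  dsimp only
  rw [← h1, ← whisker_exchange_assoc, ← hea i, reassoc_of% (E i).act_one]
  monoidal

end Linearity

/-! ### The canonical distributive law of a universal coaction -/

section Law

variable {B : Type u} [Category.{v} B] [MonoidalCategory B] [BraidedCategory B]
  {A : B} [BimonObj A] {T : A ⟶ A} {Z : B}

/-- A morphism underlies a morphism of right modules if its composites with a universal family of
module morphisms do. -/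
lemma IsSkewAntipode.act_hom_of_jointlyEpic (hT : IsSkewAntipode A T) {I : Type*}
    {E N : I → RightMod A} {X V : RightMod A} {e : ∀ i, E i ⟶ N i ⊗ X}
    (he : JointlyEpic (E := fun i => (E i).X) (N := fun i => (N i).X) (X := X.X)
      fun i => (e i).hom)
    (f : X.X ⟶ V.X) (g : ∀ i, E i ⟶ N i ⊗ V)
    (h : ∀ i, RightMod.Hom.hom (e i) ≫ (N i).X ◁ f = (g i).hom) :
    X.act ≫ f = f ▷ A ≫ V.act :=
  hT.linear_of_jointlyEpic he (fun i => (e i).act_hom) f fun i => by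
    have h1 := h i
    have h2 := (g i).act_hom
    exact ((E i).act ≫= h1).trans (h2.trans (congrArg (fun k => k ▷ A ≫ _) h1.symm))

/-- The action on `M ⊗ Z` determined by a morphism `Z ⊗ A ⟶ A ⊗ Z` and a right action on `M`. -/
def lawAct (ω : Z ⊗ A ⟶ A ⊗ Z) (M : RightMod A) : (M.X ⊗ Z) ⊗ A ⟶ M.X ⊗ Z :=
  (α_ M.X Z A).hom ≫ M.X ◁ ω ≫ (α_ M.X A Z).inv ≫ M.act ▷ Z

lemma slide_comp_whiskerRight_param (Y P : B) {E N X : B} (f : E ⟶ N ⊗ X) :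
    slide Y (f ▷ P ≫ (α_ N X P).hom) =
      (α_ Y E P).inv ≫ slide Y f ▷ P ≫ (α_ N (Y ⊗ X) P).hom ≫ N ◁ (α_ Y X P).hom := by
  dsimp only [slide]
  monoidal

namespace UnivCoact

variable (U : UnivCoact A Z) (ω : Z ⊗ A ⟶ A ⊗ Z)

/-- The formula defining the canonical distributive law `ω` of a bialgebra with skew antipode `T`:
on elements, it describes `n₀ ⊗ ω(n₁ ⊗ a)` as `((n · a₃)₀ · T(a₁)) ⊗ a₂ ⊗ (n · a₃)₁`. -/
def IsLaw (T : A ⟶ A) : Prop :=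
  ∀ N : RightMod A, U.coact N ▷ A ≫ (α_ N.X Z A).hom ≫ N.X ◁ ω =
    N.twist T (splitAct A N.X ≫ A ◁ N.act ≫ U.cent A N)

variable {U ω}

/-- The canonical law makes the centralizing morphisms linear. -/
lemma IsLaw.cent_linear (hω : U.IsLaw ω T) (hT : IsSkewAntipode A T) (M N : RightMod A) :
    (M ⊗ N).act ≫ U.cent M.X N = U.cent M.X N ▷ A ≫ N.diagAct (lawAct ω M) := by
  have h1 : U.cent M.X N ▷ A ≫ N.diagAct (lawAct ω M) =
      N.twist (𝟙 A) (U.cent M.X N ▷ A ≫ (α_ N.X (M.X ⊗ Z) A).hom ≫ N.X ◁ lawAct ω M) := by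
    rw [N.twist_eq_diag]
    simp [RightMod.diagAct]
  have h2 : U.cent M.X N ▷ A ≫ (α_ N.X (M.X ⊗ Z) A).hom ≫ N.X ◁ lawAct ω M =
      ((α_ M.X N.X A).hom ≫ slide M.X (N.twist T (splitAct A N.X ≫ A ◁ N.act ≫ U.cent A N))) ≫
        N.X ◁ ((α_ M.X A Z).inv ≫ M.act ▷ Z) := by
    rw [← hω N, ← Category.assoc (U.coact N ▷ A), slide_comp_whiskerLeft,
      slide_comp_whiskerRight_param, cent, lawAct]
    simp
  rw [h1, h2, ← N.twist_comp, N.twist_slide, hT.twist_id_twist, cent, ← Category.assoc,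
    slide_comp, whiskerLeft_comp]
  have h3 := slide_tensor M.X A (U.coact N)
  have h4 := slide_natural M.act (U.coact N)
  have h5 : (M ⊗ N).act = (α_ M.X N.X A).hom ≫ M.X ◁ (splitAct A N.X ≫ A ◁ N.act) ≫
      (α_ M.X A N.X).inv ≫ M.act ▷ N.X := by
    change (M.X ⊗ N.X) ◁ Δ[A] ≫ tensorμ M.X N.X A A ≫ (M.act ⊗ₘ N.act) = _
    rw [MonoidalCategory.tensorHom_def', tensorμ, splitAct]
    monoidal
  refine (congrArg (fun k : (M.X ⊗ N.X) ⊗ A ⟶ M.X ⊗ N.X => k ≫ slide M.X (U.coact N)) h5).trans ?_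
  simp only [Category.assoc]
  rw [h4, h3]
  simp [cent]

/-- The right module `M ⊗ Z`, on which `A` acts through the canonical law. -/
def IsLaw.zMod (hω : U.IsLaw ω T) (hT : IsSkewAntipode A T) (M : RightMod A) : RightMod A where
  X := M.X ⊗ Z
  act := lawAct ω M
  act_one := act_one_of_jointlyEpic (E := fun N => M ⊗ N) (U.jointlyEpic_cent M.X)
    (hω.cent_linear hT M)
  act_act := hT.act_act_of_jointlyEpic (E := fun N => M ⊗ N) (U.jointlyEpic_cent M.X)
    (hω.cent_linear hT M)

/-- The centralizing morphisms as morphisms of right modules. -/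
def IsLaw.centHom (hω : U.IsLaw ω T) (hT : IsSkewAntipode A T) (M N : RightMod A) :
    M ⊗ N ⟶ N ⊗ hω.zMod hT M where
  hom := U.cent M.X N
  act_hom := hω.cent_linear hT M N

end UnivCoact

namespace UnivCoact

variable [BimonObj Z] {U : UnivCoact A Z} {ω : Z ⊗ A ⟶ A ⊗ Z}

/-- The coproduct of `Z` describes the centralizing morphisms of a tensor product of parameters. -/
lemma Compat.cent_comul (hU : U.Compat μ[Z] η[Z] Δ[Z] ε[Z]) (X Y : B) (N : RightMod A) :
    U.cent (X ⊗ Y) N ≫ N.X ◁ freeComul Z X Y =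
      (α_ X Y N.X).hom ≫ X ◁ U.cent Y N ≫ (α_ X N.X (Y ⊗ Z)).inv ≫ U.cent X N ▷ (Y ⊗ Z) ≫
        (α_ N.X (X ⊗ Z) (Y ⊗ Z)).hom := by
  have h1 := hU.comul N
  have h2 := braiding_naturality_right Y (U.coact N)
  rw [braiding_tensor_right_hom] at h2
  have h3 := slide_comp_whiskerLeft (X ⊗ Y) (U.coact N) Δ[Z]
  rw [h1, slide_comp_coact] at h3
  rw [freeComul, whiskerLeft_comp, cent_def, ← reassoc_of% h3]
  dsimp only [cent, tensorμ, slide]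
  rw [braiding_tensor_left_hom]
  calc
    _ = 𝟙 _ ⊗≫ X ◁ Y ◁ U.coact N ⊗≫ X ◁ Y ◁ U.coact N ▷ Z ⊗≫ X ◁ (β_ Y N.X).hom ▷ Z ▷ Z ⊗≫
        ((β_ X N.X).hom ▷ (Y ⊗ Z) ≫ (N.X ⊗ X) ◁ (β_ Y Z).hom) ▷ Z ⊗≫ 𝟙 _ := by monoidal
    _ = 𝟙 _ ⊗≫ X ◁ Y ◁ U.coact N ⊗≫ X ◁ (Y ◁ U.coact N ≫ (α_ Y N.X Z).inv ≫
        (β_ Y N.X).hom ▷ Z ≫ (α_ N.X Y Z).hom ≫ N.X ◁ (β_ Y Z).hom ≫ (α_ N.X Z Y).inv) ▷ Z ⊗≫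
        (β_ X N.X).hom ▷ (Z ⊗ Y) ▷ Z ⊗≫ 𝟙 _ := by
      rw [← whisker_exchange]; monoidal
    _ = _ := by
      rw [h2]; monoidal

end UnivCoact

end Law

/-! ### The axioms of the canonical law -/

section LawAxioms

variable {B : Type u} [Category.{v} B] [MonoidalCategory B] [BraidedCategory B]
  {A : B} [BimonObj A] {T : A ⟶ A} {Z : B}

/-- The regular right module. -/
def RightMod.regular (A : B) [MonObj A] : RightMod A where
  X := A
  act := μ[A]
  act_one := MonObj.mul_one A
  act_act := MonObj.mul_assoc A

/-- The action on `A ⊗ Z` determined by a law, for the regular module `A`. -/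
def regAct (ω : Z ⊗ A ⟶ A ⊗ Z) : (A ⊗ Z) ⊗ A ⟶ A ⊗ Z :=
  (α_ A Z A).hom ≫ A ◁ ω ≫ (α_ A A Z).inv ≫ μ[A] ▷ Z

/-- The action on `A ⊗ Z` recovers the law. -/
lemma one_regAct (ω : Z ⊗ A ⟶ A ⊗ Z) : η[A] ▷ Z ▷ A ≫ regAct ω = (λ_ Z).hom ▷ A ≫ ω := by
  have h := MonObj.one_mul A
  rw [regAct, associator_naturality_left_assoc, ← whisker_exchange_assoc,
    associator_inv_naturality_left_assoc, ← comp_whiskerRight, h]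
  monoidal

/-- Naturality of the comonoidal structure of `? ⊗ A`. -/
lemma freeComul_natural' (P : B) [ComonObj P] {X X' Y Y' : B} (f : X ⟶ X') (g : Y ⟶ Y') :
    (f ⊗ₘ g) ▷ P ≫ freeComul P X' Y' = freeComul P X Y ≫ (f ▷ P ⊗ₘ g ▷ P) := by
  dsimp only [freeComul]
  rw [← whisker_exchange_assoc, tensorμ_natural_left, Category.assoc]

lemma freeComul_unit (P : B) [ComonObj P] :
    freeComul P (𝟙_ B) (𝟙_ B) ≫ ((λ_ P).hom ⊗ₘ (λ_ P).hom) =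
      (λ_ (𝟙_ B)).hom ▷ P ≫ (λ_ P).hom ≫ Δ[P] := by
  have h := tensor_left_unitality P P
  rw [← cancel_epi ((λ_ (𝟙_ B)).inv ▷ P), freeComul]
  simp only [Category.assoc]
  rw [← whisker_exchange_assoc, ← h]
  monoidal

namespace UnivCoact

variable [BimonObj Z] {U : UnivCoact A Z} {ω : Z ⊗ A ⟶ A ⊗ Z}

/-- The product `(M ⊗ Z) ⊗ Z ⟶ M ⊗ Z` of the monad `? ⊗ Z` is linear: tested on pairs of modules,
it becomes the centralizing morphism of their tensor product. -/
lemma IsLaw.mulHom_linear (hω : U.IsLaw ω T) (hT : IsSkewAntipode A T)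
    (hU : U.Compat μ[Z] η[Z] Δ[Z] ε[Z]) (M : RightMod A) :
    lawAct ω (hω.zMod hT M) ≫ (α_ M.X Z Z).hom ≫ M.X ◁ μ[Z] =
      ((α_ M.X Z Z).hom ≫ M.X ◁ μ[Z]) ▷ A ≫ lawAct ω M := by
  refine hT.act_hom_of_jointlyEpic (I := RightMod A × RightMod A)
    (E := fun p => (M ⊗ p.1) ⊗ p.2) (N := fun p => p.1 ⊗ p.2)
    (X := hω.zMod hT (hω.zMod hT M)) (V := hω.zMod hT M)
    (e := fun p => hω.centHom hT M p.1 ▷ p.2 ≫ (α_ _ _ _).hom ≫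
      p.1 ◁ hω.centHom hT (hω.zMod hT M) p.2 ≫ (α_ _ _ _).inv) ?_ _
    (fun p => (α_ M p.1 p.2).hom ≫ hω.centHom hT M (p.1 ⊗ p.2)) ?_
  · exact (U.jointlyEpic_cent M.X).comp (U.jointlyEpic_cent (M.X ⊗ Z))
  · rintro ⟨L, N⟩
    have h := hU.cent_tensor M.X L N
    change (U.cent M.X L ▷ N.X ≫ (α_ L.X (M.X ⊗ Z) N.X).hom ≫ L.X ◁ U.cent (M.X ⊗ Z) N ≫
      (α_ L.X N.X ((M.X ⊗ Z) ⊗ Z)).inv) ≫ (L.X ⊗ N.X) ◁ ((α_ M.X Z Z).hom ≫ M.X ◁ μ[Z]) =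
      (α_ M.X L.X N.X).hom ≫ U.cent M.X (L ⊗ N)
    rw [h]
    monoidal

/-- The unit `M ⟶ M ⊗ Z` of the monad `? ⊗ Z` is linear: it is the centralizing morphism of the
unit module. -/
lemma IsLaw.oneHom_linear (hω : U.IsLaw ω T) (hT : IsSkewAntipode A T)
    (hU : U.Compat μ[Z] η[Z] Δ[Z] ε[Z]) (M : RightMod A) :
    M.act ≫ (ρ_ M.X).inv ≫ M.X ◁ η[Z] = ((ρ_ M.X).inv ≫ M.X ◁ η[Z]) ▷ A ≫ lawAct ω M := by
  have h : ((ρ_ M).inv ≫ hω.centHom hT M (𝟙_ _) ≫ (λ_ _).hom).hom =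
      (ρ_ M.X).inv ≫ M.X ◁ η[Z] := by
    have h := hU.cent_one M.X
    change (ρ_ M.X).inv ≫ U.cent M.X (𝟙_ (RightMod A)) ≫ (λ_ (M.X ⊗ Z)).hom = _
    rw [h]
    simp
  have h2 := ((ρ_ M).inv ≫ hω.centHom hT M (𝟙_ _) ≫ (λ_ _).hom).act_hom
  rw [h] at h2
  exact h2

/-- The comonoidal structure `(M ⊗ M') ⊗ Z ⟶ (M ⊗ Z) ⊗ (M' ⊗ Z)` of the monad `? ⊗ Z` is linear:
tested on a module, it becomes a composite of two centralizing morphisms. -/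
lemma IsLaw.comulHom_linear (hω : U.IsLaw ω T) (hT : IsSkewAntipode A T)
    (hU : U.Compat μ[Z] η[Z] Δ[Z] ε[Z]) (M M' : RightMod A) :
    lawAct ω (M ⊗ M') ≫ freeComul Z M.X M'.X =
      freeComul Z M.X M'.X ▷ A ≫ (hω.zMod hT M ⊗ hω.zMod hT M').act := by
  refine hT.act_hom_of_jointlyEpic (I := RightMod A)
    (E := fun N => (M ⊗ M') ⊗ N) (N := fun N => N)
    (X := hω.zMod hT (M ⊗ M')) (V := hω.zMod hT M ⊗ hω.zMod hT M')
    (e := fun N => hω.centHom hT (M ⊗ M') N) (U.jointlyEpic_cent (M.X ⊗ M'.X)) _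
    (fun N => (α_ M M' N).hom ≫ M ◁ hω.centHom hT M' N ≫ (α_ _ _ _).inv ≫
      hω.centHom hT M N ▷ hω.zMod hT M' ≫ (α_ _ _ _).hom) fun N => ?_
  exact hU.cent_comul M.X M'.X N

/-- The counit `𝟙 ⊗ Z ⟶ 𝟙` of the comonoidal monad `? ⊗ Z` is linear. -/
lemma IsLaw.counitHom_linear (hω : U.IsLaw ω T) (hT : IsSkewAntipode A T)
    (hU : U.Compat μ[Z] η[Z] Δ[Z] ε[Z]) :
    lawAct ω (𝟙_ (RightMod A)) ≫ freeCounit Z = freeCounit Z ▷ A ≫ (𝟙_ (RightMod A)).act := by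
  refine hT.act_hom_of_jointlyEpic (I := RightMod A)
    (E := fun N => 𝟙_ (RightMod A) ⊗ N) (N := fun N => N)
    (X := hω.zMod hT (𝟙_ _)) (V := 𝟙_ _)
    (e := fun N => hω.centHom hT (𝟙_ _) N) (U.jointlyEpic_cent (𝟙_ B)) _
    (fun N => (λ_ N).hom ≫ (ρ_ N).inv) fun N => ?_
  have h := hU.counit N
  change U.cent (𝟙_ B) N ≫ N.X ◁ ((λ_ Z).hom ≫ ε[Z]) = (λ_ N.X).hom ≫ (ρ_ N.X).inv
  rw [cent, slide_unit, ← h]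
  simp

/-- The canonical law is a comultiplicative distributive law: the structure morphisms of the
monad `? ⊗ Z` on right modules are linear, and the regular module detects the law. -/
lemma IsLaw.isComulDistribLaw (hω : U.IsLaw ω T) (hT : IsSkewAntipode A T)
    (hU : U.Compat μ[Z] η[Z] Δ[Z] ε[Z]) : IsComulDistribLaw A Z ω where
  mul_left := by
    have h := η[A] ▷ Z ▷ Z ▷ A ≫= hω.mulHom_linear hT hU (RightMod.regular A)
    have h1 := one_regAct ω
    change η[A] ▷ Z ▷ Z ▷ A ≫ ((α_ (A ⊗ Z) Z A).hom ≫ (A ⊗ Z) ◁ ω ≫ (α_ (A ⊗ Z) A Z).inv ≫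
      regAct ω ▷ Z) ≫ (α_ A Z Z).hom ≫ A ◁ μ[Z] =
      η[A] ▷ Z ▷ Z ▷ A ≫ ((α_ A Z Z).hom ≫ A ◁ μ[Z]) ▷ A ≫ regAct ω at h
    rw [← cancel_epi ((λ_ Z).hom ▷ Z ▷ A)]
    calc
      _ = ((α_ _ Z Z).hom ≫ 𝟙_ B ◁ μ[Z]) ▷ A ≫ (λ_ Z).hom ▷ A ≫ ω := by monoidal
      _ = ((α_ _ Z Z).hom ≫ (𝟙_ B ◁ μ[Z] ≫ η[A] ▷ Z)) ▷ A ≫ regAct ω := by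
        rw [← h1]; monoidal
      _ = η[A] ▷ Z ▷ Z ▷ A ≫ ((α_ A Z Z).hom ≫ A ◁ μ[Z]) ▷ A ≫
          regAct ω := by
        rw [whisker_exchange]; monoidal
      _ = (α_ _ Z A).hom ≫ (η[A] ▷ Z ▷ (Z ⊗ A) ≫ (A ⊗ Z) ◁ ω) ≫ (α_ (A ⊗ Z) A Z).inv ≫
          regAct ω ▷ Z ≫ (α_ A Z Z).hom ≫ A ◁ μ[Z] := by
        rw [← h]; monoidal
      _ = (α_ _ Z A).hom ≫ (𝟙_ B ⊗ Z) ◁ ω ≫ (α_ _ A Z).inv ≫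
          (η[A] ▷ Z ▷ A ≫ regAct ω) ▷ Z ≫ (α_ A Z Z).hom ≫ A ◁ μ[Z] := by
        rw [← whisker_exchange]; monoidal
      _ = _ := by rw [h1]; monoidal
  one_left := by
    have h := η[A] ▷ A ≫= hω.oneHom_linear hT hU (RightMod.regular A)
    have h1 := one_regAct ω
    have h2 := MonObj.one_mul A
    change η[A] ▷ A ≫ μ[A] ≫ (ρ_ A).inv ≫ A ◁ η[Z] =
      η[A] ▷ A ≫ ((ρ_ A).inv ≫ A ◁ η[Z]) ▷ A ≫ regAct ω at h
    rw [reassoc_of% h2] at h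
    rw [h]
    calc
      _ = (λ_ (𝟙_ B)).inv ▷ A ≫ (𝟙_ B ◁ η[Z]) ▷ A ≫ (λ_ Z).hom ▷ A ≫ ω := by monoidal
      _ = (λ_ (𝟙_ B)).inv ▷ A ≫ (𝟙_ B ◁ η[Z] ≫ η[A] ▷ Z) ▷ A ≫
          regAct ω := by rw [← h1]; monoidal
      _ = _ := by rw [whisker_exchange, unitors_inv_equal]; monoidal
  mul_right := by
    have h := η[A] ▷ Z ▷ A ▷ A ≫= (hω.zMod hT (RightMod.regular A)).act_act
    have h1 := one_regAct ω
    change η[A] ▷ Z ▷ A ▷ A ≫ regAct ω ▷ A ≫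
      regAct ω = η[A] ▷ Z ▷ A ▷ A ≫ (α_ (A ⊗ Z) A A).hom ≫
      (A ⊗ Z) ◁ μ[A] ≫ regAct ω at h
    rw [← cancel_epi ((λ_ Z).hom ▷ (A ⊗ A)), ← cancel_epi (α_ _ A A).hom]
    calc
      _ = (α_ _ A A).hom ≫ (𝟙_ B ⊗ Z) ◁ μ[A] ≫ (λ_ Z).hom ▷ A ≫ ω := by
        rw [whisker_exchange_assoc]
      _ = (α_ _ A A).hom ≫ (η[A] ▷ Z ▷ (A ⊗ A) ≫ (A ⊗ Z) ◁ μ[A]) ≫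
          regAct ω := by
        rw [← h1, whisker_exchange_assoc, Category.assoc]
      _ = (η[A] ▷ Z ▷ A ≫ regAct ω) ▷ A ≫
          regAct ω := by
        rw [comp_whiskerRight_assoc, h]; monoidal
      _ = ((λ_ Z).hom ▷ A ≫ ω) ▷ A ≫ (α_ A Z A).hom ≫ A ◁ ω ≫ (α_ A A Z).inv ≫ μ[A] ▷ Z := by
        rw [h1]; rfl
      _ = _ := by monoidal
  one_right := by
    have h := η[A] ▷ Z ▷ 𝟙_ B ≫= (hω.zMod hT (RightMod.regular A)).act_one
    have h1 := one_regAct ω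
    change η[A] ▷ Z ▷ 𝟙_ B ≫ (A ⊗ Z) ◁ η[A] ≫ regAct ω =
      η[A] ▷ Z ▷ 𝟙_ B ≫ (ρ_ (A ⊗ Z)).hom at h
    rw [← whisker_exchange_assoc, h1, whisker_exchange_assoc] at h
    rw [← cancel_epi ((λ_ Z).hom ▷ 𝟙_ B), h]
    monoidal
  comul := by
    have h := (η[A] ⊗ₘ η[A]) ▷ Z ▷ A ≫=
      hω.comulHom_linear hT hU (RightMod.regular A) (RightMod.regular A)
    have h1 := one_regAct ω
    have h2 : ((η[A] ⊗ₘ η[A]) ▷ A ≫ (A ⊗ A) ◁ Δ[A] ≫ tensorμ A A A A ≫ (μ[A] ⊗ₘ μ[A])) =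
        (λ_ (𝟙_ B)).hom ▷ A ≫ (λ_ A).hom ≫ Δ[A] := by
      have h3 := freeComul_natural' A η[A] η[A]
      rw [freeComul] at h3
      rw [reassoc_of% h3, tensorHom_comp_tensorHom, MonObj.one_mul, freeComul_unit]
    have h4 := freeComul_natural' A (η[A] ▷ Z) (η[A] ▷ Z)
    have h5 := freeComul_natural' A (λ_ Z).hom (λ_ Z).hom
    have h6 := freeComul_unit Z
    rw [freeComul] at h4
    have h3 := freeComul_natural' Z η[A] η[A]
    change (η[A] ⊗ₘ η[A]) ▷ Z ▷ A ≫ ((α_ (A ⊗ A) Z A).hom ≫ (A ⊗ A) ◁ ω ≫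
      (α_ (A ⊗ A) A Z).inv ≫ ((A ⊗ A) ◁ Δ[A] ≫ tensorμ A A A A ≫ (μ[A] ⊗ₘ μ[A])) ▷ Z) ≫
      freeComul Z A A = (η[A] ⊗ₘ η[A]) ▷ Z ▷ A ≫ freeComul Z A A ▷ A ≫
      ((A ⊗ Z) ⊗ (A ⊗ Z)) ◁ Δ[A] ≫ tensorμ (A ⊗ Z) (A ⊗ Z) A A ≫
      (regAct ω ⊗ₘ regAct ω) at h
    rw [← cancel_epi ((λ_ Z).hom ▷ A), ← cancel_epi ((λ_ (𝟙_ B)).hom ▷ Z ▷ A)]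
    calc
      _ = (α_ _ Z A).hom ≫ (𝟙_ B ⊗ 𝟙_ B) ◁ ω ≫ (α_ _ A Z).inv ≫
          ((λ_ (𝟙_ B)).hom ▷ A ≫ (λ_ A).hom ≫ Δ[A]) ▷ Z ≫ (A ⊗ A) ◁ Δ[Z] ≫
            tensorμ A A Z Z := by
        rw [MonoidalCategory.tensorHom_def]; monoidal
      _ = (α_ _ Z A).hom ≫ ((η[A] ⊗ₘ η[A]) ▷ (Z ⊗ A) ≫ (A ⊗ A) ◁ ω) ≫
          (α_ (A ⊗ A) A Z).inv ≫ ((A ⊗ A) ◁ Δ[A] ≫ tensorμ A A A A ≫ (μ[A] ⊗ₘ μ[A])) ▷ Z ≫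
            freeComul Z A A := by
        rw [← h2, ← whisker_exchange, freeComul]
        simp only [comp_whiskerRight, Category.assoc, associator_inv_naturality_left_assoc]
      _ = ((η[A] ⊗ₘ η[A]) ▷ Z ≫ freeComul Z A A) ▷ A ≫
          ((A ⊗ Z) ⊗ (A ⊗ Z)) ◁ Δ[A] ≫ tensorμ (A ⊗ Z) (A ⊗ Z) A A ≫
            (regAct ω ⊗ₘ regAct ω) := by
        rw [comp_whiskerRight ((η[A] ⊗ₘ η[A]) ▷ Z), Category.assoc _ (freeComul Z A A ▷ A), ← h]
        simp
      _ = (freeComul Z (𝟙_ B) (𝟙_ B) ≫ ((λ_ Z).hom ⊗ₘ (λ_ Z).hom)) ▷ A ≫ freeComul A Z Z ≫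
            (ω ⊗ₘ ω) := by
        rw [h3, comp_whiskerRight_assoc, reassoc_of% h4, tensorHom_comp_tensorHom, h1,
          comp_whiskerRight_assoc, reassoc_of% h5, tensorHom_comp_tensorHom]
      _ = _ := by
        rw [h6, freeComul, MonoidalCategory.tensorHom_def Δ[Z] Δ[A]]
        simp
  counit := by
    have h := hω.counitHom_linear hT hU
    change ((α_ (𝟙_ B) Z A).hom ≫ 𝟙_ B ◁ ω ≫ (α_ (𝟙_ B) A Z).inv ≫
      (𝟙_ B ◁ ε[A] ≫ (ρ_ (𝟙_ B)).hom) ▷ Z) ≫ (λ_ Z).hom ≫ ε[Z] =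
      ((λ_ Z).hom ≫ ε[Z]) ▷ A ≫ 𝟙_ B ◁ ε[A] ≫ (ρ_ (𝟙_ B)).hom at h
    rw [← cancel_epi ((λ_ Z).hom ▷ A), ← cancel_mono (ρ_ (𝟙_ B)).hom]
    calc
      _ = ((α_ (𝟙_ B) Z A).hom ≫ 𝟙_ B ◁ ω ≫ (α_ (𝟙_ B) A Z).inv ≫
          (𝟙_ B ◁ ε[A] ≫ (ρ_ (𝟙_ B)).hom) ▷ Z) ≫ (λ_ Z).hom ≫ ε[Z] := by
        rw [MonoidalCategory.tensorHom_def, ← unitors_equal]; monoidal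
      _ = _ := by rw [h, MonoidalCategory.tensorHom_def]; monoidal

end UnivCoact

end LawAxioms

/-! ### Left and right modules over a Hopf algebra -/

section Flip

variable {B : Type u} [Category.{v} B] [MonoidalCategory B] [BraidedCategory B]
  {H : B} [HopfObj H]

lemma RightMod.mk_congr {B : Type u} [Category.{v} B] [MonoidalCategory B] {A X : B}
    [MonObj A] {a b : X ⊗ A ⟶ X} (h : a = b) (h₁ h₂ h₃ h₄) :
    (RightMod.mk X a h₁ h₂ : RightMod A) = RightMod.mk X b h₃ h₄ := by
  subst h
  rfl

lemma flipAct_one (M : Mod B H) : M.X ◁ η[H] ≫ flipAct M = (ρ_ M.X).hom := by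
  have h := HopfObj.one_antipode H
  rw [flipAct, ← whiskerLeft_comp_assoc, h, braiding_naturality_right_assoc, leftAct_one,
    braiding_tensorUnit_right]
  simp

lemma flipAct_flipAct (M : Mod B H) :
    flipAct M ▷ H ≫ flipAct M = (α_ M.X H H).hom ≫ M.X ◁ μ[H] ≫ flipAct M := by
  have h1 : (α_ H H M.X).hom ≫ H ◁ (𝒮[H] ▷ M.X ≫ leftAct M) ≫ 𝒮[H] ▷ M.X ≫ leftAct M =
      ((β_ H H).inv ≫ μ[H]) ▷ M.X ≫ 𝒮[H] ▷ M.X ≫ leftAct M := by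
    have h := HopfObj.mul_antipode H
    have h2 := leftAct_mul M
    rw [← comp_whiskerRight_assoc, Category.assoc, h, ← braiding_inv_naturality_assoc,
      Iso.inv_hom_id_assoc, comp_whiskerRight_assoc, h2, MonoidalCategory.tensorHom_def']
    simp only [comp_whiskerRight, whiskerLeft_comp, Category.assoc]
    rw [associator_naturality_left_assoc, ← whisker_exchange_assoc]
    simp
  have h2 := braiding_naturality_left (𝒮[H] ▷ M.X ≫ leftAct M) H
  have h3 := braiding_naturality_right M.X μ[H]
  rw [braiding_tensor_left_hom] at h2
  rw [braiding_tensor_right_hom] at h3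
  have h4 : flipAct M = (β_ M.X H).hom ≫ 𝒮[H] ▷ M.X ≫ leftAct M := by
    rw [flipAct, braiding_naturality_right_assoc]
  rw [h4, comp_whiskerRight, Category.assoc, reassoc_of% h2, h1, reassoc_of% h3]
  have h5 : (β_ H H).hom ▷ M.X ≫ ((β_ H H).inv ≫ μ[H]) ▷ M.X = μ[H] ▷ M.X := by
    rw [← comp_whiskerRight, Iso.hom_inv_id_assoc]
  rw [reassoc_of% h5]
  simp

/-- The right module obtained from a left module with the braiding and the antipode. -/
def flipMod (M : Mod B H) : RightMod H where
  X := M.X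
  act := flipAct M
  act_one := flipAct_one M
  act_act := flipAct_flipAct M

variable [IsIso 𝒮[H]]

/-- The left module obtained from a right module with the inverse braiding and the inverse
antipode. -/
noncomputable def unflipMod (N : RightMod H) : Mod B H :=
  leftMk N.X (inv 𝒮[H] ▷ N.X ≫ N.opAct)
    (by
      have h : η[H] ≫ inv 𝒮[H] = η[H] := by
        rw [IsIso.comp_inv_eq, HopfObj.one_antipode]
      rw [← comp_whiskerRight_assoc, h, N.one_opAct])
    (by
      have h : μ[H] ≫ inv 𝒮[H] = (inv 𝒮[H] ⊗ₘ inv 𝒮[H]) ≫ (β_ H H).inv ≫ μ[H] := by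
        rw [IsIso.comp_inv_eq, Category.assoc, Category.assoc, HopfObj.mul_antipode,
          ← braiding_inv_naturality_assoc, Iso.inv_hom_id_assoc, tensorHom_comp_tensorHom_assoc]
        simp
      rw [← comp_whiskerRight_assoc, h, comp_whiskerRight_assoc, ← N.opAct_opAct,
        MonoidalCategory.tensorHom_def']
      simp only [comp_whiskerRight, whiskerLeft_comp, Category.assoc]
      rw [associator_naturality_left_assoc, ← whisker_exchange_assoc]
      simp)

lemma flipMod_unflipMod (N : RightMod H) : flipMod (unflipMod N) = N := by
  have h : flipAct (unflipMod N) = N.act := by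
    change N.X ◁ 𝒮[H] ≫ (β_ N.X H).hom ≫ inv 𝒮[H] ▷ N.X ≫ (β_ N.X H).inv ≫ N.act = N.act
    rw [← braiding_naturality_right_assoc, ← whiskerLeft_comp_assoc]
    simp
  cases N
  exact RightMod.mk_congr h _ _ _ _

end Flip

/-! ### Duals of modules -/

section Duals

variable {B : Type u} [Category.{v} B] [MonoidalCategory B]

lemma ExactPairing.hom_ext_left (Q P : B) [ExactPairing Q P] {X : B} {f g : X ⟶ Q}
    (h : P ◁ f ≫ ε_ Q P = P ◁ g ≫ ε_ Q P) : f = g := by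
  have h1 := ExactPairing.evaluation_coevaluation Q P
  have h2 : ∀ k : X ⟶ Q, k = (λ_ X).inv ≫ η_ Q P ▷ X ≫ (α_ Q P X).hom ≫
      Q ◁ (P ◁ k ≫ ε_ Q P) ≫ (ρ_ Q).hom := fun k => by
    calc
      k = (λ_ X).inv ≫ (𝟙_ B ◁ k ≫ η_ Q P ▷ Q) ≫ (α_ Q P Q).hom ≫ Q ◁ ε_ Q P ≫ (ρ_ Q).hom := by
        rw [Category.assoc, reassoc_of% h1]; simp
      _ = _ := by rw [whisker_exchange]; monoidal
  rw [h2 f, h, ← h2 g]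

lemma ExactPairing.hom_ext_right (Q P : B) [ExactPairing Q P] {X : B} {f g : X ⟶ P}
    (h : f ▷ Q ≫ ε_ Q P = g ▷ Q ≫ ε_ Q P) : f = g := by
  have h1 := ExactPairing.coevaluation_evaluation Q P
  have h2 : ∀ k : X ⟶ P, k = (ρ_ X).inv ≫ X ◁ η_ Q P ≫ (α_ X Q P).inv ≫
      (k ▷ Q ≫ ε_ Q P) ▷ P ≫ (λ_ P).hom := fun k => by
    calc
      k = (ρ_ X).inv ≫ (k ▷ 𝟙_ B ≫ P ◁ η_ Q P) ≫ (α_ P Q P).inv ≫ ε_ Q P ▷ P ≫ (λ_ P).hom := by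
        rw [Category.assoc, reassoc_of% h1]; simp
      _ = _ := by rw [← whisker_exchange]; monoidal
  rw [h2 f, h, ← h2 g]

lemma ExactPairing.exists_left (Q P : B) [ExactPairing Q P] {X : B} (f : P ⊗ X ⟶ 𝟙_ B) :
    ∃ k : X ⟶ Q, P ◁ k ≫ ε_ Q P = f := by
  have h1 := ExactPairing.coevaluation_evaluation Q P
  refine ⟨(λ_ X).inv ≫ η_ Q P ▷ X ≫ (α_ Q P X).hom ≫ Q ◁ f ≫ (ρ_ Q).hom, ?_⟩
  calc
    _ = 𝟙 _ ⊗≫ P ◁ η_ Q P ▷ X ⊗≫ ((P ⊗ Q) ◁ f ≫ ε_ Q P ▷ 𝟙_ B) ⊗≫ 𝟙 (𝟙_ B) := by monoidal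
    _ = 𝟙 _ ⊗≫ (P ◁ η_ Q P ≫ (α_ P Q P).inv ≫ ε_ Q P ▷ P) ▷ X ⊗≫ f := by
      rw [whisker_exchange]; monoidal
    _ = f := by rw [h1]; monoidal

lemma ExactPairing.exists_right (Q P : B) [ExactPairing Q P] {X : B} (f : X ⊗ Q ⟶ 𝟙_ B) :
    ∃ k : X ⟶ P, k ▷ Q ≫ ε_ Q P = f := by
  have h1 := ExactPairing.evaluation_coevaluation Q P
  refine ⟨(ρ_ X).inv ≫ X ◁ η_ Q P ≫ (α_ X Q P).inv ≫ f ▷ P ≫ (λ_ P).hom, ?_⟩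
  calc
    _ = 𝟙 _ ⊗≫ X ◁ η_ Q P ▷ Q ⊗≫ (f ▷ (P ⊗ Q) ≫ 𝟙_ B ◁ ε_ Q P) ⊗≫ 𝟙 (𝟙_ B) := by monoidal
    _ = 𝟙 _ ⊗≫ X ◁ (η_ Q P ▷ Q ≫ (α_ Q P Q).hom ≫ Q ◁ ε_ Q P) ⊗≫ f := by
      rw [← whisker_exchange]; monoidal
    _ = f := by rw [h1]; monoidal

/-- A right module and a left module in duality, for which the evaluation is balanced. -/
def IsBalanced {A : B} [MonObj A] (P : RightMod A) (Q : Mod B A) [ExactPairing Q.X P.X] : Prop :=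
  P.act ▷ Q.X ≫ ε_ Q.X P.X = (α_ P.X A Q.X).hom ≫ P.X ◁ leftAct Q ≫ ε_ Q.X P.X

/-- For modules in duality, the coevaluation is balanced as well. -/
lemma IsBalanced.coev {A : B} [MonObj A] {P : RightMod A} {Q : Mod B A} [ExactPairing Q.X P.X]
    (h : IsBalanced P Q) : A ◁ η_ Q.X P.X ≫ (α_ A Q.X P.X).inv ≫ leftAct Q ▷ P.X =
      (ρ_ A).hom ≫ (λ_ A).inv ≫ η_ Q.X P.X ▷ A ≫ (α_ Q.X P.X A).hom ≫ Q.X ◁ P.act := by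
  have h1 := ExactPairing.evaluation_coevaluation Q.X P.X
  have h2 := ExactPairing.coevaluation_evaluation Q.X P.X
  unfold IsBalanced at h
  calc
    _ = 𝟙 _ ⊗≫ A ◁ η_ Q.X P.X ⊗≫ (𝟙_ B ◁ leftAct Q ≫ (η_ Q.X P.X ▷ Q.X ≫ (α_ Q.X P.X Q.X).hom ≫
        Q.X ◁ ε_ Q.X P.X)) ▷ P.X ⊗≫ 𝟙 (Q.X ⊗ P.X) := by rw [h1]; monoidal
    _ = 𝟙 _ ⊗≫ A ◁ η_ Q.X P.X ⊗≫ (𝟙_ B ◁ leftAct Q ≫ η_ Q.X P.X ▷ Q.X) ▷ P.X ⊗≫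
        Q.X ◁ ε_ Q.X P.X ▷ P.X ⊗≫ 𝟙 (Q.X ⊗ P.X) := by monoidal
    _ = 𝟙 _ ⊗≫ (𝟙_ B ◁ A ◁ η_ Q.X P.X ≫ η_ Q.X P.X ▷ (A ⊗ Q.X ⊗ P.X)) ⊗≫
        Q.X ◁ ((α_ P.X A Q.X).hom ≫ P.X ◁ leftAct Q ≫ ε_ Q.X P.X) ▷ P.X ⊗≫
        𝟙 (Q.X ⊗ P.X) := by rw [whisker_exchange]; monoidal
    _ = 𝟙 _ ⊗≫ η_ Q.X P.X ▷ A ⊗≫ Q.X ◁ ((P.X ⊗ A) ◁ η_ Q.X P.X ≫ P.act ▷ (Q.X ⊗ P.X)) ⊗≫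
        Q.X ◁ ε_ Q.X P.X ▷ P.X ⊗≫ 𝟙 (Q.X ⊗ P.X) := by
      rw [← h, whisker_exchange]; monoidal
    _ = 𝟙 _ ⊗≫ η_ Q.X P.X ▷ A ⊗≫ Q.X ◁ P.act ⊗≫
        Q.X ◁ (P.X ◁ η_ Q.X P.X ≫ (α_ P.X Q.X P.X).inv ≫ ε_ Q.X P.X ▷ P.X) ⊗≫
        𝟙 (Q.X ⊗ P.X) := by
      rw [whisker_exchange]; monoidal
    _ = _ := by rw [h2]; monoidal

/-- The dual of a right module carries the left action for which the evaluation is balanced. -/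
lemma exists_leftDual {A : B} [MonObj A] (P : RightMod A) (Y : B) [ExactPairing Y P.X] :
    ∃ (Q : Mod B A) (_ : ExactPairing Q.X P.X), IsBalanced P Q := by
  obtain ⟨l, hl⟩ := ExactPairing.exists_left Y P.X ((α_ P.X A Y).inv ≫ P.act ▷ Y ≫ ε_ Y P.X)
  refine ⟨leftMk Y l ?_ ?_, ‹_›, ?_⟩
  · refine ExactPairing.hom_ext_left Y P.X ?_
    have h := P.act_one
    rw [whiskerLeft_comp_assoc, hl, associator_inv_naturality_middle_assoc,
      ← comp_whiskerRight_assoc, h]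
    monoidal
  · refine ExactPairing.hom_ext_left Y P.X ?_
    have h := P.act_act
    calc
      _ = (α_ P.X (A ⊗ A) Y).inv ≫ (P.X ◁ μ[A] ≫ P.act) ▷ Y ≫ ε_ Y P.X := by
        rw [whiskerLeft_comp_assoc, hl]; simp
      _ = (α_ P.X (A ⊗ A) Y).inv ≫ (α_ P.X A A).inv ▷ Y ≫ P.act ▷ A ▷ Y ≫
          (α_ P.X A Y).hom ≫ P.X ◁ l ≫ ε_ Y P.X := by
        rw [hl, Iso.hom_inv_id_assoc, ← comp_whiskerRight_assoc (P.act ▷ A), h]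
        simp
      _ = (α_ P.X (A ⊗ A) Y).inv ≫ (α_ P.X A A).inv ▷ Y ≫ (α_ (P.X ⊗ A) A Y).hom ≫
          (P.act ▷ (A ⊗ Y) ≫ P.X ◁ l) ≫ ε_ Y P.X := by
        simp
      _ = P.X ◁ (α_ A A Y).hom ≫ P.X ◁ A ◁ l ≫ (α_ P.X A Y).inv ≫ P.act ▷ Y ≫ ε_ Y P.X := by
        rw [← whisker_exchange]; monoidal
      _ = _ := by rw [← hl]; simp
  · exact ((Iso.eq_inv_comp _).1 hl).symm

/-- The dual of a left module carries the right action for which the evaluation is balanced. -/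
lemma exists_rightDual {A : B} [MonObj A] (Q : Mod B A) (Y : B) [ExactPairing Q.X Y] :
    ∃ (P : RightMod A) (_ : ExactPairing Q.X P.X), IsBalanced P Q := by
  obtain ⟨l, hl⟩ := ExactPairing.exists_right Q.X Y ((α_ Y A Q.X).hom ≫ Y ◁ leftAct Q ≫ ε_ Q.X Y)
  refine ⟨⟨Y, l, ?_, ?_⟩, ‹_›, ?_⟩
  · refine ExactPairing.hom_ext_right Q.X Y ?_
    have h := leftAct_one Q
    rw [comp_whiskerRight_assoc, hl, associator_naturality_middle_assoc,
      ← whiskerLeft_comp_assoc, h]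
    monoidal
  · refine ExactPairing.hom_ext_right Q.X Y ?_
    have h := leftAct_mul Q
    calc
      _ = l ▷ A ▷ Q.X ≫ l ▷ Q.X ≫ ε_ Q.X Y := by simp
      _ = (α_ (Y ⊗ A) A Q.X).hom ≫ (l ▷ (A ⊗ Q.X) ≫ Y ◁ leftAct Q) ≫ ε_ Q.X Y := by
        rw [hl]; simp
      _ = (α_ (Y ⊗ A) A Q.X).hom ≫ (Y ⊗ A) ◁ leftAct Q ≫ (α_ Y A Q.X).hom ≫
          Y ◁ leftAct Q ≫ ε_ Q.X Y := by
        rw [← whisker_exchange, Category.assoc, hl]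
      _ = (α_ Y A A).hom ▷ Q.X ≫ (α_ Y (A ⊗ A) Q.X).hom ≫
          Y ◁ ((α_ A A Q.X).hom ≫ A ◁ leftAct Q ≫ leftAct Q) ≫ ε_ Q.X Y := by monoidal
      _ = _ := by
        rw [← h, comp_whiskerRight, comp_whiskerRight, Category.assoc, Category.assoc, hl]
        simp
  · exact hl

variable [BraidedCategory B] {A : B} [HopfObj A]

/-- Acting by `𝒮(a₂)` and then by `a₁` is acting by the counit. -/
lemma splitAct_flipAct (Q : Mod B A) :
    splitAct A Q.X ≫ A ◁ flipAct Q ≫ leftAct Q = Q.X ◁ ε[A] ≫ (ρ_ Q.X).hom := by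
  have h1 := leftAct_mul Q
  have h2 := HopfObj.antipode_right A
  have h3 := leftAct_one Q
  have h4 := braiding_naturality_right Q.X (Δ[A] ≫ A ◁ 𝒮[A] ≫ μ[A])
  calc
    _ = Q.X ◁ (Δ[A] ≫ A ◁ 𝒮[A]) ≫ (β_ Q.X (A ⊗ A)).hom ≫ (α_ A A Q.X).hom ≫
        A ◁ leftAct Q ≫ leftAct Q := by
      rw [braiding_tensor_right_hom]
      dsimp only [splitAct, flipAct]
      calc
        _ = 𝟙 _ ⊗≫ Q.X ◁ Δ[A] ⊗≫ ((β_ Q.X A).hom ▷ A ≫ (A ⊗ Q.X) ◁ 𝒮[A]) ⊗≫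
            A ◁ (β_ Q.X A).hom ≫ A ◁ leftAct Q ≫ leftAct Q := by monoidal
        _ = _ := by rw [← whisker_exchange]; monoidal
    _ = Q.X ◁ (Δ[A] ≫ A ◁ 𝒮[A] ≫ μ[A]) ≫ (β_ Q.X A).hom ≫ leftAct Q := by
      rw [← h1, ← braiding_naturality_right_assoc]
      simp only [whiskerLeft_comp, Category.assoc]
    _ = _ := by
      rw [h2, whiskerLeft_comp_assoc, braiding_naturality_right_assoc, h3,
        braiding_tensorUnit_right]
      simp

/-- A balanced pair of modules in duality gives a duality between right modules. -/
@[reducible]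
def IsBalanced.exactPairing {P : RightMod A} {Q : Mod B A} [ExactPairing Q.X P.X]
    (h : IsBalanced P Q) : ExactPairing (flipMod Q) P where
  coevaluation' :=
    { hom := η_ Q.X P.X
      act_hom := by
        have h1 := h.coev
        have h2 := braiding_naturality_left (η_ Q.X P.X) A
        have h3 := HopfObj.antipode_left A
        have h4 := P.act_act
        have h5 := P.act_one
        rw [braiding_tensor_left_hom] at h2
        change (𝟙_ B ◁ ε[A] ≫ (ρ_ (𝟙_ B)).hom) ≫ η_ Q.X P.X =
          η_ Q.X P.X ▷ A ≫ (Q.X ⊗ P.X) ◁ Δ[A] ≫ tensorμ Q.X P.X A A ≫ (flipAct Q ⊗ₘ P.act)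
        have h6 : flipAct Q = (β_ Q.X A).hom ≫ 𝒮[A] ▷ Q.X ≫ leftAct Q := by
          rw [flipAct, braiding_naturality_right_assoc]
        rw [braiding_tensorUnit_left] at h2
        symm
        calc
          _ = (η_ Q.X P.X ▷ A ≫ (Q.X ⊗ P.X) ◁ Δ[A]) ⊗≫ Q.X ◁ (β_ P.X A).hom ▷ A ⊗≫
              (β_ Q.X A).hom ▷ (P.X ⊗ A) ⊗≫ (𝒮[A] ▷ Q.X ≫ leftAct Q) ▷ (P.X ⊗ A) ≫
              Q.X ◁ P.act := by
            rw [h6, MonoidalCategory.tensorHom_def, tensorμ]; monoidal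
          _ = 𝟙_ B ◁ Δ[A] ⊗≫ (η_ Q.X P.X ▷ A ≫ (α_ Q.X P.X A).hom ≫ Q.X ◁ (β_ P.X A).hom ≫
              (α_ Q.X A P.X).inv ≫ (β_ Q.X A).hom ▷ P.X ≫ (α_ A Q.X P.X).hom) ▷ A ⊗≫
              (𝒮[A] ▷ Q.X ≫ leftAct Q) ▷ (P.X ⊗ A) ≫ Q.X ◁ P.act := by
            rw [← whisker_exchange]; monoidal
          _ = 𝟙_ B ◁ Δ[A] ⊗≫ (A ◁ η_ Q.X P.X ≫ 𝒮[A] ▷ (Q.X ⊗ P.X)) ▷ A ⊗≫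
              leftAct Q ▷ (P.X ⊗ A) ≫ Q.X ◁ P.act := by
            rw [h2]; monoidal
          _ = 𝟙_ B ◁ Δ[A] ⊗≫ 𝒮[A] ▷ A ⊗≫ (A ◁ η_ Q.X P.X ≫ (α_ A Q.X P.X).inv ≫
              leftAct Q ▷ P.X) ▷ A ⊗≫ Q.X ◁ P.act := by
            rw [whisker_exchange]; monoidal
          _ = 𝟙_ B ◁ (Δ[A] ≫ 𝒮[A] ▷ A) ⊗≫ η_ Q.X P.X ▷ (A ⊗ A) ⊗≫
              Q.X ◁ (P.act ▷ A ≫ P.act) := by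
            rw [h1]; monoidal
          _ = 𝟙_ B ◁ (Δ[A] ≫ 𝒮[A] ▷ A) ⊗≫ (η_ Q.X P.X ▷ (A ⊗ A) ≫
              (Q.X ⊗ P.X) ◁ μ[A]) ⊗≫ Q.X ◁ P.act := by
            rw [h4]; monoidal
          _ = 𝟙_ B ◁ (Δ[A] ≫ 𝒮[A] ▷ A ≫ μ[A]) ⊗≫ η_ Q.X P.X ▷ A ⊗≫ Q.X ◁ P.act := by
            rw [← whisker_exchange]; monoidal
          _ = 𝟙_ B ◁ ε[A] ⊗≫ (𝟙_ B ◁ η[A] ≫ η_ Q.X P.X ▷ A) ⊗≫ Q.X ◁ P.act := by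
            rw [h3]; monoidal
          _ = 𝟙_ B ◁ ε[A] ⊗≫ η_ Q.X P.X ⊗≫ Q.X ◁ (P.X ◁ η[A] ≫ P.act) := by
            rw [whisker_exchange]; monoidal
          _ = _ := by rw [h5]; monoidal }
  evaluation' :=
    { hom := ε_ Q.X P.X
      act_hom := by
        have h1 := splitAct_flipAct Q
        unfold IsBalanced at h
        change ((P.X ⊗ Q.X) ◁ Δ[A] ≫ tensorμ P.X Q.X A A ≫ (P.act ⊗ₘ flipAct Q)) ≫ ε_ Q.X P.X =
          ε_ Q.X P.X ▷ A ≫ 𝟙_ B ◁ ε[A] ≫ (ρ_ (𝟙_ B)).hom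
        calc
          _ = (P.X ⊗ Q.X) ◁ Δ[A] ≫ tensorμ P.X Q.X A A ≫ (P.X ⊗ A) ◁ flipAct Q ≫
              P.act ▷ Q.X ≫ ε_ Q.X P.X := by
            rw [MonoidalCategory.tensorHom_def']; simp
          _ = (α_ P.X Q.X A).hom ≫ P.X ◁ (splitAct A Q.X ≫ A ◁ flipAct Q ≫ leftAct Q) ≫
              ε_ Q.X P.X := by
            rw [h]
            dsimp only [splitAct, tensorμ]
            monoidal
          _ = _ := by
            rw [h1, ← whisker_exchange_assoc]
            monoidal }
  coevaluation_evaluation' := RightMod.hom_ext _ _ (ExactPairing.coevaluation_evaluation Q.X P.X)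
  evaluation_coevaluation' := RightMod.hom_ext _ _ (ExactPairing.evaluation_coevaluation Q.X P.X)

variable [RigidCategory B]

/-- A right module over a Hopf algebra has a left dual: the dual left module, flipped by the
antipode. -/
lemma exists_exactPairing_left (N : RightMod A) :
    ∃ L : RightMod A, Nonempty (ExactPairing L N) := by
  obtain ⟨Q, _, h⟩ := exists_leftDual N (ᘁN.X)
  exact ⟨flipMod Q, ⟨h.exactPairing⟩⟩

/-- If the antipode is invertible, a right module is the flip of a left module, whose dual right
module is a right dual. -/
lemma exists_exactPairing_right [IsIso 𝒮[A]] (N : RightMod A) :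
    ∃ R : RightMod A, Nonempty (ExactPairing N R) := by
  obtain ⟨P, _, h⟩ := exists_rightDual (unflipMod N) (unflipMod N).Xᘁ
  exact ⟨P, by rw [← flipMod_unflipMod N]; exact ⟨h.exactPairing⟩⟩

end Duals

/-! ### Invertibility of half braidings -/

section HalfBraidings

variable {B : Type u} [Category.{v} B] [MonoidalCategory B] [BraidedCategory B]
  {A : B} [BimonObj A]

/-- A multiplicative natural family is invertible at the modules which have a left dual. -/
lemma isIso_of_exactPairing_left {N L : RightMod A} [ExactPairing L N] {V : B}
    (σ : ∀ N : RightMod A, V ⊗ N.X ⟶ N.X ⊗ V)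
    (nat : ∀ {M N : RightMod A} (f : M ⟶ N), V ◁ f.hom ≫ σ N = σ M ≫ f.hom ▷ V)
    (tensor : ∀ M N : RightMod A, σ (M ⊗ N) = (α_ V M.X N.X).inv ≫ σ M ▷ N.X ≫
      (α_ M.X V N.X).hom ≫ M.X ◁ σ N ≫ (α_ M.X N.X V).inv)
    (unit : σ (𝟙_ (RightMod A)) = (ρ_ V).hom ≫ (λ_ V).inv) : IsIso (σ N) := by
  have z1 := congrArg RightMod.Hom.hom (ExactPairing.coevaluation_evaluation L N)
  have n1 := nat (ε_ L N)
  have n2 := nat (η_ L N)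
  obtain ⟨ev, hev⟩ : ∃ ev : N.X ⊗ L.X ⟶ 𝟙_ B, ev = (ε_ L N).hom := ⟨_, rfl⟩
  obtain ⟨co, hco⟩ : ∃ co : 𝟙_ B ⟶ L.X ⊗ N.X, co = (η_ L N).hom := ⟨_, rfl⟩
  rw [tensor, unit, ← hev] at n1
  rw [tensor, unit, ← hco] at n2
  change N.X ◁ (η_ L N).hom ≫ (α_ N.X L.X N.X).inv ≫ (ε_ L N).hom ▷ N.X =
    (ρ_ N.X).hom ≫ (λ_ N.X).inv at z1
  rw [← hev, ← hco] at z1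
  change N.X ◁ co ≫ (α_ N.X L.X N.X).inv ≫ ev ▷ N.X = (ρ_ N.X).hom ≫ (λ_ N.X).inv at z1
  change V ◁ ev ≫ (ρ_ V).hom ≫ (λ_ V).inv = ((α_ V N.X L.X).inv ≫ σ N ▷ L.X ≫
      (α_ N.X V L.X).hom ≫ N.X ◁ σ L ≫ (α_ N.X L.X V).inv) ≫ ev ▷ V at n1
  change V ◁ co ≫ (α_ V L.X N.X).inv ≫ σ L ▷ N.X ≫ (α_ L.X V N.X).hom ≫ L.X ◁ σ N ≫
    (α_ L.X N.X V).inv = ((ρ_ V).hom ≫ (λ_ V).inv) ≫ co ▷ V at n2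
  -- The inverse is the mate of `σ L` under the duality.
  refine ⟨⟨𝟙 _ ⊗≫ N.X ◁ V ◁ co ⊗≫ N.X ◁ σ L ▷ N.X ⊗≫ ev ▷ V ▷ N.X ⊗≫ 𝟙 (V ⊗ N.X), ?_, ?_⟩⟩
  · calc
      _ = 𝟙 _ ⊗≫ (σ N ▷ 𝟙_ B ≫ (N.X ⊗ V) ◁ co) ⊗≫ N.X ◁ σ L ▷ N.X ⊗≫ ev ▷ V ▷ N.X ⊗≫
          𝟙 (V ⊗ N.X) := by monoidal
      _ = 𝟙 _ ⊗≫ V ◁ N.X ◁ co ⊗≫ (((α_ V N.X L.X).inv ≫ σ N ▷ L.X ≫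
          (α_ N.X V L.X).hom ≫ N.X ◁ σ L ≫ (α_ N.X L.X V).inv) ≫ ev ▷ V) ▷ N.X ⊗≫
          𝟙 (V ⊗ N.X) := by rw [← whisker_exchange]; monoidal
      _ = 𝟙 _ ⊗≫ V ◁ (N.X ◁ co ≫ (α_ N.X L.X N.X).inv ≫ ev ▷ N.X) ⊗≫
          𝟙 (V ⊗ N.X) := by rw [← n1]; monoidal
      _ = _ := by rw [z1]; monoidal
  · calc
      _ = 𝟙 _ ⊗≫ N.X ◁ V ◁ co ⊗≫ N.X ◁ σ L ▷ N.X ⊗≫ (ev ▷ (V ⊗ N.X) ≫ 𝟙_ B ◁ σ N) ⊗≫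
          𝟙 (N.X ⊗ V) := by monoidal
      _ = 𝟙 _ ⊗≫ N.X ◁ (V ◁ co ≫ (α_ V L.X N.X).inv ≫ σ L ▷ N.X ≫ (α_ L.X V N.X).hom ≫
          L.X ◁ σ N ≫ (α_ L.X N.X V).inv) ⊗≫ ev ▷ N.X ▷ V ⊗≫ 𝟙 (N.X ⊗ V) := by
        rw [← whisker_exchange]; monoidal
      _ = 𝟙 _ ⊗≫ (N.X ◁ co ≫ (α_ N.X L.X N.X).inv ≫ ev ▷ N.X) ▷ V ⊗≫ 𝟙 (N.X ⊗ V) := by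
        rw [n2]; monoidal
      _ = _ := by rw [z1]; monoidal

/-- The mirror image of `isIso_of_exactPairing_left`. -/
lemma isIso_of_exactPairing_right {N R : RightMod A} [ExactPairing N R] {V : B}
    (σ : ∀ N : RightMod A, N.X ⊗ V ⟶ V ⊗ N.X)
    (nat : ∀ {M N : RightMod A} (f : M ⟶ N), f.hom ▷ V ≫ σ N = σ M ≫ V ◁ f.hom)
    (tensor : ∀ M N : RightMod A, σ (M ⊗ N) = (α_ M.X N.X V).hom ≫ M.X ◁ σ N ≫
      (α_ M.X V N.X).inv ≫ σ M ▷ N.X ≫ (α_ V M.X N.X).hom)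
    (unit : σ (𝟙_ (RightMod A)) = (λ_ V).hom ≫ (ρ_ V).inv) : IsIso (σ N) := by
  have z1 := congrArg RightMod.Hom.hom (ExactPairing.evaluation_coevaluation N R)
  have n1 := nat (ε_ N R)
  have n2 := nat (η_ N R)
  obtain ⟨ev, hev⟩ : ∃ ev : R.X ⊗ N.X ⟶ 𝟙_ B, ev = (ε_ N R).hom := ⟨_, rfl⟩
  obtain ⟨co, hco⟩ : ∃ co : 𝟙_ B ⟶ N.X ⊗ R.X, co = (η_ N R).hom := ⟨_, rfl⟩
  rw [tensor, unit, ← hev] at n1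
  rw [tensor, unit, ← hco] at n2
  change (η_ N R).hom ▷ N.X ≫ (α_ N.X R.X N.X).hom ≫ N.X ◁ (ε_ N R).hom =
    (λ_ N.X).hom ≫ (ρ_ N.X).inv at z1
  rw [← hev, ← hco] at z1
  change co ▷ N.X ≫ (α_ N.X R.X N.X).hom ≫ N.X ◁ ev = (λ_ N.X).hom ≫ (ρ_ N.X).inv at z1
  change ev ▷ V ≫ (λ_ V).hom ≫ (ρ_ V).inv = ((α_ R.X N.X V).hom ≫ R.X ◁ σ N ≫
      (α_ R.X V N.X).inv ≫ σ R ▷ N.X ≫ (α_ V R.X N.X).hom) ≫ V ◁ ev at n1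
  change co ▷ V ≫ (α_ N.X R.X V).hom ≫ N.X ◁ σ R ≫ (α_ N.X V R.X).inv ≫ σ N ▷ R.X ≫
    (α_ V N.X R.X).hom = ((λ_ V).hom ≫ (ρ_ V).inv) ≫ V ◁ co at n2
  refine ⟨⟨𝟙 _ ⊗≫ co ▷ V ▷ N.X ⊗≫ N.X ◁ σ R ▷ N.X ⊗≫ N.X ◁ V ◁ ev ⊗≫ 𝟙 (N.X ⊗ V), ?_, ?_⟩⟩
  · calc
      _ = 𝟙 _ ⊗≫ (𝟙_ B ◁ σ N ≫ co ▷ (V ⊗ N.X)) ⊗≫ N.X ◁ σ R ▷ N.X ⊗≫ N.X ◁ V ◁ ev ⊗≫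
          𝟙 (N.X ⊗ V) := by monoidal
      _ = 𝟙 _ ⊗≫ co ▷ N.X ▷ V ⊗≫ N.X ◁ (((α_ R.X N.X V).hom ≫ R.X ◁ σ N ≫
          (α_ R.X V N.X).inv ≫ σ R ▷ N.X ≫ (α_ V R.X N.X).hom) ≫ V ◁ ev) ⊗≫
          𝟙 (N.X ⊗ V) := by rw [whisker_exchange]; monoidal
      _ = 𝟙 _ ⊗≫ (co ▷ N.X ≫ (α_ N.X R.X N.X).hom ≫ N.X ◁ ev) ▷ V ⊗≫
          𝟙 (N.X ⊗ V) := by rw [← n1]; monoidal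
      _ = _ := by rw [z1]; monoidal
  · calc
      _ = 𝟙 _ ⊗≫ co ▷ V ▷ N.X ⊗≫ N.X ◁ σ R ▷ N.X ⊗≫ ((N.X ⊗ V) ◁ ev ≫ σ N ▷ 𝟙_ B) ⊗≫
          𝟙 (V ⊗ N.X) := by monoidal
      _ = 𝟙 _ ⊗≫ (co ▷ V ≫ (α_ N.X R.X V).hom ≫ N.X ◁ σ R ≫ (α_ N.X V R.X).inv ≫
          σ N ▷ R.X ≫ (α_ V N.X R.X).hom) ▷ N.X ⊗≫ V ◁ N.X ◁ ev ⊗≫ 𝟙 (V ⊗ N.X) := by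
        rw [whisker_exchange]; monoidal
      _ = 𝟙 _ ⊗≫ V ◁ (co ▷ N.X ≫ (α_ N.X R.X N.X).hom ≫ N.X ◁ ev) ⊗≫ 𝟙 (V ⊗ N.X) := by
        rw [n2]; monoidal
      _ = _ := by rw [z1]; monoidal

end HalfBraidings

/-! ### The antipode of a universal coaction -/

section Antipode

variable {B : Type u} [Category.{v} B] [MonoidalCategory B] [BraidedCategory B]
  {A : B} {Z : B} [BimonObj Z]

namespace UnivCoact

/-- The half braiding `M ⊗ N ⟶ N ⊗ M` between a right `Z`-module `M` and the right
`A`-modules `N`. -/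
def halfBraid [BimonObj A] (U : UnivCoact A Z) (M : RightMod Z) (N : RightMod A) :
    M.X ⊗ N.X ⟶ N.X ⊗ M.X :=
  U.cent M.X N ≫ N.X ◁ M.act

lemma halfBraid_natural [BimonObj A] (U : UnivCoact A Z) (M : RightMod Z) {N N' : RightMod A}
    (f : N ⟶ N') : M.X ◁ f.hom ≫ U.halfBraid M N' = U.halfBraid M N ≫ f.hom ▷ M.X := by
  rw [halfBraid, halfBraid, ← Category.assoc, U.cent_natural_right, Category.assoc,
    ← whisker_exchange, Category.assoc]

/-- The half braiding is multiplicative in the `A`-module, because `M` is a module for the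
product of `Z`. -/
lemma Compat.halfBraid_tensor [BimonObj A] {U : UnivCoact A Z}
    (hU : U.Compat μ[Z] η[Z] Δ[Z] ε[Z]) (M : RightMod Z) (N N' : RightMod A) :
    U.halfBraid M (N ⊗ N') = (α_ M.X N.X N'.X).inv ≫ U.halfBraid M N ▷ N'.X ≫
      (α_ N.X M.X N'.X).hom ≫ N.X ◁ U.halfBraid M N' ≫ (α_ N.X N'.X M.X).inv := by
  have h1 := hU.cent_tensor M.X N N'
  have h2 := U.cent_natural_left M.act N'
  have h3 := M.act_act
  rw [halfBraid, h1]
  dsimp only [halfBraid, RightMod.tensor_X]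
  calc
    _ = (α_ M.X N.X N'.X).inv ≫ U.cent M.X N ▷ N'.X ≫ (α_ N.X (M.X ⊗ Z) N'.X).hom ≫
        N.X ◁ (U.cent (M.X ⊗ Z) N' ≫ N'.X ◁ ((α_ M.X Z Z).hom ≫ M.X ◁ μ[Z] ≫ M.act)) ≫
        (α_ N.X N'.X M.X).inv := by monoidal
    _ = (α_ M.X N.X N'.X).inv ≫ U.cent M.X N ▷ N'.X ≫ (α_ N.X (M.X ⊗ Z) N'.X).hom ≫
        N.X ◁ ((U.cent (M.X ⊗ Z) N' ≫ N'.X ◁ M.act ▷ Z) ≫ N'.X ◁ M.act) ≫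
        (α_ N.X N'.X M.X).inv := by rw [← h3]; monoidal
    _ = _ := by rw [← h2]; monoidal

lemma Compat.halfBraid_unit [BimonObj A] {U : UnivCoact A Z}
    (hU : U.Compat μ[Z] η[Z] Δ[Z] ε[Z]) (M : RightMod Z) :
    U.halfBraid M (𝟙_ (RightMod A)) = (ρ_ M.X).hom ≫ (λ_ M.X).inv := by
  have h1 := hU.cent_one M.X
  have h3 := M.act_one
  rw [halfBraid, h1, ← h3]
  dsimp only [RightMod.unit_X]
  monoidal

/-- The right `Z`-linear extension `N ⊗ Z ⟶ N ⊗ Z` of the coaction. -/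
def galois [BimonObj A] (U : UnivCoact A Z) (N : RightMod A) : N.X ⊗ Z ⟶ N.X ⊗ Z :=
  U.coact N ▷ Z ≫ (α_ N.X Z Z).hom ≫ N.X ◁ μ[Z]

lemma galois_natural [BimonObj A] (U : UnivCoact A Z) {M N : RightMod A} (f : M ⟶ N) :
    f.hom ▷ Z ≫ U.galois N = U.galois M ≫ f.hom ▷ Z := by
  rw [galois, galois, ← comp_whiskerRight_assoc, U.natural]
  simp [whisker_exchange]

variable [HopfObj A] [RigidCategory B]

/-- Half braidings are invertible because `A`-modules have left duals. -/
lemma Compat.isIso_halfBraid {U : UnivCoact A Z} (hU : U.Compat μ[Z] η[Z] Δ[Z] ε[Z])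
    (M : RightMod Z) (N : RightMod A) : IsIso (U.halfBraid M N) := by
  obtain ⟨L, ⟨_⟩⟩ := exists_exactPairing_left N
  exact isIso_of_exactPairing_left (L := L) (fun N => U.halfBraid M N)
    (U.halfBraid_natural M) (hU.halfBraid_tensor M) (hU.halfBraid_unit M)

/-- The Galois morphisms are invertible because `A`-modules have right duals: composed with the
inverse braiding they form a natural family `N ⊗ Z ⟶ Z ⊗ N` which is multiplicative in `N`. -/
lemma Compat.isIso_galois [IsIso 𝒮[A]] {U : UnivCoact A Z}
    (hU : U.Compat μ[Z] η[Z] Δ[Z] ε[Z]) (N : RightMod A) : IsIso (U.galois N) := by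
  obtain ⟨R, ⟨_⟩⟩ := exists_exactPairing_right N
  have h : IsIso (U.galois N ≫ (β_ Z N.X).inv) := by
    refine isIso_of_exactPairing_right (R := R) (fun N => U.galois N ≫ (β_ Z N.X).inv)
      (fun f => ?_) (fun M N => ?_) ?_
    · rw [← Category.assoc, U.galois_natural, Category.assoc, Category.assoc,
        braiding_inv_naturality_left]
    · have h1 := hU.mul M N
      have h2 := MonObj.mul_assoc Z
      have h3 := braiding_inv_naturality_right N.X μ[Z]
      rw [braiding_tensor_left_inv] at h3
      change (U.coact (M ⊗ N) ▷ Z ≫ (α_ (M.X ⊗ N.X) Z Z).hom ≫ (M.X ⊗ N.X) ◁ μ[Z]) ≫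
        (β_ Z (M.X ⊗ N.X)).inv = _
      rw [h1, braiding_tensor_right_inv]
      dsimp only [galois, cent, slide]
      calc
        _ = 𝟙 ((M.X ⊗ N.X) ⊗ Z) ⊗≫ U.coact M ▷ N.X ▷ Z ⊗≫ M.X ◁ Z ◁ U.coact N ▷ Z ⊗≫
            M.X ◁ (β_ Z N.X).hom ▷ Z ▷ Z ⊗≫ M.X ◁ N.X ◁ (μ[Z] ▷ Z ≫ μ[Z]) ⊗≫
            M.X ◁ (β_ Z N.X).inv ⊗≫ (β_ Z M.X).inv ▷ N.X ⊗≫ 𝟙 (Z ⊗ (M.X ⊗ N.X)) := by monoidal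
        _ = 𝟙 ((M.X ⊗ N.X) ⊗ Z) ⊗≫ U.coact M ▷ N.X ▷ Z ⊗≫ M.X ◁ Z ◁ U.coact N ▷ Z ⊗≫
            M.X ◁ (β_ Z N.X).hom ▷ Z ▷ Z ⊗≫ M.X ◁ N.X ◁ Z ◁ μ[Z] ⊗≫
            M.X ◁ (N.X ◁ μ[Z] ≫ (β_ Z N.X).inv) ⊗≫ (β_ Z M.X).inv ▷ N.X ⊗≫
              𝟙 (Z ⊗ (M.X ⊗ N.X)) := by rw [h2]; monoidal
        _ = 𝟙 ((M.X ⊗ N.X) ⊗ Z) ⊗≫ U.coact M ▷ N.X ▷ Z ⊗≫ M.X ◁ Z ◁ U.coact N ▷ Z ⊗≫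
            M.X ◁ ((β_ Z N.X).hom ▷ (Z ⊗ Z) ≫ (N.X ⊗ Z) ◁ μ[Z]) ⊗≫
            M.X ◁ (β_ Z N.X).inv ▷ Z ⊗≫ M.X ◁ Z ◁ (β_ Z N.X).inv ⊗≫ M.X ◁ μ[Z] ▷ N.X ⊗≫
            (β_ Z M.X).inv ▷ N.X ⊗≫ 𝟙 (Z ⊗ (M.X ⊗ N.X)) := by rw [h3]; monoidal
        _ = 𝟙 ((M.X ⊗ N.X) ⊗ Z) ⊗≫ U.coact M ▷ N.X ▷ Z ⊗≫ M.X ◁ Z ◁ U.coact N ▷ Z ⊗≫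
            M.X ◁ Z ◁ N.X ◁ μ[Z] ⊗≫ M.X ◁ ((β_ Z N.X).hom ≫ (β_ Z N.X).inv) ▷ Z ⊗≫
            M.X ◁ Z ◁ (β_ Z N.X).inv ⊗≫ M.X ◁ μ[Z] ▷ N.X ⊗≫
            (β_ Z M.X).inv ▷ N.X ⊗≫ 𝟙 (Z ⊗ (M.X ⊗ N.X)) := by
          rw [← whisker_exchange]; monoidal
        _ = 𝟙 ((M.X ⊗ N.X) ⊗ Z) ⊗≫ (U.coact M ▷ (N.X ⊗ Z) ≫
            (M.X ⊗ Z) ◁ (U.coact N ▷ Z ≫ (α_ N.X Z Z).hom ≫ N.X ◁ μ[Z] ≫ (β_ Z N.X).inv)) ⊗≫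
            M.X ◁ μ[Z] ▷ N.X ⊗≫ (β_ Z M.X).inv ▷ N.X ⊗≫ 𝟙 (Z ⊗ (M.X ⊗ N.X)) := by
          rw [Iso.hom_inv_id]; monoidal
        _ = _ := by rw [← whisker_exchange]; monoidal
    · have h1 := hU.one
      have h2 := MonObj.one_mul Z
      change (U.coact (𝟙_ (RightMod A)) ▷ Z ≫ (α_ (𝟙_ B) Z Z).hom ≫ 𝟙_ B ◁ μ[Z]) ≫
        (β_ Z (𝟙_ B)).inv = _
      rw [h1]
      calc
        _ = 𝟙 (𝟙_ B ⊗ Z) ⊗≫ η[Z] ▷ Z ≫ μ[Z] ≫ (λ_ Z).inv ≫ (β_ Z (𝟙_ B)).inv := by monoidal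
        _ = _ := by
          rw [reassoc_of% h2]
          simp [monoidalComp]
  have h2 : U.galois N = (U.galois N ≫ (β_ Z N.X).inv) ≫ (β_ Z N.X).hom := by simp
  rw [h2]
  infer_instance

/-- The antipode `S` is determined by `n₀ ⊗ S(n₁) = G⁻¹(n ⊗ 1)`, where `G` is the Galois morphism
`n ⊗ z ↦ n₀ ⊗ n₁ z`. -/
lemma Compat.exists_antipode [IsIso 𝒮[A]] {U : UnivCoact A Z}
    (hU : U.Compat μ[Z] η[Z] Δ[Z] ε[Z]) :
    ∃ S : Z ⟶ Z, Δ[Z] ≫ S ▷ Z ≫ μ[Z] = ε[Z] ≫ η[Z] ∧ Δ[Z] ≫ Z ◁ S ≫ μ[Z] = ε[Z] ≫ η[Z] := by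
  have hi := hU.isIso_galois
  have hnat : ∀ {M N : RightMod A} (f : M ⟶ N),
      f.hom ▷ Z ≫ inv (U.galois N) = inv (U.galois M) ≫ f.hom ▷ Z := fun {M N} f => by
    rw [IsIso.comp_inv_eq, Category.assoc, U.galois_natural, IsIso.inv_hom_id_assoc]
  obtain ⟨S, hS⟩ := U.exists_lift_coact
    (fun N => (ρ_ N.X).inv ≫ N.X ◁ η[Z] ≫ inv (U.galois N)) (fun {M N} f => by
      simp only [Category.assoc]
      rw [← hnat, whisker_exchange_assoc]
      simp)
  -- The inverse of the Galois morphism is linear, hence determined by its value on the unit.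
  have hlin : ∀ N : RightMod A, (U.coact N ≫ N.X ◁ S) ▷ Z ≫ (α_ N.X Z Z).hom ≫ N.X ◁ μ[Z] =
      inv (U.galois N) := fun N => by
    have h1 : N.X ◁ μ[Z] ≫ inv (U.galois N) = (α_ N.X Z Z).inv ≫ inv (U.galois N) ▷ Z ≫
        (α_ N.X Z Z).hom ≫ N.X ◁ μ[Z] := by
      have h2 := MonObj.mul_assoc Z
      have h3 : U.galois N ▷ Z ≫ (α_ N.X Z Z).hom ≫ N.X ◁ μ[Z] =
          (α_ N.X Z Z).hom ≫ N.X ◁ μ[Z] ≫ U.galois N := by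
        dsimp only [galois]
        calc
          _ = U.coact N ▷ Z ▷ Z ⊗≫ N.X ◁ (μ[Z] ▷ Z ≫ μ[Z]) := by monoidal
          _ = (α_ N.X Z Z).hom ≫ (U.coact N ▷ (Z ⊗ Z) ≫ (N.X ⊗ Z) ◁ μ[Z]) ⊗≫ N.X ◁ μ[Z] := by
            rw [h2]; monoidal
          _ = _ := by rw [← whisker_exchange]; monoidal
      rw [IsIso.comp_inv_eq, ← cancel_epi (α_ N.X Z Z).hom]
      simp only [Category.assoc]
      rw [← h3, Iso.hom_inv_id_assoc, ← comp_whiskerRight_assoc]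
      simp
    have h4 := MonObj.one_mul Z
    rw [hS]
    calc
      _ = ((ρ_ N.X).inv ≫ N.X ◁ η[Z]) ▷ Z ≫ (α_ N.X Z Z).hom ≫ ((α_ N.X Z Z).inv ≫
          inv (U.galois N) ▷ Z ≫ (α_ N.X Z Z).hom ≫ N.X ◁ μ[Z]) := by simp
      _ = (ρ_ N.X).inv ▷ Z ⊗≫ N.X ◁ (η[Z] ▷ Z ≫ μ[Z]) ≫ inv (U.galois N) := by
        rw [← h1]; monoidal
      _ = _ := by rw [h4]; monoidal
  have hone : ∀ N : RightMod A, (ρ_ N.X).inv ≫ N.X ◁ η[Z] ≫ U.galois N = U.coact N := fun N => by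
    have h4 := MonObj.mul_one Z
    dsimp only [galois]
    rw [whisker_exchange_assoc]
    calc
      _ = U.coact N ⊗≫ N.X ◁ (Z ◁ η[Z] ≫ μ[Z]) := by monoidal
      _ = _ := by rw [h4]; monoidal
  refine ⟨S, U.jointlyEpic.hom_ext fun N => ?_, U.jointlyEpic.hom_ext fun N => ?_⟩
  · have h1 := hU.comul N
    have h2 := hU.counit N
    calc
      _ = (U.coact N ≫ N.X ◁ Δ[Z]) ≫ N.X ◁ S ▷ Z ≫ N.X ◁ μ[Z] := by simp
      _ = U.coact N ≫ (U.coact N ≫ N.X ◁ S) ▷ Z ≫ (α_ N.X Z Z).hom ≫ N.X ◁ μ[Z] := by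
        rw [h1]; simp
      _ = (ρ_ N.X).inv ≫ N.X ◁ η[Z] := by
        rw [hlin, IsIso.comp_inv_eq, Category.assoc, hone]
      _ = _ := by rw [← h2]; simp
  · have h1 := hU.comul N
    have h2 := hU.counit N
    calc
      _ = (U.coact N ≫ N.X ◁ Δ[Z]) ≫ N.X ◁ Z ◁ S ≫ N.X ◁ μ[Z] := by simp
      _ = U.coact N ≫ (U.coact N ▷ Z ≫ (N.X ⊗ Z) ◁ S) ≫ (α_ N.X Z Z).hom ≫ N.X ◁ μ[Z] := by
        rw [h1]; simp
      _ = (U.coact N ≫ N.X ◁ S) ≫ U.galois N := by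
        rw [← whisker_exchange, galois]; simp
      _ = (ρ_ N.X).inv ≫ N.X ◁ η[Z] := by
        rw [hS]; simp
      _ = _ := by rw [← h2]; simp

end UnivCoact

end Antipode

/-! ### The skew antipode of a universal coaction -/

section SkewAntipode

variable {B : Type u} [Category.{v} B] [MonoidalCategory B] [BraidedCategory B]
  {A : B} {Z : B} [BimonObj Z]

namespace UnivCoact

/-- The half braiding of the regular module of `Z` is linear for left multiplication. -/
lemma halfBraid_regular_linear [BimonObj A] (U : UnivCoact A Z) (N : RightMod A) :
    μ[Z] ▷ N.X ≫ U.halfBraid (RightMod.regular Z) N =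
      (α_ Z Z N.X).hom ≫ slide Z (U.halfBraid (RightMod.regular Z) N) ≫ N.X ◁ μ[Z] := by
  have h1 := slide_comp_whiskerLeft Z (U.cent Z N) μ[Z]
  have h2 := MonObj.mul_assoc Z
  have h3 := slide_tensor Z Z (U.coact N)
  have h4 := slide_natural μ[Z] (U.coact N)
  change μ[Z] ▷ N.X ≫ U.cent Z N ≫ N.X ◁ μ[Z] =
    (α_ Z Z N.X).hom ≫ slide Z (U.cent Z N ≫ N.X ◁ μ[Z]) ≫ N.X ◁ μ[Z]
  rw [h1]
  dsimp only [cent]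
  rw [reassoc_of% h4, h3, ← whiskerLeft_comp, h2]
  simp

/-- The half braiding of the regular module of `Z` restricts, on the unit, to the coaction. -/
lemma one_halfBraid_regular [BimonObj A] (U : UnivCoact A Z) (N : RightMod A) :
    (λ_ N.X).inv ≫ η[Z] ▷ N.X ≫ U.halfBraid (RightMod.regular Z) N = U.coact N := by
  have h1 := U.cent_natural_left η[Z] N
  have h2 := MonObj.one_mul Z
  have h3 := slide_unit (U.coact N)
  change (λ_ N.X).inv ≫ η[Z] ▷ N.X ≫ U.cent Z N ≫ N.X ◁ μ[Z] = U.coact N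
  rw [reassoc_of% h1, ← whiskerLeft_comp, h2, cent, h3]
  simp

variable [HopfObj A] [RigidCategory B]

/-- The inverse half braidings of the regular module of `Z` define an antipode for the product
composed with the inverse braiding. -/
lemma Compat.exists_skewAntipode {U : UnivCoact A Z} (hU : U.Compat μ[Z] η[Z] Δ[Z] ε[Z]) :
    ∃ S : Z ⟶ Z, Δ[Z] ≫ (β_ Z Z).inv ≫ Z ◁ S ≫ μ[Z] = ε[Z] ≫ η[Z] := by
  obtain ⟨σ, hσ⟩ : ∃ σ : ∀ N : RightMod A, Z ⊗ N.X ⟶ N.X ⊗ Z,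
      σ = U.halfBraid (RightMod.regular Z) := ⟨_, rfl⟩
  have hi : ∀ N, IsIso (σ N) := fun N => by
    rw [hσ]
    exact hU.isIso_halfBraid (RightMod.regular Z) N
  have hnat : ∀ {M N : RightMod A} (f : M ⟶ N),
      f.hom ▷ Z ≫ inv (σ N) = inv (σ M) ≫ Z ◁ f.hom := fun {M N} f => by
    have h : Z ◁ f.hom ≫ σ N = σ M ≫ f.hom ▷ Z := by
      rw [hσ]
      exact U.halfBraid_natural (RightMod.regular Z) f
    rw [IsIso.comp_inv_eq, Category.assoc, h, IsIso.inv_hom_id_assoc]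
  have hone : ∀ N : RightMod A, (λ_ N.X).inv ≫ η[Z] ▷ N.X ≫ σ N = U.coact N := fun N => by
    rw [hσ]
    exact U.one_halfBraid_regular N
  have hmul : ∀ N : RightMod A, ((α_ Z N.X Z).inv ≫ (β_ Z N.X).hom ▷ Z ≫ (α_ N.X Z Z).hom ≫
      N.X ◁ μ[Z]) ≫ inv (σ N) = Z ◁ inv (σ N) ≫ (α_ Z Z N.X).inv ≫ μ[Z] ▷ N.X := fun N => by
    have h : μ[Z] ▷ N.X ≫ σ N =
        (α_ Z Z N.X).hom ≫ slide Z (σ N) ≫ N.X ◁ μ[Z] := by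
      rw [hσ]
      exact U.halfBraid_regular_linear N
    rw [IsIso.comp_inv_eq]
    simp only [Category.assoc]
    rw [h, slide, Iso.inv_hom_id_assoc]
    simp only [Category.assoc]
    rw [← whiskerLeft_comp_assoc, IsIso.inv_hom_id]
    simp
  obtain ⟨S, hS⟩ := U.exists_lift_coact
    (fun N => (ρ_ N.X).inv ≫ N.X ◁ η[Z] ≫ inv (σ N) ≫ (β_ Z N.X).hom) (fun {M N} f => by
      simp only [Category.assoc]
      rw [← braiding_naturality_right, ← reassoc_of% hnat, whisker_exchange_assoc]
      simp)
  -- The inverse of the half braiding is linear, hence determined by its value on the unit.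
  have hlin : ∀ N : RightMod A, (U.coact N ≫ N.X ◁ S) ▷ Z ≫ (α_ N.X Z Z).hom ≫
      N.X ◁ ((β_ Z Z).inv ≫ μ[Z]) = inv (σ N) ≫ (β_ Z N.X).hom := fun N => by
    obtain ⟨t, ht⟩ : ∃ t, t = (ρ_ N.X).inv ≫ N.X ◁ η[Z] ≫ inv (σ N) := ⟨_, rfl⟩
    have h1 : inv (σ N) = (β_ Z N.X).inv ≫ Z ◁ t ≫ (α_ Z Z N.X).inv ≫ μ[Z] ▷ N.X := by
      have h2 := MonObj.mul_one Z
      rw [ht, whiskerLeft_comp, whiskerLeft_comp, Category.assoc, Category.assoc, ← hmul N]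
      simp only [← Category.assoc]
      rw [IsIso.eq_comp_inv, IsIso.inv_hom_id]
      calc
        𝟙 _ = ((β_ Z N.X).inv ≫ (β_ Z N.X).hom) ⊗≫ N.X ◁ (Z ◁ η[Z] ≫ μ[Z]) := by
          rw [h2, Iso.inv_hom_id]; monoidal
        _ = (β_ Z N.X).inv ⊗≫ ((β_ Z N.X).hom ▷ 𝟙_ B ≫ (N.X ⊗ Z) ◁ η[Z]) ⊗≫ N.X ◁ μ[Z] := by
          monoidal
        _ = _ := by rw [← whisker_exchange]; monoidal
    have h2 := braiding_inv_naturality_left t Z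
    have h3 := braiding_naturality_left μ[Z] N.X
    have h4 := braiding_naturality_left (β_ Z Z).inv N.X
    have h5 : U.coact N ≫ N.X ◁ S = t ≫ (β_ Z N.X).hom := by
      rw [hS, ht]; simp
    rw [braiding_tensor_right_inv] at h2
    rw [braiding_tensor_left_hom] at h3 h4
    rw [h5, h1, Category.assoc, Category.assoc, Category.assoc, h3, ← reassoc_of% h2]
    have h6 : Z ◁ (β_ Z N.X).inv ≫ Z ◁ (β_ Z N.X).hom = 𝟙 _ := by
      rw [← whiskerLeft_comp, Iso.inv_hom_id, whiskerLeft_id]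
    calc
      _ = t ▷ Z ⊗≫ (Z ◁ (β_ Z N.X).inv ≫ Z ◁ (β_ Z N.X).hom) ⊗≫ (β_ Z N.X).hom ▷ Z ⊗≫
          N.X ◁ (β_ Z Z).inv ≫ N.X ◁ μ[Z] := by
        rw [h6]; monoidal
      _ = t ▷ Z ⊗≫ Z ◁ (β_ Z N.X).inv ⊗≫ (((α_ Z Z N.X).hom ≫ Z ◁ (β_ Z N.X).hom ≫
          (α_ Z N.X Z).inv ≫ (β_ Z N.X).hom ▷ Z ≫ (α_ N.X Z Z).hom) ≫ N.X ◁ (β_ Z Z).inv) ≫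
          N.X ◁ μ[Z] := by monoidal
      _ = _ := by rw [← h4]; monoidal
  refine ⟨S, U.jointlyEpic.hom_ext fun N => ?_⟩
  have h1 := hU.comul N
  have h2 := hU.counit N
  have h3 := braiding_inv_naturality_left S Z
  calc
    _ = (U.coact N ≫ N.X ◁ Δ[Z]) ≫ N.X ◁ ((β_ Z Z).inv ≫ Z ◁ S) ≫ N.X ◁ μ[Z] := by simp
    _ = U.coact N ≫ (U.coact N ≫ N.X ◁ S) ▷ Z ≫ (α_ N.X Z Z).hom ≫
        N.X ◁ ((β_ Z Z).inv ≫ μ[Z]) := by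
      rw [h1, ← h3]; monoidal
    _ = (λ_ N.X).inv ≫ η[Z] ▷ N.X ≫ (β_ Z N.X).hom := by
      rw [hlin, ← hone]; simp
    _ = _ := by
      rw [whiskerLeft_comp, reassoc_of% h2, braiding_naturality_left]; simp

end UnivCoact

end SkewAntipode

/-! ### The centralizer as a universal coaction -/

section FreeModules

variable {B : Type u} [Category.{v} B] [MonoidalCategory B]

lemma freeUnit_natural (A : B) [MonObj A] {Y Y' : B} (f : Y ⟶ Y') :
    f ≫ freeUnit A Y' = freeUnit A Y ≫ f ▷ A := by
  dsimp only [freeUnit]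
  rw [rightUnitor_inv_naturality_assoc, ← whisker_exchange, Category.assoc]

lemma freeUnit_act {A : B} [MonObj A] (N : RightMod A) : freeUnit A N.X ≫ N.act = 𝟙 N.X := by
  rw [freeUnit, Category.assoc, N.act_one, Iso.inv_hom_id]

lemma freeUnit_whiskerRight_freeMul (A Y : B) [MonObj A] :
    freeUnit A Y ▷ A ≫ freeMul A Y = 𝟙 (Y ⊗ A) := by
  have h := MonObj.one_mul A
  dsimp only [freeUnit, freeMul]
  calc
    _ = 𝟙 _ ⊗≫ Y ◁ (η[A] ▷ A ≫ μ[A]) := by monoidal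
    _ = _ := by rw [h]; monoidal

end FreeModules

section Centralizer

variable {B : Type u} [Category.{v} B] [MonoidalCategory B] [RigidCategory B]
  {W : Cowedge (dualTensor B)}

/-- The action of a module, as a morphism out of a free module. -/
def RightMod.actHom {A : B} [MonObj A] (N : RightMod A) : RightMod.free A N.X ⟶ N where
  hom := N.act
  act_hom := by
    have h := N.act_act
    dsimp only [RightMod.free]
    rw [h, Category.assoc]

/-- The coaction `N ⟶ N ⊗ A ⊗ Z(A) ⟶ N ⊗ Z(A)` on the object underlying a right module. -/
def modCoact (W : Cowedge (dualTensor B)) {A : B} [MonObj A] (N : RightMod A) :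
    N.X ⟶ N.X ⊗ centralizerObj W A :=
  coactZ W A N.X ≫ N.act ▷ centralizerObj W A

/-- The coaction on a free module restricts along the unit to the defining coaction of the
centralizer, so that free modules suffice to determine morphisms out of it. -/
lemma freeUnit_coactZ_freeMul (W : Cowedge (dualTensor B)) (A Y : B) [MonObj A] :
    freeUnit A Y ≫ coactZ W A (Y ⊗ A) ≫ freeMul A Y ▷ centralizerObj W A = coactZ W A Y := by
  have h1 := coactZ_natural W A (freeUnit A Y)
  have h2 := freeUnit_whiskerRight_freeMul A Y
  rw [reassoc_of% h1, ← comp_whiskerRight, h2]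
  simp

variable [BraidedCategory B]

/-- The morphism of free modules induced by a morphism. -/
def RightMod.freeMap (A : B) [MonObj A] {Y Y' : B} (f : Y ⟶ Y') :
    RightMod.free A Y ⟶ RightMod.free A Y' where
  hom := f ▷ A
  act_hom := by
    have h := freeMul_natural A f
    exact h.symm

lemma slide_coactZ (W : Cowedge (dualTensor B)) (A X Y : B) :
    slide X (coactZ W A Y) = centralizing W A X Y := rfl

/-- The centralizer of `A` coacts universally on right `A`-modules. -/
def centralizerCoact (hW : IsColimit W) (A : B) [BimonObj A] :
    UnivCoact A (centralizerObj W A) where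
  coact N := modCoact W N
  natural {M N} f := by
    have h := f.act_hom
    dsimp only [modCoact]
    rw [← Category.assoc, coactZ_natural, Category.assoc, Category.assoc, ← comp_whiskerRight,
      ← comp_whiskerRight, h]
  jointlyEpic P V g h H := by
    -- Restrict the hypothesis for free modules along their units.
    refine z_param_hom_ext hW fun Y => ?_
    have h1 := freeUnit_coactZ_freeMul W A Y
    have h2 := congrArg (fun k => freeUnit A Y ▷ P ≫ k) (H (RightMod.free A Y))
    have h3 : ∀ k : centralizerObj W A ⊗ P ⟶ V, freeUnit A Y ▷ P ≫
        (coactZ W A (Y ⊗ A) ≫ freeMul A Y ▷ centralizerObj W A) ▷ P ≫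
          (α_ (Y ⊗ A) (centralizerObj W A) P).hom ≫ (Y ⊗ A) ◁ k =
        coactZ W A Y ▷ P ≫ (α_ (Y ⊗ A) (centralizerObj W A) P).hom ≫ (Y ⊗ A) ◁ k := fun k => by
      rw [← comp_whiskerRight_assoc, h1]
    exact (h3 g).symm.trans (h2.trans (h3 h))
  exists_lift {M V} k hk := by
    -- The lift is defined by free modules; every module is the image of a free one by its action.
    obtain ⟨κ, hκ⟩ : ∃ κ : ∀ Y : B, M ⊗ (Y ⊗ A) ⟶ (Y ⊗ A) ⊗ V,
        κ = fun Y => k (RightMod.free A Y) := ⟨_, rfl⟩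
    refine ⟨zLiftLeft hW A M V (fun Y => M ◁ freeUnit A Y ≫ κ Y) ?_, ?_⟩
    · intro Y Y' f
      have h1 := freeUnit_natural A f
      have h2 : M ◁ f ▷ A ≫ κ Y' = κ Y ≫ f ▷ A ▷ V := by
        rw [hκ]
        exact hk (RightMod.freeMap A f)
      rw [← whiskerLeft_comp_assoc, h1, whiskerLeft_comp_assoc, h2, Category.assoc]
    · intro N
      have h1 : M ◁ N.act ≫ k N = κ N.X ≫ N.act ▷ V := by
        rw [hκ]
        exact hk N.actHom
      have h2 := freeUnit_act N
      rw [modCoact, slide_comp_whiskerRight, Category.assoc, ← whisker_exchange, slide_coactZ,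
        ← Category.assoc, centralizing_zLiftLeft, Category.assoc, ← h1, ← whiskerLeft_comp_assoc,
        h2]
      simp

/-- The defining equation of the product of the centralizer, solved for the coaction on `X ⊗ Y`. -/
lemma coactZ_tensor (hW : IsColimit W) (A : B) [ComonObj A] (X Y : B) :
    coactZ W A (X ⊗ Y) ≫ freeComul A X Y ▷ centralizerObj W A =
      coactZ W A X ▷ Y ≫ (α_ (X ⊗ A) (centralizerObj W A) Y).hom ≫
        (X ⊗ A) ◁ (centralizing W A (centralizerObj W A) Y ≫ (Y ⊗ A) ◁ zMul hW A) ≫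
          (α_ (X ⊗ A) (Y ⊗ A) (centralizerObj W A)).inv := by
  have h1 := centralizing_zLiftLeft hW A (centralizerObj W A) (centralizerObj W A) _
    (zMul_natural hW A) Y
  have h2 := coactZ_zLiftParam hW A Y ((Y ⊗ A) ⊗ centralizerObj W A) _ (zMulAux_natural W A Y) X
  rw [zMul, h1]
  have h3 := congrArg (fun k => k ≫ (α_ (X ⊗ A) (Y ⊗ A) (centralizerObj W A)).inv) h2
  simp only [Category.assoc, Iso.hom_inv_id, Category.comp_id] at h3
  exact h3.symm

/-- The defining equations of the structure morphisms of the centralizer, pushed forward along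
the actions of modules, express the compatibility of the universal coaction with tensor products. -/
lemma centralizerCoact_compat (hW : IsColimit W) (A : B) [BimonObj A] :
    (centralizerCoact hW A).Compat (zMul hW A) (zUnit W A) (zComul hW A) (zCounit hW A) where
  mul M N := by
    have h := coactZ_tensor hW A M.X N.X
    have h1 : (M ⊗ N).act = freeComul A M.X N.X ≫ (M.act ⊗ₘ N.act) :=
      (Category.assoc _ _ _).symm
    change coactZ W A (M.X ⊗ N.X) ≫ (M ⊗ N).act ▷ centralizerObj W A =
      modCoact W M ▷ N.X ≫ (α_ M.X (centralizerObj W A) N.X).hom ≫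
        M.X ◁ (slide (centralizerObj W A) (modCoact W N) ≫ N.X ◁ zMul hW A) ≫
          (α_ M.X N.X (centralizerObj W A)).inv
    refine (congrArg (fun k : (M.X ⊗ N.X) ⊗ A ⟶ M.X ⊗ N.X =>
      coactZ W A (M.X ⊗ N.X) ≫ k ▷ centralizerObj W A) h1).trans ?_
    rw [comp_whiskerRight, reassoc_of% h, modCoact, modCoact, slide_comp_whiskerRight, slide_coactZ,
      MonoidalCategory.tensorHom_def']
    calc
      _ = coactZ W A M.X ▷ N.X ⊗≫ ((M.X ⊗ A) ◁ (centralizing W A (centralizerObj W A) N.X ≫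
          (N.X ⊗ A) ◁ zMul hW A ≫ N.act ▷ centralizerObj W A) ≫
            M.act ▷ (N.X ⊗ centralizerObj W A)) ⊗≫ 𝟙 _ := by monoidal
      _ = _ := by
        rw [whisker_exchange, whisker_exchange]; monoidal
  one := by
    change coactZ W A (𝟙_ B) ≫ (𝟙_ B ◁ ε[A] ≫ (ρ_ (𝟙_ B)).hom) ▷ centralizerObj W A =
      (coactZ W A (𝟙_ B) ≫ freeCounit A ▷ centralizerObj W A ≫
        (λ_ (centralizerObj W A)).hom) ≫ (λ_ (centralizerObj W A)).inv
    simp only [Category.assoc, Iso.hom_inv_id, Category.comp_id]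
    congr 2
    rw [freeCounit]
    monoidal
  comul N := by
    have h := coactZ_zLift hW A _ _ (zComul_natural W A) N.X
    have h1 : freeMul A N.X ≫ N.act = N.act ▷ A ≫ N.act := by
      rw [N.act_act, freeMul, Category.assoc]
    have h2 := coactZ_natural W A N.act
    change (coactZ W A N.X ≫ N.act ▷ centralizerObj W A) ≫ N.X ◁ zComul hW A =
      modCoact W N ≫ modCoact W N ▷ centralizerObj W A ≫ (α_ _ _ _).hom
    rw [Category.assoc, ← whisker_exchange, zComul, ← Category.assoc, h]
    dsimp only [modCoact]
    calc
      _ = coactZ W A N.X ≫ (coactZ W A (N.X ⊗ A) ≫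
          (freeMul A N.X ≫ N.act) ▷ centralizerObj W A) ▷ centralizerObj W A ≫ (α_ _ _ _).hom := by
        simp
      _ = coactZ W A N.X ≫ ((coactZ W A (N.X ⊗ A) ≫ N.act ▷ A ▷ centralizerObj W A) ≫
          N.act ▷ centralizerObj W A) ▷ centralizerObj W A ≫ (α_ _ _ _).hom := by
        rw [h1, comp_whiskerRight (N.act ▷ A), Category.assoc]
      _ = _ := by
        rw [← h2]; simp
  counit N := by
    have h := coactZ_zLift hW A _ _ (zCounit_natural A) N.X
    have h1 := freeUnit_act N
    change (coactZ W A N.X ≫ N.act ▷ centralizerObj W A) ≫ N.X ◁ zCounit hW A = _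
    rw [Category.assoc, ← whisker_exchange, zCounit, ← Category.assoc, h, Category.assoc,
      ← rightUnitor_inv_naturality, reassoc_of% h1]

/-- The defining equation of the canonical law, pushed forward along the action of a module. -/
lemma centralizerCoact_isLaw (hW : IsColimit W) (A : B) [HopfObj A] [IsIso 𝒮[A]] :
    (centralizerCoact hW A).IsLaw (canonicalLaw hW A) (inv 𝒮[A]) := fun N => by
  have h1 := coactZ_zLiftParam hW A A (A ⊗ centralizerObj W A) _ (canonicalLaw_natural W A) N.X
  have h2 : freeMul A N.X ≫ N.act = N.act ▷ A ≫ N.act := by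
    rw [N.act_act, freeMul, Category.assoc]
  have h3 : antipodeAct A N.X ≫ N.act = A ◁ N.act ≫ inv 𝒮[A] ▷ N.X ≫ N.opAct := by
    rw [antipodeAct, Category.assoc, Category.assoc, h2, ← braiding_inv_naturality_right_assoc,
      ← whisker_exchange_assoc, RightMod.opAct]
  have h4 : lawAux W A N.X ≫ N.act ▷ (A ⊗ centralizerObj W A) = splitAct A N.X ≫ A ◁ N.act ≫
      centralizing W A A N.X ≫ N.act ▷ (A ⊗ centralizerObj W A) := by
    have h5 := centralizing_natural W A A N.act
    rw [lawAux, Category.assoc, Category.assoc, ← comp_whiskerRight, h2, reassoc_of% h5,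
      comp_whiskerRight]
  have h5 : (centralizerCoact hW A).cent A N =
      centralizing W A A N.X ≫ N.act ▷ (A ⊗ centralizerObj W A) :=
    slide_comp_whiskerRight A (coactZ W A N.X) N.act
  rw [h5, ← h4]
  change modCoact W N ▷ A ≫ _ = _
  calc
    _ = coactZ W A N.X ▷ A ⊗≫ (N.act ▷ (centralizerObj W A ⊗ A) ≫ N.X ◁ canonicalLaw hW A) := by
      rw [modCoact]; monoidal
    _ = (coactZ W A N.X ▷ A ≫ (α_ (N.X ⊗ A) (centralizerObj W A) A).hom ≫
        (N.X ⊗ A) ◁ canonicalLaw hW A) ≫ N.act ▷ (A ⊗ centralizerObj W A) := by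
      rw [← whisker_exchange]; monoidal
    _ = splitAct A N.X ⊗≫ A ◁ lawAux W A N.X ⊗≫
        (antipodeAct A N.X ≫ N.act) ▷ (A ⊗ centralizerObj W A) := by
      rw [canonicalLaw, h1]; monoidal
    _ = _ := by
      rw [h3, RightMod.twist]; monoidal

/-- The linearity of the centralizing morphisms, for free modules and restricted along their
units, is the canonicity of the law. -/
lemma UnivCoact.IsLaw.isCanonicalLaw {A : B} [BimonObj A] {hW : IsColimit W} {T : A ⟶ A}
    {ω : centralizerObj W A ⊗ A ⟶ A ⊗ centralizerObj W A}
    (hω : (centralizerCoact hW A).IsLaw ω T) (hT : IsSkewAntipode A T) :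
    IsCanonicalLaw W A ω := fun X Y => by
  have h := congrArg (fun k => (freeUnit A X ⊗ₘ freeUnit A Y) ▷ A ≫ k)
    (hω.cent_linear hT (RightMod.free A X) (RightMod.free A Y))
  have h1 : (RightMod.free A X ⊗ RightMod.free A Y).act =
      freeComul A (X ⊗ A) (Y ⊗ A) ≫ (freeMul A X ⊗ₘ freeMul A Y) :=
    (Category.assoc _ _ _).symm
  have h2 : (RightMod.free A Y).diagAct (lawAct ω (RightMod.free A X)) =
      freeComul A (Y ⊗ A) ((X ⊗ A) ⊗ centralizerObj W A) ≫ (freeMul A Y ⊗ₘ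
        ((α_ (X ⊗ A) (centralizerObj W A) A).hom ≫ (X ⊗ A) ◁ ω ≫
          (α_ (X ⊗ A) A (centralizerObj W A)).inv ≫ freeMul A X ▷ centralizerObj W A)) :=
    (Category.assoc _ _ _).symm
  have h3 : (centralizerCoact hW A).cent (X ⊗ A) (RightMod.free A Y) =
      centralizing W A (X ⊗ A) (Y ⊗ A) ≫ freeMul A Y ▷ ((X ⊗ A) ⊗ centralizerObj W A) :=
    slide_comp_whiskerRight _ _ _
  have h4 : (freeUnit A X ⊗ₘ freeUnit A Y) ≫ centralizing W A (X ⊗ A) (Y ⊗ A) ≫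
      freeMul A Y ▷ ((X ⊗ A) ⊗ centralizerObj W A) =
      centralizing W A X Y ≫ (Y ⊗ A) ◁ freeUnit A X ▷ centralizerObj W A := by
    have h5 := centralizing_natural W A X (freeUnit A Y)
    have h6 := slide_natural (freeUnit A X) (coactZ W A (Y ⊗ A))
    have h7 := freeUnit_whiskerRight_freeMul A Y
    rw [slide_coactZ, slide_coactZ] at h6
    rw [MonoidalCategory.tensorHom_def', Category.assoc, reassoc_of% h6, reassoc_of% h5,
      whisker_exchange, ← comp_whiskerRight_assoc, h7]
    simp
  have h8 := freeComul_natural A (freeUnit A X) (freeUnit A Y)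
  have h9 := freeComul_natural A (𝟙 (Y ⊗ A)) (freeUnit A X ▷ centralizerObj W A)
  have h10 := freeUnit_whiskerRight_freeMul A X
  have h11 := freeUnit_whiskerRight_freeMul A Y
  rw [id_tensorHom, id_whiskerRight] at h9
  have h12 : (freeUnit A X ⊗ₘ freeUnit A Y) ▷ A ≫ (freeComul A (X ⊗ A) (Y ⊗ A) ≫
      (freeMul A X ⊗ₘ freeMul A Y)) ≫ centralizing W A (X ⊗ A) (Y ⊗ A) ≫
        freeMul A Y ▷ ((X ⊗ A) ⊗ centralizerObj W A) =
      (freeUnit A X ⊗ₘ freeUnit A Y) ▷ A ≫ (centralizing W A (X ⊗ A) (Y ⊗ A) ≫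
        freeMul A Y ▷ ((X ⊗ A) ⊗ centralizerObj W A)) ▷ A ≫
        freeComul A (Y ⊗ A) ((X ⊗ A) ⊗ centralizerObj W A) ≫ (freeMul A Y ⊗ₘ
        ((α_ (X ⊗ A) (centralizerObj W A) A).hom ≫ (X ⊗ A) ◁ ω ≫
          (α_ (X ⊗ A) A (centralizerObj W A)).inv ≫ freeMul A X ▷ centralizerObj W A)) := by
    rw [← h1, ← h2, ← h3]
    exact h
  rw [Category.assoc, reassoc_of% h8, tensorHom_comp_tensorHom_assoc, h10, h11,
    id_tensorHom_id, Category.id_comp, ← comp_whiskerRight_assoc, h4, comp_whiskerRight_assoc,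
    reassoc_of% h9, tensorHom_comp_tensorHom, Category.id_comp] at h12
  rw [h12]
  congr 3
  calc
    _ = (α_ X (centralizerObj W A) A).hom ≫ X ◁ ω ≫ (α_ X A (centralizerObj W A)).inv ≫
        𝟙 (X ⊗ A) ▷ centralizerObj W A := by simp
    _ = 𝟙 _ ⊗≫ (X ◁ ω ≫ freeUnit A X ▷ (A ⊗ centralizerObj W A)) ⊗≫
        freeMul A X ▷ centralizerObj W A := by
      rw [← h10]; monoidal
    _ = _ := by
      rw [whisker_exchange]; monoidal

end Centralizer

/-! ### Products of bialgebras along a distributive law -/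

section Distrib

variable {B : Type u} [Category.{v} B] [MonoidalCategory B] [BraidedCategory B]

section ComonHom

variable {X Y : B} [ComonObj X] [ComonObj Y]

instance isComonHom_whiskerRight (f : X ⟶ Y) [IsComonHom f] (Z : B) [ComonObj Z] :
    IsComonHom (f ▷ Z) :=
  inferInstanceAs (IsComonHom ((Comon.Hom.mk f : Comon.mk X ⟶ Comon.mk Y) ▷ Comon.mk Z).hom)

instance isComonHom_whiskerLeft (f : X ⟶ Y) [IsComonHom f] (Z : B) [ComonObj Z] :
    IsComonHom (Z ◁ f) :=
  inferInstanceAs (IsComonHom (Comon.mk Z ◁ (Comon.Hom.mk f : Comon.mk X ⟶ Comon.mk Y)).hom)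

instance isComonHom_associator (X Y Z : B) [ComonObj X] [ComonObj Y] [ComonObj Z] :
    IsComonHom (α_ X Y Z).hom := by
  have h : IsComonHom (α_ (Comon.mk X) (Comon.mk Y) (Comon.mk Z)).hom.hom := inferInstance
  rw [Comon.monoidal_associator_hom_hom] at h
  change IsComonHom (𝟙 (X ⊗ Y) ▷ Z ≫ (α_ X Y Z).hom ≫ X ◁ 𝟙 (Y ⊗ Z)) at h
  rwa [id_whiskerRight, whiskerLeft_id, Category.id_comp, Category.comp_id] at h

instance isComonHom_tensorHom {X' Y' : B} [ComonObj X'] [ComonObj Y'] (f : X ⟶ Y) (g : X' ⟶ Y')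
    [IsComonHom f] [IsComonHom g] : IsComonHom (f ⊗ₘ g) := by
  rw [MonoidalCategory.tensorHom_def]
  infer_instance

instance isComonHom_mul (P : B) [BimonObj P] : IsComonHom μ[P] where
  hom_counit := BimonObj.mul_counit P
  hom_comul := by
    have h := BimonObj.mul_comul P
    rw [h, Comon.tensorObj_comul, Category.assoc]

end ComonHom

variable {P Q : B} [BimonObj P] [BimonObj Q] {ω : Q ⊗ P ⟶ P ⊗ Q}

namespace IsComulDistribLaw

lemma isComonHom (h : IsComulDistribLaw P Q ω) : IsComonHom ω where
  hom_counit := by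
    have h1 := h.counit
    rw [Comon.tensorObj_counit, Comon.tensorObj_counit, reassoc_of% h1]
  hom_comul := by
    have h1 := h.comul
    rw [Comon.tensorObj_comul, Comon.tensorObj_comul, h1, Category.assoc]

lemma isComonHom_distribMul (h : IsComulDistribLaw P Q ω) : IsComonHom (distribMul P Q ω) := by
  have := h.isComonHom
  dsimp only [distribMul]
  infer_instance

/-- The unit law of the product twisted by a distributive law. -/
lemma one_mul (h : IsComulDistribLaw P Q ω) :
    distribOne P Q ▷ (P ⊗ Q) ≫ distribMul P Q ω = (λ_ (P ⊗ Q)).hom := by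
  have h1 := h.one_left
  have h2 := MonObj.one_mul P
  have h3 := MonObj.one_mul Q
  dsimp only [distribMul, distribOne]
  rw [MonoidalCategory.tensorHom_def η[P] η[Q], MonoidalCategory.tensorHom_def μ[P] μ[Q]]
  calc
    _ = 𝟙 (𝟙_ B ⊗ P ⊗ Q) ⊗≫ η[P] ▷ P ▷ Q ⊗≫ P ◁ (η[Q] ▷ P ≫ ω) ▷ Q ⊗≫ μ[P] ▷ (Q ⊗ Q) ⊗≫
        P ◁ μ[Q] := by monoidal
    _ = 𝟙 (𝟙_ B ⊗ P ⊗ Q) ⊗≫ η[P] ▷ P ▷ Q ⊗≫ ((P ⊗ P) ◁ (η[Q] ▷ Q) ≫ μ[P] ▷ (Q ⊗ Q)) ⊗≫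
        P ◁ μ[Q] := by rw [h1]; monoidal
    _ = 𝟙 (𝟙_ B ⊗ P ⊗ Q) ⊗≫ (η[P] ▷ P ≫ μ[P]) ▷ Q ⊗≫ P ◁ (η[Q] ▷ Q ≫ μ[Q]) := by
      rw [whisker_exchange]; monoidal
    _ = _ := by rw [h2, h3]; monoidal

lemma mul_one (h : IsComulDistribLaw P Q ω) :
    (P ⊗ Q) ◁ distribOne P Q ≫ distribMul P Q ω = (ρ_ (P ⊗ Q)).hom := by
  have h1 := h.one_right
  have h2 := MonObj.mul_one P
  have h3 := MonObj.mul_one Q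
  dsimp only [distribMul, distribOne]
  rw [MonoidalCategory.tensorHom_def' η[P] η[Q], MonoidalCategory.tensorHom_def' μ[P] μ[Q]]
  calc
    _ = 𝟙 ((P ⊗ Q) ⊗ 𝟙_ B) ⊗≫ P ◁ Q ◁ η[Q] ⊗≫ P ◁ (Q ◁ η[P] ≫ ω) ▷ Q ⊗≫ (P ⊗ P) ◁ μ[Q] ⊗≫
        μ[P] ▷ Q := by monoidal
    _ = 𝟙 ((P ⊗ Q) ⊗ 𝟙_ B) ⊗≫ P ◁ Q ◁ η[Q] ⊗≫ (P ◁ η[P] ▷ (Q ⊗ Q) ≫ P ◁ P ◁ μ[Q]) ⊗≫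
        μ[P] ▷ Q := by rw [h1]; monoidal
    _ = 𝟙 ((P ⊗ Q) ⊗ 𝟙_ B) ⊗≫ P ◁ (Q ◁ η[Q] ≫ μ[Q]) ⊗≫ (P ◁ η[P] ≫ μ[P]) ▷ Q := by
      rw [← whiskerLeft_comp, ← whisker_exchange]; monoidal
    _ = _ := by rw [h2, h3]; monoidal

lemma mul_assoc (h : IsComulDistribLaw P Q ω) :
    distribMul P Q ω ▷ (P ⊗ Q) ≫ distribMul P Q ω =
      (α_ (P ⊗ Q) (P ⊗ Q) (P ⊗ Q)).hom ≫ (P ⊗ Q) ◁ distribMul P Q ω ≫ distribMul P Q ω := by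
  have h1 := h.mul_left
  have h2 := h.mul_right
  have h3 := MonObj.mul_assoc P
  have h4 := MonObj.mul_assoc Q
  dsimp only [distribMul]
  -- Both sides apply `ω` three times and then multiply all factors.
  obtain ⟨k, hk⟩ : ∃ k : (Q ⊗ Q) ⊗ P ⊗ Q ⟶ P ⊗ ((Q ⊗ Q) ⊗ Q),
    k = 𝟙 _ ⊗≫ Q ◁ ω ▷ Q ⊗≫ ω ▷ Q ▷ Q ⊗≫ 𝟙 _ := ⟨_, rfl⟩
  obtain ⟨l, hl⟩ : ∃ l : Q ⊗ (P ⊗ P) ⟶ (P ⊗ P) ⊗ Q,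
    l = 𝟙 _ ⊗≫ ω ▷ P ⊗≫ P ◁ ω ⊗≫ 𝟙 _ := ⟨_, rfl⟩
  calc
    _ = 𝟙 (((P ⊗ Q) ⊗ (P ⊗ Q)) ⊗ (P ⊗ Q)) ⊗≫ P ◁ ω ▷ Q ▷ P ▷ Q ⊗≫
        μ[P] ▷ (Q ⊗ Q) ▷ P ▷ Q ⊗≫ P ◁ (μ[Q] ▷ P ≫ ω) ▷ Q ⊗≫ μ[P] ▷ (Q ⊗ Q) ⊗≫ P ◁ μ[Q] := by
      rw [MonoidalCategory.tensorHom_def μ[P] μ[Q]]; monoidal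
    _ = 𝟙 (((P ⊗ Q) ⊗ (P ⊗ Q)) ⊗ (P ⊗ Q)) ⊗≫ P ◁ ω ▷ Q ▷ P ▷ Q ⊗≫
        (μ[P] ▷ ((Q ⊗ Q) ⊗ P ⊗ Q) ≫ P ◁ k) ⊗≫ ((P ⊗ P) ◁ (μ[Q] ▷ Q) ≫ μ[P] ▷ (Q ⊗ Q)) ⊗≫
          P ◁ μ[Q] := by
      rw [h1, hk]; monoidal
    _ = 𝟙 (((P ⊗ Q) ⊗ (P ⊗ Q)) ⊗ (P ⊗ Q)) ⊗≫ P ◁ ω ▷ Q ▷ P ▷ Q ⊗≫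
        (P ⊗ P) ◁ k ⊗≫ (μ[P] ▷ P ≫ μ[P]) ▷ ((Q ⊗ Q) ⊗ Q) ⊗≫ P ◁ (μ[Q] ▷ Q ≫ μ[Q]) := by
      rw [← whisker_exchange μ[P] k, whisker_exchange μ[P] (μ[Q] ▷ Q)]; monoidal
    _ = 𝟙 (((P ⊗ Q) ⊗ (P ⊗ Q)) ⊗ (P ⊗ Q)) ⊗≫ P ◁ ω ▷ Q ▷ P ▷ Q ⊗≫
        (P ⊗ P) ◁ k ⊗≫ (P ◁ μ[P] ≫ μ[P]) ▷ (Q ⊗ (Q ⊗ Q)) ⊗≫ P ◁ (Q ◁ μ[Q] ≫ μ[Q]) := by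
      rw [h3, h4]; monoidal
    _ = 𝟙 (((P ⊗ Q) ⊗ (P ⊗ Q)) ⊗ (P ⊗ Q)) ⊗≫ P ◁ (ω ▷ (Q ⊗ P) ≫ (P ⊗ Q) ◁ ω) ▷ Q ⊗≫
        P ◁ P ◁ ω ▷ Q ▷ Q ⊗≫ P ◁ μ[P] ▷ (Q ⊗ (Q ⊗ Q)) ⊗≫
          (μ[P] ▷ (Q ⊗ (Q ⊗ Q)) ≫ P ◁ (Q ◁ μ[Q])) ⊗≫ P ◁ μ[Q] := by
      rw [hk]; monoidal
    _ = 𝟙 (((P ⊗ Q) ⊗ (P ⊗ Q)) ⊗ (P ⊗ Q)) ⊗≫ P ◁ (Q ⊗ P) ◁ ω ▷ Q ⊗≫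
        P ◁ (l ▷ (Q ⊗ Q)) ⊗≫ P ◁ μ[P] ▷ (Q ⊗ (Q ⊗ Q)) ⊗≫ (P ⊗ P) ◁ (Q ◁ μ[Q]) ⊗≫
          μ[P] ▷ (Q ⊗ Q) ⊗≫ P ◁ μ[Q] := by
      rw [← whisker_exchange ω ω, ← whisker_exchange μ[P] (Q ◁ μ[Q]), hl]; monoidal
    _ = 𝟙 (((P ⊗ Q) ⊗ (P ⊗ Q)) ⊗ (P ⊗ Q)) ⊗≫ P ◁ (Q ⊗ P) ◁ ω ▷ Q ⊗≫
        P ◁ (l ▷ (Q ⊗ Q)) ⊗≫ P ◁ (μ[P] ▷ (Q ⊗ (Q ⊗ Q)) ≫ P ◁ (Q ◁ μ[Q])) ⊗≫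
          μ[P] ▷ (Q ⊗ Q) ⊗≫ P ◁ μ[Q] := by
      monoidal
    _ = 𝟙 (((P ⊗ Q) ⊗ (P ⊗ Q)) ⊗ (P ⊗ Q)) ⊗≫ P ◁ (Q ⊗ P) ◁ ω ▷ Q ⊗≫
        P ◁ (l ▷ (Q ⊗ Q) ≫ ((P ⊗ P) ⊗ Q) ◁ μ[Q]) ⊗≫ P ◁ μ[P] ▷ Q ▷ Q ⊗≫
          μ[P] ▷ (Q ⊗ Q) ⊗≫ P ◁ μ[Q] := by
      rw [← whisker_exchange μ[P]]; monoidal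
    _ = 𝟙 (((P ⊗ Q) ⊗ (P ⊗ Q)) ⊗ (P ⊗ Q)) ⊗≫ P ◁ (Q ⊗ P) ◁ ω ▷ Q ⊗≫
        P ◁ (Q ⊗ (P ⊗ P)) ◁ μ[Q] ⊗≫ P ◁ (Q ◁ μ[P] ≫ ω) ▷ Q ⊗≫
          μ[P] ▷ (Q ⊗ Q) ⊗≫ P ◁ μ[Q] := by
      rw [← whisker_exchange l μ[Q], h2, hl]; monoidal
    _ = 𝟙 (((P ⊗ Q) ⊗ (P ⊗ Q)) ⊗ (P ⊗ Q)) ⊗≫ (P ⊗ Q) ◁ (P ◁ ω ▷ Q ⊗≫ (P ⊗ P) ◁ μ[Q] ≫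
        μ[P] ▷ Q) ⊗≫ P ◁ ω ▷ Q ⊗≫ μ[P] ▷ (Q ⊗ Q) ≫ P ◁ μ[Q] := by
      monoidal
    _ = _ := by
      rw [← MonoidalCategory.tensorHom_def' μ[P] μ[Q], ← MonoidalCategory.tensorHom_def μ[P] μ[Q]]
      monoidal

end IsComulDistribLaw

end Distrib

/-! ### Factorizations of bialgebras -/

section Factorization

variable {B : Type u} [Category.{v} B] [MonoidalCategory B] [BraidedCategory B]

section ComonHom

attribute [local instance] ComonObj.instTensorUnit

lemma isComonHom_rightUnitor (X : B) [ComonObj X] : IsComonHom (ρ_ X).hom := by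
  have h : IsComonHom (ρ_ (Comon.mk X)).hom.hom := inferInstance
  rw [Comon.monoidal_rightUnitor_hom_hom] at h
  change IsComonHom (X ◁ 𝟙 (𝟙_ B) ≫ (ρ_ X).hom) at h
  rwa [whiskerLeft_id, Category.id_comp] at h

lemma isComonHom_leftUnitor (X : B) [ComonObj X] : IsComonHom (λ_ X).hom := by
  have h : IsComonHom (λ_ (Comon.mk X)).hom.hom := inferInstance
  rw [Comon.monoidal_leftUnitor_hom_hom] at h
  change IsComonHom (𝟙 (𝟙_ B) ▷ X ≫ (λ_ X).hom) at h
  rwa [id_whiskerRight, Category.id_comp] at h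

lemma isComonHom_counit {B : Type u} [Category.{v} B] [MonoidalCategory B] (X : B)
    [ComonObj X] : IsComonHom ε[X] where
  hom_counit := by simp
  hom_comul := by
    have h := ComonObj.counit_comul X
    change ε[X] ≫ (λ_ (𝟙_ B)).inv = _
    rw [MonoidalCategory.tensorHom_def, reassoc_of% h, leftUnitor_inv_naturality]

lemma isComonHom_one (X : B) [BimonObj X] : IsComonHom η[X] where
  hom_counit := BimonObj.one_counit X
  hom_comul := by
    have h := BimonObj.one_comul X
    rw [h]
    rfl

instance isComonHom_fst (P Q : B) [ComonObj P] [ComonObj Q] :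
    IsComonHom (P ◁ ε[Q] ≫ (ρ_ P).hom) := by
  have := isComonHom_rightUnitor P
  have := isComonHom_counit Q
  infer_instance

instance isComonHom_snd (P Q : B) [ComonObj P] [ComonObj Q] :
    IsComonHom (ε[P] ▷ Q ≫ (λ_ Q).hom) := by
  have := isComonHom_leftUnitor Q
  have := isComonHom_counit P
  infer_instance

instance isComonHom_inl (P Q : B) [ComonObj P] [BimonObj Q] :
    IsComonHom ((ρ_ P).inv ≫ P ◁ η[Q]) := by
  have := isComonHom_rightUnitor P
  have := isComonHom_one Q
  infer_instance

instance isComonHom_inr (P Q : B) [BimonObj P] [ComonObj Q] :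
    IsComonHom ((λ_ Q).inv ≫ η[P] ▷ Q) := by
  have := isComonHom_leftUnitor Q
  have := isComonHom_one P
  infer_instance

end ComonHom

/-- The identity of `P ⊗ Q` is the convolution product of the two projections. -/
lemma comul_fst_snd (P Q : B) [ComonObj P] [ComonObj Q] :
    Δ[P ⊗ Q] ≫ ((P ◁ ε[Q] ≫ (ρ_ P).hom) ⊗ₘ (ε[P] ▷ Q ≫ (λ_ Q).hom)) = 𝟙 (P ⊗ Q) := by
  have h1 := ComonObj.comul_counit P
  have h2 := ComonObj.counit_comul Q
  have h3 := braiding_naturality ε[P] ε[Q]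
  rw [Comon.tensorObj_comul, tensorμ]
  calc
    _ = (Δ[P] ⊗ₘ Δ[Q]) ⊗≫ P ◁ ((β_ P Q).hom ≫ (ε[Q] ⊗ₘ ε[P])) ▷ Q ⊗≫ 𝟙 (P ⊗ Q) := by
      rw [MonoidalCategory.tensorHom_def ε[Q] ε[P], MonoidalCategory.tensorHom_def _ (ε[P] ▷ Q ≫ _)]
      monoidal
    _ = P ◁ Δ[Q] ⊗≫ (Δ[P] ≫ P ◁ ε[P]) ▷ (Q ⊗ Q) ⊗≫ P ◁ (ε[Q] ▷ Q) ⊗≫ 𝟙 (P ⊗ Q) := by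
      rw [← h3, MonoidalCategory.tensorHom_def' Δ[P] Δ[Q],
        MonoidalCategory.tensorHom_def ε[P] ε[Q], braiding_tensorUnit_left]
      monoidal
    _ = P ◁ (Δ[Q] ≫ ε[Q] ▷ Q) ⊗≫ 𝟙 (P ⊗ Q) := by
      rw [h1]; monoidal
    _ = _ := by
      rw [h2]; monoidal

/-- The coproduct of `P ⊗ Q` followed by the projections in the other order is the braiding. -/
lemma comul_snd_fst (P Q : B) [ComonObj P] [ComonObj Q] :
    Δ[P ⊗ Q] ≫ ((ε[P] ▷ Q ≫ (λ_ Q).hom) ⊗ₘ (P ◁ ε[Q] ≫ (ρ_ P).hom)) = (β_ P Q).hom := by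
  have h1 := ComonObj.counit_comul P
  have h2 := ComonObj.comul_counit Q
  rw [Comon.tensorObj_comul, tensorμ]
  calc
    _ = Δ[P] ▷ Q ⊗≫ (P ◁ (P ◁ Δ[Q] ≫ (α_ P Q Q).inv ≫ (β_ P Q).hom ▷ Q) ≫
        ε[P] ▷ ((Q ⊗ P) ⊗ Q)) ⊗≫ (Q ⊗ P) ◁ ε[Q] ⊗≫ 𝟙 (Q ⊗ P) := by
      rw [MonoidalCategory.tensorHom_def Δ[P] Δ[Q], MonoidalCategory.tensorHom_def _ (P ◁ ε[Q] ≫ _)]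
      monoidal
    _ = (Δ[P] ≫ ε[P] ▷ P) ▷ Q ⊗≫ P ◁ Δ[Q] ⊗≫ ((β_ P Q).hom ▷ Q ≫ (Q ⊗ P) ◁ ε[Q]) ⊗≫
        𝟙 (Q ⊗ P) := by
      rw [whisker_exchange]; monoidal
    _ = 𝟙 (P ⊗ Q) ⊗≫ P ◁ (Δ[Q] ≫ Q ◁ ε[Q]) ⊗≫ (β_ P Q).hom := by
      rw [h1, ← whisker_exchange]; monoidal
    _ = _ := by
      rw [h2]; monoidal

/-- The coopposite of a comonoid: the same object, with the coproduct followed by the inverse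
braiding. -/
def Cop (X : B) : B := X

instance (X : B) [ComonObj X] : ComonObj (Cop X) where
  counit := (ε[X] : X ⟶ 𝟙_ B)
  comul := (Δ[X] ≫ (β_ X X).inv : X ⟶ X ⊗ X)
  counit_comul := by
    have h := ComonObj.comul_counit X
    change (Δ[X] ≫ (β_ X X).inv) ≫ ε[X] ▷ X = (λ_ X).inv
    rw [Category.assoc, ← braiding_inv_naturality_right, reassoc_of% h]
    simp
  comul_counit := by
    have h := ComonObj.counit_comul X
    change (Δ[X] ≫ (β_ X X).inv) ≫ X ◁ ε[X] = (ρ_ X).inv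
    rw [Category.assoc, ← braiding_inv_naturality_left, reassoc_of% h]
    simp
  comul_assoc := by
    have h := ComonObj.comul_assoc X
    change (Δ[X] ≫ (β_ X X).inv) ≫ X ◁ (Δ[X] ≫ (β_ X X).inv) =
      (Δ[X] ≫ (β_ X X).inv) ≫ (Δ[X] ≫ (β_ X X).inv) ▷ X ≫ (α_ X X X).hom
    rw [whiskerLeft_comp, comp_whiskerRight, Category.assoc, Category.assoc, Category.assoc,
      ← braiding_inv_naturality_left_assoc, ← braiding_inv_naturality_right_assoc, reassoc_of% h,
      ← braiding_inv_naturality_left, braiding_tensor_right_inv, braiding_tensor_left_inv]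
    simp

/-- A comonoid morphism is one for the coopposite coproducts. -/
lemma isComonHom_cop {X Y : B} [ComonObj X] [ComonObj Y] (f : X ⟶ Y) [IsComonHom f] :
    IsComonHom (M := Cop X) (N := Cop Y) f where
  hom_counit := IsComonHom.hom_counit (M := X) (N := Y) f
  hom_comul := by
    have h := IsComonHom.hom_comul f
    change f ≫ Δ[Y] ≫ (β_ Y Y).inv = (Δ[X] ≫ (β_ X X).inv) ≫ (f ⊗ₘ f)
    rw [reassoc_of% h, Category.assoc, braiding_inv_naturality]

end Factorization

/-! ### Convolution and antipodes of factorized bialgebras -/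

section Factorization

section Conv

variable {B : Type u} [Category.{v} B] [MonoidalCategory B]
  {E P Q D : B} [ComonObj E] [ComonObj P] [ComonObj Q] [MonObj D]

/-- The convolution product of morphisms from a comonoid to a monoid. -/
def convMul (f g : P ⟶ D) : P ⟶ D := Δ[P] ≫ (f ⊗ₘ g) ≫ μ[D]

lemma convMul_assoc (f g h : P ⟶ D) : convMul (convMul f g) h = convMul f (convMul g h) := by
  have h1 := ComonObj.comul_assoc P
  have h2 := MonObj.mul_assoc D
  have h3 : (Δ[P] ≫ (f ⊗ₘ g) ≫ μ[D]) ⊗ₘ h = Δ[P] ▷ P ≫ ((f ⊗ₘ g) ⊗ₘ h) ≫ μ[D] ▷ D := by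
    rw [← tensorHom_id, ← tensorHom_id, tensorHom_comp_tensorHom, tensorHom_comp_tensorHom,
      Category.id_comp, Category.comp_id]
  have h4 : f ⊗ₘ (Δ[P] ≫ (g ⊗ₘ h) ≫ μ[D]) = P ◁ Δ[P] ≫ (f ⊗ₘ (g ⊗ₘ h)) ≫ D ◁ μ[D] := by
    rw [← id_tensorHom, ← id_tensorHom, tensorHom_comp_tensorHom, tensorHom_comp_tensorHom,
      Category.id_comp, Category.comp_id]
  rw [convMul, convMul, convMul, convMul, h3, h4, Category.assoc, Category.assoc, Category.assoc,
    Category.assoc, reassoc_of% h1, h2, associator_naturality_assoc]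

lemma one_convMul (f : P ⟶ D) : convMul (ε[P] ≫ η[D]) f = f := by
  have h1 := ComonObj.counit_comul P
  have h2 := MonObj.one_mul D
  rw [convMul, MonoidalCategory.tensorHom_def, comp_whiskerRight, Category.assoc, Category.assoc,
    reassoc_of% h1, ← whisker_exchange_assoc, h2]
  simp

lemma comp_convMul (f : E ⟶ P) [IsComonHom f] (a b : P ⟶ D) :
    f ≫ convMul a b = convMul (f ≫ a) (f ≫ b) := by
  have h := IsComonHom.hom_comul f
  rw [convMul, convMul, reassoc_of% h, tensorHom_comp_tensorHom_assoc]

lemma convMul_comp {D' : B} [MonObj D'] (f : D ⟶ D') [IsMonHom f] (a b : P ⟶ D) :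
    convMul a b ≫ f = convMul (a ≫ f) (b ≫ f) := by
  have h := IsMonHom.mul_hom f
  rw [convMul, convMul, Category.assoc, Category.assoc, h, tensorHom_comp_tensorHom_assoc]

/-- If two morphisms `P ⟶ D` and `Q ⟶ D` are invertible for the convolution product, so is a
morphism `k : K ⟶ D` which becomes, along an isomorphism `E ≅ K`, the convolution product of their
composites with comonoid morphisms `E ⟶ P` and `E ⟶ Q`. -/
lemma exists_convMul_inverse {K : B} [ComonObj K] (p : E ⟶ P) (q : E ⟶ Q) [hp : IsComonHom p]
    [hq : IsComonHom q] {f f' : P ⟶ D} {g g' : Q ⟶ D} (hf : convMul f f' = ε[P] ≫ η[D])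
    (hf' : convMul f' f = ε[P] ≫ η[D]) (hg : convMul g g' = ε[Q] ≫ η[D])
    (hg' : convMul g' g = ε[Q] ≫ η[D]) (e : E ⟶ K) [IsIso e] [IsComonHom e] (k : K ⟶ D)
    (he : e ≫ k = convMul (p ≫ f) (q ≫ g)) :
    ∃ s : K ⟶ D, convMul s k = ε[K] ≫ η[D] ∧ convMul k s = ε[K] ≫ η[D] := by
  have hp := IsComonHom.hom_counit p
  have hq := IsComonHom.hom_counit q
  have hd := IsComonHom.hom_counit e
  have h1 : convMul (p ≫ f) (p ≫ f') = ε[E] ≫ η[D] := by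
    rw [← comp_convMul, hf, reassoc_of% hp]
  have h2 : convMul (p ≫ f') (p ≫ f) = ε[E] ≫ η[D] := by
    rw [← comp_convMul, hf', reassoc_of% hp]
  have h3 : convMul (q ≫ g) (q ≫ g') = ε[E] ≫ η[D] := by
    rw [← comp_convMul, hg, reassoc_of% hq]
  have h4 : convMul (q ≫ g') (q ≫ g) = ε[E] ≫ η[D] := by
    rw [← comp_convMul, hg', reassoc_of% hq]
  refine ⟨inv e ≫ convMul (q ≫ g') (p ≫ f'), ?_, ?_⟩
  · rw [← cancel_epi e, comp_convMul, IsIso.hom_inv_id_assoc, he, convMul_assoc,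
      ← convMul_assoc (p ≫ f'), h2, one_convMul, h4, reassoc_of% hd]
  · rw [← cancel_epi e, comp_convMul, IsIso.hom_inv_id_assoc, he, convMul_assoc,
      ← convMul_assoc (q ≫ g), h3, one_convMul, h1, reassoc_of% hd]

/-- If `s` is a right convolution inverse of the identity of `P`, then `s ≫ f` is one of an
algebra morphism `f` out of `P`. -/
lemma convMul_antipode_of_comp {P : B} [ComonObj P] [MonObj P] {s : P ⟶ P}
    (h : convMul (𝟙 P) s = ε[P] ≫ η[P]) (f : P ⟶ D) [IsMonHom f] :
    convMul f (s ≫ f) = ε[P] ≫ η[D] := by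
  have h1 := convMul_comp f (𝟙 P) s
  have h2 := IsMonHom.one_hom f
  rw [h, Category.assoc, h2, Category.id_comp] at h1
  exact h1.symm

/-- If `s` is a left convolution inverse of the identity of `P`, then `s ≫ f` is one of an
algebra morphism `f` out of `P`. -/
lemma antipode_convMul_of_comp {P : B} [ComonObj P] [MonObj P] {s : P ⟶ P}
    (h : convMul s (𝟙 P) = ε[P] ≫ η[P]) (f : P ⟶ D) [IsMonHom f] :
    convMul (s ≫ f) f = ε[P] ≫ η[D] := by
  have h1 := convMul_comp f s (𝟙 P)
  have h2 := IsMonHom.one_hom f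
  rw [h, Category.assoc, h2, Category.id_comp] at h1
  exact h1.symm

end Conv

variable {B : Type u} [Category.{v} B] [MonoidalCategory B] [BraidedCategory B]

/-- A factorization of a bialgebra `D` through sub-bialgebras `P` and `Q`: the product of `D`
restricts to an isomorphism `P ⊗ Q ≅ D`, and `ω` describes products in the other order. -/
structure Factorization {P Q : B} [BimonObj P] [BimonObj Q] (ω : Q ⊗ P ⟶ P ⊗ Q) (D : B)
    [BimonObj D] where
  inl : P ⟶ D
  inr : Q ⟶ D
  isBimonHom_inl : IsBimonHom inl
  isBimonHom_inr : IsBimonHom inr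
  isIso : IsIso ((inl ⊗ₘ inr) ≫ μ[D])
  law : (inr ⊗ₘ inl) ≫ μ[D] = ω ≫ (inl ⊗ₘ inr) ≫ μ[D]

section Antipodes

variable {P D : B} [BimonObj D]

lemma convMul_antipode [HopfObj P] (f : P ⟶ D) [IsMonHom f] :
    convMul f (𝒮[P] ≫ f) = ε[P] ≫ η[D] := by
  have h := HopfObj.antipode_right P
  refine convMul_antipode_of_comp ?_ f
  rw [convMul, id_tensorHom, h]

lemma antipode_convMul [HopfObj P] (f : P ⟶ D) [IsMonHom f] :
    convMul (𝒮[P] ≫ f) f = ε[P] ≫ η[D] := by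
  have h := HopfObj.antipode_left P
  refine antipode_convMul_of_comp ?_ f
  rw [convMul, tensorHom_id, h]

/-- The coopposite of a bialgebra keeps its product. -/
instance (P : B) [h : MonObj P] : MonObj (Cop P) := h

/-- A skew antipode gives convolution inverses for the coopposite coproduct. -/
lemma IsSkewAntipode.convMul_cop [BimonObj P] {T : P ⟶ P} (hT : IsSkewAntipode P T) (f : P ⟶ D)
    [h : IsMonHom f] : convMul (P := Cop P) f (T ≫ f) = ε[P] ≫ η[D] := by
  have : IsMonHom (M := Cop P) (N := D) f := h
  refine convMul_antipode_of_comp (P := Cop P) (s := T) ?_ f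
  change (Δ[P] ≫ (β_ P P).inv) ≫ (𝟙 P ⊗ₘ T) ≫ μ[P] = ε[P] ≫ η[P]
  rw [id_tensorHom, Category.assoc, hT.right]

lemma IsSkewAntipode.convMul_cop' [BimonObj P] {T : P ⟶ P} (hT : IsSkewAntipode P T) (f : P ⟶ D)
    [h : IsMonHom f] : convMul (P := Cop P) (T ≫ f) f = ε[P] ≫ η[D] := by
  have : IsMonHom (M := Cop P) (N := D) f := h
  refine antipode_convMul_of_comp (P := Cop P) (s := T) ?_ f
  change (Δ[P] ≫ (β_ P P).inv) ≫ (T ⊗ₘ 𝟙 P) ≫ μ[P] = ε[P] ≫ η[P]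
  rw [tensorHom_id, Category.assoc, hT.left]

end Antipodes

namespace Factorization

variable {P Q D : B} [BimonObj D]

section

variable [BimonObj P] [BimonObj Q] {ω : Q ⊗ P ⟶ P ⊗ Q} (F : Factorization ω D)

/-- The isomorphism `P ⊗ Q ⟶ D`. -/
def prod : P ⊗ Q ⟶ D := (F.inl ⊗ₘ F.inr) ≫ μ[D]

instance : IsIso F.prod := F.isIso

instance : IsComonHom F.prod := by
  have := F.isBimonHom_inl
  have := F.isBimonHom_inr
  dsimp only [prod]
  infer_instance

/-- The product isomorphism is the convolution product of the inclusions of the factors. -/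
lemma prod_eq_convMul : F.prod = convMul ((P ◁ ε[Q] ≫ (ρ_ P).hom) ≫ F.inl)
    ((ε[P] ▷ Q ≫ (λ_ Q).hom) ≫ F.inr) := by
  have h := comul_fst_snd P Q
  rw [convMul, ← tensorHom_comp_tensorHom, Category.assoc, reassoc_of% h]
  rfl

/-- The product isomorphism is also the convolution product, in the same order, for the
coopposite coproduct of `P ⊗ Q`. -/
lemma prod_eq_convMul_cop : F.prod = convMul (P := Cop (P ⊗ Q))
    ((P ◁ ε[Q] ≫ (ρ_ P).hom) ≫ F.inl) ((ε[P] ▷ Q ≫ (λ_ Q).hom) ≫ F.inr) := by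
  have h := comul_snd_fst P Q
  change _ = (Δ[P ⊗ Q] ≫ (β_ (P ⊗ Q) (P ⊗ Q)).inv) ≫
    (((P ◁ ε[Q] ≫ (ρ_ P).hom) ≫ F.inl) ⊗ₘ ((ε[P] ▷ Q ≫ (λ_ Q).hom) ≫ F.inr)) ≫ μ[D]
  rw [← tensorHom_comp_tensorHom, Category.assoc, Category.assoc,
    ← braiding_inv_naturality_assoc, reassoc_of% h, Iso.hom_inv_id_assoc]
  rfl

end

variable [HopfObj P] [HopfObj Q] {ω : Q ⊗ P ⟶ P ⊗ Q}

/-- A bialgebra which factors through Hopf algebras has an antipode. -/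
lemma exists_antipode (F : Factorization ω D) :
    ∃ s : D ⟶ D, Δ[D] ≫ s ▷ D ≫ μ[D] = ε[D] ≫ η[D] ∧ Δ[D] ≫ D ◁ s ≫ μ[D] = ε[D] ≫ η[D] := by
  have := F.isBimonHom_inl
  have := F.isBimonHom_inr
  obtain ⟨s, h1, h2⟩ := exists_convMul_inverse (P ◁ ε[Q] ≫ (ρ_ P).hom) (ε[P] ▷ Q ≫ (λ_ Q).hom)
    (convMul_antipode F.inl) (antipode_convMul F.inl) (convMul_antipode F.inr)
    (antipode_convMul F.inr) F.prod (𝟙 D) ((Category.comp_id _).trans F.prod_eq_convMul)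
  refine ⟨s, ?_, ?_⟩
  · rwa [convMul, tensorHom_id] at h1
  · rwa [convMul, id_tensorHom] at h2

/-- A bialgebra which factors through bialgebras with skew antipodes has a skew antipode. -/
lemma exists_skewAntipode (F : Factorization ω D) {T : P ⟶ P} {T' : Q ⟶ Q}
    (hT : IsSkewAntipode P T) (hT' : IsSkewAntipode Q T') :
    ∃ s : D ⟶ D, Δ[D] ≫ (β_ D D).inv ≫ D ◁ s ≫ μ[D] = ε[D] ≫ η[D] := by
  have := F.isBimonHom_inl
  have := F.isBimonHom_inr
  have hp := isComonHom_cop (P ◁ ε[Q] ≫ (ρ_ P).hom)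
  have hq := isComonHom_cop (ε[P] ▷ Q ≫ (λ_ Q).hom)
  have hF := isComonHom_cop F.prod
  have hi : @IsIso B _ (Cop (P ⊗ Q)) (Cop D) F.prod := F.isIso
  obtain ⟨s, -, h2⟩ : ∃ s : D ⟶ D, convMul (P := Cop D) s (𝟙 D) = ε[D] ≫ η[D] ∧
      convMul (P := Cop D) (𝟙 D) s = ε[D] ≫ η[D] :=
    exists_convMul_inverse (E := Cop (P ⊗ Q)) (P := Cop P) (Q := Cop Q) (K := Cop D) _ _
    (hp := hp) (hq := hq)
    (hT.convMul_cop F.inl) (hT.convMul_cop' F.inl) (hT'.convMul_cop F.inr)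
    (hT'.convMul_cop' F.inr) F.prod (𝟙 D) ((Category.comp_id _).trans F.prod_eq_convMul_cop)
  refine ⟨s, ?_⟩
  have h3 : (Δ[D] ≫ (β_ D D).inv) ≫ (𝟙 D ⊗ₘ s) ≫ μ[D] = ε[D] ≫ η[D] := h2
  rwa [id_tensorHom, Category.assoc] at h3

/-- The antipode of `D` exchanges the two products `P ⊗ Q ⟶ D` and `Q ⊗ P ⟶ D`, so that the law
is invertible if the antipodes are. -/
lemma isIso_law {D : B} [HopfObj D] (F : Factorization ω D) [IsIso 𝒮[P]] [IsIso 𝒮[Q]]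
    [IsIso 𝒮[D]] : IsIso ω := by
  have := F.isBimonHom_inl
  have := F.isBimonHom_inr
  have h1 := HopfObj.mul_antipode D
  have h2 := HopfObj.hom_antipode F.inl
  have h3 := HopfObj.hom_antipode F.inr
  have h4 : (F.inr ⊗ₘ F.inl) ≫ μ[D] =
      (𝒮[Q] ⊗ₘ 𝒮[P]) ≫ (β_ Q P).hom ≫ F.prod ≫ inv 𝒮[D] := by
    rw [← cancel_mono 𝒮[D], Category.assoc, h1]
    simp only [Category.assoc, IsIso.inv_hom_id, Category.comp_id]
    rw [tensorHom_comp_tensorHom_assoc, h2, h3, ← tensorHom_comp_tensorHom_assoc,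
      braiding_naturality_assoc]
    rfl
  have h5 : ω = ((𝒮[Q] ⊗ₘ 𝒮[P]) ≫ (β_ Q P).hom ≫ F.prod ≫ inv 𝒮[D]) ≫ inv F.prod := by
    rw [← h4, F.law, Category.assoc]
    exact ((ω ≫= IsIso.hom_inv_id F.prod).trans (Category.comp_id ω)).symm
  rw [h5]
  infer_instance

end Factorization

end Factorization

/-! ### The bialgebra of a comultiplicative distributive law -/

section Distrib

variable {B : Type u} [Category.{v} B] [MonoidalCategory B] [BraidedCategory B]
  {P Q : B} [BimonObj P] [BimonObj Q] {ω : Q ⊗ P ⟶ P ⊗ Q}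

lemma distribOne_comul (P Q : B) [BimonObj P] [BimonObj Q] :
    distribOne P Q ≫ distribComul P Q =
      (λ_ (𝟙_ B)).inv ≫ (distribOne P Q ⊗ₘ distribOne P Q) := by
  let _ := ComonObj.instTensorUnit B
  have := isComonHom_leftUnitor (𝟙_ B)
  have := isComonHom_one P
  have := isComonHom_one Q
  have h : IsComonHom (distribOne P Q) := by
    dsimp only [distribOne]
    infer_instance
  have h1 := h.hom_comul
  rw [Comon.tensorObj_comul] at h1
  exact h1

/-- The bialgebra `P ⊗_ω Q`. -/
@[reducible]
def IsComulDistribLaw.bimonObj (h : IsComulDistribLaw P Q ω) : BimonObj (P ⊗ Q) where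
  one := distribOne P Q
  mul := distribMul P Q ω
  comul := distribComul P Q
  counit := distribCounit P Q
  one_mul := h.one_mul
  mul_one := h.mul_one
  mul_assoc := h.mul_assoc
  counit_comul := by
    have h1 := ComonObj.counit_comul (P ⊗ Q)
    rw [Comon.tensorObj_comul] at h1
    exact h1
  comul_counit := by
    have h1 := ComonObj.comul_counit (P ⊗ Q)
    rw [Comon.tensorObj_comul] at h1
    exact h1
  comul_assoc := by
    have h1 := ComonObj.comul_assoc (P ⊗ Q)
    rw [Comon.tensorObj_comul] at h1
    exact h1
  mul_comul := by
    have h1 := h.isComonHom_distribMul.hom_comul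
    rw [Comon.tensorObj_comul (P ⊗ Q), Comon.tensorObj_comul, Category.assoc] at h1
    exact h1
  one_comul := distribOne_comul P Q
  mul_counit := by
    have h1 := h.isComonHom_distribMul.hom_counit
    rw [Comon.tensorObj_counit (P ⊗ Q), Comon.tensorObj_counit] at h1
    exact h1
  one_counit := by
    have h1 := BimonObj.one_counit P
    have h2 := BimonObj.one_counit Q
    change ((λ_ (𝟙_ B)).inv ≫ (η[P] ⊗ₘ η[Q])) ≫ (ε[P] ⊗ₘ ε[Q]) ≫ (λ_ (𝟙_ B)).hom = 𝟙 _
    rw [Category.assoc, tensorHom_comp_tensorHom_assoc, h1, h2]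
    simp

lemma IsComulDistribLaw.inl_mul_inr (h : IsComulDistribLaw P Q ω) :
    ((ρ_ P).inv ≫ P ◁ η[Q] ⊗ₘ (λ_ Q).inv ≫ η[P] ▷ Q) ≫ distribMul P Q ω = 𝟙 (P ⊗ Q) := by
  have h1 := h.one_left
  have h2 := MonObj.mul_one P
  have h3 := MonObj.one_mul Q
  dsimp only [distribMul]
  rw [MonoidalCategory.tensorHom_def μ[P] μ[Q], MonoidalCategory.tensorHom_def]
  calc
    _ = 𝟙 (P ⊗ Q) ⊗≫ P ◁ (η[Q] ▷ 𝟙_ B ≫ Q ◁ η[P]) ▷ Q ⊗≫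
        P ◁ ω ▷ Q ⊗≫ μ[P] ▷ (Q ⊗ Q) ⊗≫ P ◁ μ[Q] := by monoidal
    _ = 𝟙 (P ⊗ Q) ⊗≫ P ◁ (𝟙_ B ◁ η[P] ≫ η[Q] ▷ P) ▷ Q ⊗≫
        P ◁ ω ▷ Q ⊗≫ μ[P] ▷ (Q ⊗ Q) ⊗≫ P ◁ μ[Q] := by
      rw [← whisker_exchange]
    _ = 𝟙 (P ⊗ Q) ⊗≫ P ◁ η[P] ▷ Q ⊗≫ P ◁ (η[Q] ▷ P ≫ ω) ▷ Q ⊗≫ μ[P] ▷ (Q ⊗ Q) ⊗≫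
        P ◁ μ[Q] := by monoidal
    _ = 𝟙 (P ⊗ Q) ⊗≫ P ◁ η[P] ▷ Q ⊗≫ ((P ⊗ P) ◁ (η[Q] ▷ Q) ≫ μ[P] ▷ (Q ⊗ Q)) ⊗≫
        P ◁ μ[Q] := by
      rw [h1]; monoidal
    _ = 𝟙 (P ⊗ Q) ⊗≫ (P ◁ η[P] ≫ μ[P]) ▷ Q ⊗≫ P ◁ (η[Q] ▷ Q ≫ μ[Q]) := by
      rw [whisker_exchange]; monoidal
    _ = _ := by
      rw [h2, h3]; monoidal

lemma IsComulDistribLaw.inl_mul_inl (h : IsComulDistribLaw P Q ω) :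
    ((ρ_ P).inv ≫ P ◁ η[Q] ⊗ₘ (ρ_ P).inv ≫ P ◁ η[Q]) ≫ distribMul P Q ω =
      μ[P] ≫ (ρ_ P).inv ≫ P ◁ η[Q] := by
  have h1 := h.one_left
  have h2 := MonObj.mul_one Q
  dsimp only [distribMul]
  rw [MonoidalCategory.tensorHom_def' μ[P] μ[Q], MonoidalCategory.tensorHom_def]
  calc
    _ = 𝟙 (P ⊗ P) ⊗≫ P ◁ η[Q] ▷ P ⊗≫ P ◁ ((Q ⊗ P) ◁ η[Q] ≫ ω ▷ Q) ⊗≫ (P ⊗ P) ◁ μ[Q] ⊗≫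
        μ[P] ▷ Q := by monoidal
    _ = 𝟙 (P ⊗ P) ⊗≫ P ◁ (η[Q] ▷ P ≫ ω) ⊗≫ (P ⊗ P) ◁ (Q ◁ η[Q] ≫ μ[Q]) ⊗≫ μ[P] ▷ Q := by
      rw [whisker_exchange]; monoidal
    _ = 𝟙 (P ⊗ P) ⊗≫ ((P ⊗ P) ◁ η[Q] ≫ μ[P] ▷ Q) := by
      rw [h1, h2]; monoidal
    _ = _ := by
      rw [whisker_exchange]; monoidal

lemma IsComulDistribLaw.inr_mul_inr (h : IsComulDistribLaw P Q ω) :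
    ((λ_ Q).inv ≫ η[P] ▷ Q ⊗ₘ (λ_ Q).inv ≫ η[P] ▷ Q) ≫ distribMul P Q ω =
      μ[Q] ≫ (λ_ Q).inv ≫ η[P] ▷ Q := by
  have h1 := h.one_right
  have h2 := MonObj.mul_one P
  dsimp only [distribMul]
  rw [MonoidalCategory.tensorHom_def μ[P] μ[Q], MonoidalCategory.tensorHom_def]
  calc
    _ = 𝟙 (Q ⊗ Q) ⊗≫ η[P] ▷ (Q ⊗ Q) ⊗≫ P ◁ (Q ◁ η[P] ≫ ω) ▷ Q ⊗≫ μ[P] ▷ (Q ⊗ Q) ⊗≫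
        P ◁ μ[Q] := by monoidal
    _ = 𝟙 (Q ⊗ Q) ⊗≫ η[P] ▷ (Q ⊗ Q) ⊗≫ (P ◁ η[P] ≫ μ[P]) ▷ (Q ⊗ Q) ⊗≫ P ◁ μ[Q] := by
      rw [h1]; monoidal
    _ = 𝟙 (Q ⊗ Q) ⊗≫ (η[P] ▷ (Q ⊗ Q) ≫ P ◁ μ[Q]) := by
      rw [h2]; monoidal
    _ = _ := by
      rw [← whisker_exchange]; monoidal

lemma inr_mul_inl {B : Type u} [Category.{v} B] [MonoidalCategory B] (P Q : B) [MonObj P]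
    [MonObj Q] (ω : Q ⊗ P ⟶ P ⊗ Q) :
    ((λ_ Q).inv ≫ η[P] ▷ Q ⊗ₘ (ρ_ P).inv ≫ P ◁ η[Q]) ≫ distribMul P Q ω = ω := by
  have h1 := MonObj.one_mul P
  have h2 := MonObj.mul_one Q
  dsimp only [distribMul]
  rw [MonoidalCategory.tensorHom_def' μ[P] μ[Q], MonoidalCategory.tensorHom_def]
  calc
    _ = 𝟙 (Q ⊗ P) ⊗≫ η[P] ▷ (Q ⊗ P) ⊗≫ P ◁ ((Q ⊗ P) ◁ η[Q] ≫ ω ▷ Q) ⊗≫ (P ⊗ P) ◁ μ[Q] ⊗≫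
        μ[P] ▷ Q := by monoidal
    _ = 𝟙 (Q ⊗ P) ⊗≫ (η[P] ▷ (Q ⊗ P) ≫ P ◁ ω) ⊗≫ (P ⊗ P) ◁ (Q ◁ η[Q] ≫ μ[Q]) ⊗≫
        μ[P] ▷ Q := by
      rw [whisker_exchange]; monoidal
    _ = 𝟙 (Q ⊗ P) ⊗≫ ω ⊗≫ (η[P] ▷ P ≫ μ[P]) ▷ Q := by
      rw [← whisker_exchange, h2]; monoidal
    _ = _ := by
      rw [h1]; monoidal

/-- The bialgebra `P ⊗_ω Q` factors through `P` and `Q`. -/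
def IsComulDistribLaw.factorization (h : IsComulDistribLaw P Q ω) :
    @Factorization B _ _ _ P Q _ _ ω (P ⊗ Q) h.bimonObj := by
  letI := h.bimonObj
  exact
    { inl := (ρ_ P).inv ≫ P ◁ η[Q]
      inr := (λ_ Q).inv ≫ η[P] ▷ Q
      isBimonHom_inl :=
        { one_hom := by
            change η[P] ≫ (ρ_ P).inv ≫ P ◁ η[Q] = (λ_ (𝟙_ B)).inv ≫ (η[P] ⊗ₘ η[Q])
            rw [MonoidalCategory.tensorHom_def]
            monoidal
          mul_hom := by
            change μ[P] ≫ (ρ_ P).inv ≫ P ◁ η[Q] =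
              ((ρ_ P).inv ≫ P ◁ η[Q] ⊗ₘ (ρ_ P).inv ≫ P ◁ η[Q]) ≫ distribMul P Q ω
            exact (h.inl_mul_inl).symm
          hom_counit := by
            have h2 := (isComonHom_inl P Q).hom_counit
            exact h2
          hom_comul := by
            have h2 := (isComonHom_inl P Q).hom_comul
            rw [Comon.tensorObj_comul] at h2
            exact h2 }
      isBimonHom_inr :=
        { one_hom := by
            change η[Q] ≫ (λ_ Q).inv ≫ η[P] ▷ Q = (λ_ (𝟙_ B)).inv ≫ (η[P] ⊗ₘ η[Q])
            rw [MonoidalCategory.tensorHom_def']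
            monoidal
          mul_hom := by
            change μ[Q] ≫ (λ_ Q).inv ≫ η[P] ▷ Q =
              ((λ_ Q).inv ≫ η[P] ▷ Q ⊗ₘ (λ_ Q).inv ≫ η[P] ▷ Q) ≫ distribMul P Q ω
            exact (h.inr_mul_inr).symm
          hom_counit := by
            have h2 := (isComonHom_inr P Q).hom_counit
            exact h2
          hom_comul := by
            have h2 := (isComonHom_inr P Q).hom_comul
            rw [Comon.tensorObj_comul] at h2
            exact h2 }
      isIso := by
        change IsIso (((ρ_ P).inv ≫ P ◁ η[Q] ⊗ₘ (λ_ Q).inv ≫ η[P] ▷ Q) ≫ distribMul P Q ω)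
        rw [h.inl_mul_inr]
        infer_instance
      law := by
        change ((λ_ Q).inv ≫ η[P] ▷ Q ⊗ₘ (ρ_ P).inv ≫ P ◁ η[Q]) ≫ distribMul P Q ω =
          ω ≫ ((ρ_ P).inv ≫ P ◁ η[Q] ⊗ₘ (λ_ Q).inv ≫ η[P] ▷ Q) ≫ distribMul P Q ω
        rw [h.inl_mul_inr, Category.comp_id, inr_mul_inl] }

end Distrib

/-! ### Modules over a factorized bialgebra -/

section Res

variable {B : Type u} [Category.{v} B] [MonoidalCategory B]

/-- Restriction of right modules along a morphism of algebras. -/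
def RightMod.res {P D : B} [MonObj P] [MonObj D] (f : P ⟶ D) [IsMonHom f] (M : RightMod D) :
    RightMod P where
  X := M.X
  act := M.X ◁ f ≫ M.act
  act_one := by
    have h := IsMonHom.one_hom (f := f)
    rw [← whiskerLeft_comp_assoc, h, M.act_one]
  act_act := by
    have h := IsMonHom.mul_hom (f := f)
    have h1 := M.act_act
    rw [← whiskerLeft_comp_assoc, h, MonoidalCategory.tensorHom_def]
    simp only [comp_whiskerRight, whiskerLeft_comp, Category.assoc]
    rw [← whisker_exchange_assoc, h1]
    simp

lemma RightMod.res_hom {P D : B} [MonObj P] [MonObj D] (f : P ⟶ D) [IsMonHom f]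
    {M N : RightMod D} (g : M ⟶ N) : (M.res f).act ≫ g.hom = g.hom ▷ P ≫ (N.res f).act := by
  have h := g.act_hom
  change (M.X ◁ f ≫ M.act) ≫ g.hom = g.hom ▷ P ≫ N.X ◁ f ≫ N.act
  rw [Category.assoc, h, ← whisker_exchange_assoc]

lemma RightMod.res_tensor_act [BraidedCategory B] {P D : B} [BimonObj P] [BimonObj D] (f : P ⟶ D)
    [IsMonHom f] [IsComonHom f] (M N : RightMod D) :
    ((M ⊗ N).res f).act = (M.res f ⊗ N.res f).act := by
  have h := IsComonHom.hom_comul (f := f)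
  change (M.X ⊗ N.X) ◁ f ≫ (M.X ⊗ N.X) ◁ Δ[D] ≫ tensorμ M.X N.X D D ≫ (M.act ⊗ₘ N.act) =
    (M.X ⊗ N.X) ◁ Δ[P] ≫ tensorμ M.X N.X P P ≫ ((M.X ◁ f ≫ M.act) ⊗ₘ (N.X ◁ f ≫ N.act))
  rw [← whiskerLeft_comp_assoc, h, whiskerLeft_comp_assoc, tensorμ_natural_right_assoc,
    tensorHom_comp_tensorHom]

lemma RightMod.res_unit_act [BraidedCategory B] {P D : B} [BimonObj P] [BimonObj D] (f : P ⟶ D)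
    [IsMonHom f] [IsComonHom f] :
    ((𝟙_ (RightMod D)).res f).act = (𝟙_ (RightMod P) : RightMod P).act := by
  have h := IsComonHom.hom_counit (f := f)
  change 𝟙_ B ◁ f ≫ 𝟙_ B ◁ ε[D] ≫ (ρ_ (𝟙_ B)).hom = 𝟙_ B ◁ ε[P] ≫ (ρ_ (𝟙_ B)).hom
  rw [← whiskerLeft_comp_assoc, h]

end Res

namespace Factorization

variable {B : Type u} [Category.{v} B] [MonoidalCategory B] [BraidedCategory B]
  {P Q D : B} [BimonObj P] [BimonObj Q] [BimonObj D] {ω : Q ⊗ P ⟶ P ⊗ Q}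
  (F : Factorization ω D)

/-- The action of the first factor on a right `D`-module. -/
def actL (M : RightMod D) : M.X ⊗ P ⟶ M.X := M.X ◁ F.inl ≫ M.act

/-- The action of the second factor on a right `D`-module. -/
def actR (M : RightMod D) : M.X ⊗ Q ⟶ M.X := M.X ◁ F.inr ≫ M.act

/-- Restriction of right `D`-modules to the first factor. -/
def resL (M : RightMod D) : RightMod P where
  X := M.X
  act := F.actL M
  act_one :=
    have := F.isBimonHom_inl
    (M.res F.inl).act_one
  act_act :=
    have := F.isBimonHom_inl
    (M.res F.inl).act_act

/-- Restriction of right `D`-modules to the second factor. -/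
def resR (M : RightMod D) : RightMod Q where
  X := M.X
  act := F.actR M
  act_one :=
    have := F.isBimonHom_inr
    (M.res F.inr).act_one
  act_act :=
    have := F.isBimonHom_inr
    (M.res F.inr).act_act

lemma actL_tensor (M N : RightMod D) : F.actL (M ⊗ N) = (F.resL M ⊗ F.resL N).act :=
  have := F.isBimonHom_inl
  RightMod.res_tensor_act F.inl M N

lemma actR_tensor (M N : RightMod D) : F.actR (M ⊗ N) = (F.resR M ⊗ F.resR N).act :=
  have := F.isBimonHom_inr
  RightMod.res_tensor_act F.inr M N

lemma actL_unit : F.actL (𝟙_ (RightMod D)) = (𝟙_ (RightMod P) : RightMod P).act :=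
  have := F.isBimonHom_inl
  RightMod.res_unit_act F.inl

lemma actR_unit : F.actR (𝟙_ (RightMod D)) = (𝟙_ (RightMod Q) : RightMod Q).act :=
  have := F.isBimonHom_inr
  RightMod.res_unit_act F.inr

lemma actL_hom {M N : RightMod D} (g : M ⟶ N) : F.actL M ≫ g.hom = g.hom ▷ P ≫ F.actL N :=
  have := F.isBimonHom_inl
  RightMod.res_hom F.inl g

lemma actR_hom {M N : RightMod D} (g : M ⟶ N) : F.actR M ≫ g.hom = g.hom ▷ Q ≫ F.actR N :=
  have := F.isBimonHom_inr
  RightMod.res_hom F.inr g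

/-- The morphism of `P`-modules underlying a morphism of `D`-modules. -/
def resLMap {M N : RightMod D} (g : M ⟶ N) : F.resL M ⟶ F.resL N where
  hom := g.hom
  act_hom := F.actL_hom g

/-- The action of `D`, expressed by the actions of the factors. -/
lemma prod_act (M : RightMod D) : M.X ◁ F.prod ≫ M.act =
    (α_ M.X P Q).inv ≫ F.actL M ▷ Q ≫ F.actR M := by
  have h := M.act_act
  rw [actL, actR, prod, MonoidalCategory.tensorHom_def]
  simp only [whiskerLeft_comp, comp_whiskerRight, Category.assoc]
  rw [← whisker_exchange_assoc, h]
  simp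

/-- The exchange rule between the actions of the factors. -/
lemma actR_actL (M : RightMod D) :
    F.actR M ▷ P ≫ F.actL M =
      ((α_ M.X Q P).hom ≫ M.X ◁ ω ≫ (α_ M.X P Q).inv ≫ F.actL M ▷ Q) ≫ F.actR M := by
  have h := M.act_act
  have h1 := F.law
  have h2 : F.actR M ▷ P ≫ F.actL M =
      (α_ M.X Q P).hom ≫ M.X ◁ ((F.inr ⊗ₘ F.inl) ≫ μ[D]) ≫ M.act := by
    rw [actL, actR, MonoidalCategory.tensorHom_def]
    simp only [whiskerLeft_comp, comp_whiskerRight, Category.assoc]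
    rw [← whisker_exchange_assoc, h]
    simp
  have h3 := F.prod_act M
  rw [prod] at h3
  rw [h2, h1, whiskerLeft_comp, Category.assoc, h3]
  simp

/-- A morphism which is linear for both factors is linear for `D`. -/
lemma act_hom_of_res {M N : RightMod D} (f : M.X ⟶ N.X)
    (h1 : F.actL M ≫ f = f ▷ P ≫ F.actL N) (h2 : F.actR M ≫ f = f ▷ Q ≫ F.actR N) :
    M.act ≫ f = f ▷ D ≫ N.act := by
  have hM := F.prod_act M
  have hN := F.prod_act N
  rw [← cancel_epi (M.X ◁ F.prod), reassoc_of% hM, whisker_exchange_assoc, hN, h2,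
    ← comp_whiskerRight_assoc, h1]
  simp

/-- Two actions satisfying the exchange rule combine to an action of `P ⊗_ω Q`. -/
lemma act_distribMul {B : Type u} [Category.{v} B] [MonoidalCategory B] {P Q : B} [MonObj P]
    [MonObj Q] {ω : Q ⊗ P ⟶ P ⊗ Q} {X : B}
    {a : X ⊗ P ⟶ X} {r : X ⊗ Q ⟶ X}
    (ha : a ▷ P ≫ a = (α_ X P P).hom ≫ X ◁ μ[P] ≫ a)
    (hr : r ▷ Q ≫ r = (α_ X Q Q).hom ≫ X ◁ μ[Q] ≫ r)
    (h : r ▷ P ≫ a = ((α_ X Q P).hom ≫ X ◁ ω ≫ (α_ X P Q).inv ≫ a ▷ Q) ≫ r) :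
    ((α_ X P Q).inv ≫ a ▷ Q ≫ r) ▷ (P ⊗ Q) ≫ (α_ X P Q).inv ≫ a ▷ Q ≫ r =
      (α_ X (P ⊗ Q) (P ⊗ Q)).hom ≫ X ◁ distribMul P Q ω ≫ (α_ X P Q).inv ≫ a ▷ Q ≫ r := by
  dsimp only [distribMul]
  rw [MonoidalCategory.tensorHom_def]
  calc
    _ = 𝟙 ((X ⊗ (P ⊗ Q)) ⊗ (P ⊗ Q)) ⊗≫ a ▷ Q ▷ P ▷ Q ⊗≫ (r ▷ P ≫ a) ▷ Q ≫ r := by monoidal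
    _ = 𝟙 ((X ⊗ (P ⊗ Q)) ⊗ (P ⊗ Q)) ⊗≫ (a ▷ (Q ⊗ P) ≫ X ◁ ω) ▷ Q ⊗≫ a ▷ Q ▷ Q ⊗≫
        (r ▷ Q ≫ r) := by rw [h]; monoidal
    _ = 𝟙 ((X ⊗ (P ⊗ Q)) ⊗ (P ⊗ Q)) ⊗≫ X ◁ P ◁ ω ▷ Q ⊗≫ (a ▷ P ≫ a) ▷ Q ▷ Q ⊗≫
        (r ▷ Q ≫ r) := by rw [← whisker_exchange]; monoidal
    _ = 𝟙 ((X ⊗ (P ⊗ Q)) ⊗ (P ⊗ Q)) ⊗≫ X ◁ P ◁ ω ▷ Q ⊗≫ X ◁ μ[P] ▷ (Q ⊗ Q) ⊗≫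
        (a ▷ (Q ⊗ Q) ≫ X ◁ μ[Q]) ≫ r := by rw [ha, hr]; monoidal
    _ = _ := by rw [← whisker_exchange]; monoidal

/-- The product of `D`, transported to `P ⊗ Q`. -/
lemma prod_mul : F.prod ▷ (P ⊗ Q) ≫ D ◁ F.prod ≫ μ[D] = distribMul P Q ω ≫ F.prod := by
  have h2 := MonObj.one_mul D
  have h : (D ◁ F.prod ≫ μ[D]) ▷ (P ⊗ Q) ≫ D ◁ F.prod ≫ μ[D] =
      (α_ D (P ⊗ Q) (P ⊗ Q)).hom ≫ D ◁ distribMul P Q ω ≫ D ◁ F.prod ≫ μ[D] := by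
    have h1 : D ◁ F.prod ≫ μ[D] = (α_ D P Q).inv ≫ (D ◁ F.inl ≫ μ[D]) ▷ Q ≫ D ◁ F.inr ≫ μ[D] :=
      F.prod_act (RightMod.regular D)
    rw [h1]
    exact act_distribMul (F.resL (RightMod.regular D)).act_act
      (F.resR (RightMod.regular D)).act_act (F.actR_actL (RightMod.regular D))
  have h3 : ∀ {Y : B} (f : Y ⟶ D), (λ_ Y).inv ≫ η[D] ▷ Y ≫ D ◁ f ≫ μ[D] = f := fun f => by
    rw [← whisker_exchange_assoc, h2]
    simp
  have h4 := h3 (distribMul P Q ω ≫ F.prod)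
  have h5 := h3 F.prod
  rw [← h4, whiskerLeft_comp, Category.assoc]
  have h6 := congrArg (fun k => (λ_ _).inv ≫ η[D] ▷ ((P ⊗ Q) ⊗ (P ⊗ Q)) ≫
    (α_ D (P ⊗ Q) (P ⊗ Q)).inv ≫ k) h
  simp only [Iso.inv_hom_id_assoc] at h6
  rw [← h6]
  nth_rewrite 1 [← h5]
  monoidal

/-- A right `D`-module from an action of each of the factors. -/
noncomputable def modMk (M : RightMod P) (r : M.X ⊗ Q ⟶ M.X) (hr₁ : M.X ◁ η[Q] ≫ r = (ρ_ M.X).hom)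
    (hr₂ : r ▷ Q ≫ r = (α_ M.X Q Q).hom ≫ M.X ◁ μ[Q] ≫ r)
    (h : r ▷ P ≫ M.act = lawAct ω M ≫ r) : RightMod D where
  X := M.X
  act := M.X ◁ inv F.prod ≫ (α_ M.X P Q).inv ≫ M.act ▷ Q ≫ r
  act_one := by
    have := F.isBimonHom_inl
    have := F.isBimonHom_inr
    have h1 : η[D] ≫ inv F.prod = distribOne P Q := by
      rw [IsIso.comp_inv_eq]
      have h2 := IsMonHom.one_hom (f := F.inl)
      have h3 := IsMonHom.one_hom (f := F.inr)
      have h4 := MonObj.one_mul D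
      rw [distribOne, prod, Category.assoc, tensorHom_comp_tensorHom_assoc, h2, h3,
        MonoidalCategory.tensorHom_def', Category.assoc, h4]
      simp
    have h2 := M.act_one
    rw [← whiskerLeft_comp_assoc, h1, distribOne, MonoidalCategory.tensorHom_def]
    calc
      _ = 𝟙 (M.X ⊗ 𝟙_ B) ⊗≫ M.X ◁ η[P] ▷ 𝟙_ B ⊗≫ ((M.X ⊗ P) ◁ η[Q] ≫ M.act ▷ Q) ≫ r := by
        monoidal
      _ = 𝟙 (M.X ⊗ 𝟙_ B) ⊗≫ (M.X ◁ η[P] ≫ M.act) ▷ 𝟙_ B ⊗≫ M.X ◁ η[Q] ≫ r := by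
        rw [whisker_exchange]; monoidal
      _ = _ := by rw [h2, hr₁]; monoidal
  act_act := by
    have h1 := F.prod_mul
    have h2 : inv F.prod ▷ D ≫ (P ⊗ Q) ◁ inv F.prod ≫ distribMul P Q ω =
        μ[D] ≫ inv F.prod := by
      rw [← cancel_mono F.prod]
      simp only [Category.assoc, IsIso.inv_hom_id, Category.comp_id]
      rw [← h1, whisker_exchange_assoc, ← comp_whiskerRight_assoc, IsIso.inv_hom_id,
        ← whiskerLeft_comp_assoc, IsIso.inv_hom_id]
      simp
    have h3 := act_distribMul M.act_act hr₂ h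
    rw [comp_whiskerRight, Category.assoc, ← whisker_exchange_assoc, h3,
      ← whiskerLeft_comp_assoc, ← h2]
    simp

lemma actL_modMk (M : RightMod P) (r : M.X ⊗ Q ⟶ M.X) (hr₁ hr₂ h) :
    F.actL (F.modMk M r hr₁ hr₂ h) = M.act := by
  have := F.isBimonHom_inr
  have h1 : F.inl ≫ inv F.prod = (ρ_ P).inv ≫ P ◁ η[Q] := by
    have h2 := IsMonHom.one_hom (f := F.inr)
    have h3 := MonObj.mul_one D
    rw [IsIso.comp_inv_eq, prod, MonoidalCategory.tensorHom_def, Category.assoc,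
      Category.assoc, whisker_exchange_assoc, ← whiskerLeft_comp_assoc, h2, h3]
    simp
  change M.X ◁ F.inl ≫ M.X ◁ inv F.prod ≫ (α_ M.X P Q).inv ≫ M.act ▷ Q ≫ r = M.act
  rw [← whiskerLeft_comp_assoc, h1]
  calc
    _ = 𝟙 (M.X ⊗ P) ⊗≫ ((M.X ⊗ P) ◁ η[Q] ≫ M.act ▷ Q) ≫ r := by monoidal
    _ = 𝟙 (M.X ⊗ P) ⊗≫ M.act ▷ 𝟙_ B ≫ M.X ◁ η[Q] ≫ r := by rw [whisker_exchange]; monoidal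
    _ = _ := by rw [hr₁]; monoidal

lemma actR_modMk (M : RightMod P) (r : M.X ⊗ Q ⟶ M.X) (hr₁ hr₂ h) :
    F.actR (F.modMk M r hr₁ hr₂ h) = r := by
  have := F.isBimonHom_inl
  have h1 : F.inr ≫ inv F.prod = (λ_ Q).inv ≫ η[P] ▷ Q := by
    have h2 := IsMonHom.one_hom (f := F.inl)
    have h3 := MonObj.one_mul D
    rw [IsIso.comp_inv_eq, prod, MonoidalCategory.tensorHom_def', Category.assoc,
      Category.assoc, ← whisker_exchange_assoc, ← comp_whiskerRight_assoc, h2, h3]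
    simp
  have h2 := M.act_one
  change M.X ◁ F.inr ≫ M.X ◁ inv F.prod ≫ (α_ M.X P Q).inv ≫ M.act ▷ Q ≫ r = r
  rw [← whiskerLeft_comp_assoc, h1]
  calc
    _ = 𝟙 (M.X ⊗ Q) ⊗≫ (M.X ◁ η[P] ≫ M.act) ▷ Q ≫ r := by monoidal
    _ = _ := by rw [h2]; monoidal

end Factorization

/-! ### Half braidings and modules over the double -/

section Amnestic

lemma RightMod.eqToHom_hom {B : Type u} [Category.{v} B] [MonoidalCategory B] {A : B} [MonObj A]
    {M N : RightMod A} (h : M = N) :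
    RightMod.Hom.hom (eqToHom h) = eqToHom (congrArg RightMod.X h) := by
  subst h
  rfl

/-- A morphism of modules which underlies an identity forces an equality of modules. -/
lemma RightMod.eq_of_hom {B : Type u} [Category.{v} B] [MonoidalCategory B] {A : B} [MonObj A]
    {M N : RightMod A} (h : M.X = N.X) (g : M ⟶ N) (hg : g.hom = eqToHom h) : M = N := by
  obtain ⟨X, a, a₁, a₂⟩ := M
  obtain ⟨Y, b, b₁, b₂⟩ := N
  obtain rfl : X = Y := h
  refine RightMod.mk_congr ?_ _ _ _ _
  obtain ⟨g, hg'⟩ := g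
  obtain rfl : g = 𝟙 X := hg
  change a ≫ 𝟙 X = 𝟙 X ▷ A ≫ b at hg'
  simpa using hg'

variable {C : Type u} [Category.{v} C] [MonoidalCategory C]

lemma center_eqToHom_f {X Y : Center C} (h : X = Y) :
    Center.Hom.f (eqToHom h) = eqToHom (congrArg Sigma.fst h) := by
  subst h
  rfl

lemma halfBraiding_ext {X : C} {σ τ : HalfBraiding X} (h : ∀ U, (σ.β U).hom = (τ.β U).hom) :
    σ = τ := by
  obtain ⟨s, _, _⟩ := σ
  obtain ⟨t, _, _⟩ := τ
  obtain rfl : s = t := funext fun U => Iso.ext (h U)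
  rfl

/-- A morphism of the center which underlies an identity forces an equality of objects. -/
lemma center_eq_of_hom {X Y : Center C} (h : X.1 = Y.1) (g : X ⟶ Y) (hg : g.f = eqToHom h) :
    X = Y := by
  obtain ⟨X, σ⟩ := X
  obtain ⟨Y, τ⟩ := Y
  obtain rfl : X = Y := h
  obtain ⟨g, hg'⟩ := g
  obtain rfl : g = 𝟙 X := hg
  have : σ = τ := halfBraiding_ext fun U => by
    have h := hg' U
    change 𝟙 X ▷ U ≫ (τ.β U).hom = (σ.β U).hom ≫ U ◁ 𝟙 X at h
    simpa using h.symm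
  rw [this]

/-- Half braidings are normalized. -/
lemma halfBraiding_unit {X : C} (σ : HalfBraiding X) :
    (σ.β (𝟙_ C)).hom = (ρ_ X).hom ≫ (λ_ X).inv := by
  have h1 := σ.monoidal (𝟙_ C) (𝟙_ C)
  have h2 := σ.naturality (λ_ (𝟙_ C)).hom
  rw [h1] at h2
  have h3 : ((ρ_ X).inv ≫ (σ.β (𝟙_ C)).hom ≫ (λ_ X).hom) ≫ (ρ_ X).inv ≫ (σ.β (𝟙_ C)).hom ≫
      (λ_ X).hom = ((ρ_ X).inv ≫ (σ.β (𝟙_ C)).hom ≫ (λ_ X).hom) ≫ 𝟙 X := by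
    have h4 := congrArg (fun k => (ρ_ X).inv ≫ X ◁ (λ_ (𝟙_ C)).inv ≫ k ≫ (λ_ X).hom) h2
    simp only [whiskerLeft_inv_hom_assoc, Category.assoc] at h4
    rw [Category.comp_id]
    refine Eq.trans ?_ h4.symm
    monoidal
  rw [cancel_epi] at h3
  rw [← cancel_epi (ρ_ X).inv, ← cancel_mono (λ_ X).hom, Category.assoc, h3]
  simp

/-- An isomorphism in the center of a category of modules, from an isomorphism of underlying
objects. -/
def centerIsoMk {B : Type u} [Category.{v} B] [MonoidalCategory B] [BraidedCategory B] {A : B}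
    [BimonObj A] {X Y : Center (RightMod A)} (e : X.1.X ≅ Y.1.X)
    (h₁ : X.1.act ≫ e.hom = e.hom ▷ A ≫ Y.1.act)
    (h₂ : ∀ V : RightMod A, e.hom ▷ V.X ≫ RightMod.Hom.hom (Y.2.β V).hom =
      RightMod.Hom.hom (X.2.β V).hom ≫ V.X ◁ e.hom) : X ≅ Y where
  hom := ⟨(RightMod.isoMk e h₁).hom, fun V => RightMod.hom_ext _ _ (h₂ V)⟩
  inv := ⟨(RightMod.isoMk e h₁).inv, fun V => RightMod.hom_ext _ _ (by
    have h := h₂ V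
    change e.inv ▷ V.X ≫ RightMod.Hom.hom (X.2.β V).hom =
      RightMod.Hom.hom (Y.2.β V).hom ≫ V.X ◁ e.inv
    obtain ⟨x, hx⟩ : ∃ x : X.1.X ⊗ V.X ⟶ V.X ⊗ X.1.X, x = RightMod.Hom.hom (X.2.β V).hom :=
      ⟨_, rfl⟩
    obtain ⟨y, hy⟩ : ∃ y : Y.1.X ⊗ V.X ⟶ V.X ⊗ Y.1.X, y = RightMod.Hom.hom (Y.2.β V).hom :=
      ⟨_, rfl⟩
    have h' : e.hom ▷ V.X ≫ y = x ≫ V.X ◁ e.hom := by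
      rw [hx, hy]
      exact h
    have h2 : e.inv ▷ V.X ≫ x = y ≫ V.X ◁ e.inv := by
      rw [← cancel_epi (e.hom ▷ V.X), reassoc_of% h']
      simp
    rw [hx, hy] at h2
    exact h2)⟩
  hom_inv_id := Center.ext _ _ (RightMod.isoMk e h₁).hom_inv_id
  inv_hom_id := Center.ext _ _ (RightMod.isoMk e h₁).inv_hom_id

lemma comp_id_eq_id_whiskerRight_comp {X P : C} {a b : X ⊗ P ⟶ X} (h : a = b) :
    a ≫ 𝟙 X = 𝟙 X ▷ P ≫ b := by
  rw [h]; simp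

lemma id_whiskerRight_comp_eq_comp_whiskerLeft_id {X V : C} {a b : X ⊗ V ⟶ V ⊗ X} (h : b = a) :
    𝟙 X ▷ V ≫ b = a ≫ V ◁ 𝟙 X := by
  rw [h]; simp

end Amnestic

section ToCenter

variable {B : Type u} [Category.{v} B] [MonoidalCategory B] [BraidedCategory B]

namespace UnivCoact

/-- The half braiding of a tensor product of `Z`-modules. -/
lemma halfBraid_tensor_left {A Z : B} [BimonObj A] [BimonObj Z] {U : UnivCoact A Z}
    (hU : U.Compat μ[Z] η[Z] Δ[Z] ε[Z]) (M N : RightMod Z) (V : RightMod A) :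
    U.halfBraid (M ⊗ N) V = (α_ M.X N.X V.X).hom ≫ M.X ◁ U.halfBraid N V ≫
      (α_ M.X V.X N.X).inv ≫ U.halfBraid M V ▷ N.X ≫ (α_ V.X M.X N.X).hom := by
  have h1 := hU.cent_comul M.X N.X V
  change U.cent (M.X ⊗ N.X) V ≫ V.X ◁ ((M.X ⊗ N.X) ◁ Δ[Z] ≫ tensorμ M.X N.X Z Z ≫
    (M.act ⊗ₘ N.act)) = _
  have h2 : (M.X ⊗ N.X) ◁ Δ[Z] ≫ tensorμ M.X N.X Z Z ≫ (M.act ⊗ₘ N.act) =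
    freeComul Z M.X N.X ≫ (M.act ⊗ₘ N.act) := by simp [freeComul]
  rw [h2, whiskerLeft_comp, reassoc_of% h1]
  dsimp only [halfBraid]
  rw [MonoidalCategory.tensorHom_def']
  calc
    _ = 𝟙 ((M.X ⊗ N.X) ⊗ V.X) ⊗≫ M.X ◁ U.cent N.X V ⊗≫ (U.cent M.X V ▷ (N.X ⊗ Z) ≫
        (V.X ⊗ (M.X ⊗ Z)) ◁ N.act) ⊗≫ V.X ◁ M.act ▷ N.X ⊗≫ 𝟙 (V.X ⊗ (M.X ⊗ N.X)) := by monoidal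
    _ = _ := by rw [← whisker_exchange]; monoidal

lemma halfBraid_unit_left {A Z : B} [BimonObj A] [BimonObj Z] {U : UnivCoact A Z}
    (hU : U.Compat μ[Z] η[Z] Δ[Z] ε[Z]) (V : RightMod A) :
    U.halfBraid (𝟙_ (RightMod Z)) V = (λ_ V.X).hom ≫ (ρ_ V.X).inv := by
  have h1 := hU.counit V
  change U.cent (𝟙_ B) V ≫ V.X ◁ (𝟙_ B ◁ ε[Z] ≫ (ρ_ (𝟙_ B)).hom) = _
  rw [cent_def, slide_unit, ← h1]
  simp

end UnivCoact

variable [RigidCategory B] {A Z D : B} [HopfObj A] [BimonObj Z] [BimonObj D]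
  {U : UnivCoact A Z} {T : A ⟶ A} {ω : Z ⊗ A ⟶ A ⊗ Z}

open UnivCoact

namespace Factorization

variable (F : Factorization ω D) (hω : U.IsLaw ω T) (hT : IsSkewAntipode A T)
  (hU : U.Compat μ[Z] η[Z] Δ[Z] ε[Z])

/-- The action of the second factor is linear for the first. -/
def actRHom (M : RightMod D) : hω.zMod hT (F.resL M) ⟶ F.resL M where
  hom := F.actR M
  act_hom := (F.actR_actL M).symm

/-- The linear half braiding of a module over the double. -/
def braidHom (M : RightMod D) (N : RightMod A) : F.resL M ⊗ N ⟶ N ⊗ F.resL M :=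
  hω.centHom hT (F.resL M) N ≫ N ◁ F.actRHom hω hT M

/-- The half braiding of a module over the double. -/
noncomputable def halfBraiding (M : RightMod D) : HalfBraiding (F.resL M) where
  β N :=
    RightMod.isoMk (M := F.resL M ⊗ N) (N := N ⊗ F.resL M)
      (@asIso _ _ _ _ (U.halfBraid (F.resR M) N) (hU.isIso_halfBraid (F.resR M) N))
      (F.braidHom hω hT M N).act_hom
  monoidal N N' := RightMod.hom_ext _ _ (hU.halfBraid_tensor (F.resR M) N N')
  naturality f := RightMod.hom_ext _ _ (U.halfBraid_natural (F.resR M) f)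

/-- The functor from modules over the double of `A` to the center of the category of
`A`-modules. -/
noncomputable def toCenter : RightMod D ⥤ Center (RightMod A) where
  obj M := ⟨F.resL M, F.halfBraiding hω hT hU M⟩
  map {M N} g :=
    { f := F.resLMap g
      comm := fun V => RightMod.hom_ext _ _ (by
        have h := F.actR_hom g
        have h1 := U.cent_natural_left g.hom V
        change g.hom ▷ V.X ≫ U.cent N.X V ≫ V.X ◁ F.actR N =
          (U.cent M.X V ≫ V.X ◁ F.actR M) ≫ V.X ◁ g.hom
        rw [reassoc_of% h1, Category.assoc, ← whiskerLeft_comp, ← whiskerLeft_comp, h]) }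

lemma toCenter_map_f_hom {M N : RightMod D} (g : M ⟶ N) :
    RightMod.Hom.hom (Center.Hom.f ((F.toCenter hω hT hU).map g)) = g.hom := rfl

instance : (F.toCenter hω hT hU).Faithful where
  map_injective {_ _ f g} h := RightMod.hom_ext f g
    (congrArg (fun k => RightMod.Hom.hom (Center.Hom.f k)) h)

instance : (F.toCenter hω hT hU).Full where
  map_surjective {M N} f := by
    obtain ⟨φ, hφ⟩ : ∃ φ : M.X ⟶ N.X, φ = f.f.hom := ⟨_, rfl⟩
    have hA : F.actL M ≫ φ = φ ▷ A ≫ F.actL N := by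
      rw [hφ]
      exact f.f.act_hom
    refine ⟨⟨φ, F.act_hom_of_res φ hA ?_⟩, Center.ext _ _ (RightMod.hom_ext _ _ hφ)⟩
    -- Compatibility with the half braidings is linearity for `Z`, tested on the universal family.
    refine (U.jointlyEpic_cent M.X).hom_ext fun V => ?_
    have h : φ ▷ V.X ≫ U.cent N.X V ≫ V.X ◁ F.actR N =
        (U.cent M.X V ≫ V.X ◁ F.actR M) ≫ V.X ◁ φ := by
      rw [hφ]
      exact congrArg RightMod.Hom.hom (f.comm V)
    have h1 := U.cent_natural_left φ V
    rw [reassoc_of% h1, Category.assoc] at h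
    rw [whiskerLeft_comp, whiskerLeft_comp, h]

/-- A `D`-module is determined by the associated half braiding: the identity of the common
underlying object lifts to a morphism, the functor being full. -/
lemma toCenter_obj_injective : Function.Injective (F.toCenter hω hT hU).obj := fun M N h => by
  refine RightMod.eq_of_hom (congrArg (fun c => c.1.X) h)
    ((F.toCenter hω hT hU).preimage (eqToHom h)) ?_
  rw [← F.toCenter_map_f_hom hω hT hU, Functor.map_preimage, center_eqToHom_f,
    RightMod.eqToHom_hom]
  rfl

/-- Every half braiding on an `A`-module `V` comes from a `D`-module: by universality it is given
by a morphism `V ⊗ Z ⟶ V`, which is an action since half braidings are multiplicative, and which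
satisfies the exchange rule with the action of `A` since half braidings are linear. -/
lemma toCenter_obj_surjective : Function.Surjective (F.toCenter hω hT hU).obj := fun c => by
  obtain ⟨V, σ⟩ := c
  obtain ⟨k, hk⟩ : ∃ k : ∀ N : RightMod A, V.X ⊗ N.X ⟶ N.X ⊗ V.X,
    k = fun N => RightMod.Hom.hom (σ.β N).hom := ⟨_, rfl⟩
  have hk' : ∀ N, RightMod.Hom.hom (σ.β N).hom = k N := fun N => by rw [hk]
  obtain ⟨r, hr⟩ := U.exists_lift k (fun {N N'} f => by
    rw [hk]
    exact congrArg RightMod.Hom.hom (σ.naturality f))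
  replace hr : ∀ N, U.cent V.X N ≫ N.X ◁ r = k N := hr
  -- The unit law of the action is the normalization of half braidings.
  have hr₁ : V.X ◁ η[Z] ≫ r = (ρ_ V.X).hom := by
    have h1 : k (𝟙_ (RightMod A)) = (ρ_ V.X).hom ≫ (λ_ V.X).inv := by
      rw [hk]
      exact congrArg RightMod.Hom.hom (halfBraiding_unit σ)
    have h2 := hU.cent_one V.X
    rw [← hr, h2] at h1
    have h3 : (V.X ◁ η[Z] ≫ (λ_ (V.X ⊗ Z)).inv) ≫ 𝟙_ B ◁ r =
        (ρ_ V.X).hom ≫ (λ_ V.X).inv := h1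
    rw [Category.assoc, ← leftUnitor_inv_naturality, ← Category.assoc, cancel_mono] at h3
    exact h3
  -- Associativity is the hexagon of half braidings, tested on pairs of modules.
  have hr₂ : r ▷ Z ≫ r = (α_ V.X Z Z).hom ≫ V.X ◁ μ[Z] ≫ r := by
    refine (U.jointlyEpic_cent (V.X ⊗ Z)).hom_ext fun N' => ?_
    refine U.jointlyEpic_cent V.X _ _ fun N => ?_
    have h1 : k (N ⊗ N') = (α_ V.X N.X N'.X).inv ≫ k N ▷ N'.X ≫ (α_ N.X V.X N'.X).hom ≫
        N.X ◁ k N' ≫ (α_ N.X N'.X V.X).inv := by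
      rw [hk]
      exact congrArg RightMod.Hom.hom (σ.monoidal N N')
    have h2 := hU.cent_tensor V.X N N'
    have h3 := U.cent_natural_left r N'
    rw [← hr (N ⊗ N'), h2, ← hr N, ← hr N'] at h1
    have h4 : ((α_ V.X N.X N'.X).inv ≫ U.cent V.X N ▷ N'.X ≫ (α_ N.X (V.X ⊗ Z) N'.X).hom ≫
      N.X ◁ (U.cent (V.X ⊗ Z) N' ≫ N'.X ◁ ((α_ V.X Z Z).hom ≫ V.X ◁ μ[Z])) ≫
        (α_ N.X N'.X (V.X ⊗ Z)).inv) ≫ (N.X ⊗ N'.X) ◁ r =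
        (α_ V.X N.X N'.X).inv ≫ (U.cent V.X N ≫ N.X ◁ r) ▷ N'.X ≫ (α_ N.X V.X N'.X).hom ≫
        N.X ◁ (U.cent V.X N' ≫ N'.X ◁ r) ≫ (α_ N.X N'.X V.X).inv := h1
    rw [← cancel_epi (α_ V.X N.X N'.X).inv, ← cancel_mono (α_ N.X N'.X V.X).inv]
    calc
      _ = (α_ V.X N.X N'.X).inv ≫ U.cent V.X N ▷ N'.X ≫ (α_ N.X (V.X ⊗ Z) N'.X).hom ≫
          N.X ◁ ((U.cent (V.X ⊗ Z) N' ≫ N'.X ◁ r ▷ Z) ≫ N'.X ◁ r) ≫ (α_ N.X N'.X V.X).inv := by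
        monoidal
      _ = (α_ V.X N.X N'.X).inv ≫ (U.cent V.X N ≫ N.X ◁ r) ▷ N'.X ≫ (α_ N.X V.X N'.X).hom ≫
          N.X ◁ (U.cent V.X N' ≫ N'.X ◁ r) ≫ (α_ N.X N'.X V.X).inv := by
        rw [← h3]; monoidal
      _ = _ := by
        rw [← h4]; monoidal
  -- The exchange rule holds because `r` is linear, the half braiding being so.
  have h : r ▷ A ≫ V.act = lawAct ω V ≫ r :=
    (hT.act_hom_of_jointlyEpic (X := hω.zMod hT V) (V := V) (e := fun N => hω.centHom hT V N)
      (U.jointlyEpic_cent V.X) r (fun N => (σ.β N).hom) fun N => by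
        rw [hk']
        exact hr N).symm
  have h1 : F.resL (F.modMk V r hr₁ hr₂ h) = V := by
    have h2 := F.actL_modMk V r hr₁ hr₂ h
    obtain ⟨X, a, a₁, a₂⟩ := V
    exact RightMod.mk_congr h2 _ _ _ _
  refine ⟨F.modMk V r hr₁ hr₂ h, center_eq_of_hom h1 ⟨eqToHom h1, fun N => ?_⟩ rfl⟩
  refine RightMod.hom_ext _ _ ?_
  have h2 : ∀ (q : V.X ⊗ Z ⟶ V.X) (e : V.X ⟶ V.X), q = r → e = 𝟙 V.X →
      e ▷ N.X ≫ k N = (U.cent V.X N ≫ N.X ◁ q) ≫ N.X ◁ e := fun q e hq he => by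
    rw [he, hq, hr]
    simp
  rw [hk] at h2
  exact h2 _ _ (F.actR_modMk V r hr₁ hr₂ h) (RightMod.eqToHom_hom h1)

/-- The monoidal structure of the functor to the center; its structure morphisms underlie
identities. -/
noncomputable def toCenterCoreMonoidal : (F.toCenter hω hT hU).CoreMonoidal where
  εIso := centerIsoMk (X := 𝟙_ (Center (RightMod A)))
    (Y := (F.toCenter hω hT hU).obj (𝟙_ (RightMod D))) (Iso.refl (𝟙_ B))
    (comp_id_eq_id_whiskerRight_comp F.actL_unit.symm)
    (fun V => id_whiskerRight_comp_eq_comp_whiskerLeft_id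
      ((congrArg (fun k : 𝟙_ B ⊗ Z ⟶ 𝟙_ B => U.cent (𝟙_ B) V ≫ V.X ◁ k) F.actR_unit).trans
        (halfBraid_unit_left hU V)))
  μIso M N := centerIsoMk (X := (F.toCenter hω hT hU).obj M ⊗ (F.toCenter hω hT hU).obj N)
    (Y := (F.toCenter hω hT hU).obj (M ⊗ N)) (Iso.refl (M.X ⊗ N.X))
    (comp_id_eq_id_whiskerRight_comp (F.actL_tensor M N).symm)
    (fun V => id_whiskerRight_comp_eq_comp_whiskerLeft_id
      ((congrArg (fun k : (M.X ⊗ N.X) ⊗ Z ⟶ M.X ⊗ N.X => U.cent (M.X ⊗ N.X) V ≫ V.X ◁ k)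
        (F.actR_tensor M N)).trans (halfBraid_tensor_left hU (F.resR M) (F.resR N) V)))
  μIso_hom_natural_left {M N} f P := Center.ext _ _ (RightMod.hom_ext _ _ (by
    change f.hom ▷ P.X ≫ 𝟙 (N.X ⊗ P.X) = 𝟙 (M.X ⊗ P.X) ≫ f.hom ▷ P.X
    simp))
  μIso_hom_natural_right {M N} P f := Center.ext _ _ (RightMod.hom_ext _ _ (by
    change P.X ◁ f.hom ≫ 𝟙 (P.X ⊗ N.X) = 𝟙 (P.X ⊗ M.X) ≫ P.X ◁ f.hom
    simp))
  associativity M N P := Center.ext _ _ (RightMod.hom_ext _ _ (by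
    change 𝟙 (M.X ⊗ N.X) ▷ P.X ≫ 𝟙 ((M.X ⊗ N.X) ⊗ P.X) ≫ (α_ M.X N.X P.X).hom =
      (α_ M.X N.X P.X).hom ≫ M.X ◁ 𝟙 (N.X ⊗ P.X) ≫ 𝟙 (M.X ⊗ (N.X ⊗ P.X))
    simp))
  left_unitality M := Center.ext _ _ (RightMod.hom_ext _ _ (by
    change (λ_ M.X).hom = 𝟙 (𝟙_ B) ▷ M.X ≫ 𝟙 (𝟙_ B ⊗ M.X) ≫ (λ_ M.X).hom
    simp))
  right_unitality M := Center.ext _ _ (RightMod.hom_ext _ _ (by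
    change (ρ_ M.X).hom = M.X ◁ 𝟙 (𝟙_ B) ≫ 𝟙 (M.X ⊗ 𝟙_ B) ≫ (ρ_ M.X).hom
    simp))

end Factorization

end ToCenter

/-! ### Isomorphisms of braided categories from bijective functors -/

section BraidedIso

open Functor.LaxMonoidal Functor.OplaxMonoidal

section Inverse

variable {C : Type u} [Category.{v} C] {D : Type u'} [Category.{v'} D] (F : C ⥤ D) [F.Full]
  [F.Faithful] (hF : Function.Bijective F.obj)

/-- The strict inverse of a fully faithful functor which is bijective on objects. -/
noncomputable def strictInverse : D ⥤ C where
  obj X := (hF.2 X).choose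
  map {X Y} f := F.preimage
    (eqToHom (hF.2 X).choose_spec ≫ f ≫ eqToHom (hF.2 Y).choose_spec.symm)
  map_id X := F.map_injective (by simp)
  map_comp f g := F.map_injective (by simp)

lemma strictInverse_comp : strictInverse F hF ⋙ F = 𝟭 D :=
  CategoryTheory.Functor.ext (fun X => (hF.2 X).choose_spec) (fun X Y f => by
    simp [strictInverse])

lemma comp_strictInverse : F ⋙ strictInverse F hF = 𝟭 C :=
  CategoryTheory.Functor.ext (fun X => hF.1 (hF.2 (F.obj X)).choose_spec) (fun X Y f =>
    F.map_injective (by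
      rw [Functor.map_comp, Functor.map_comp, eqToHom_map, eqToHom_map]
      simp [strictInverse]))

end Inverse

variable {C : Type u} [Category.{v} C] [MonoidalCategory C] [BraidedCategory C]
  {D : Type u'} [Category.{v'} D] [MonoidalCategory D] [BraidedCategory D]

/-- A fully faithful braided functor which is bijective on objects is an isomorphism of braided
categories. -/
noncomputable def BraidedIso.ofBijective (F : C ⥤ D) [h : F.Braided] [F.Full] [F.Faithful]
    (hF : Function.Bijective F.obj) : BraidedIso C D where
  functor := F
  braided := h
  inverse := strictInverse F hF
  functor_comp_inverse := comp_strictInverse F hF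
  inverse_comp_functor := strictInverse_comp F hF

/-- The inverse of a braided equivalence is braided. -/
@[reducible]
noncomputable def inverseBraided (e : C ≌ D) [e.functor.Braided] : e.inverse.Braided :=
  letI := e.inverseMonoidal
  have : e.IsMonoidal :=
    letI := e.toAdjunction.rightAdjointLaxMonoidal
    (inferInstance : e.toAdjunction.IsMonoidal)
  { braided := fun X Y => by
      have h := e.functor_map_μ_inverse_comp_counitIso_hom_app_tensor X Y
      have h' := e.functor_map_μ_inverse_comp_counitIso_hom_app_tensor Y X
      apply e.functor.map_injective
      rw [← cancel_mono (e.counitIso.hom.app (Y ⊗ X))]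
      have h2 := e.counitIso.hom.naturality (β_ X Y).hom
      simp only [Functor.comp_map, Functor.id_map] at h2
      rw [Functor.map_comp, Functor.map_comp, Category.assoc, Category.assoc, h2, reassoc_of% h,
        h', Functor.map_braiding]
      simp }

/-- The equivalence underlying an isomorphism of braided categories. -/
def BraidedIso.equivalence (e : BraidedIso C D) : C ≌ D where
  functor := e.functor
  inverse := e.inverse
  unitIso := eqToIso e.functor_comp_inverse.symm
  counitIso := eqToIso e.inverse_comp_functor
  functor_unitIso_comp X := by
    simp [eqToHom_map]

/-- The inverse of an isomorphism of braided categories. -/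
noncomputable def BraidedIso.symm (e : BraidedIso C D) : BraidedIso D C where
  functor := e.inverse
  braided :=
    have : e.equivalence.functor.Braided := e.braided
    inverseBraided e.equivalence
  inverse := e.functor
  functor_comp_inverse := e.inverse_comp_functor
  inverse_comp_functor := e.functor_comp_inverse

/-- The composite of isomorphisms of braided categories. -/
def BraidedIso.trans {E : Type*} [Category* E] [MonoidalCategory E] [BraidedCategory E]
    (e : BraidedIso C D) (f : BraidedIso D E) : BraidedIso C E where
  functor := e.functor ⋙ f.functor
  braided :=
    have := e.braided
    have := f.braided
    inferInstance
  inverse := f.inverse ⋙ e.inverse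
  functor_comp_inverse := by
    rw [Functor.assoc, ← Functor.assoc f.functor, f.functor_comp_inverse, Functor.id_comp,
      e.functor_comp_inverse]
  inverse_comp_functor := by
    rw [Functor.assoc, ← Functor.assoc e.inverse, e.inverse_comp_functor, Functor.id_comp,
      f.inverse_comp_functor]

variable (C) in
/-- A braided category is isomorphic to its monoidal opposite. -/
def BraidedIso.mop : BraidedIso C Cᴹᵒᵖ where
  functor := mopFunctor C
  braided := inferInstance
  inverse := unmopFunctor C
  functor_comp_inverse := rfl
  inverse_comp_functor := rfl

/-- A fully faithful functor along which a braiding is pulled back is braided. -/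
@[reducible]
noncomputable def braidedOfFullyFaithful {C : Type u} [Category.{v} C] [MonoidalCategory C]
    (F : C ⥤ D) [F.Monoidal] [F.Full] [F.Faithful] :
    letI := BraidedCategory.ofFullyFaithful F
    F.Braided :=
  letI := BraidedCategory.ofFullyFaithful F
  { braided := fun X Y => by
      change Functor.LaxMonoidal.μ F X Y ≫ F.map (F.preimage (δ F X Y ≫
        (β_ (F.obj X) (F.obj Y)).hom ≫ Functor.LaxMonoidal.μ F Y X)) = _
      simp }

end BraidedIso

/-! ### R-matrices and braidings of right modules -/

section RMatrix

/-- The action on a tensor product of free modules. -/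
lemma RightMod.free_tensor_act {B : Type u} [Category.{v} B] [MonoidalCategory B]
    [BraidedCategory B] {H : B} [BimonObj H] (X Y : B) :
    (RightMod.free H X ⊗ RightMod.free H Y).act =
      freeComul H (X ⊗ H) (Y ⊗ H) ≫ (freeMul H X ⊗ₘ freeMul H Y) := by
  dsimp only [freeComul]
  rw [Category.assoc]
  rfl

variable {B : Type u} [Category.{v} B] [MonoidalCategory B] [BraidedCategory B]
  [RigidCategory B] {W : Cowedge (dualTensor B)} {H : B}

/-- The family encoded by a morphism `C ⊗ C ⟶ H ⊗ H` is natural. -/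
lemma rFamily_natural (r : W.pt ⊗ W.pt ⟶ H ⊗ H) {X X' Y Y' : B} (f : X ⟶ X') (g : Y ⟶ Y') :
    (f ⊗ₘ g) ≫ rFamily W r X' Y' = rFamily W r X Y ≫ (g ▷ H ⊗ₘ f ▷ H) := by
  have h1 := coact_natural W f
  have h2 := coact_natural W g
  have h3 := tensorμ_natural f (𝟙 W.pt) g (𝟙 W.pt)
  have h4 := tensorμ_natural_left g f H H
  have h5 := braiding_naturality f g
  dsimp only [rFamily]
  rw [tensorHom_id, tensorHom_id, id_tensorHom_id] at h3
  have h6 : ((f ⊗ₘ g) ⊗ₘ 𝟙 (W.pt ⊗ W.pt)) ≫ ((β_ X' Y').hom ⊗ₘ r) =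
      ((β_ X Y).hom ⊗ₘ r) ≫ (g ⊗ₘ f) ▷ (H ⊗ H) := by
    rw [← tensorHom_id, tensorHom_comp_tensorHom, tensorHom_comp_tensorHom, h5,
      Category.id_comp, Category.comp_id]
  rw [tensorHom_comp_tensorHom_assoc, h1, h2, ← tensorHom_comp_tensorHom_assoc, reassoc_of% h3,
    reassoc_of% h6, h4]
  simp only [Category.assoc]

lemma rFamily_natural_left (r : W.pt ⊗ W.pt ⟶ H ⊗ H) {X X' : B} (f : X ⟶ X') (Y : B) :
    f ▷ Y ≫ rFamily W r X' Y = rFamily W r X Y ≫ (Y ⊗ H) ◁ f ▷ H := by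
  have h := rFamily_natural r f (𝟙 Y)
  rw [tensorHom_id, id_whiskerRight, id_tensorHom] at h
  exact h

lemma rFamily_natural_right (r : W.pt ⊗ W.pt ⟶ H ⊗ H) (X : B) {Y Y' : B} (g : Y ⟶ Y') :
    X ◁ g ≫ rFamily W r X Y' = rFamily W r X Y ≫ g ▷ H ▷ (X ⊗ H) := by
  have h := rFamily_natural r (𝟙 X) g
  rw [id_tensorHom, id_whiskerRight, tensorHom_id] at h
  exact h

/-- Exchanging `X` and `Y` after coactions, when the coefficients of `X` are discarded by a
counit. -/
lemma tensorμ_of_counit {B : Type u} [Category.{v} B] [MonoidalCategory B] [BraidedCategory B]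
    {A C Q H X Y : B} (d : X ⟶ X ⊗ C) (c : Y ⟶ Y ⊗ C) {e : C ⟶ 𝟙_ B}
    (h1 : d ≫ X ◁ e = (ρ_ X).inv) (k : C ⟶ A ⊗ Q) (i : A ⟶ H) (j : Q ⟶ H) :
    (d ⊗ₘ c) ≫ tensorμ X C Y C ≫ ((β_ X Y).hom ⊗ₘ (e ▷ C ≫ (λ_ C).hom ≫ k ≫ (i ⊗ₘ j))) ≫
        tensorμ Y X H H =
      (X ◁ (c ≫ Y ◁ k ≫ (α_ Y A Q).inv) ≫ (α_ X (Y ⊗ A) Q).inv ≫ (β_ X (Y ⊗ A)).hom ▷ Q ≫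
        (α_ (Y ⊗ A) X Q).hom) ≫ (Y ◁ i ⊗ₘ X ◁ j) := by
  have h2 := braiding_naturality_left (e) Y
  rw [braiding_tensorUnit_left] at h2
  have h3 := tensorμ_natural_right Y X i j
  have h4 : ((β_ X Y).hom ⊗ₘ (e ▷ C ≫ (λ_ C).hom ≫ k ≫ (i ⊗ₘ j))) ≫ tensorμ Y X H H =
      (β_ X Y).hom ▷ (C ⊗ C) ≫ (Y ⊗ X) ◁ (e ▷ C ≫ (λ_ C).hom ≫ k) ≫
        tensorμ Y X A Q ≫ (Y ◁ i ⊗ₘ X ◁ j) := by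
    rw [MonoidalCategory.tensorHom_def, ← h3]
    simp
  rw [h4, MonoidalCategory.tensorHom_def (d) c, braiding_tensor_right_hom]
  obtain ⟨g, hg⟩ : ∃ g, g = (Y ◁ i ⊗ₘ X ◁ j) := ⟨_, rfl⟩
  rw [← hg]
  dsimp only [tensorμ]
  calc
    _ = 𝟙 (X ⊗ Y) ⊗≫ d ▷ Y ⊗≫ X ◁ C ◁ c ⊗≫ X ◁ (β_ C Y).hom ▷ C ⊗≫
        ((β_ X Y).hom ▷ C ≫ (Y ⊗ X) ◁ e) ▷ C ⊗≫ (Y ⊗ X) ◁ k ⊗≫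
        Y ◁ (β_ X A).hom ▷ Q ⊗≫ g := by monoidal
    _ = 𝟙 (X ⊗ Y) ⊗≫ d ▷ Y ⊗≫ X ◁ C ◁ c ⊗≫ X ◁ ((β_ C Y).hom ≫ Y ◁ e) ▷ C ⊗≫
        (β_ X Y).hom ▷ C ⊗≫ (Y ⊗ X) ◁ k ⊗≫
        Y ◁ (β_ X A).hom ▷ Q ⊗≫ g := by
      rw [← whisker_exchange (β_ X Y).hom e]; monoidal
    _ = 𝟙 (X ⊗ Y) ⊗≫ d ▷ Y ⊗≫ X ◁ (C ◁ c ≫ e ▷ (Y ⊗ C)) ⊗≫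
        (β_ X Y).hom ▷ C ⊗≫ (Y ⊗ X) ◁ k ⊗≫
        Y ◁ (β_ X A).hom ▷ Q ⊗≫ g := by
      rw [← h2]; monoidal
    _ = 𝟙 (X ⊗ Y) ⊗≫ (d ≫ X ◁ e) ▷ Y ⊗≫ X ◁ c ⊗≫
        ((β_ X Y).hom ▷ C ≫ (Y ⊗ X) ◁ k) ⊗≫
        Y ◁ (β_ X A).hom ▷ Q ⊗≫ g := by
      rw [whisker_exchange e c]; monoidal
    _ = 𝟙 (X ⊗ Y) ⊗≫ X ◁ c ⊗≫ ((X ⊗ Y) ◁ k ≫ (β_ X Y).hom ▷ (A ⊗ Q)) ⊗≫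
        Y ◁ (β_ X A).hom ▷ Q ⊗≫ g := by
      rw [h1, ← whisker_exchange (β_ X Y).hom k]; monoidal
    _ = _ := by monoidal

/-- The family encoded by a morphism `C ⊗ C ⟶ H ⊗ H` which factors through the counit of the first
factor and through `C ⟶ A ⊗ Z(A)`. -/
lemma rFamily_of_coevZ (hW : IsColimit W) {A : B} (i : A ⟶ H) (j : centralizerObj W A ⟶ H)
    (X Y : B) :
    rFamily W (coendCounit hW ▷ W.pt ≫ (λ_ W.pt).hom ≫ coevZ W A ≫ (i ⊗ₘ j)) X Y =
      centralizing W A X Y ≫ (Y ◁ i ⊗ₘ X ◁ j) := by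
  have h1 : coact W X ≫ X ◁ coendCounit hW = (ρ_ X).inv :=
    coact_coendLift hW (𝟙_ B) (fun Y => (ρ_ Y).inv) (fun f => by simp) X
  exact tensorμ_of_counit (coact W X) (coact W Y) h1 (coevZ W A) i j

end RMatrix

/-! ### R-matrices from braidings -/

section Generic

variable {B : Type u} [Category.{v} B] [MonoidalCategory B] [BraidedCategory B]
  [RigidCategory B] {W : Cowedge (dualTensor B)} {H : B} [BimonObj H]
  {r : W.pt ⊗ W.pt ⟶ H ⊗ H}

lemma freeUnit_free_tensor_act (X Y : B) :
    (freeUnit H X ⊗ₘ freeUnit H Y) ▷ H ≫ freeComul H (X ⊗ H) (Y ⊗ H) ≫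
      (freeMul H X ⊗ₘ freeMul H Y) = freeComul H X Y := by
  have h := freeComul_natural H (freeUnit H X) (freeUnit H Y)
  rw [reassoc_of% h, tensorHom_comp_tensorHom, freeUnit_whiskerRight_freeMul,
    freeUnit_whiskerRight_freeMul]
  simp

/-- The braiding of free modules restricts to the family encoded by `r`. -/
lemma freeUnit_rightBraid (X Y : B) :
    (freeUnit H X ⊗ₘ freeUnit H Y) ≫ rFamily W r (X ⊗ H) (Y ⊗ H) ≫
      (freeMul H Y ⊗ₘ freeMul H X) = rFamily W r X Y := by
  have h := rFamily_natural r (freeUnit H X) (freeUnit H Y)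
  rw [reassoc_of% h, tensorHom_comp_tensorHom, freeUnit_whiskerRight_freeMul,
    freeUnit_whiskerRight_freeMul]
  simp

/-- A morphism which encodes a braiding of right modules is an R-matrix. -/
lemma isRMatrix_of_braiding (bR : BraidedCategory (RightMod H))
    (h : ∀ M N : RightMod H, RightMod.Hom.hom (bR.braiding M N).hom = rightBraid W r M N) :
    IsRMatrix W H r where
  linear X Y := by
    have h1 := (bR.braiding (RightMod.free H X) (RightMod.free H Y)).hom.act_hom
    rw [h, RightMod.free_tensor_act, RightMod.free_tensor_act] at h1
    have h2 : (freeComul H (X ⊗ H) (Y ⊗ H) ≫ (freeMul H X ⊗ₘ freeMul H Y)) ≫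
        rFamily W r (X ⊗ H) (Y ⊗ H) ≫ (freeMul H Y ⊗ₘ freeMul H X) =
        (rFamily W r (X ⊗ H) (Y ⊗ H) ≫ (freeMul H Y ⊗ₘ freeMul H X)) ▷ H ≫
          freeComul H (Y ⊗ H) (X ⊗ H) ≫ (freeMul H Y ⊗ₘ freeMul H X) := h1
    have h3 := congrArg (fun k => (freeUnit H X ⊗ₘ freeUnit H Y) ▷ H ≫ k) h2
    have h4 := freeUnit_free_tensor_act (H := H) X Y
    have h5 := freeUnit_rightBraid (r := r) X Y
    rw [← comp_whiskerRight_assoc, h5, Category.assoc, reassoc_of% h4] at h3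
    exact h3
  tensor_left X Y V := by
    have h1 := congrArg RightMod.Hom.hom (bR.hexagon_reverse (RightMod.free H X)
      (RightMod.free H Y) (RightMod.free H V))
    have h2 : (α_ (X ⊗ H) (Y ⊗ H) (V ⊗ H)).inv ≫ (rFamily W r ((X ⊗ H) ⊗ (Y ⊗ H)) (V ⊗ H) ≫
        (freeMul H V ⊗ₘ (freeComul H (X ⊗ H) (Y ⊗ H) ≫ (freeMul H X ⊗ₘ freeMul H Y)))) ≫
        (α_ (V ⊗ H) (X ⊗ H) (Y ⊗ H)).inv =
        (X ⊗ H) ◁ (rFamily W r (Y ⊗ H) (V ⊗ H) ≫ (freeMul H V ⊗ₘ freeMul H Y)) ≫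
          (α_ (X ⊗ H) (V ⊗ H) (Y ⊗ H)).inv ≫
            (rFamily W r (X ⊗ H) (V ⊗ H) ≫ (freeMul H V ⊗ₘ freeMul H X)) ▷ (Y ⊗ H) := by
      have h3 : RightMod.Hom.hom (bR.braiding (RightMod.free H X ⊗ RightMod.free H Y)
          (RightMod.free H V)).hom = rFamily W r ((X ⊗ H) ⊗ (Y ⊗ H)) (V ⊗ H) ≫
            (freeMul H V ⊗ₘ (freeComul H (X ⊗ H) (Y ⊗ H) ≫ (freeMul H X ⊗ₘ freeMul H Y))) := by
        rw [← RightMod.free_tensor_act]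
        exact h _ _
      have h4 : RightMod.Hom.hom (bR.braiding (RightMod.free H Y) (RightMod.free H V)).hom =
        rFamily W r (Y ⊗ H) (V ⊗ H) ≫ (freeMul H V ⊗ₘ freeMul H Y) := h _ _
      have h5 : RightMod.Hom.hom (bR.braiding (RightMod.free H X) (RightMod.free H V)).hom =
        rFamily W r (X ⊗ H) (V ⊗ H) ≫ (freeMul H V ⊗ₘ freeMul H X) := h _ _
      rw [← h3, ← h4, ← h5]
      exact h1
    have h6 := rFamily_natural r (freeUnit H X ⊗ₘ freeUnit H Y) (freeUnit H V)
    have h7 := freeUnit_free_tensor_act (H := H) X Y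
    have h8 : ((freeUnit H X ⊗ₘ freeUnit H Y) ⊗ₘ freeUnit H V) ≫
        rFamily W r ((X ⊗ H) ⊗ (Y ⊗ H)) (V ⊗ H) ≫
        (freeMul H V ⊗ₘ (freeComul H (X ⊗ H) (Y ⊗ H) ≫ (freeMul H X ⊗ₘ freeMul H Y))) =
        rFamily W r (X ⊗ Y) V ≫ (V ⊗ H) ◁ freeComul H X Y := by
      rw [reassoc_of% h6, tensorHom_comp_tensorHom, h7, freeUnit_whiskerRight_freeMul,
        id_tensorHom]
    have h9 := freeUnit_rightBraid (r := r) Y V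
    have h10 : freeUnit H X ▷ (V ⊗ H) ≫ rFamily W r (X ⊗ H) (V ⊗ H) ≫
        (freeMul H V ⊗ₘ freeMul H X) = rFamily W r X (V ⊗ H) ≫ freeMul H V ▷ (X ⊗ H) := by
      rw [← Category.assoc, rFamily_natural_left, Category.assoc, ← id_tensorHom,
        tensorHom_comp_tensorHom, freeUnit_whiskerRight_freeMul, Category.id_comp, tensorHom_id]
    rw [← h8, ← cancel_epi (α_ X Y V).inv, ← cancel_mono (α_ (V ⊗ H) (X ⊗ H) (Y ⊗ H)).inv]
    have h11 := congrArg (fun k => (freeUnit H X ⊗ₘ (freeUnit H Y ⊗ₘ freeUnit H V)) ≫ k) h2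
    have h12 := associator_inv_naturality (freeUnit H X) (freeUnit H Y) (freeUnit H V)
    have h13 : (freeUnit H X ⊗ₘ (freeUnit H Y ⊗ₘ freeUnit H V)) ≫
        (X ⊗ H) ◁ (rFamily W r (Y ⊗ H) (V ⊗ H) ≫ (freeMul H V ⊗ₘ freeMul H Y)) =
        X ◁ rFamily W r Y V ≫ freeUnit H X ▷ ((V ⊗ H) ⊗ (Y ⊗ H)) := by
      rw [← id_tensorHom, tensorHom_comp_tensorHom, h9, Category.comp_id,
        MonoidalCategory.tensorHom_def']
    rw [reassoc_of% h12, reassoc_of% h13, associator_inv_naturality_left_assoc,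
      ← comp_whiskerRight, h10] at h11
    refine Eq.trans ?_ (h11.trans ?_)
    · simp only [Category.assoc]
    · simp
  tensor_right X Y V := by
    have h1 := congrArg RightMod.Hom.hom (bR.hexagon_forward (RightMod.free H X)
      (RightMod.free H Y) (RightMod.free H V))
    have h2 : (α_ (X ⊗ H) (Y ⊗ H) (V ⊗ H)).hom ≫ (rFamily W r (X ⊗ H) ((Y ⊗ H) ⊗ (V ⊗ H)) ≫
        ((freeComul H (Y ⊗ H) (V ⊗ H) ≫ (freeMul H Y ⊗ₘ freeMul H V)) ⊗ₘ freeMul H X)) ≫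
        (α_ (Y ⊗ H) (V ⊗ H) (X ⊗ H)).hom =
        (rFamily W r (X ⊗ H) (Y ⊗ H) ≫ (freeMul H Y ⊗ₘ freeMul H X)) ▷ (V ⊗ H) ≫
          (α_ (Y ⊗ H) (X ⊗ H) (V ⊗ H)).hom ≫
            (Y ⊗ H) ◁ (rFamily W r (X ⊗ H) (V ⊗ H) ≫ (freeMul H V ⊗ₘ freeMul H X)) := by
      have h3 : RightMod.Hom.hom (bR.braiding (RightMod.free H X)
          (RightMod.free H Y ⊗ RightMod.free H V)).hom =
          rFamily W r (X ⊗ H) ((Y ⊗ H) ⊗ (V ⊗ H)) ≫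
            ((freeComul H (Y ⊗ H) (V ⊗ H) ≫ (freeMul H Y ⊗ₘ freeMul H V)) ⊗ₘ freeMul H X) := by
        rw [← RightMod.free_tensor_act]
        exact h _ _
      have h4 : RightMod.Hom.hom (bR.braiding (RightMod.free H X) (RightMod.free H Y)).hom =
        rFamily W r (X ⊗ H) (Y ⊗ H) ≫ (freeMul H Y ⊗ₘ freeMul H X) := h _ _
      have h5 : RightMod.Hom.hom (bR.braiding (RightMod.free H X) (RightMod.free H V)).hom =
        rFamily W r (X ⊗ H) (V ⊗ H) ≫ (freeMul H V ⊗ₘ freeMul H X) := h _ _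
      rw [← h3, ← h4, ← h5]
      exact h1
    have h6 := rFamily_natural r (freeUnit H X) (freeUnit H Y ⊗ₘ freeUnit H V)
    have h7 := freeUnit_free_tensor_act (H := H) Y V
    have h8 : (freeUnit H X ⊗ₘ (freeUnit H Y ⊗ₘ freeUnit H V)) ≫
        rFamily W r (X ⊗ H) ((Y ⊗ H) ⊗ (V ⊗ H)) ≫
        ((freeComul H (Y ⊗ H) (V ⊗ H) ≫ (freeMul H Y ⊗ₘ freeMul H V)) ⊗ₘ freeMul H X) =
        rFamily W r X (Y ⊗ V) ≫ freeComul H Y V ▷ (X ⊗ H) := by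
      rw [reassoc_of% h6, tensorHom_comp_tensorHom, h7, freeUnit_whiskerRight_freeMul,
        tensorHom_id]
    have h9 := freeUnit_rightBraid (r := r) X Y
    have h10 : (X ⊗ H) ◁ freeUnit H V ≫ rFamily W r (X ⊗ H) (V ⊗ H) ≫
        (freeMul H V ⊗ₘ freeMul H X) = rFamily W r (X ⊗ H) V ≫ (V ⊗ H) ◁ freeMul H X := by
      rw [← Category.assoc, rFamily_natural_right, Category.assoc, ← tensorHom_id,
        tensorHom_comp_tensorHom, freeUnit_whiskerRight_freeMul, Category.id_comp, id_tensorHom]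
    rw [← h8, ← cancel_epi (α_ X Y V).hom, ← cancel_mono (α_ (Y ⊗ H) (V ⊗ H) (X ⊗ H)).hom]
    have h11 := congrArg (fun k => ((freeUnit H X ⊗ₘ freeUnit H Y) ⊗ₘ freeUnit H V) ≫ k) h2
    have h12 := associator_naturality (freeUnit H X) (freeUnit H Y) (freeUnit H V)
    have h13 : ((freeUnit H X ⊗ₘ freeUnit H Y) ⊗ₘ freeUnit H V) ≫
        (rFamily W r (X ⊗ H) (Y ⊗ H) ≫ (freeMul H Y ⊗ₘ freeMul H X)) ▷ (V ⊗ H) =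
        rFamily W r X Y ▷ V ≫ ((Y ⊗ H) ⊗ (X ⊗ H)) ◁ freeUnit H V := by
      rw [← tensorHom_id, tensorHom_comp_tensorHom, h9, Category.comp_id,
        MonoidalCategory.tensorHom_def]
    rw [reassoc_of% h12, reassoc_of% h13, associator_naturality_right_assoc,
      ← whiskerLeft_comp, h10] at h11
    refine Eq.trans ?_ (h11.trans ?_)
    · simp only [Category.assoc]
    · simp
  unit_left X := by
    have h1 := congrArg RightMod.Hom.hom
      (@braiding_tensorUnit_left _ _ _ bR (RightMod.free H X))
    have h2 : rFamily W r (𝟙_ B) (X ⊗ H) ≫ (freeMul H X ⊗ₘ (𝟙_ B ◁ ε[H] ≫ (ρ_ (𝟙_ B)).hom)) =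
        (λ_ (X ⊗ H)).hom ≫ (ρ_ (X ⊗ H)).inv := (h _ _).symm.trans h1
    have h3 : freeCounit H = 𝟙_ B ◁ ε[H] ≫ (ρ_ (𝟙_ B)).hom := by
      dsimp only [freeCounit]
      monoidal
    have h4 := congrArg (fun k => 𝟙_ B ◁ freeUnit H X ≫ k) h2
    rw [← Category.assoc, rFamily_natural_right, ← h3, Category.assoc, ← tensorHom_id,
      tensorHom_comp_tensorHom, freeUnit_whiskerRight_freeMul, Category.id_comp,
      id_tensorHom, leftUnitor_naturality_assoc] at h4
    exact h4
  unit_right X := by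
    have h1 := congrArg RightMod.Hom.hom
      (@braiding_tensorUnit_right _ _ _ bR (RightMod.free H X))
    have h2 : rFamily W r (X ⊗ H) (𝟙_ B) ≫ ((𝟙_ B ◁ ε[H] ≫ (ρ_ (𝟙_ B)).hom) ⊗ₘ freeMul H X) =
        (ρ_ (X ⊗ H)).hom ≫ (λ_ (X ⊗ H)).inv := (h _ _).symm.trans h1
    have h3 : freeCounit H = 𝟙_ B ◁ ε[H] ≫ (ρ_ (𝟙_ B)).hom := by
      dsimp only [freeCounit]
      monoidal
    have h4 := congrArg (fun k => freeUnit H X ▷ 𝟙_ B ≫ k) h2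
    rw [← Category.assoc, rFamily_natural_left, ← h3, Category.assoc, ← id_tensorHom,
      tensorHom_comp_tensorHom, freeUnit_whiskerRight_freeMul, Category.id_comp,
      tensorHom_id, rightUnitor_naturality_assoc] at h4
    exact h4

end Generic

/-! ### The braiding of modules over the double -/

section RightBraiding

variable {B : Type u} [Category.{v} B] [MonoidalCategory B] [BraidedCategory B]
  [RigidCategory B] {A Z D : B} [HopfObj A] [BimonObj Z] [BimonObj D]
  {U : UnivCoact A Z} {T : A ⟶ A} {ω : Z ⊗ A ⟶ A ⊗ Z}

namespace Factorization

variable (F : Factorization ω D) (hω : U.IsLaw ω T) (hT : IsSkewAntipode A T)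
  (hU : U.Compat μ[Z] η[Z] Δ[Z] ε[Z])

noncomputable instance : (F.toCenter hω hT hU).Monoidal :=
  (F.toCenterCoreMonoidal hω hT hU).toMonoidal

/-- The braiding of right modules over the double, pulled back from the center. -/
@[reducible]
noncomputable def rightBraiding : BraidedCategory (RightMod D) :=
  BraidedCategory.ofFullyFaithful (F.toCenter hω hT hU)

/-- The braiding of `D`-modules `M` and `N` is the half braiding between `M`, restricted to `Z`,
and `N`, restricted to `A`. -/
lemma rightBraiding_hom (M N : RightMod D) :
    RightMod.Hom.hom ((F.rightBraiding hω hT hU).braiding M N).hom =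
      U.halfBraid (F.resR M) (F.resL N) := by
  let := F.rightBraiding hω hT hU
  let : (F.toCenter hω hT hU).Braided := braidedOfFullyFaithful _
  have h : RightMod.Hom.hom (Center.Hom.f ((F.toCenter hω hT hU).map (β_ M N).hom)) =
      𝟙 (M.X ⊗ N.X) ≫ U.halfBraid (F.resR M) (F.resL N) ≫ 𝟙 (N.X ⊗ M.X) :=
    congrArg (fun k => RightMod.Hom.hom (Center.Hom.f k))
      (Functor.map_braiding (F.toCenter hω hT hU) M N)
  refine h.trans ?_
  rw [Category.id_comp]
  exact Category.comp_id _

/-- The category of right modules over the double is isomorphic to the center of the category of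
right `A`-modules. -/
noncomputable def rightModIso :
    letI := F.rightBraiding hω hT hU
    BraidedIso (RightMod D) (Center (RightMod A)) :=
  letI := F.rightBraiding hω hT hU
  letI : (F.toCenter hω hT hU).Braided := braidedOfFullyFaithful _
  BraidedIso.ofBijective (F.toCenter hω hT hU)
    ⟨F.toCenter_obj_injective hω hT hU, F.toCenter_obj_surjective hω hT hU⟩

/-- The half braiding of modules over the double, for the universal coaction of the
centralizer. -/
lemma halfBraid_centralizerCoact {W : Cowedge (dualTensor B)} {hW : IsColimit W}
    [BimonObj (centralizerObj W A)] {ω : centralizerObj W A ⊗ A ⟶ A ⊗ centralizerObj W A}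
    (F : Factorization ω D) (M N : RightMod D) :
    (centralizerCoact hW A).halfBraid (F.resR M) (F.resL N) =
      (centralizing W A M.X N.X ≫ (N.X ◁ F.inl ⊗ₘ M.X ◁ F.inr)) ≫ (N.act ⊗ₘ M.act) := by
  have h : slide M.X (coactZ W A N.X ≫ F.actL N ▷ centralizerObj W A) =
      slide M.X (coactZ W A N.X) ≫ F.actL N ▷ (M.X ⊗ centralizerObj W A) :=
    slide_comp_whiskerRight _ _ _
  change slide M.X (coactZ W A N.X ≫ F.actL N ▷ centralizerObj W A) ≫ N.X ◁ F.actR M = _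
  rw [h, slide_coactZ, Category.assoc, Category.assoc, tensorHom_comp_tensorHom,
    MonoidalCategory.tensorHom_def]
  rfl

end Factorization

end RightBraiding

/-! ### Left modules and the opposite tensor product -/

section Flip

variable {B : Type u} [Category.{v} B] [MonoidalCategory B] [BraidedCategory B]

/-- Both sides are braid diagrams exchanging `N ⊗ M` with `P ⊗ Q`; they agree because the double
braiding of `M` and `P` can be moved past `Q` and `N`, and by the Yang–Baxter equation. -/
lemma tensorμ_braiding (N M P Q : B) :
    tensorμ N M P Q ≫ ((β_ N P).hom ⊗ₘ (β_ M Q).hom) ≫ (β_ (P ⊗ N) (Q ⊗ M)).hom =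
      (N ⊗ M) ◁ (β_ P Q).hom ≫ (β_ N M).hom ▷ (Q ⊗ P) ≫ (β_ (M ⊗ N) (Q ⊗ P)).hom ≫
        tensorμ Q P M N := by
  have h1 := braiding_naturality_left ((β_ M P).hom ≫ (β_ P M).hom) Q
  have h2 := braiding_naturality_right N ((β_ M P).hom ≫ (β_ P M).hom)
  have h3 := yang_baxter N M Q
  rw [braiding_tensor_left_hom] at h1
  rw [braiding_tensor_right_hom] at h2
  rw [braiding_naturality, braiding_tensor_left_hom N P, braiding_tensor_right_hom P,
    braiding_tensor_right_hom N, braiding_tensor_left_hom M N, braiding_tensor_right_hom N,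
    braiding_tensor_right_hom M, MonoidalCategory.tensorHom_def]
  dsimp only [tensorμ]
  calc
    _ = 𝟙 ((N ⊗ M) ⊗ (P ⊗ Q)) ⊗≫ N ◁ ((β_ M P).hom ≫ (β_ P M).hom) ▷ Q ⊗≫
        N ◁ M ◁ (β_ P Q).hom ⊗≫ ((α_ N M Q).inv ≫ (β_ N M).hom ▷ Q ≫ (α_ M N Q).hom ≫
          M ◁ (β_ N Q).hom ≫ (α_ M Q N).inv ≫ (β_ M Q).hom ▷ N ≫ (α_ Q M N).hom) ▷ P ⊗≫
        Q ◁ M ◁ (β_ N P).hom ⊗≫ 𝟙 ((Q ⊗ M) ⊗ (P ⊗ N)) := by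
      monoidal
    _ = 𝟙 ((N ⊗ M) ⊗ (P ⊗ Q)) ⊗≫ N ◁ (((β_ M P).hom ≫ (β_ P M).hom) ▷ Q ≫ (α_ M P Q).hom ≫
        M ◁ (β_ P Q).hom ≫ (α_ M Q P).inv ≫ (β_ M Q).hom ▷ P ≫ (α_ Q M P).hom) ⊗≫
        (β_ N Q).hom ▷ (M ⊗ P) ⊗≫ Q ◁ (β_ N M).hom ▷ P ⊗≫
        Q ◁ M ◁ (β_ N P).hom ⊗≫ 𝟙 ((Q ⊗ M) ⊗ (P ⊗ N)) := by
      rw [h3]; monoidal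
    _ = 𝟙 ((N ⊗ M) ⊗ (P ⊗ Q)) ⊗≫ N ◁ M ◁ (β_ P Q).hom ⊗≫ N ◁ (β_ M Q).hom ▷ P ⊗≫
        ((N ⊗ Q) ◁ ((β_ M P).hom ≫ (β_ P M).hom) ≫ (β_ N Q).hom ▷ (M ⊗ P)) ⊗≫
        Q ◁ (β_ N M).hom ▷ P ⊗≫
        Q ◁ M ◁ (β_ N P).hom ⊗≫ 𝟙 ((Q ⊗ M) ⊗ (P ⊗ N)) := by
      rw [h1]; monoidal
    _ = 𝟙 ((N ⊗ M) ⊗ (P ⊗ Q)) ⊗≫ N ◁ M ◁ (β_ P Q).hom ⊗≫ N ◁ (β_ M Q).hom ▷ P ⊗≫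
        (β_ N Q).hom ▷ (M ⊗ P) ⊗≫ Q ◁ (N ◁ ((β_ M P).hom ≫ (β_ P M).hom) ≫
        (α_ N M P).inv ≫ (β_ N M).hom ▷ P ≫ (α_ M N P).hom ≫
        M ◁ (β_ N P).hom ≫ (α_ M P N).inv) ⊗≫ 𝟙 ((Q ⊗ M) ⊗ (P ⊗ N)) := by
      rw [whisker_exchange]; monoidal
    _ = 𝟙 ((N ⊗ M) ⊗ (P ⊗ Q)) ⊗≫ N ◁ M ◁ (β_ P Q).hom ⊗≫ (N ◁ (β_ M Q).hom ≫ (α_ N Q M).inv ≫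
        (β_ N Q).hom ▷ M ≫ (α_ Q N M).hom ≫ Q ◁ (β_ N M).hom) ▷ P ⊗≫
        Q ◁ M ◁ (β_ N P).hom ⊗≫ Q ◁ ((β_ M P).hom ≫ (β_ P M).hom) ▷ N ⊗≫
        𝟙 ((Q ⊗ M) ⊗ (P ⊗ N)) := by
      rw [h2]; monoidal
    _ = 𝟙 ((N ⊗ M) ⊗ (P ⊗ Q)) ⊗≫ N ◁ M ◁ (β_ P Q).hom ⊗≫ (β_ N M).hom ▷ Q ▷ P ⊗≫
        M ◁ (β_ N Q).hom ▷ P ⊗≫ ((β_ M Q).hom ▷ (N ⊗ P) ≫ (Q ⊗ M) ◁ (β_ N P).hom) ⊗≫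
        Q ◁ ((β_ M P).hom ≫ (β_ P M).hom) ▷ N ⊗≫ 𝟙 ((Q ⊗ M) ⊗ (P ⊗ N)) := by
      rw [← h3]; monoidal
    _ = _ := by
      rw [← whisker_exchange]; monoidal

variable {H : B} [HopfObj H]

/-- The braiding intertwines the tensor products of left and right modules. -/
lemma flipMod_tensor (M N : Mod B H) :
    (flipMod N ⊗ flipMod M).act ≫ (β_ N.X M.X).hom =
      (β_ N.X M.X).hom ▷ H ≫ flipAct (M ⊗ N) := by
  have h1 := HopfObj.antipode_comul H
  have h2 := tensorμ_braiding N.X M.X H H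
  change ((N.X ⊗ M.X) ◁ Δ[H] ≫ tensorμ N.X M.X H H ≫ ((N.X ◁ 𝒮[H] ≫ (β_ N.X H).hom ≫ leftAct N) ⊗ₘ
      (M.X ◁ 𝒮[H] ≫ (β_ M.X H).hom ≫ leftAct M))) ≫ _ =
    (β_ N.X M.X).hom ▷ H ≫ (M.X ⊗ N.X) ◁ 𝒮[H] ≫ (β_ (M.X ⊗ N.X) H).hom ≫
      Δ[H] ▷ (M.X ⊗ N.X) ≫ tensorμ H H M.X N.X ≫ (leftAct M ⊗ₘ leftAct N)
  rw [← braiding_naturality_right_assoc, ← whiskerLeft_comp_assoc, h1]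
  simp only [whiskerLeft_comp, Category.assoc, ← tensorHom_comp_tensorHom, braiding_naturality]
  rw [← tensorμ_natural_right_assoc, reassoc_of% h2, ← whiskerLeft_comp_assoc _ (𝒮[H] ⊗ₘ 𝒮[H]),
    ← whiskerLeft_comp_assoc _ (β_ H H).hom, ← braiding_naturality]
  simp only [whiskerLeft_comp, Category.assoc]
  simp only [whisker_exchange_assoc]

lemma flipMod_unit : (𝟙_ (RightMod H) : RightMod H).act = flipAct (𝟙_ (Mod B H)) := by
  have h1 := HopfObj.antipode_counit H
  change 𝟙_ B ◁ ε[H] ≫ (ρ_ (𝟙_ B)).hom =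
    𝟙_ B ◁ 𝒮[H] ≫ (β_ (𝟙_ B) H).hom ≫ ε[H] ▷ 𝟙_ B ≫ (λ_ (𝟙_ B)).hom
  rw [← braiding_naturality_right_assoc, ← whiskerLeft_comp_assoc, h1, braiding_tensorUnit_left]
  monoidal

lemma flipAct_hom {M N : Mod B H} (f : M ⟶ N) : flipAct M ≫ f.hom = f.hom ▷ H ≫ flipAct N := by
  have h := leftAct_hom f
  dsimp only [flipAct]
  rw [Category.assoc, Category.assoc, h, ← whisker_exchange_assoc,
    ← braiding_naturality_left_assoc]

variable [IsIso 𝒮[H]]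

/-- If the antipode is invertible, a left action is recovered from the flipped right action. -/
lemma leftAct_eq (M : Mod B H) :
    leftAct M = inv 𝒮[H] ▷ M.X ≫ (β_ M.X H).inv ≫ flipAct M := by
  rw [flipAct, braiding_inv_naturality_left_assoc, ← whiskerLeft_comp_assoc]
  simp

lemma unflipMod_flipMod (M : Mod B H) : unflipMod (flipMod M) = M := by
  have h : inv 𝒮[H] ▷ M.X ≫ (β_ M.X H).inv ≫ flipAct M = leftAct M := (leftAct_eq M).symm
  have key : ∀ (t : H ⊗ M.X ⟶ M.X) (t₁ t₂), t = leftAct M → leftMk M.X t t₁ t₂ = M := by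
    rintro t t₁ t₂ rfl
    rfl
  exact key _ _ _ h

end Flip

section LeftFlip

variable {B : Type u} [Category.{v} B] [MonoidalCategory B] [BraidedCategory B]

/-- The braiding is compatible with the associator of the opposite tensor product. -/
lemma braiding_tensor_assoc (X Y Z : B) :
    (β_ X Y).hom ▷ Z ≫ (β_ (Y ⊗ X) Z).hom ≫ (α_ Z Y X).inv =
      (α_ X Y Z).hom ≫ X ◁ (β_ Y Z).hom ≫ (β_ X (Z ⊗ Y)).hom := by
  have h := yang_baxter X Y Z
  rw [braiding_tensor_left_hom, braiding_tensor_right_hom]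
  simp only [Category.assoc]
  rw [← cancel_mono (α_ Z Y X).hom, ← cancel_epi (α_ X Y Z).inv]
  simpa using h

variable (H : B) [HopfObj H]

/-- Left modules, with the opposite tensor product, as right modules along the antipode. -/
def leftFlip : (Mod B H)ᴹᵒᵖ ⥤ RightMod H where
  obj M := flipMod M.unmop
  map {M N} f := { hom := f.unmop.hom, act_hom := flipAct_hom f.unmop }

/-- The monoidal structure of `leftFlip`; its structure morphisms underlie the braiding. -/
def leftFlipCoreMonoidal : (leftFlip H).CoreMonoidal where
  εIso := RightMod.isoMk (M := 𝟙_ (RightMod H)) (N := (leftFlip H).obj (𝟙_ (Mod B H)ᴹᵒᵖ))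
    (Iso.refl (𝟙_ B)) (comp_id_eq_id_whiskerRight_comp flipMod_unit)
  μIso M N := RightMod.isoMk (M := (leftFlip H).obj M ⊗ (leftFlip H).obj N)
    (N := (leftFlip H).obj (M ⊗ N)) (β_ M.unmop.X N.unmop.X) (flipMod_tensor N.unmop M.unmop)
  μIso_hom_natural_left f P := RightMod.hom_ext _ _ (braiding_naturality_left f.unmop.hom P.unmop.X)
  μIso_hom_natural_right P f := RightMod.hom_ext _ _
    (braiding_naturality_right P.unmop.X f.unmop.hom)
  associativity M N P := RightMod.hom_ext _ _
    (braiding_tensor_assoc M.unmop.X N.unmop.X P.unmop.X)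
  left_unitality M := RightMod.hom_ext _ _ (by
    change (λ_ M.unmop.X).hom = 𝟙 (𝟙_ B) ▷ M.unmop.X ≫ (β_ (𝟙_ B) M.unmop.X).hom ≫
      (ρ_ M.unmop.X).hom
    simp)
  right_unitality M := RightMod.hom_ext _ _ (by
    change (ρ_ M.unmop.X).hom = M.unmop.X ◁ 𝟙 (𝟙_ B) ≫ (β_ M.unmop.X (𝟙_ B)).hom ≫
      (λ_ M.unmop.X).hom
    simp)

instance : (leftFlip H).Monoidal := (leftFlipCoreMonoidal H).toMonoidal

instance : (leftFlip H).Faithful where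
  map_injective h := MonoidalOpposite.hom_ext (Mod.hom_ext _ _
    (congrArg RightMod.Hom.hom h))

variable [IsIso 𝒮[H]]

/-- A morphism which is linear for the flipped actions is linear for the left actions. -/
lemma hom_of_flipAct {M N : Mod B H} (f : M.X ⟶ N.X) (h : flipAct M ≫ f = f ▷ H ≫ flipAct N) :
    leftAct M ≫ f = H ◁ f ≫ leftAct N := by
  rw [leftAct_eq M, leftAct_eq N, Category.assoc, Category.assoc, h, whisker_exchange_assoc,
    braiding_inv_naturality_right_assoc]

instance : (leftFlip H).Full where
  map_surjective f := ⟨(leftHomMk f.hom (hom_of_flipAct H f.hom f.act_hom)).mop, rfl⟩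

lemma leftFlip_obj_bijective : Function.Bijective (leftFlip H).obj :=
  ⟨fun M N h => MonoidalOpposite.unmop_injective <| by
    rw [← unflipMod_flipMod M.unmop, ← unflipMod_flipMod N.unmop]
    exact congrArg unflipMod h, fun N => ⟨⟨unflipMod N⟩, flipMod_unflipMod N⟩⟩

end LeftFlip

/-- A braiding of the monoidal opposite gives a braiding. -/
@[reducible]
def braidedOfMop (C : Type u) [Category.{v} C] [MonoidalCategory C] [BraidedCategory Cᴹᵒᵖ] :
    BraidedCategory C where
  braiding X Y := (β_ (MonoidalOpposite.mop Y) (MonoidalOpposite.mop X)).unmop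
  braiding_naturality_right X _ _ f := congrArg Quiver.Hom.unmop
    (braiding_naturality_left f.mop (MonoidalOpposite.mop X))
  braiding_naturality_left f X := congrArg Quiver.Hom.unmop
    (braiding_naturality_right (MonoidalOpposite.mop X) f.mop)
  hexagon_forward X Y Z := congrArg Quiver.Hom.unmop
    (hexagon_reverse (MonoidalOpposite.mop Z) (MonoidalOpposite.mop Y) (MonoidalOpposite.mop X))
  hexagon_reverse X Y Z := congrArg Quiver.Hom.unmop
    (hexagon_forward (MonoidalOpposite.mop Z) (MonoidalOpposite.mop Y) (MonoidalOpposite.mop X))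

/-! ### Transport of centers along monoidal isomorphisms -/

/-- Compatibility with half braidings may be tested on the image of an essentially surjective
functor. -/
lemma center_comm_of_image {C : Type u} [Category.{v} C] {D : Type u'} [Category.{v'} D]
    [MonoidalCategory D] (F : C ⥤ D) [F.EssSurj] {M N : D} {σ : HalfBraiding M}
    {τ : HalfBraiding N} {f : M ⟶ N}
    (h : ∀ U : C, f ▷ F.obj U ≫ (τ.β (F.obj U)).hom = (σ.β (F.obj U)).hom ≫ F.obj U ◁ f) (V : D) :
    f ▷ V ≫ (τ.β V).hom = (σ.β V).hom ≫ V ◁ f := by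
  rw [← cancel_epi (M ◁ (F.objObjPreimageIso V).hom), whisker_exchange_assoc, τ.naturality,
    reassoc_of% h, σ.naturality_assoc, whisker_exchange]

/-- An isomorphism in the center, from an isomorphism of underlying objects. -/
def centerIsoOfIso {C : Type u} [Category.{v} C] [MonoidalCategory C] {X Y : Center C}
    (e : X.1 ≅ Y.1) (h : ∀ V : C, e.hom ▷ V ≫ (Y.2.β V).hom = (X.2.β V).hom ≫ V ◁ e.hom) :
    X ≅ Y where
  hom := ⟨e.hom, h⟩
  inv := ⟨e.inv, fun V => by
    rw [← cancel_epi (e.hom ▷ V), reassoc_of% (h V)]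
    simp⟩
  hom_inv_id := Center.ext _ _ e.hom_inv_id
  inv_hom_id := Center.ext _ _ e.inv_hom_id

section CenterMap

open Functor.LaxMonoidal Functor.OplaxMonoidal

variable {C : Type u} [Category.{v} C] [MonoidalCategory C]
  {D : Type u'} [Category.{v'} D] [MonoidalCategory D] (F : C ⥤ D) [F.Monoidal]

/-- The image under `F` of a component `M ⊗ U ≅ U ⊗ M` of a half braiding. -/
def halfBraidingImage {M : C} (σ : HalfBraiding M) (U : C) :
    F.obj M ⊗ F.obj U ≅ F.obj U ⊗ F.obj M :=
  Functor.Monoidal.μIso F M U ≪≫ F.mapIso (σ.β U) ≪≫ (Functor.Monoidal.μIso F U M).symm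

lemma halfBraidingImage_natural {M : C} (σ : HalfBraiding M) {U V : C} (f : U ⟶ V) :
    F.obj M ◁ F.map f ≫ (halfBraidingImage F σ V).hom =
      (halfBraidingImage F σ U).hom ≫ F.map f ▷ F.obj M := by
  simp only [halfBraidingImage, Iso.trans_hom, Iso.symm_hom, Functor.mapIso_hom,
    Functor.Monoidal.μIso_hom, Functor.Monoidal.μIso_inv, Category.assoc]
  rw [Functor.LaxMonoidal.μ_natural_right_assoc, Functor.OplaxMonoidal.δ_natural_left,
    ← F.map_comp_assoc, ← F.map_comp_assoc, σ.naturality]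

lemma halfBraidingImage_hom {M N : C} (σ : HalfBraiding M) (τ : HalfBraiding N) (f : M ⟶ N) (U : C)
    (h : f ▷ U ≫ (τ.β U).hom = (σ.β U).hom ≫ U ◁ f) :
    F.map f ▷ F.obj U ≫ (halfBraidingImage F τ U).hom =
      (halfBraidingImage F σ U).hom ≫ F.obj U ◁ F.map f := by
  simp only [halfBraidingImage, Iso.trans_hom, Iso.symm_hom, Functor.mapIso_hom,
    Functor.Monoidal.μIso_hom, Functor.Monoidal.μIso_inv, Category.assoc]
  rw [Functor.LaxMonoidal.μ_natural_left_assoc, Functor.OplaxMonoidal.δ_natural_right,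
    ← F.map_comp_assoc, ← F.map_comp_assoc, h]

/-- A morphism of images compatible with the images of half braidings lifts to a compatible
morphism. -/
lemma halfBraidingImage_preimage [F.Full] [F.Faithful] {M N : C} (σ : HalfBraiding M)
    (τ : HalfBraiding N) (f : F.obj M ⟶ F.obj N) (U : C)
    (h : f ▷ F.obj U ≫ (halfBraidingImage F τ U).hom =
      (halfBraidingImage F σ U).hom ≫ F.obj U ◁ f) :
    F.preimage f ▷ U ≫ (τ.β U).hom = (σ.β U).hom ≫ U ◁ F.preimage f := by
  obtain ⟨f, rfl⟩ := F.map_surjective f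
  simp only [halfBraidingImage, Iso.trans_hom, Iso.symm_hom, Functor.mapIso_hom,
    Functor.Monoidal.μIso_hom, Functor.Monoidal.μIso_inv, Category.assoc] at h
  rw [Functor.LaxMonoidal.μ_natural_left_assoc, Functor.OplaxMonoidal.δ_natural_right,
    ← F.map_comp_assoc, ← F.map_comp_assoc, cancel_epi, cancel_mono] at h
  rw [F.preimage_map]
  exact F.map_injective h

/-- The half braiding whose image under a fully faithful functor is given. -/
noncomputable def halfBraidingPull [F.Full] [F.Faithful] {M : C} (τ : HalfBraiding (F.obj M)) :
    HalfBraiding M where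
  β U := F.preimageIso ((Functor.Monoidal.μIso F M U).symm ≪≫ τ.β (F.obj U) ≪≫
    Functor.Monoidal.μIso F U M)
  monoidal U V := F.map_injective (by
    have h := τ.naturality (Functor.OplaxMonoidal.δ F U V)
    rw [τ.monoidal] at h
    have h2 := congrArg (fun k => k ≫ Functor.LaxMonoidal.μ F U V ▷ F.obj M) h
    simp only [Category.assoc, ← comp_whiskerRight, Functor.Monoidal.δ_μ, id_whiskerRight,
      Category.comp_id] at h2
    simp only [Functor.preimageIso_hom, F.map_preimage, F.map_comp, Iso.trans_hom, Iso.symm_hom,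
      Functor.Monoidal.μIso_hom, Functor.Monoidal.μIso_inv, Functor.Monoidal.map_whiskerRight,
      Functor.Monoidal.map_whiskerLeft, Functor.Monoidal.map_associator,
      Functor.Monoidal.map_associator_inv, comp_whiskerRight, whiskerLeft_comp, Category.assoc,
      Functor.Monoidal.μ_δ_assoc, Functor.Monoidal.whiskerLeft_μ_δ_assoc,
      Functor.Monoidal.whiskerRight_μ_δ_assoc, ← h2])
  naturality {U V} f := F.map_injective (by
    simp only [Functor.preimageIso_hom, F.map_preimage, F.map_comp, Iso.trans_hom, Iso.symm_hom,
      Functor.Monoidal.μIso_hom, Functor.Monoidal.μIso_inv, Category.assoc]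
    rw [← Functor.OplaxMonoidal.δ_natural_right_assoc, τ.naturality_assoc,
      Functor.LaxMonoidal.μ_natural_left])

lemma halfBraidingImage_pull [F.Full] [F.Faithful] {M : C} (τ : HalfBraiding (F.obj M)) (U : C) :
    halfBraidingImage F (halfBraidingPull F τ) U = τ.β (F.obj U) :=
  Iso.ext (by simp [halfBraidingImage, halfBraidingPull])

/-- The image of a half braiding is multiplicative on the objects in the image of `F`. -/
lemma halfBraidingImage_tensor {M : C} (σ : HalfBraiding M) (U V : C) :
    F.obj M ◁ Functor.LaxMonoidal.μ F U V ≫ (halfBraidingImage F σ (U ⊗ V)).hom =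
      ((α_ _ _ _).inv ≫ (halfBraidingImage F σ U).hom ▷ F.obj V ≫ (α_ _ _ _).hom ≫
        F.obj U ◁ (halfBraidingImage F σ V).hom ≫ (α_ _ _ _).inv) ≫
          Functor.LaxMonoidal.μ F U V ▷ F.obj M := by
  simp only [halfBraidingImage, Iso.trans_hom, Iso.symm_hom, Functor.mapIso_hom,
    Functor.Monoidal.μIso_hom, Functor.Monoidal.μIso_inv, Category.assoc, σ.monoidal, F.map_comp,
    Functor.Monoidal.map_whiskerRight, Functor.Monoidal.map_whiskerLeft,
    Functor.Monoidal.map_associator,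
    Functor.Monoidal.map_associator_inv, comp_whiskerRight, whiskerLeft_comp,
    Functor.Monoidal.μ_δ, Functor.Monoidal.μ_δ_assoc, Functor.Monoidal.whiskerLeft_μ_δ_assoc,
    Category.comp_id]

/-- The image of the half braiding of a tensor product in the center. -/
lemma halfBraidingImage_tensor_left (X Y : Center C) (U : C) :
    Functor.LaxMonoidal.μ F X.1 Y.1 ▷ F.obj U ≫ (halfBraidingImage F (X ⊗ Y).2 U).hom =
      ((α_ _ _ _).hom ≫ F.obj X.1 ◁ (halfBraidingImage F Y.2 U).hom ≫ (α_ _ _ _).inv ≫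
        (halfBraidingImage F X.2 U).hom ▷ F.obj Y.1 ≫ (α_ _ _ _).hom) ≫
          F.obj U ◁ Functor.LaxMonoidal.μ F X.1 Y.1 := by
  change _ ▷ _ ≫ Functor.LaxMonoidal.μ F (X.1 ⊗ Y.1) U ≫ F.map ((α_ X.1 Y.1 U).hom ≫
    X.1 ◁ (Y.2.β U).hom ≫ (α_ X.1 U Y.1).inv ≫ (X.2.β U).hom ▷ Y.1 ≫ (α_ U X.1 Y.1).hom) ≫
    Functor.OplaxMonoidal.δ F U (X.1 ⊗ Y.1) = _
  simp only [halfBraidingImage, Iso.trans_hom, Iso.symm_hom, Functor.mapIso_hom,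
    Functor.Monoidal.μIso_hom, Functor.Monoidal.μIso_inv, Category.assoc, F.map_comp,
    Functor.Monoidal.map_whiskerRight,
    Functor.Monoidal.map_whiskerLeft, Functor.Monoidal.map_associator,
    Functor.Monoidal.map_associator_inv, comp_whiskerRight, whiskerLeft_comp,
    Functor.Monoidal.μ_δ, Functor.Monoidal.μ_δ_assoc, Functor.Monoidal.whiskerRight_μ_δ_assoc,
    Category.comp_id]

lemma halfBraidingImage_unit_left (U : C) :
    Functor.LaxMonoidal.ε F ▷ F.obj U ≫ (halfBraidingImage F (𝟙_ (Center C)).2 U).hom =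
      ((λ_ _).hom ≫ (ρ_ _).inv) ≫ F.obj U ◁ Functor.LaxMonoidal.ε F := by
  change _ ▷ _ ≫ Functor.LaxMonoidal.μ F (𝟙_ C) U ≫ F.map ((λ_ U).hom ≫ (ρ_ U).inv) ≫
    Functor.OplaxMonoidal.δ F U (𝟙_ C) = _
  rw [F.map_comp, Functor.Monoidal.map_leftUnitor, Functor.Monoidal.map_rightUnitor_inv]
  simp only [Category.assoc, Functor.Monoidal.μ_δ, Functor.Monoidal.μ_δ_assoc,
    Functor.Monoidal.whiskerRight_ε_η_assoc, Category.comp_id]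

variable [F.EssSurj]

/-- The half braiding of `F M` with an arbitrary object `V ≅ F U`. -/
noncomputable def halfBraidingPushIso {M : C} (σ : HalfBraiding M) (V : D) :
    F.obj M ⊗ V ≅ V ⊗ F.obj M :=
  whiskerLeftIso (F.obj M) (F.objObjPreimageIso V).symm ≪≫
    halfBraidingImage F σ (F.objPreimage V) ≪≫
      whiskerRightIso (F.objObjPreimageIso V) (F.obj M)

variable [F.Full]

/-- The half braiding of `F M` with `V` does not depend on the presentation of `V` as an image. -/
lemma halfBraidingPushIso_comp {M : C} (σ : HalfBraiding M) {U : C} {V : D} (f : F.obj U ⟶ V) :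
    F.obj M ◁ f ≫ (halfBraidingPushIso F σ V).hom =
      (halfBraidingImage F σ U).hom ≫ f ▷ F.obj M := by
  have h := halfBraidingImage_natural F σ (F.preimage (f ≫ (F.objObjPreimageIso V).inv))
  rw [F.map_preimage, whiskerLeft_comp, Category.assoc] at h
  change F.obj M ◁ f ≫ F.obj M ◁ (F.objObjPreimageIso V).inv ≫
    (halfBraidingImage F σ (F.objPreimage V)).hom ≫ (F.objObjPreimageIso V).hom ▷ F.obj M = _
  rw [reassoc_of% h, ← comp_whiskerRight, Category.assoc, Iso.inv_hom_id, Category.comp_id]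

lemma halfBraidingPushIso_obj {M : C} (σ : HalfBraiding M) (U : C) :
    halfBraidingPushIso F σ (F.obj U) = halfBraidingImage F σ U :=
  Iso.ext (by simpa using halfBraidingPushIso_comp F σ (𝟙 (F.obj U)))

/-- Multiplicativity of a half braiding may be transported along morphisms of the second
argument. -/
lemma hexagon_transport {X U U' V V' : D} (a : U ⟶ V) (a' : U' ⟶ V') {s : X ⊗ U ⟶ U ⊗ X}
    {s' : X ⊗ U' ⟶ U' ⊗ X} {p : X ⊗ V ⟶ V ⊗ X} {p' : X ⊗ V' ⟶ V' ⊗ X}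
    (h : X ◁ a ≫ p = s ≫ a ▷ X) (h' : X ◁ a' ≫ p' = s' ≫ a' ▷ X) :
    X ◁ (a ▷ U' ≫ V ◁ a') ≫ (α_ _ _ _).inv ≫ p ▷ V' ≫ (α_ _ _ _).hom ≫ V ◁ p' ≫ (α_ _ _ _).inv =
      ((α_ _ _ _).inv ≫ s ▷ U' ≫ (α_ _ _ _).hom ≫ U ◁ s' ≫ (α_ _ _ _).inv) ≫
        (a ▷ U' ≫ V ◁ a') ▷ X := by
  calc
    _ = 𝟙 (X ⊗ (U ⊗ U')) ⊗≫ X ◁ a ▷ U' ⊗≫ ((X ⊗ V) ◁ a' ≫ p ▷ V') ⊗≫ V ◁ p' ⊗≫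
        𝟙 ((V ⊗ V') ⊗ X) := by monoidal
    _ = 𝟙 (X ⊗ (U ⊗ U')) ⊗≫ (X ◁ a ≫ p) ▷ U' ⊗≫ V ◁ (X ◁ a' ≫ p') ⊗≫ 𝟙 ((V ⊗ V') ⊗ X) := by
      rw [whisker_exchange]; monoidal
    _ = 𝟙 (X ⊗ (U ⊗ U')) ⊗≫ s ▷ U' ⊗≫ (a ▷ (X ⊗ U') ≫ V ◁ s') ⊗≫ V ◁ a' ▷ X ⊗≫
        𝟙 ((V ⊗ V') ⊗ X) := by
      rw [h, h']; monoidal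
    _ = _ := by
      rw [← whisker_exchange]; monoidal

/-- The image of a half braiding under a monoidal functor which is full and essentially
surjective. -/
noncomputable def halfBraidingPush {M : C} (σ : HalfBraiding M) : HalfBraiding (F.obj M) where
  β := halfBraidingPushIso F σ
  monoidal V V' := by
    obtain ⟨a, ha⟩ : ∃ a : F.obj (F.objPreimage V) ≅ V, a = F.objObjPreimageIso V := ⟨_, rfl⟩
    obtain ⟨a', ha'⟩ : ∃ a : F.obj (F.objPreimage V') ≅ V', a = F.objObjPreimageIso V' := ⟨_, rfl⟩
    have h := halfBraidingPushIso_comp F σ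
      (Functor.OplaxMonoidal.δ F (F.objPreimage V) (F.objPreimage V') ≫ a.hom ▷ _ ≫ V ◁ a'.hom)
    have h' := halfBraidingImage_tensor F σ (F.objPreimage V) (F.objPreimage V')
    have h3 := hexagon_transport a.hom a'.hom (halfBraidingPushIso_comp F σ a.hom)
      (halfBraidingPushIso_comp F σ a'.hom)
    rw [← cancel_epi (F.obj M ◁ (a.hom ▷ _ ≫ V ◁ a'.hom)), h3,
      ← cancel_epi (F.obj M ◁ Functor.OplaxMonoidal.δ F _ _), ← whiskerLeft_comp_assoc, h,
      ← cancel_epi (F.obj M ◁ Functor.LaxMonoidal.μ F _ _), reassoc_of% h',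
      ← whiskerLeft_comp_assoc, Functor.Monoidal.μ_δ, whiskerLeft_id, Category.id_comp,
      ← comp_whiskerRight, Functor.Monoidal.μ_δ_assoc]
    simp only [Category.assoc]
  naturality {V V'} f := by
    rw [← cancel_epi (F.obj M ◁ (F.objObjPreimageIso V).hom), ← whiskerLeft_comp_assoc,
      halfBraidingPushIso_comp,
      reassoc_of% (halfBraidingPushIso_comp F σ (F.objObjPreimageIso V).hom), comp_whiskerRight]

/-- The functor induced between centers. -/
noncomputable def centerMap : Center C ⥤ Center D where
  obj X := ⟨F.obj X.1, halfBraidingPush F X.2⟩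
  map {X Y} f := ⟨F.map f.f, center_comm_of_image F fun U => by
    have h := halfBraidingImage_hom F X.2 Y.2 f.f U (f.comm _)
    rwa [← halfBraidingPushIso_obj, ← halfBraidingPushIso_obj] at h⟩
  map_id X := Center.ext _ _ (F.map_id _)
  map_comp f g := Center.ext _ _ (F.map_comp _ _)

/-- The monoidal structure of the functor between centers. -/
noncomputable def centerMapCoreMonoidal : (centerMap F).CoreMonoidal where
  εIso := centerIsoOfIso (X := 𝟙_ (Center D)) (Y := (centerMap F).obj (𝟙_ (Center C)))
    (Functor.Monoidal.εIso F) (center_comm_of_image F fun U => by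
      have h := halfBraidingImage_unit_left F U
      rwa [← halfBraidingPushIso_obj] at h)
  μIso X Y := centerIsoOfIso (X := (centerMap F).obj X ⊗ (centerMap F).obj Y)
    (Y := (centerMap F).obj (X ⊗ Y)) (Functor.Monoidal.μIso F X.1 Y.1)
      (center_comm_of_image F fun U => by
        have h := halfBraidingImage_tensor_left F X Y U
        rwa [← halfBraidingPushIso_obj, ← halfBraidingPushIso_obj, ← halfBraidingPushIso_obj] at h)
  μIso_hom_natural_left f X := Center.ext _ _ (Functor.LaxMonoidal.μ_natural_left F f.f X.1)
  μIso_hom_natural_right X f := Center.ext _ _ (Functor.LaxMonoidal.μ_natural_right F X.1 f.f)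
  associativity X Y Z := Center.ext _ _ (Functor.LaxMonoidal.associativity F X.1 Y.1 Z.1)
  left_unitality X := Center.ext _ _ (Functor.LaxMonoidal.left_unitality F X.1)
  right_unitality X := Center.ext _ _ (Functor.LaxMonoidal.right_unitality F X.1)

noncomputable instance : (centerMap F).Monoidal := (centerMapCoreMonoidal F).toMonoidal

noncomputable instance : (centerMap F).Braided where
  braided X Y := Center.ext _ _ (by
    have h : Functor.LaxMonoidal.μ F X.1 Y.1 ≫ F.map (X.2.β Y.1).hom =
        (halfBraidingPushIso F X.2 (F.obj Y.1)).hom ≫ Functor.LaxMonoidal.μ F Y.1 X.1 := by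
      simp [halfBraidingPushIso_obj, halfBraidingImage]
    exact h)

variable [F.Faithful]

instance : (centerMap F).Faithful where
  map_injective h := Center.ext _ _ (F.map_injective (congrArg Center.Hom.f h))

instance : (centerMap F).Full where
  map_surjective {X Y} g := ⟨⟨F.preimage g.f, fun U => halfBraidingImage_preimage F _ _ _ U (by
    have h := g.comm (F.obj U)
    change g.f ▷ F.obj U ≫ (halfBraidingPushIso F Y.2 (F.obj U)).hom =
      (halfBraidingPushIso F X.2 (F.obj U)).hom ≫ F.obj U ◁ g.f at h
    rwa [halfBraidingPushIso_obj, halfBraidingPushIso_obj] at h)⟩,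
      Center.ext _ _ (F.map_preimage _)⟩

lemma centerMap_obj_injective (hF : Function.Injective F.obj) :
    Function.Injective (centerMap F).obj := fun X Y h => by
  have h1 : X.1 = Y.1 := hF (congrArg Sigma.fst h)
  obtain ⟨g, hg⟩ := (centerMap F).map_surjective (eqToHom h)
  refine center_eq_of_hom h1 g (F.map_injective ?_)
  rw [eqToHom_map]
  exact (congrArg Center.Hom.f hg).trans (center_eqToHom_f h)

lemma centerMap_obj_surjective (hF : Function.Surjective F.obj) :
    Function.Surjective (centerMap F).obj := by
  rintro ⟨N, τ⟩
  obtain ⟨M, rfl⟩ := hF N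
  refine ⟨⟨M, halfBraidingPull F τ⟩, center_eq_of_hom rfl
    ⟨𝟙 _, center_comm_of_image F fun U => ?_⟩ rfl⟩
  have h := halfBraidingImage_pull F τ U
  rw [← halfBraidingPushIso_obj] at h
  change 𝟙 (F.obj M) ▷ F.obj U ≫ (τ.β (F.obj U)).hom =
    (halfBraidingPushIso F (halfBraidingPull F τ) (F.obj U)).hom ≫ F.obj U ◁ 𝟙 (F.obj M)
  rw [h]
  simp

/-- The isomorphism between the centers of isomorphic monoidal categories. -/
noncomputable def centerIso (hF : Function.Bijective F.obj) : BraidedIso (Center C) (Center D) :=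
  BraidedIso.ofBijective (centerMap F)
    ⟨centerMap_obj_injective F hF.1, centerMap_obj_surjective F hF.2⟩

end CenterMap

/-! ### The right center and the mirror of the center -/

section Mirror

variable {C : Type u} [Category.{v} C] [MonoidalCategory C]

/-- The inverse of a right half braiding, which is a left half braiding. -/
def invHalfBraiding {M : Cᴹᵒᵖ} (κ : HalfBraiding M) : HalfBraiding M.unmop where
  β U := (κ.β ⟨U⟩).unmop.symm
  monoidal U V := by
    have h : (κ.β ⟨U ⊗ V⟩).unmop = α_ _ _ _ ≪≫ whiskerLeftIso U (κ.β ⟨V⟩).unmop ≪≫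
        (α_ _ _ _).symm ≪≫ whiskerRightIso (κ.β ⟨U⟩).unmop V ≪≫ α_ _ _ _ :=
      Iso.ext (congrArg Quiver.Hom.unmop (κ.monoidal ⟨V⟩ ⟨U⟩))
    have h' := congrArg Iso.inv h
    simp only [Iso.trans_inv, Iso.symm_inv, whiskerLeftIso_inv, whiskerRightIso_inv,
      Category.assoc] at h'
    exact h'
  naturality {U V} f := by
    have h : f ▷ M.unmop ≫ (κ.β ⟨V⟩).hom.unmop = (κ.β ⟨U⟩).hom.unmop ≫ M.unmop ◁ f :=
      congrArg Quiver.Hom.unmop (κ.naturality f.mop)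
    change M.unmop ◁ f ≫ (κ.β ⟨V⟩).unmop.inv = (κ.β ⟨U⟩).unmop.inv ≫ f ▷ M.unmop
    rw [Iso.comp_inv_eq, Category.assoc, Iso.eq_inv_comp]
    exact h.symm

/-- The inverse of a left half braiding, which is a right half braiding. -/
def mopHalfBraiding {M : C} (σ : HalfBraiding M) : HalfBraiding (MonoidalOpposite.mop M) where
  β U := (σ.β U.unmop).symm.mop
  monoidal U V := by
    have h : σ.β (V.unmop ⊗ U.unmop) = (α_ _ _ _).symm ≪≫ whiskerRightIso (σ.β V.unmop) U.unmop ≪≫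
        α_ _ _ _ ≪≫ whiskerLeftIso V.unmop (σ.β U.unmop) ≪≫ (α_ _ _ _).symm :=
      Iso.ext (σ.monoidal V.unmop U.unmop)
    have h' := congrArg Iso.inv h
    simp only [Iso.trans_inv, Iso.symm_inv, whiskerLeftIso_inv, whiskerRightIso_inv,
      Category.assoc] at h'
    exact MonoidalOpposite.hom_ext h'
  naturality {U V} f := MonoidalOpposite.hom_ext (by
    have h := σ.naturality f.unmop
    change f.unmop ▷ M ≫ (σ.β V.unmop).inv = (σ.β U.unmop).inv ≫ M ◁ f.unmop
    rw [Iso.comp_inv_eq, Category.assoc, Iso.eq_inv_comp]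
    exact h.symm)

lemma center_braiding_inv_f (X Y : Center C) : Center.Hom.f (β_ X Y).inv = (X.2.β Y.1).inv :=
  IsIso.Iso.inv_hom (X.2.β Y.1)

variable (C)

/-- Inverting half braidings, as a functor from the right center to the mirror of the center. -/
def mirrorFunctor : RightCenter C ⥤ Mirror (Center C) where
  obj X := (⟨X.unmop.1.unmop, invHalfBraiding X.unmop.2⟩ : Center C)
  map {X Y} f := (⟨f.unmop.f.unmop, fun U => by
    have h := congrArg Quiver.Hom.unmop (f.unmop.comm ⟨U⟩)
    change U ◁ f.unmop.f.unmop ≫ (Y.unmop.2.β ⟨U⟩).unmop.hom =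
      (X.unmop.2.β ⟨U⟩).unmop.hom ≫ f.unmop.f.unmop ▷ U at h
    change f.unmop.f.unmop ▷ U ≫ (Y.unmop.2.β ⟨U⟩).unmop.inv =
      (X.unmop.2.β ⟨U⟩).unmop.inv ≫ U ◁ f.unmop.f.unmop
    rw [Iso.comp_inv_eq, Category.assoc, Iso.eq_inv_comp]
    exact h.symm⟩ : Center.Hom _ _)

/-- Inverting half braidings, as a functor from the mirror of the center to the right center. -/
def mirrorInverse : Mirror (Center C) ⥤ RightCenter C where
  obj X := ⟨⟨⟨X.1⟩, mopHalfBraiding X.2⟩⟩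
  map {X Y} f := ⟨⟨(Center.Hom.f f).mop, fun U => MonoidalOpposite.hom_ext (by
    have h := Center.Hom.comm f U.unmop
    change U.unmop ◁ Center.Hom.f f ≫ (Y.2.β U.unmop).inv =
      (X.2.β U.unmop).inv ≫ Center.Hom.f f ▷ U.unmop
    rw [Iso.comp_inv_eq, Category.assoc, Iso.eq_inv_comp]
    exact h.symm)⟩⟩

/-- The monoidal structure of `mirrorFunctor`; its structure morphisms underlie identities. -/
noncomputable def mirrorFunctorCoreMonoidal : (mirrorFunctor C).CoreMonoidal where
  εIso := centerIsoOfIso (X := 𝟙_ (Center C)) (Y := (mirrorFunctor C).obj (𝟙_ (RightCenter C)))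
    (Iso.refl (𝟙_ C)) (fun V => by
      change 𝟙 (𝟙_ C) ▷ V ≫ (λ_ V).hom ≫ (ρ_ V).inv = ((λ_ V).hom ≫ (ρ_ V).inv) ≫ V ◁ 𝟙 (𝟙_ C)
      simp)
  μIso X Y := centerIsoOfIso
    (X := ((mirrorFunctor C).obj X ⊗ (mirrorFunctor C).obj Y : Mirror (Center C)))
    (Y := (mirrorFunctor C).obj (X ⊗ Y)) (Iso.refl (X.unmop.1.unmop ⊗ Y.unmop.1.unmop))
    (fun V => by
      have key : ∀ (P Q : C) (p : V ⊗ P ≅ P ⊗ V) (q : V ⊗ Q ≅ Q ⊗ V),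
          𝟙 (P ⊗ Q) ▷ V ≫ ((α_ V P Q).symm ≪≫ whiskerRightIso p Q ≪≫ α_ P V Q ≪≫
            whiskerLeftIso P q ≪≫ (α_ P Q V).symm).inv =
          ((α_ P Q V).hom ≫ P ◁ q.inv ≫ (α_ P V Q).inv ≫ p.inv ▷ Q ≫ (α_ V P Q).hom) ≫
            V ◁ 𝟙 (P ⊗ Q) := by
        intro P Q p q
        simp
      exact key _ _ (X.unmop.2.β ⟨V⟩).unmop (Y.unmop.2.β ⟨V⟩).unmop)
  μIso_hom_natural_left {X Y} f X' := Center.ext _ _ (by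
    change f.unmop.f.unmop ▷ X'.unmop.1.unmop ≫ 𝟙 _ = 𝟙 _ ≫ f.unmop.f.unmop ▷ X'.unmop.1.unmop
    simp)
  μIso_hom_natural_right {X Y} X' f := Center.ext _ _ (by
    change X'.unmop.1.unmop ◁ f.unmop.f.unmop ≫ 𝟙 _ = 𝟙 _ ≫ X'.unmop.1.unmop ◁ f.unmop.f.unmop
    simp)
  associativity X Y Z := Center.ext _ _ (by
    have h : Center.Hom.f ((mirrorFunctor C).map (α_ X Y Z).hom) =
        (α_ X.unmop.1.unmop Y.unmop.1.unmop Z.unmop.1.unmop).hom :=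
      congrArg Quiver.Hom.unmop (Center.associator_inv_f Z.unmop Y.unmop X.unmop)
    have key : ∀ (P Q R : C) (k : (P ⊗ Q) ⊗ R ⟶ P ⊗ (Q ⊗ R)), k = (α_ P Q R).hom →
        𝟙 (P ⊗ Q) ▷ R ≫ 𝟙 ((P ⊗ Q) ⊗ R) ≫ k =
          (α_ P Q R).hom ≫ P ◁ 𝟙 (Q ⊗ R) ≫ 𝟙 (P ⊗ (Q ⊗ R)) := by
      rintro P Q R k rfl
      simp
    exact key _ _ _ _ h)
  left_unitality X := Center.ext _ _ (by
    change (λ_ X.unmop.1.unmop).hom = 𝟙 (𝟙_ C) ▷ X.unmop.1.unmop ≫ 𝟙 _ ≫ (λ_ X.unmop.1.unmop).hom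
    simp)
  right_unitality X := Center.ext _ _ (by
    change (ρ_ X.unmop.1.unmop).hom = X.unmop.1.unmop ◁ 𝟙 (𝟙_ C) ≫ 𝟙 _ ≫ (ρ_ X.unmop.1.unmop).hom
    simp)

noncomputable instance : (mirrorFunctor C).Monoidal := (mirrorFunctorCoreMonoidal C).toMonoidal

noncomputable instance : (mirrorFunctor C).Braided where
  braided X Y := Center.ext _ _ (by
    have h := center_braiding_inv_f ((mirrorFunctor C).obj Y : Center C) ((mirrorFunctor C).obj X)
    have key : ∀ (P Q : C) (k l : P ⊗ Q ⟶ Q ⊗ P), k = l → 𝟙 (P ⊗ Q) ≫ l = k ≫ 𝟙 (Q ⊗ P) := by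
      rintro P Q k l rfl
      simp
    exact key _ _ _ _ h)

/-- The right center is isomorphic to the mirror of the center. -/
noncomputable def mirrorIso : BraidedIso (RightCenter C) (Mirror (Center C)) where
  functor := mirrorFunctor C
  braided := inferInstance
  inverse := mirrorInverse C
  functor_comp_inverse := rfl
  inverse_comp_functor := rfl

end Mirror

/-! ### The braiding of left modules -/

section LeftBraiding

variable {B : Type u} [Category.{v} B] [MonoidalCategory B] [BraidedCategory B] (H : B)
  [HopfObj H] [IsIso 𝒮[H]] [BraidedCategory (RightMod H)]

/-- The braiding of left modules, pulled back from right modules along `leftFlip`. -/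
@[reducible]
noncomputable def leftBraiding : BraidedCategory (Mod B H) :=
  letI := BraidedCategory.ofFullyFaithful (leftFlip H)
  braidedOfMop (Mod B H)

/-- The braiding of left modules is conjugate, by the braiding of the base category, to that of
the flipped right modules, whose order is reversed. -/
lemma leftBraiding_hom (M N : Mod B H) :
    ((leftBraiding H).braiding M N).hom.hom = (β_ N.X M.X).inv ≫
      RightMod.Hom.hom (β_ (flipMod N) (flipMod M)).hom ≫ (β_ M.X N.X).hom :=
  congrArg RightMod.Hom.hom ((leftFlip H).map_preimage
    (Functor.OplaxMonoidal.δ (leftFlip H) ⟨N⟩ ⟨M⟩ ≫ (β_ (flipMod N) (flipMod M)).hom ≫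
      Functor.LaxMonoidal.μ (leftFlip H) ⟨M⟩ ⟨N⟩))

/-- The category of left modules is isomorphic to the category of right modules. -/
noncomputable def leftRightIso :
    letI := leftBraiding H
    BraidedIso (Mod B H) (RightMod H) :=
  letI := leftBraiding H
  haveI : (leftFlip H).Braided := braidedOfFullyFaithful (leftFlip H)
  (BraidedIso.mop (Mod B H)).trans (BraidedIso.ofBijective (leftFlip H) (leftFlip_obj_bijective H))

/-- The center of the category of right modules is isomorphic to the right center of the category
of left modules. -/
noncomputable def centerRightCenterIso (H : B) [HopfObj H] [IsIso 𝒮[H]] :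
    BraidedIso (Center (RightMod H)) (RightCenter (Mod B H)) :=
  have : (leftFlip H).EssSurj :=
    ⟨fun N => ⟨_, ⟨eqToIso ((leftFlip_obj_bijective H).2 N).choose_spec⟩⟩⟩
  (centerIso (leftFlip H) (leftFlip_obj_bijective H)).symm.trans (BraidedIso.mop _)

end LeftBraiding

/-! ### The centralizer and the double -/

section Double

variable {B : Type u} [Category.{v} B] [MonoidalCategory B] [BraidedCategory B]

variable [RigidCategory B] {W : Cowedge (dualTensor B)} (hW : IsColimit W) (A : B)
  [HopfObj A]

variable {A} in
/-- The braiding pulled back from the center is the one encoded by the R-matrix. -/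
lemma rightBraiding_eq_rightBraid [HopfObj (centralizerObj W A)] {D : B} [HopfObj D]
    {ω : centralizerObj W A ⊗ A ⟶ A ⊗ centralizerObj W A} {T : A ⟶ A} (F : Factorization ω D)
    (hω : (centralizerCoact hW A).IsLaw ω T) (hT : IsSkewAntipode A T)
    (hU : (centralizerCoact hW A).Compat μ[centralizerObj W A] η[centralizerObj W A]
      Δ[centralizerObj W A] ε[centralizerObj W A]) (M N : RightMod D) :
    RightMod.Hom.hom ((F.rightBraiding hω hT hU).braiding M N).hom =
      rightBraid W (coendCounit hW ▷ W.pt ≫ (λ_ W.pt).hom ≫ coevZ W A ≫ (F.inl ⊗ₘ F.inr)) M N := by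
  rw [F.rightBraiding_hom hω hT hU, F.halfBraid_centralizerCoact, rightBraid,
    rFamily_of_coevZ]

variable [IsIso 𝒮[A]]

/-- The double of `A` along a comultiplicative distributive law is a Hopf algebra. -/
lemma IsComulDistribLaw.exists_hopfObj_doubleObj [HopfObj (centralizerObj W A)]
    [IsIso 𝒮[centralizerObj W A]] {ω : centralizerObj W A ⊗ A ⟶ A ⊗ centralizerObj W A}
    (h : IsComulDistribLaw A (centralizerObj W A) ω) :
    ∃ _ : HopfObj (doubleObj W A),
      (μ[doubleObj W A] = distribMul A (centralizerObj W A) ω ∧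
        η[doubleObj W A] = distribOne A (centralizerObj W A) ∧
        Δ[doubleObj W A] = distribComul A (centralizerObj W A) ∧
        ε[doubleObj W A] = distribCounit A (centralizerObj W A)) ∧
      IsIso 𝒮[doubleObj W A] ∧
      ∃ F : Factorization ω (doubleObj W A), F.inl = (ρ_ A).inv ≫ A ◁ η[centralizerObj W A] ∧
        F.inr = (λ_ (centralizerObj W A)).inv ≫ η[A] ▷ centralizerObj W A := by
  let : BimonObj (doubleObj W A) := h.bimonObj
  have F : Factorization ω (doubleObj W A) := h.factorization
  obtain ⟨s, h1, h2⟩ := F.exists_antipode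
  obtain ⟨s', h3⟩ := F.exists_skewAntipode (isSkewAntipode_inv A)
    (isSkewAntipode_inv (centralizerObj W A))
  let i : HopfObj (doubleObj W A) := { antipode := s, antipode_left := h1, antipode_right := h2 }
  exact ⟨i, ⟨rfl, rfl, rfl, rfl⟩, isIso_antipode_of_skew (doubleObj W A) s' h3, h.factorization,
    rfl, rfl⟩

/-- The centralizer is a Hopf algebra with invertible antipode. -/
lemma exists_hopfObj_centralizerObj :
    ∃ _ : HopfObj (centralizerObj W A),
      (μ[centralizerObj W A] = zMul hW A ∧ η[centralizerObj W A] = zUnit W A ∧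
        Δ[centralizerObj W A] = zComul hW A ∧ ε[centralizerObj W A] = zCounit hW A) ∧
      IsIso 𝒮[centralizerObj W A] := by
  let := (centralizerCoact_compat hW A).bimonObj
  have hU : (centralizerCoact hW A).Compat μ[centralizerObj W A] η[centralizerObj W A]
    Δ[centralizerObj W A] ε[centralizerObj W A] := centralizerCoact_compat hW A
  obtain ⟨s, h1, h2⟩ := hU.exists_antipode
  obtain ⟨s', h3⟩ := hU.exists_skewAntipode
  let i : HopfObj (centralizerObj W A) :=
    { antipode := s, antipode_left := h1, antipode_right := h2 }
  exact ⟨i, ⟨rfl, rfl, rfl, rfl⟩, isIso_antipode_of_skew (centralizerObj W A) s' h3⟩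

end Double

end BraidedDouble

theorem mainTheorem9 {B : Type u} [Category.{v} B] [MonoidalCategory B] [BraidedCategory B]
    [RigidCategory B] (W : Cowedge (dualTensor B)) (hW : IsColimit W)
    (A : B) [HopfObj A] [IsIso 𝒮[A]] :
    ∃ _ : HopfObj (centralizerObj W A),
      (μ[centralizerObj W A] = zMul hW A ∧ η[centralizerObj W A] = zUnit W A ∧
        Δ[centralizerObj W A] = zComul hW A ∧ ε[centralizerObj W A] = zCounit hW A) ∧
      IsIso 𝒮[centralizerObj W A] ∧
      IsComulDistribLaw A (centralizerObj W A) (canonicalLaw hW A) ∧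
      IsIso (canonicalLaw hW A) ∧
      IsCanonicalLaw W A (canonicalLaw hW A) ∧
    ∃ _ : HopfObj (doubleObj W A),
      (μ[doubleObj W A] = distribMul A (centralizerObj W A) (canonicalLaw hW A) ∧
        η[doubleObj W A] = distribOne A (centralizerObj W A) ∧
        Δ[doubleObj W A] = distribComul A (centralizerObj W A) ∧
        ε[doubleObj W A] = distribCounit A (centralizerObj W A)) ∧
      IsIso 𝒮[doubleObj W A] ∧
      IsRMatrix W (doubleObj W A) (doubleRMatrix hW A) ∧
      (∀ X Y : B, rFamily W (doubleRMatrix hW A) X Y =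
        centralizing W A X Y ≫
          (((ρ_ (Y ⊗ A)).inv ≫ (Y ⊗ A) ◁ zUnit W A ≫
              (α_ Y A (centralizerObj W A)).hom) ⊗ₘ
            (freeUnit A X ▷ centralizerObj W A ≫ (α_ X A (centralizerObj W A)).hom))) ∧
    ∃ bR : BraidedCategory (RightMod (doubleObj W A)),
      (∀ M N : RightMod (doubleObj W A),
        (bR.braiding M N).hom.hom = rightBraid W (doubleRMatrix hW A) M N) ∧
    ∃ bL : BraidedCategory (Mod B (doubleObj W A)),
      (∀ M N : Mod B (doubleObj W A),
        (bL.braiding M N).hom.hom = leftBraid W (doubleRMatrix hW A) M N) ∧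
      Nonempty (BraidedIso (Center (RightMod A)) (RightMod (doubleObj W A))) ∧
      Nonempty (BraidedIso (RightMod (doubleObj W A)) (Mod B (doubleObj W A))) ∧
      Nonempty (BraidedIso (Mod B (doubleObj W A)) (RightCenter (Mod B A))) ∧
      Nonempty (BraidedIso (RightCenter (Mod B A)) (Mirror (Center (Mod B A)))) := by
  obtain ⟨hZ, hZ', hS⟩ := exists_hopfObj_centralizerObj hW A
  obtain ⟨e1, e2, e3, e4⟩ := hZ'
  have hU : (centralizerCoact hW A).Compat μ[centralizerObj W A] η[centralizerObj W A]
      Δ[centralizerObj W A] ε[centralizerObj W A] := by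
    rw [e1, e2, e3, e4]
    exact centralizerCoact_compat hW A
  have hT := isSkewAntipode_inv A
  have hω := centralizerCoact_isLaw hW A
  have hL := hω.isComulDistribLaw hT hU
  obtain ⟨hD, hD', hSD, F, hl, hr⟩ := hL.exists_hopfObj_doubleObj
  rw [e2] at hl
  have hR : doubleRMatrix hW A = coendCounit hW ▷ W.pt ≫ (λ_ W.pt).hom ≫ coevZ W A ≫
      (F.inl ⊗ₘ F.inr) := by
    rw [hl, hr]
    rfl
  let bR : BraidedCategory (RightMod (doubleObj W A)) := F.rightBraiding hω hT hU
  have hbR : ∀ M N : RightMod (doubleObj W A),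
      RightMod.Hom.hom (bR.braiding M N).hom = rightBraid W (doubleRMatrix hW A) M N := by
    intro M N
    rw [hR]
    exact rightBraiding_eq_rightBraid hW F hω hT hU M N
  let bL : BraidedCategory (Mod B (doubleObj W A)) := leftBraiding (doubleObj W A)
  refine ⟨hZ, ⟨e1, e2, e3, e4⟩, hS, hL, F.isIso_law, hω.isCanonicalLaw hT, hD, hD', hSD,
    isRMatrix_of_braiding bR hbR, fun X Y => ?_, bR, hbR, bL, fun M N => ?_,
    ⟨(F.rightModIso hω hT hU).symm⟩, ⟨(leftRightIso (doubleObj W A)).symm⟩,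
    ⟨((leftRightIso (doubleObj W A)).trans (F.rightModIso hω hT hU)).trans
      (centerRightCenterIso A)⟩, ⟨mirrorIso (Mod B A)⟩⟩
  · have h1 : Y ◁ ((ρ_ A).inv ≫ A ◁ zUnit W A) = (ρ_ (Y ⊗ A)).inv ≫ (Y ⊗ A) ◁ zUnit W A ≫
        (α_ Y A (centralizerObj W A)).hom := by
      monoidal
    have h2 : X ◁ ((λ_ (centralizerObj W A)).inv ≫ η[A] ▷ centralizerObj W A) =
        freeUnit A X ▷ centralizerObj W A ≫ (α_ X A (centralizerObj W A)).hom := by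
      rw [freeUnit]
      monoidal
    rw [← h1, ← h2]
    exact rFamily_of_coevZ hW ((ρ_ A).inv ≫ A ◁ zUnit W A)
      ((λ_ (centralizerObj W A)).inv ≫ η[A] ▷ centralizerObj W A) X Y
  · refine (leftBraiding_hom (doubleObj W A) M N).trans ?_
    refine (congrArg (fun k => (β_ N.X M.X).inv ≫ k ≫ (β_ M.X N.X).hom)
      (hbR (flipMod N) (flipMod M))).trans ?_
    exact congrArg (fun k => (β_ N.X M.X).inv ≫ k) (Category.assoc _ _ _)
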